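/- **Setting.** Let $U\subset\mathbb C^{N+1}$ be a coordinate chart with coordinates $t^0,\dots,t^N$, and let $\mathsf F$ be a cTP structure of rank $N+1$ over $U$ with a frame $e_0,\dots,e_N$: that is, $\mathsf F=\mathbb C^{N+1}\otimes\mathcal O_U[\![z]\!]$ with a flat connection $\nabla=d-z^{-1}\mathcal C(t,z)$, $\mathcal C=\sum_i\mathcal C_i(t,z)\,dt^i$, where the matrices $\mathcal C_i$ have entries in $\mathcal O(U)[\![z]\!]$, and a $z$-sesquilinear pairing $((-)^*s_1,s_2)_{\mathsf F}\in\mathcal O_U[\![z]\!]$ (where $(-)^*f(z)=f(-z)$) which is $(-)^*$-symmetric, $\nabla$-flat, and non-degenerate on $\mathsf F_0=\mathsf F/z\mathsf F$. Put $\Omega(s_1,s_2)=\operatorname{Res}_{z=0}((-)^*s_1,s_2)_{\mathsf F}\,dz$ on $\mathsf F[z^{-1}]$, and let $\Omega^\vee$ be the dual form on $\mathsf F[z^{-1}]^\vee$, transported by $s\mapsto\Omega(s,\cdot)$. Assume that $\mathsf F$ is miniversal: for every $t\in U$ there is $x_1\in\mathsf F_{0,t}$ such that $v\mapsto \mathcal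 C_v(t,0)x_1$ is an isomorphism $T_tU\to\mathsf F_{0,t}$. A *pseudo-opposite module* is an $\mathcal O_U$-submodule $\mathsf P\subset\mathsf F[z^{-1}]$ with $\mathsf F[z^{-1}]=\mathsf F\oplus\mathsf P$ and $\Omega(\mathsf P,\mathsf P)=0$; it is *parallel* if $\nabla\mathsf P\subset\Omega^1_U\otimes\mathsf P$ and *curved* otherwise. $\Pi_{\mathsf P}:\mathsf F[z^{-1}]\to\mathsf F$ denotes the projection along $\mathsf P$. The total space is $\mathbb L=\{(t,\mathbf x):t\in U,\ \mathbf x=\sum_{n\ge1}\sum_i x_n^ie_iz^n\in z\mathsf F_t\}$, with coordinates $\{\mathsf x^\mu\}=\{t^i,x_n^i\}_{n\ge1,\,0\le i\le N}$. Let $P(t,x_1)=(-1)^{N+1}\det(\mathcal C_0(t,0)x_1,\dots,\mathcal C_N(t,0)x_1)$, $\mathbb L^\circ=\{P\ne0\}$ and $\boldsymbol{\mathcal O}=\mathcal O(U)[\{x_n^i\},P^{-1}]$. One-forms are finite sums $\sum_\mu c_\mu d\mathsf x^\mu$, $c_\mu\in\boldsymbol{\mathcal O}$. Over $\mathbb L^\circ$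 the dual Kodaira–Spencer map $\mathrm{KS}^*:\mathrm{pr}^*\mathsf F^\vee\to\boldsymbol\Omega^1$, $\varphi\mapsto\varphi(\tilde\nabla\mathbf x)$, is an isomorphism, where $\tilde\nabla=\mathrm{pr}^*\nabla$, with dual connection $\tilde\nabla^\vee$. For pseudo-opposite modules $\mathsf P,\mathsf Q$ and one-forms $\omega_i=\mathrm{KS}^*\varphi_i$ put: - $\nabla^{\mathsf Q}\omega_1=\mathrm{KS}^*\big((\tilde\nabla^\vee\Pi_{\mathsf Q}^*\varphi_1)|_{\mathrm{pr}^*\mathsf F}\big)$, extended to tensors: if $\nabla^{\mathsf Q}_\nu d\mathsf x^\rho=-\Gamma^\rho_{\nu\sigma}d\mathsf x^\sigma$, then $\nabla^{\mathsf Q}_\nu T_{\mu_1\dots\mu_n}=\partial_\nu T_{\mu_1\dots\mu_n}-\sum_iT_{\mu_1\dots\rho\dots\mu_n}\Gamma^\rho_{\nu\mu_i}$ ($\rho$ in the $i$-th place); - the *propagator* $\Delta(\mathsf P,\mathsf Q)(\omega_1,\omega_2)=\Omega^\vee(\Pi_{\mathsf P}^*\varphi_1,\Pi_{\mathsf Q}^*\varphi_2)$;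 - the *background torsion* $\Lambda_{\mathsf Q}(\omega_1,\omega_2)=\Omega^\vee(\tilde\nabla^\vee\Pi_{\mathsf Q}^*\varphi_1,\Pi_{\mathsf Q}^*\varphi_2)=(\Lambda_{\mathsf Q})_\rho(\omega_1,\omega_2)\,d\mathsf x^\rho$, with components $\Lambda^{\alpha\beta}_\rho=(\Lambda_{\mathsf Q})_\rho(d\mathsf x^\alpha,d\mathsf x^\beta)$. Let $\mathsf P$ be parallel. An element $\mathscr C$ of the *local Fock space* $\mathfrak{Fock}(U;\mathsf P)$ is a collection of completely symmetric tensors $C^{(g)}_{\mathsf P;\mu_1\dots\mu_n}$ with components in $\boldsymbol{\mathcal O}$, for $g,n\ge0$ and $2g-2+n>0$, such that: - (Yukawa) $C^{(0)}_{\mathsf P;\mu_1\mu_2\mu_3}d\mathsf x^{\mu_1}\otimes d\mathsf x^{\mu_2}\otimes d\mathsf x^{\mu_3}=\sum_{i,j,h}(\mathcal C_i(t,0)x_1,\mathcal C_j(t,0)\mathcal C_h(t,0)x_1)_{\mathsf F_0}\,dt^i\otimes dt^j\otimes dt^h$; - (Jetness) $C^{(g)}_{\mathsf P;\nu\mu_1\dots\mu_n}=\nabla^{\mathsf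 P}_\nu C^{(g)}_{\mathsf P;\mu_1\dots\mu_n}$; - (Grading & Filtration) the genus-$g$ tensors have degree $2-2g$ and lie in the filter $3g-3$, where $t^i,dt^i$ have degree $0$, $x_n^i,dx_n^i$ have degree $1$, functions of $t$ have filter $0$, $x_n^i$ and $dx_n^i$ have filter $n-1$, and $dt^i$ has filter $-1$; - (Pole) $P\,C^{(1)}_{\mathsf P;\mu}d\mathsf x^\mu$ is regular on $\mathbb L$, and $C^{(g)}_{\mathsf P}\in P^{-(5g-5)}\mathcal O(U)[x_1,x_2,Px_3,\dots,P^{3g-4}x_{3g-2}]$ for $g\ge2$. For an arbitrary, possibly curved, pseudo-opposite module $\mathsf Q$ over $U$, the *correlation functions under $\mathsf Q$* corresponding to $\mathscr C$ are given by the Feynman rule $$C^{(g)}_{\mathsf Q;\mu_1\dots\mu_n}=\sum_\Gamma\frac1{|\mathrm{Aut}(\Gamma)|}\mathrm{Cont}_\Gamma(\mathscr C,\Delta(\mathsf P,\mathsf Q))_{\mu_1\dots\mu_n},$$ summed over the isomorphism classes of connected graphs $\Gamma$ with vertices decorated by genera $g_v\ge0$ and with $n$ labelled legs, which are stable ($2g_v-2+n_v>0$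 at every vertex $v$, with $n_v$ the number of edge and leg ends at $v$) and of genus $g=\sum_vg_v+1-\chi(\Gamma)$. Here $\mathrm{Cont}_\Gamma$ is obtained by putting $C^{(g_v)}_{\mathsf P}$ with $n_v$ indices on each vertex, $\Delta(\mathsf P,\mathsf Q)$ on each edge and $\mu_i$ on the $i$-th leg, and contracting the indices of the edges. **Theorem (anomaly equation).** Let $g\ge0$ and $n\ge1$ with $2g-2+(n-1)>0$. For all indices $\mu_1,\dots,\mu_n$, $$C^{(g)}_{\mathsf Q;\mu_1\dots\mu_n}=\nabla^{\mathsf Q}_{\mu_1}C^{(g)}_{\mathsf Q;\mu_2\dots\mu_n}+\frac12\sum_{\substack{\{2,\dots,n\}=S_1\sqcup S_2\\k+l=g}}C^{(k)}_{\mathsf Q;S_1,\alpha}\,\Lambda^{\alpha\beta}_{\mu_1}\,C^{(l)}_{\mathsf Q;S_2,\beta}+\frac12\,C^{(g-1)}_{\mathsf Q;\mu_2\dots\mu_n\alpha\beta}\,\Lambda^{\alpha\beta}_{\mu_1},$$ where $\Lambda=\Lambda_{\mathsf Q}$. The sum runs over ordered decompositions and ordered pairs $(k,l)$, repeated indices $\alpha,\beta$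 are summed over (finitely many terms are non-zero), terms with an unstable correlation function ($2h-2+m\le0$ for the genus-$h$, $m$-point function) are omitted, and the last term is absent for $g=0$. -/

import Mathlib

noncomputable section

namespace CTPFock

open TopologicalSpace

/-! ### Holomorphic functions on a coordinate chart -/

/-- The coordinate space `ℂ^{N+1}` of the base, with coordinates `t^0, …, t^N`. -/
abbrev Base (N : ℕ) : Type := Fin (N + 1) → ℂ

/-- `𝒪(U)`: the holomorphic functions on the open set `U ⊆ ℂ^{N+1}`. -/
def Hol {N : ℕ} (U : Opens (Base N)) : Subalgebra ℂ (U → ℂ) where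
  carrier := {f | ∃ g : Base N → ℂ, AnalyticOnNhd ℂ g U ∧ ∀ t : U, f t = g t}
  mul_mem' := by
    rintro a b ⟨f, hf, haf⟩ ⟨g, hg, hbg⟩
    exact ⟨f * g, hf.mul hg, fun t => by simp [haf, hbg]⟩
  add_mem' := by
    rintro a b ⟨f, hf, haf⟩ ⟨g, hg, hbg⟩
    exact ⟨f + g, hf.add hg, fun t => by simp [haf, hbg]⟩
  algebraMap_mem' := fun r => ⟨fun _ => r, analyticOnNhd_const, fun _ => rfl⟩

/-- The ring `𝒪(U)`. -/
def HolRing {N : ℕ} (U : Opens (Base N)) : Type := Hol U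

instance {N : ℕ} (U : Opens (Base N)) : CommRing (HolRing U) := inferInstanceAs (CommRing (Hol U))

instance {N : ℕ} (U : Opens (Base N)) : Algebra ℂ (HolRing U) :=
  inferInstanceAs (Algebra ℂ (Hol U))

/-- The value of a holomorphic function at a point. -/
def HolRing.eval {N : ℕ} {U : Opens (Base N)} (t : U) : HolRing U →ₐ[ℂ] ℂ :=
  (Pi.evalAlgHom ℂ (fun _ : U => ℂ) t).comp (Hol U).val

section BaseDerivative

variable {N : ℕ} {U : Opens (Base N)}

theorem hasDerivAt_hol_line {f : U → ℂ} {g : Base N → ℂ} (hg : AnalyticOnNhd ℂ g U)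
    (hfg : ∀ t : U, f t = g t) (t : U) (v : Base N) :
    HasDerivAt (fun s : ℂ => Function.extend Subtype.val f 0 ((t : Base N) + s • v))
      (fderiv ℂ g t v) 0 := by
  have h1 : HasDerivAt (fun s : ℂ => g ((t : Base N) + s • v)) (fderiv ℂ g t v) 0 := by
    have := (hg t t.2).differentiableAt.hasFDerivAt.hasLineDerivAt v
    exact this
  refine h1.congr_of_eventuallyEq ?_
  have hc : Filter.Tendsto (fun s : ℂ => (t : Base N) + s • v) (nhds 0) (nhds (t : Base N)) := by
    have : Continuous (fun s : ℂ => (t : Base N) + s • v) := by fun_prop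
    simpa using this.tendsto 0
  filter_upwards [hc (U.isOpen.mem_nhds t.2)] with s hs
  have hs' : (t : Base N) + s • v ∈ U := hs
  have := Subtype.val_injective.extend_apply f 0 (⟨_, hs'⟩ : U)
  simp only at this
  rw [this, hfg]

/-- A family of functions on a set, stable under the partial derivative in the direction `v`
(computed on extensions by zero), is acted upon by this partial derivative as a derivation. -/
def lineDerivation {E : Type} [AddCommGroup E] [Module ℂ E] {W : Set E}
    (A : Subalgebra ℂ (W → ℂ)) (v : E)
    (hd : ∀ f ∈ A, ∀ q : W, LineDifferentiableAt ℂ (Function.extend Subtype.val f 0) (q : E) v)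
    (hA : ∀ f ∈ A, (fun q : W => lineDeriv ℂ (Function.extend Subtype.val f 0) (q : E) v) ∈ A) :
    Derivation ℂ A A :=
  Derivation.mk'
    { toFun := fun f =>
        ⟨fun q => lineDeriv ℂ (Function.extend Subtype.val (f : W → ℂ) 0) (q : E) v, hA f f.2⟩
      map_add' := by
        intro f g
        apply Subtype.ext
        funext q
        have hf : HasDerivAt _ _ _ := (hd f f.2 q).hasLineDerivAt
        have hg : HasDerivAt _ _ _ := (hd g g.2 q).hasLineDerivAt
        have e : Function.extend Subtype.val ((f + g : A) : W → ℂ) (0 : E → ℂ)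
            = Function.extend Subtype.val (f : W → ℂ) 0
              + Function.extend Subtype.val (g : W → ℂ) 0 := by
          rw [← Function.extend_add, add_zero]
          rfl
        change lineDeriv ℂ (Function.extend Subtype.val ((f + g : A) : W → ℂ) 0) (q : E) v = _
        rw [e]
        exact (hf.add hg).deriv
      map_smul' := by
        intro c f
        apply Subtype.ext
        funext q
        have hf : HasDerivAt _ _ _ := (hd f f.2 q).hasLineDerivAt
        have e : Function.extend Subtype.val ((c • f : A) : W → ℂ) (0 : E → ℂ)
            = c • Function.extend Subtype.val (f : W → ℂ) 0 := by
          rw [← Function.extend_smul, smul_zero]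
          rfl
        change lineDeriv ℂ (Function.extend Subtype.val ((c • f : A) : W → ℂ) 0) (q : E) v = _
        rw [e]
        exact (hf.const_smul c).deriv }
    (by
      intro f g
      apply Subtype.ext
      funext q
      have hf : HasDerivAt _ _ _ := (hd f f.2 q).hasLineDerivAt
      have hg : HasDerivAt _ _ _ := (hd g g.2 q).hasLineDerivAt
      have h := (hf.mul hg).deriv
      have e : Function.extend Subtype.val ((f * g : A) : W → ℂ) (0 : E → ℂ)
          = Function.extend Subtype.val (f : W → ℂ) 0 * Function.extend Subtype.val (g : W → ℂ) 0 := by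
        rw [← Function.extend_mul, mul_zero]
        rfl
      change lineDeriv ℂ (Function.extend Subtype.val ((f * g : A) : W → ℂ) 0) (q : E) v = _
      rw [e]
      refine h.trans ?_
      simp only [zero_smul, add_zero, Subtype.val_injective.extend_apply]
      change _ = (f : W → ℂ) q * lineDeriv ℂ (Function.extend Subtype.val (g : W → ℂ) 0) (q : E) v
        + (g : W → ℂ) q * lineDeriv ℂ (Function.extend Subtype.val (f : W → ℂ) 0) (q : E) v
      ring)

/-- `∂_i = ∂/∂t^i` on `𝒪(U)`. -/
def dBase (i : Fin (N + 1)) : Derivation ℂ (HolRing U) (HolRing U) :=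
  lineDerivation (W := (U : Set (Base N))) (Hol U) (Pi.single i 1)
    (by
      rintro f ⟨g, hg, hfg⟩ q
      exact (hasDerivAt_hol_line hg hfg q _).differentiableAt)
    (by
      rintro f ⟨g, hg, hfg⟩
      refine ⟨fun t => fderiv ℂ g t (Pi.single i 1), ?_, fun t => ?_⟩
      · exact (ContinuousLinearMap.apply ℂ ℂ (Pi.single i 1 : Base N)).analyticOnNhd
          _ |>.comp hg.fderiv (Set.mapsTo_univ _ _)
      · exact (hasDerivAt_hol_line hg hfg t _).deriv)

end BaseDerivative

/-! ### Laurent vectors: sections of `F[z⁻¹]` in a frame -/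

section Laurent

variable {N : ℕ} {A : Type} [CommRing A]

/-- `A((z))^{N+1}`: sections `∑_n ∑_j s_n^j e_j z^n` of `F[z⁻¹]` in a frame `e_0, …, e_N`. -/
abbrev LVec (N : ℕ) (A : Type) [CommRing A] : Type := Fin (N + 1) → LaurentSeries A

/-- A square matrix with entries in `A⟦z⟧`. -/
abbrev PMat (N : ℕ) (A : Type) [CommRing A] : Type :=
  Matrix (Fin (N + 1)) (Fin (N + 1)) (PowerSeries A)

/-- `z^n`. -/
def zPow (n : ℤ) : LaurentSeries A := HahnSeries.single n 1

/-- The frame vector `e_j z^n`. -/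
def frame (j : Fin (N + 1)) (n : ℤ) : LVec N A := Pi.single j (zPow n)

/-- `(-)^* : f(z) ↦ f(-z)`. -/
def negZ (f : LaurentSeries A) : LaurentSeries A where
  coeff n := (n.negOnePow : ℤ) • f.coeff n
  isPWO_support' := f.isPWO_support'.mono (by
    intro n hn h
    exact hn (by simp [h]))

/-- The operator `s ↦ M(z) s` on Laurent vectors. -/
def mulLaurent (M : PMat N A) (s : LVec N A) : LVec N A :=
  (M.map (HahnSeries.ofPowerSeries ℤ A)).mulVec s

/-- `A⟦z⟧^{N+1} ⊆ A((z))^{N+1}`: the sections of `F` inside those of `F[z⁻¹]`. -/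
def holPart : Submodule A (LVec N A) where
  carrier := {s | ∀ i, ∀ n < 0, (s i).coeff n = 0}
  add_mem' := by
    intro a b ha hb i n hn
    simp [ha i n hn, hb i n hn]
  zero_mem' := by intro i n _; simp
  smul_mem' := by
    intro c a ha i n hn
    simp [ha i n hn]

/-- The pairing `((-)^* s₁, s₂)_F` with Gram matrix `G_{ij}(z) = ((-)^* e_i, e_j)_F`. -/
def pairing (G : PMat N A) (s₁ s₂ : LVec N A) : LaurentSeries A :=
  ∑ i, ∑ j, negZ (s₁ i) * HahnSeries.ofPowerSeries ℤ A (G i j) * s₂ j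

/-- The symplectic form `Ω(s₁, s₂) = Res_{z=0} ((-)^* s₁, s₂)_F dz`. -/
def Om (G : PMat N A) (s₁ s₂ : LVec N A) : A := (pairing G s₁ s₂).coeff (-1)

/-- The operator `D - z⁻¹ M(z)` on Laurent vectors, where the derivation `D` of the coefficient
ring acts coefficientwise. -/
def conn [Algebra ℂ A] (D : Derivation ℂ A A) (M : PMat N A) (s : LVec N A) : LVec N A :=
  fun k => (s k).map D - zPow (-1) * mulLaurent M s k

/-- The value `⟨ψ, s⟩ = ∑ ψ_n^j s_n^j` of the functional `ψ = ∑ ψ_n^j φ_n^j`, where `φ_n^j` is the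
coordinate function dual to `e_j z^n`.  A functional in `F[z⁻¹]^∨` has `ψ_n^j = 0` for `n ≫ 0`, so
that the sum is finite. -/
def evalDual (ψ : ℤ × Fin (N + 1) → A) (s : LVec N A) : A :=
  ∑ᶠ m : ℤ × Fin (N + 1), ψ m * (s m.2).coeff m.1

/-- The functional `ι_s Ω = Ω(s, ·)`, through its values on the frame `e_j z^n`. -/
def flat (G : PMat N A) (s : LVec N A) : ℤ × Fin (N + 1) → A := fun m => Om G s (frame m.2 m.1)

/-- The inverse of `s ↦ ι_s Ω`, `F[z⁻¹] ≅ F[z⁻¹]^∨`. -/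
def sharp (G : PMat N A) : (ℤ × Fin (N + 1) → A) → LVec N A := Function.invFun (flat G)

/-- The dual symplectic pairing `Ω^∨`, transported by the isomorphism `s ↦ ι_s Ω`. -/
def OmDual (G : PMat N A) (ψ₁ ψ₂ : ℤ × Fin (N + 1) → A) : A := Om G (sharp G ψ₁) (sharp G ψ₂)

end Laurent

/-! ### cTP structures and pseudo-opposite modules -/

/-- A cTP structure of rank `N + 1` over the coordinate chart `U ⊆ ℂ^{N+1}`, in a frame
`e_0, …, e_N` of `F` over `𝒪(U)⟦z⟧`: the flat connection is `∇ = d - z⁻¹ ∑ C_i(t,z) dt^i` and the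
pairing has Gram matrix `G`. -/
structure CTP (N : ℕ) (U : Opens (Base N)) where
  /-- The connection matrices `C_i(t,z)`. -/
  C : Fin (N + 1) → PMat N (HolRing U)
  /-- The Gram matrix of the pairing. -/
  G : PMat N (HolRing U)
  /-- `∇` is flat. -/
  flat_conn : ∀ i j (s : LVec N (HolRing U)),
    conn (dBase i) (C i) (conn (dBase j) (C j) s) = conn (dBase j) (C j) (conn (dBase i) (C i) s)
  /-- `((-)^* s₁, s₂) = (-)^* ((-)^* s₂, s₁)`. -/
  pairing_symm : ∀ s₁ s₂ : LVec N (HolRing U), pairing G s₁ s₂ = negZ (pairing G s₂ s₁)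
  /-- `d((-)^* s₁, s₂) = ((-)^* ∇s₁, s₂) + ((-)^* s₁, ∇s₂)`. -/
  pairing_flat : ∀ i (s₁ s₂ : LVec N (HolRing U)), (pairing G s₁ s₂).map (dBase i) =
    pairing G (conn (dBase i) (C i) s₁) s₂ + pairing G s₁ (conn (dBase i) (C i) s₂)
  /-- The induced pairing on `F_0 = F / zF` is non-degenerate. -/
  nondeg : IsUnit (G.map PowerSeries.constantCoeff).det

namespace CTP

variable {N : ℕ} {U : Opens (Base N)} (S : CTP N U)

/-- `∇_i = ∇_{∂/∂t^i}` on `F[z⁻¹]`. -/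
def nabla (i : Fin (N + 1)) : LVec N (HolRing U) → LVec N (HolRing U) := conn (dBase i) (S.C i)

/-- The residual part `C_i(t,0)` at the point `t`, an endomorphism of `F_{0,t}`. -/
def resid (t : U) (i : Fin (N + 1)) : Matrix (Fin (N + 1)) (Fin (N + 1)) ℂ :=
  fun a b => HolRing.eval t (PowerSeries.constantCoeff (S.C i a b))

/-- `x₁ ∈ F°_{0,t}`: the map `T_t M → F_{0,t}`, `v ↦ C_v(t,0) x₁`, is an isomorphism. -/
def InF0circ (t : U) (x₁ : Fin (N + 1) → ℂ) : Prop :=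
  Function.Bijective (fun v : Fin (N + 1) → ℂ => ∑ i, v i • (S.resid t i).mulVec x₁)

/-- Miniversality: `F°_{0,t}` is a non-empty (automatically Zariski open) subset of `F_{0,t}` for
every `t`. -/
def IsMiniversal : Prop := ∀ t : U, ∃ x₁, S.InF0circ t x₁

/-- A pseudo-opposite module over `U`: an `𝒪`-submodule of `F[z⁻¹]`, complementary to `F` and
isotropic for `Ω`. -/
structure PseudoOpposite where
  /-- The underlying submodule. -/
  carrier : Submodule (HolRing U) (LVec N (HolRing U))
  /-- `F[z⁻¹] = F ⊕ P`. -/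
  isCompl : IsCompl holPart carrier
  /-- `Ω(P, P) = 0`. -/
  isotropic : ∀ s₁ ∈ carrier, ∀ s₂ ∈ carrier, Om S.G s₁ s₂ = 0

variable {S}

/-- `P` is parallel if `∇ P ⊆ Ω¹ ⊗ P`. -/
def PseudoOpposite.IsParallel (P : S.PseudoOpposite) : Prop :=
  ∀ i, ∀ s ∈ P.carrier, S.nabla i s ∈ P.carrier

/-- The projection `Π : F[z⁻¹] = F ⊕ P → F` along `P`. -/
def PseudoOpposite.proj (P : S.PseudoOpposite) : LVec N (HolRing U) →ₗ[HolRing U] LVec N (HolRing U) :=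
  Submodule.projection holPart P.carrier P.isCompl

end CTP

/-! ### The total space -/

/-- Indices `μ` of the algebraic coordinates `𝗑^μ` on the total space: `Sum.inl i` stands for
`t^i` and `Sum.inr (l, i)` for the fibre coordinate `x_{l+1}^i`, the coefficient of `e_i z^{l+1}`. -/
abbrev Idx (N : ℕ) : Type := Fin (N + 1) ⊕ (ℕ × Fin (N + 1))

/-- `|μ| = 0` for `t^i` and `|μ| = n` for `x_n^i`. -/
def Idx.level {N : ℕ} : Idx N → ℕ := Sum.elim (fun _ => 0) (fun m => m.1 + 1)

/-- The degree of `d𝗑^μ`: `0` for `dt^i` and `1` for `dx_n^i`. -/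
def Idx.deg {N : ℕ} : Idx N → ℕ := Sum.elim (fun _ => 0) (fun _ => 1)

/-- The polynomial ring `𝒪(U)[x_n^i : n ≥ 1]` of regular functions on `pr⁻¹(U)`; the variable
`X (l, i)` is `x_{l+1}^i`. -/
abbrev Poly {N : ℕ} (U : Opens (Base N)) : Type := MvPolynomial (ℕ × Fin (N + 1)) (HolRing U)

/-- The set `pr⁻¹(U)` of points `(t, 𝐱)`, `t ∈ U`, `𝐱 ∈ z F_t`, in algebraic coordinates. -/
def LL {N : ℕ} (U : Opens (Base N)) : Set (Idx N → ℂ) := {q | (fun i => q (Sum.inl i)) ∈ U}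

/-- The base point `t = pr(t, 𝐱)`. -/
def LL.base {N : ℕ} {U : Opens (Base N)} (q : LL U) : U := ⟨fun i => q.1 (Sum.inl i), q.2⟩

/-- Evaluation of a regular function on `pr⁻¹(U)` at a point. -/
def evalLL {N : ℕ} {U : Opens (Base N)} (q : LL U) : Poly U →+* ℂ :=
  MvPolynomial.eval₂Hom (HolRing.eval (LL.base q)).toRingHom (fun m => q.1 (Sum.inr m))

theorem evalLL_C {N : ℕ} {U : Opens (Base N)} (q : LL U) (a : HolRing U) :
    evalLL q (MvPolynomial.C a) = HolRing.eval (LL.base q) a := by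
  simp [evalLL]

theorem evalLL_X {N : ℕ} {U : Opens (Base N)} (q : LL U) (m : ℕ × Fin (N + 1)) :
    evalLL q (MvPolynomial.X m : Poly U) = q.1 (Sum.inr m) := by
  simp [evalLL]

namespace CTP

variable {N : ℕ} {U : Opens (Base N)} (S : CTP N U)

/-- `pr⁻¹(U)° = pr⁻¹(U) ∩ 𝕃°`: the points with `(𝐱/z)|_{z=0} ∈ F°_{0,t}`. -/
def LLo : Set (Idx N → ℂ) :=
  {q | ∃ h : q ∈ LL U, S.InF0circ (LL.base ⟨q, h⟩) (fun i => q (Sum.inr (0, i)))}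

variable {S} in
theorem LLo.mem_LL (q : S.LLo) : q.1 ∈ LL U := q.2.1

/-- The matrix over `𝒪(U)[x_1]` whose `j`-th column is `C_j(t,0) x_1`. -/
def colMatrix : Matrix (Fin (N + 1)) (Fin (N + 1)) (Poly U) :=
  fun a j => ∑ b, MvPolynomial.C (PowerSeries.constantCoeff (S.C j a b)) * MvPolynomial.X (0, b)

/-- The discriminant `P(t, x_1) = (-1)^{N+1} det(C_0(t,0) x_1, …, C_N(t,0) x_1)`. -/
def disc : Poly U := (-1) ^ (N + 1) * S.colMatrix.det

theorem mem_LLo_iff (q : LL U) : q.1 ∈ S.LLo ↔ evalLL q S.disc ≠ 0 := by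
  have h1 : evalLL q S.disc = (-1) ^ (N + 1) * ((evalLL q).mapMatrix S.colMatrix).det := by
    rw [disc, map_mul, map_pow, map_neg, map_one]
    exact congrArg _ (RingHom.map_det (R := Poly U) (S := ℂ) (evalLL q) S.colMatrix)
  have h2 : q.1 ∈ S.LLo ↔ S.InF0circ (LL.base q) (fun i => q.1 (Sum.inr (0, i))) :=
    ⟨fun h => h.2, fun h => ⟨q.2, h⟩⟩
  have h3 : (fun v : Fin (N + 1) → ℂ => ∑ i, v i •
      (S.resid (LL.base q) i).mulVec (fun i => q.1 (Sum.inr (0, i))))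
      = ((evalLL q).mapMatrix S.colMatrix).mulVec := by
    funext v a
    simp only [Finset.sum_apply, Pi.smul_apply, smul_eq_mul, Matrix.mulVec, dotProduct, resid,
      RingHom.mapMatrix_apply, Matrix.map_apply, colMatrix]
    refine Finset.sum_congr rfl fun i _ => ?_
    rw [map_sum, mul_comm]
    simp only [map_mul, evalLL_C, evalLL_X]
  rw [h2, InF0circ, h3, h1]
  have h4 : ((-1 : ℂ) ^ (N + 1)) ≠ 0 := pow_ne_zero _ (by norm_num)
  simp only [ne_eq, mul_eq_zero, h4, false_or]
  rw [← ne_eq, ← isUnit_iff_ne_zero, ← Matrix.isUnit_iff_isUnit_det]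
  constructor
  · intro h
    exact Matrix.mulVec_injective_iff_isUnit.1 h.1
  · intro h
    exact ⟨Matrix.mulVec_injective_iff_isUnit.2 h, Matrix.mulVec_surjective_iff_isUnit.2 h⟩

/-- Evaluation of a regular function on `pr⁻¹(U)` at a point of `𝕃°`. -/
def ev (q : S.LLo) : Poly U →+* ℂ := evalLL ⟨q.1, LLo.mem_LL q⟩

theorem ev_disc_ne_zero (q : S.LLo) : S.ev q S.disc ≠ 0 :=
  (S.mem_LLo_iff ⟨q.1, LLo.mem_LL q⟩).1 q.2

/-- The ring `𝒪(U)[{x_n^i}, P(t,x_1)⁻¹]` of regular functions on `pr⁻¹(U)°`. -/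
def Reg : Subalgebra ℂ (S.LLo → ℂ) where
  carrier := {f | ∃ (k : ℕ) (p : Poly U), ∀ q, f q * S.ev q S.disc ^ k = S.ev q p}
  mul_mem' := by
    rintro f g ⟨k, p, hf⟩ ⟨l, r, hg⟩
    refine ⟨k + l, p * r, fun q => ?_⟩
    rw [map_mul, ← hf, ← hg, Pi.mul_apply]
    ring
  add_mem' := by
    rintro f g ⟨k, p, hf⟩ ⟨l, r, hg⟩
    refine ⟨k + l, p * S.disc ^ l + r * S.disc ^ k, fun q => ?_⟩
    rw [map_add, map_mul, map_mul, map_pow, map_pow, ← hf, ← hg, Pi.add_apply]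
    ring
  algebraMap_mem' := fun c => ⟨0, MvPolynomial.C (algebraMap ℂ (HolRing U) c), fun q => by
    simp [ev, evalLL]⟩

end CTP

section LineDerivatives

variable {N : ℕ} {U : Opens (Base N)}

theorem line_mem_LL (μ : Idx N) (q : LL U) :
    ∀ᶠ s : ℂ in nhds 0, q.1 + s • (Pi.single μ 1 : Idx N → ℂ) ∈ LL U := by
  have hc : Continuous (fun s : ℂ => fun i : Fin (N + 1) =>
      (q.1 + s • (Pi.single μ 1 : Idx N → ℂ)) (Sum.inl i)) := by fun_prop
  have h0 := hc.tendsto 0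
  simp only [zero_smul, add_zero] at h0
  exact h0 (U.isOpen.mem_nhds q.2)

theorem poly_line (μ : Idx N) (p : Poly U) : ∃ p' : Poly U, ∀ q : LL U,
    HasDerivAt (fun s : ℂ => Function.extend (Subtype.val : LL U → Idx N → ℂ)
      (fun q => evalLL q p) 0 (q.1 + s • (Pi.single μ 1 : Idx N → ℂ))) (evalLL q p') 0 := by
  induction p using MvPolynomial.induction_on with
  | C a =>
    obtain ⟨g, hg, hag⟩ : ∃ g : Base N → ℂ, AnalyticOnNhd ℂ g U ∧
        ∀ t : U, HolRing.eval t a = g t := a.2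
    have key : ∀ q : LL U, HasDerivAt (fun s : ℂ =>
        Function.extend (Subtype.val : LL U → Idx N → ℂ)
        (fun q => evalLL q (MvPolynomial.C a)) 0 (q.1 + s • (Pi.single μ 1 : Idx N → ℂ)))
        (fderiv ℂ g (LL.base q) (fun i => (Pi.single μ 1 : Idx N → ℂ) (Sum.inl i))) 0 := by
      intro q
      have h := hasDerivAt_hol_line (f := fun t => HolRing.eval t a) hg hag (LL.base q)
        (fun i => (Pi.single μ 1 : Idx N → ℂ) (Sum.inl i))
      refine h.congr_of_eventuallyEq ?_
      filter_upwards [line_mem_LL μ q] with s hs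
      have e1 := Subtype.val_injective.extend_apply
        (fun q : LL U => evalLL q (MvPolynomial.C a)) 0 ⟨_, hs⟩
      have e2 := Subtype.val_injective.extend_apply
        (fun t : U => HolRing.eval t a) 0 (LL.base ⟨_, hs⟩)
      refine e1.trans ?_
      rw [evalLL_C, ← e2]
      rfl
    rcases μ with i | m
    · refine ⟨MvPolynomial.C (dBase i a), fun q => ?_⟩
      have e : (fun j => (Pi.single (Sum.inl i) 1 : Idx N → ℂ) (Sum.inl j)) = Pi.single i 1 := by
        funext j
        simp [Pi.single_apply]
      have h := key q
      rw [e] at h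
      rw [evalLL_C]
      have h' := (hasDerivAt_hol_line (f := fun t => HolRing.eval t a) hg hag (LL.base q)
        (Pi.single i 1)).deriv
      have e2 : HolRing.eval (LL.base q) (dBase i a)
          = fderiv ℂ g (LL.base q) (Pi.single i 1) := h'
      rw [e2]
      exact h
    · refine ⟨0, fun q => ?_⟩
      have e : (fun j => (Pi.single (Sum.inr m) 1 : Idx N → ℂ) (Sum.inl j)) = 0 := by
        funext j
        simp
      have h := key q
      rw [e, map_zero] at h
      rwa [map_zero]
  | add p r hp hr =>
    obtain ⟨p', hp⟩ := hp
    obtain ⟨r', hr⟩ := hr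
    refine ⟨p' + r', fun q => ?_⟩
    rw [map_add]
    refine ((hp q).add (hr q)).congr_of_eventuallyEq ?_
    filter_upwards [line_mem_LL μ q] with s hs
    have e := fun u : Poly U => Subtype.val_injective.extend_apply
        (fun q : LL U => evalLL q u) 0 ⟨_, hs⟩
    simp only at e
    rw [Pi.add_apply, e, e, e, map_add]
  | mul_X p m hp =>
    obtain ⟨p', hp⟩ := hp
    refine ⟨p' * MvPolynomial.X m +
      p * MvPolynomial.C (algebraMap ℂ (HolRing U) ((Pi.single μ 1 : Idx N → ℂ) (Sum.inr m))),
      fun q => ?_⟩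
    have hx : HasDerivAt (fun s : ℂ => (q.1 + s • (Pi.single μ 1 : Idx N → ℂ)) (Sum.inr m))
        ((Pi.single μ 1 : Idx N → ℂ) (Sum.inr m)) 0 := by
      simp only [Pi.add_apply, Pi.smul_apply, smul_eq_mul]
      simpa using ((hasDerivAt_id (0 : ℂ)).mul_const
        ((Pi.single μ 1 : Idx N → ℂ) (Sum.inr m))).const_add (q.1 (Sum.inr m))
    have h := (hp q).mul hx
    have e0 := Subtype.val_injective.extend_apply (fun q : LL U => evalLL q p) 0 q
    simp only [zero_smul, add_zero, e0] at h
    rw [map_add, map_mul, map_mul, evalLL_X, evalLL_C, AlgHom.commutes]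
    refine h.congr_of_eventuallyEq ?_
    filter_upwards [line_mem_LL μ q] with s hs
    have e := fun u : Poly U => Subtype.val_injective.extend_apply
        (fun q : LL U => evalLL q u) 0 ⟨_, hs⟩
    simp only at e
    rw [Pi.mul_apply, e, e, map_mul, evalLL_X]

end LineDerivatives

namespace CTP

variable {N : ℕ} {U : Opens (Base N)} (S : CTP N U)

theorem line_mem_LLo (μ : Idx N) (q : S.LLo) :
    ∀ᶠ s : ℂ in nhds 0, q.1 + s • (Pi.single μ 1 : Idx N → ℂ) ∈ S.LLo := by
  obtain ⟨p', hp'⟩ := poly_line μ S.disc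
  have hc := (hp' ⟨q.1, LLo.mem_LL q⟩).continuousAt
  have e0 := Subtype.val_injective.extend_apply (fun q : LL U => evalLL q S.disc) 0
    ⟨q.1, LLo.mem_LL q⟩
  simp only at e0
  have hne := hc.eventually_ne (y := 0) (by
    simp only [zero_smul, add_zero, e0]
    exact S.ev_disc_ne_zero q)
  filter_upwards [hne, line_mem_LL μ ⟨q.1, LLo.mem_LL q⟩] with s hs hs'
  have e := Subtype.val_injective.extend_apply (fun q : LL U => evalLL q S.disc) 0 ⟨_, hs'⟩
  simp only at e
  rw [e] at hs
  exact (S.mem_LLo_iff ⟨_, hs'⟩).2 hs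

theorem reg_line (μ : Idx N) {f : S.LLo → ℂ} (hf : f ∈ S.Reg) :
    ∃ f' ∈ S.Reg, ∀ q : S.LLo, HasDerivAt (fun s : ℂ =>
      Function.extend (Subtype.val : S.LLo → Idx N → ℂ) f 0
        (q.1 + s • (Pi.single μ 1 : Idx N → ℂ))) (f' q) 0 := by
  obtain ⟨k, p, hf⟩ := hf
  obtain ⟨p', hp⟩ := poly_line μ p
  obtain ⟨d', hd⟩ := poly_line μ (S.disc ^ k)
  refine ⟨fun q => S.ev q (p' * S.disc ^ k - p * d') / S.ev q S.disc ^ (k * 2), ⟨k * 2, _,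
    fun q => div_mul_cancel₀ _ (pow_ne_zero _ (S.ev_disc_ne_zero q))⟩, fun q => ?_⟩
  have h0 := fun u : Poly U => Subtype.val_injective.extend_apply
    (fun q : LL U => evalLL q u) 0 ⟨q.1, LLo.mem_LL q⟩
  simp only at h0
  have hne : S.ev q S.disc ^ k ≠ 0 := pow_ne_zero _ (S.ev_disc_ne_zero q)
  have h := (hp ⟨q.1, LLo.mem_LL q⟩).div (hd ⟨q.1, LLo.mem_LL q⟩) (by
    simp only [zero_smul, add_zero, h0]
    rw [map_pow]
    exact hne)
  simp only [zero_smul, add_zero, h0] at h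
  have hval : S.ev q (p' * S.disc ^ k - p * d') / S.ev q S.disc ^ (k * 2)
      = (evalLL ⟨q.1, LLo.mem_LL q⟩ p' * evalLL ⟨q.1, LLo.mem_LL q⟩ (S.disc ^ k)
        - evalLL ⟨q.1, LLo.mem_LL q⟩ p * evalLL ⟨q.1, LLo.mem_LL q⟩ d')
        / evalLL ⟨q.1, LLo.mem_LL q⟩ (S.disc ^ k) ^ 2 := by
    rw [pow_mul, map_sub, map_mul, map_mul, map_pow, map_pow]
    rfl
  have h := h.congr_deriv hval.symm
  refine h.congr_of_eventuallyEq ?_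
  filter_upwards [S.line_mem_LLo μ q] with s hs
  have e := fun u : Poly U => Subtype.val_injective.extend_apply
    (fun q : LL U => evalLL q u) 0 ⟨_, LLo.mem_LL ⟨_, hs⟩⟩
  simp only at e
  have e' := Subtype.val_injective.extend_apply f 0 ⟨_, hs⟩
  refine e'.trans ?_
  rw [Pi.div_apply, e, e, map_pow]
  have hne' : S.ev ⟨_, hs⟩ S.disc ^ k ≠ 0 := pow_ne_zero _ (S.ev_disc_ne_zero _)
  exact (eq_div_iff hne').2 (hf ⟨_, hs⟩)

/-- The ring of regular functions on `pr⁻¹(U)°`. -/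
def RegRing : Type := S.Reg

instance : CommRing S.RegRing := inferInstanceAs (CommRing S.Reg)

instance : Algebra ℂ S.RegRing := inferInstanceAs (Algebra ℂ S.Reg)

variable {S} in
/-- The value of a regular function at a point of `pr⁻¹(U)°`. -/
def RegRing.eval (q : S.LLo) : S.RegRing →ₐ[ℂ] ℂ :=
  (Pi.evalAlgHom ℂ (fun _ : S.LLo => ℂ) q).comp S.Reg.val

/-- `∂_μ = ∂/∂𝗑^μ` on the regular functions on `pr⁻¹(U)°`. -/
def dTot (μ : Idx N) : Derivation ℂ S.RegRing S.RegRing :=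
  lineDerivation (W := S.LLo) S.Reg (Pi.single μ 1)
    (fun f hf q => by
      obtain ⟨f', -, h⟩ := S.reg_line μ hf
      exact (h q).differentiableAt)
    (fun f hf => by
      obtain ⟨f', hf', h⟩ := S.reg_line μ hf
      have e : f' = fun q : S.LLo => lineDeriv ℂ (Function.extend Subtype.val f 0) q.1
          (Pi.single μ 1) := funext fun q => (h q).deriv.symm
      exact e ▸ hf')

/-- The restriction of a regular function on `pr⁻¹(U)` to `pr⁻¹(U)°`. -/
def res : Poly U →+* S.RegRing where
  toFun p := ⟨fun q => S.ev q p, 0, p, fun q => by simp⟩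
  map_zero' := Subtype.ext (funext fun q => map_zero (S.ev q))
  map_one' := Subtype.ext (funext fun q => map_one (S.ev q))
  map_add' a b := Subtype.ext (funext fun q => map_add (S.ev q) a b)
  map_mul' a b := Subtype.ext (funext fun q => map_mul (S.ev q) a b)

/-- Pull-back of functions along `pr : pr⁻¹(U)° → U`. -/
def pull : HolRing U →+* S.RegRing := S.res.comp MvPolynomial.C

/-- The fibre coordinate `x_{l+1}^i`. -/
def coord (m : ℕ × Fin (N + 1)) : S.RegRing := S.res (MvPolynomial.X m)

end CTP

/-! ### The Feynman rule -/

/-- A decorated graph with `n` labelled legs.  The vertices are `Fin nV`, the edges `Fin nE`, the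
flags of the edge `e` are `(e, false)` and `(e, true)`, each leg is its own flag; `edgeFlag` and
`leg` give the vertex a flag is attached to, and `genus` is the genus of a vertex. -/
structure FGraph (n : ℕ) where
  nV : ℕ
  nE : ℕ
  edgeFlag : Fin nE × Bool → Fin nV
  leg : Fin n → Fin nV
  genus : Fin nV → ℕ

namespace FGraph

variable {n : ℕ}

/-- The flags of a graph. -/
abbrev Flag (Γ : FGraph n) : Type := (Fin Γ.nE × Bool) ⊕ Fin n

/-- The incidence map from flags to vertices. -/
def att (Γ : FGraph n) : Γ.Flag → Fin Γ.nV := Sum.elim Γ.edgeFlag Γ.leg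

/-- The flags at the vertex `v`. -/
abbrev FlagAt (Γ : FGraph n) (v : Fin Γ.nV) : Type := {h : Γ.Flag // Γ.att h = v}

/-- The graph is (non-empty and) connected. -/
def IsConnected (Γ : FGraph n) : Prop :=
  (SimpleGraph.fromRel fun v w => ∃ e, Γ.edgeFlag (e, false) = v ∧ Γ.edgeFlag (e, true) = w).Connected

/-- `2 g_v - 2 + n_v > 0` for every vertex `v`, where `n_v` is the number of flags at `v`. -/
def IsStable (Γ : FGraph n) : Prop := ∀ v, 2 < 2 * Γ.genus v + Fintype.card (Γ.FlagAt v)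

/-- `g = ∑_v g_v + 1 - χ(Γ)`, with `χ(Γ)` the number of vertices minus the number of edges. -/
def HasGenus (Γ : FGraph n) (g : ℕ) : Prop :=
  (g : ℤ) = ∑ v, (Γ.genus v : ℤ) + 1 - ((Γ.nV : ℤ) - Γ.nE)

/-- Isomorphisms of decorated graphs, respecting the labels of the legs. -/
structure Iso (Γ Γ' : FGraph n) where
  vert : Fin Γ.nV ≃ Fin Γ'.nV
  edge : Fin Γ.nE ≃ Fin Γ'.nE
  flag : Fin Γ.nE × Bool ≃ Fin Γ'.nE × Bool
  flag_edge : ∀ h, (flag h).1 = edge h.1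
  flag_vert : ∀ h, Γ'.edgeFlag (flag h) = vert (Γ.edgeFlag h)
  leg_vert : ∀ l, Γ'.leg l = vert (Γ.leg l)
  genus_vert : ∀ v, Γ'.genus (vert v) = Γ.genus v

/-- The identity. -/
def Iso.refl (Γ : FGraph n) : Iso Γ Γ where
  vert := Equiv.refl _
  edge := Equiv.refl _
  flag := Equiv.refl _
  flag_edge _ := rfl
  flag_vert _ := rfl
  leg_vert _ := rfl
  genus_vert _ := rfl

/-- The inverse isomorphism. -/
def Iso.symm {Γ Γ' : FGraph n} (φ : Iso Γ Γ') : Iso Γ' Γ where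
  vert := φ.vert.symm
  edge := φ.edge.symm
  flag := φ.flag.symm
  flag_edge h := by
    rw [Equiv.eq_symm_apply, ← φ.flag_edge, Equiv.apply_symm_apply]
  flag_vert h := by
    rw [Equiv.eq_symm_apply, ← φ.flag_vert, Equiv.apply_symm_apply]
  leg_vert l := by
    rw [Equiv.eq_symm_apply, φ.leg_vert]
  genus_vert v := by
    rw [← φ.genus_vert, Equiv.apply_symm_apply]

/-- Composition of isomorphisms. -/
def Iso.trans {Γ Γ' Γ'' : FGraph n} (φ : Iso Γ Γ') (ψ : Iso Γ' Γ'') : Iso Γ Γ'' where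
  vert := φ.vert.trans ψ.vert
  edge := φ.edge.trans ψ.edge
  flag := φ.flag.trans ψ.flag
  flag_edge h := by simp [ψ.flag_edge, φ.flag_edge]
  flag_vert h := by simp [ψ.flag_vert, φ.flag_vert]
  leg_vert l := by simp [ψ.leg_vert l, φ.leg_vert l]
  genus_vert v := by simp [ψ.genus_vert, φ.genus_vert]

/-- Connected stable graphs of genus `g` with `n` labelled legs. -/
def Admissible (g n : ℕ) : Type :=
  {Γ : FGraph n // Γ.IsConnected ∧ Γ.IsStable ∧ Γ.HasGenus g}

/-- Being isomorphic. -/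
instance isoSetoid (g n : ℕ) : Setoid (Admissible g n) where
  r Γ Γ' := Nonempty (Iso Γ.1 Γ'.1)
  iseqv :=
    ⟨fun Γ => ⟨Iso.refl Γ.1⟩, fun ⟨φ⟩ => ⟨φ.symm⟩, fun ⟨φ⟩ ⟨ψ⟩ => ⟨φ.trans ψ⟩⟩

/-- Isomorphism classes of connected stable graphs of genus `g` with `n` labelled legs. -/
abbrev IsoClass (g n : ℕ) : Type := Quotient (isoSetoid g n)

theorem bounds {g : ℕ} (Γ : FGraph n) (hs : Γ.IsStable) (hg : Γ.HasGenus g) :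
    Γ.nV < 3 * g + n + 1 ∧ Γ.nE < 3 * g + n + 1 ∧ ∀ v, Γ.genus v < 3 * g + n + 1 := by
  have hcard : ∑ v, Fintype.card (Γ.FlagAt v) = Γ.nE * 2 + n := by
    rw [← Fintype.card_sigma, Fintype.card_congr (Equiv.sigmaFiberEquiv Γ.att)]
    simp
  have h1 : ∑ _v : Fin Γ.nV, 3 ≤ ∑ v, (2 * Γ.genus v + Fintype.card (Γ.FlagAt v)) :=
    Finset.sum_le_sum fun v _ => hs v
  rw [Finset.sum_add_distrib, hcard, ← Finset.mul_sum] at h1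
  simp only [Finset.sum_const, Finset.card_univ, Fintype.card_fin, smul_eq_mul] at h1
  have h2 : (g : ℤ) = ((∑ v, Γ.genus v : ℕ) : ℤ) + 1 - ((Γ.nV : ℤ) - Γ.nE) := by
    have := hg
    unfold HasGenus at this
    push_cast
    exact this
  have h3 : ∀ v, Γ.genus v ≤ ∑ v, Γ.genus v := fun v =>
    Finset.single_le_sum (f := Γ.genus) (fun _ _ => Nat.zero_le _) (Finset.mem_univ v)
  refine ⟨by omega, by omega, fun v => ?_⟩
  have := h3 v
  omega

instance (g n : ℕ) : Finite (Admissible g n) := by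
  let B := 3 * g + n + 1
  let T := Σ a : Fin B, Σ b : Fin B, (Fin b × Bool → Fin a) × (Fin n → Fin a) × (Fin a → Fin B)
  let F : T → FGraph n := fun x =>
    ⟨x.1, x.2.1, x.2.2.1, x.2.2.2.1, fun v => x.2.2.2.2 v⟩
  have hF : (Set.range F).Finite := Set.finite_range F
  have : Finite (Set.range F) := hF
  refine Finite.of_injective (β := Set.range F) (fun Γ => ⟨Γ.1, ?_⟩) ?_
  · obtain ⟨h1, h2, h3⟩ := bounds Γ.1 Γ.2.2.1 Γ.2.2.2
    exact ⟨⟨⟨Γ.1.nV, h1⟩, ⟨Γ.1.nE, h2⟩, Γ.1.edgeFlag, Γ.1.leg, fun v => ⟨Γ.1.genus v, h3 v⟩⟩, rfl⟩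
  · intro Γ Γ' h
    exact Subtype.ext (congrArg (fun x : Set.range F => x.1) h)

section Contraction

variable {I R : Type} [CommRing R]

/-- The contraction `Cont_Γ(C, Δ)_{μ_1 … μ_n}`: the tensor `C^{(g_v)}` with `n_v` indices is put on
each vertex `v`, `Δ` on each edge, the index `μ_i` on the `i`-th leg, and all indices of edge flags
are summed over.  (For symmetric tensors the order of the flags at a vertex is irrelevant.) -/
def cont (Γ : FGraph n) (C : ℕ → ∀ m : ℕ, (Fin m → I) →₀ R) (Δ : I → I → R) (μ : Fin n → I) : R :=
  ∑ᶠ a : Fin Γ.nE × Bool → I,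
    (∏ e, Δ (a (e, false)) (a (e, true))) *
      ∏ v, C (Γ.genus v) (Fintype.card (Γ.FlagAt v))
        (fun k => Sum.elim a μ ((Fintype.equivFin (Γ.FlagAt v)).symm k).1)

theorem cont_support (Γ : FGraph n) (C : ℕ → ∀ m : ℕ, (Fin m → I) →₀ R) (Δ : I → I → R) :
    (Function.support (Γ.cont C Δ)).Finite := by
  classical
  let J : Fin n → Finset I := fun i =>
    (C (Γ.genus (Γ.leg i)) (Fintype.card (Γ.FlagAt (Γ.leg i)))).support.image
      (fun x => x (Fintype.equivFin (Γ.FlagAt (Γ.leg i)) ⟨Sum.inr i, rfl⟩))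
  refine (Fintype.piFinset J).finite_toSet.subset ?_
  intro μ hμ
  simp only [Finset.mem_coe, Fintype.mem_piFinset]
  intro i
  obtain ⟨a, ha⟩ : ∃ a : Fin Γ.nE × Bool → I, (∏ e, Δ (a (e, false)) (a (e, true))) *
      ∏ v, C (Γ.genus v) (Fintype.card (Γ.FlagAt v))
        (fun k => Sum.elim a μ ((Fintype.equivFin (Γ.FlagAt v)).symm k).1) ≠ 0 := by
    by_contra! h
    exact hμ (by simp only [cont, h, finsum_zero])
  have h1 := right_ne_zero_of_mul ha
  have h2 : C (Γ.genus (Γ.leg i)) (Fintype.card (Γ.FlagAt (Γ.leg i)))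
      (fun k => Sum.elim a μ ((Fintype.equivFin (Γ.FlagAt (Γ.leg i))).symm k).1) ≠ 0 :=
    fun h => h1 (Finset.prod_eq_zero (Finset.mem_univ (Γ.leg i)) h)
  refine Finset.mem_image.2 ⟨_, Finsupp.mem_support_iff.2 h2, ?_⟩
  simp

/-- The Feynman sum `∑_Γ Cont_Γ(C, Δ) / |Aut Γ|` over the isomorphism classes of connected stable
graphs of genus `g` with `n` labelled legs, as a tensor with finitely many non-zero components. -/
def feynman [Algebra ℂ R] (C : ℕ → ∀ m : ℕ, (Fin m → I) →₀ R) (Δ : I → I → R) (g n : ℕ) :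
    (Fin n → I) →₀ R :=
  ∑ᶠ Γ : IsoClass g n, ((Nat.card (Iso Γ.out.1 Γ.out.1) : ℂ)⁻¹) •
    Finsupp.ofSupportFinite (Γ.out.1.cont C Δ) (Γ.out.1.cont_support C Δ)

end Contraction

end FGraph

/-! ### The Kodaira–Spencer map, connections, propagators and torsion -/

namespace CTP

variable {N : ℕ} {U : Opens (Base N)} (S : CTP N U)

/-- The pull-back of a matrix along `pr`. -/
def pullMat (M : PMat N (HolRing U)) : PMat N S.RegRing := M.map (PowerSeries.map S.pull)

/-- The pulled back connection on `pr^* F[z⁻¹]`: `∂_i - z⁻¹ C_i(t,z)` in the direction `∂/∂t^i`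
and `∂_{n,i}` in the direction `∂/∂x_n^i`. -/
def nablaTot (μ : Idx N) : LVec N S.RegRing → LVec N S.RegRing :=
  conn (S.dTot μ) (Sum.elim (fun i => S.pullMat (S.C i)) (fun _ => 0) μ)

/-- The tautological section `𝐱 = ∑_{n ≥ 1} ∑_i x_n^i e_i z^n` of `pr^*(zF)`. -/
def taut : LVec N S.RegRing := fun i =>
  zPow 1 * HahnSeries.ofPowerSeries ℤ S.RegRing (PowerSeries.mk fun l => S.coord (l, i))

/-- The Kodaira–Spencer map on the coordinate vector fields: `KS(∂_μ)`, the derivative of `𝐱` in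
the direction `∂_μ`. -/
def KS (μ : Idx N) : LVec N S.RegRing := S.nablaTot μ S.taut

/-- The dual Kodaira–Spencer map.  The section `∑ c_n^i φ_n^i` (`n ≥ 0`, finite sum) of `pr^* F^∨`
is sent to the one-form with components `μ ↦ ⟨φ, KS(∂_μ)⟩`. -/
def KSstar (φ : ℕ × Fin (N + 1) →₀ S.RegRing) : Idx N → S.RegRing :=
  fun μ => φ.sum fun m c => c * (S.KS μ m.2).coeff (m.1 : ℤ)

/-- `KS*⁻¹ d𝗑^μ`. -/
def conormal (μ : Idx N) : ℕ × Fin (N + 1) →₀ S.RegRing :=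
  Function.invFun S.KSstar (Pi.single μ 1)

variable {S}

/-- `Π^* φ ∈ pr^* F[z⁻¹]^∨` for `φ ∈ pr^* F^∨`, where `Π` is the projection to `F` along `Q`;
given through its values on the frame `e_j z^n`. -/
def piStar (Q : S.PseudoOpposite) (φ : ℕ × Fin (N + 1) →₀ S.RegRing) :
    ℤ × Fin (N + 1) → S.RegRing :=
  fun m => φ.sum fun k c => c * S.pull ((Q.proj (frame m.2 m.1) k.2).coeff (k.1 : ℤ))

variable (S) in
/-- The dual connection on `pr^* F[z⁻¹]^∨`, in the direction `∂_μ`: `⟨∇^∨ ψ, s⟩ = d⟨ψ, s⟩ - ⟨ψ, ∇ s⟩`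
on the frame `s = e_j z^n`. -/
def dualNabla (μ : Idx N) (ψ : ℤ × Fin (N + 1) → S.RegRing) : ℤ × Fin (N + 1) → S.RegRing :=
  fun m => S.dTot μ (ψ m) - evalDual ψ (S.nablaTot μ (frame m.2 m.1))

/-- The propagator `Δ(P, Q)^{μν} = Ω^∨(Π_P^* KS*⁻¹ d𝗑^μ, Π_Q^* KS*⁻¹ d𝗑^ν)`. -/
def propagator (P Q : S.PseudoOpposite) (μ ν : Idx N) : S.RegRing :=
  OmDual (S.pullMat S.G) (piStar P (S.conormal μ)) (piStar Q (S.conormal ν))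

/-- The background torsion `(Λ_Q)_ρ^{μν} = Ω^∨(∇^∨_ρ Π_Q^* KS*⁻¹ d𝗑^μ, Π_Q^* KS*⁻¹ d𝗑^ν)`. -/
def torsion (Q : S.PseudoOpposite) (ρ μ ν : Idx N) : S.RegRing :=
  OmDual (S.pullMat S.G) (S.dualNabla ρ (piStar Q (S.conormal μ))) (piStar Q (S.conormal ν))

/-- The Christoffel symbol `Γ^ρ_{νσ}` of the connection `∇^Q` on the one-forms on `pr⁻¹(U)°`, which
is the connection `∇^∨ ∘ Π_Q^*` on `pr^* F^∨` transported by `KS*`.  It is defined by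
`∇^Q_ν d𝗑^ρ = KS^*((∇^∨_ν Π_Q^* KS*⁻¹ d𝗑^ρ)|_{pr^* F}) = - ∑_σ Γ^ρ_{νσ} d𝗑^σ`. -/
def christoffel (Q : S.PseudoOpposite) (ρ ν σ : Idx N) : S.RegRing :=
  -evalDual (S.dualNabla ν (piStar Q (S.conormal ρ))) (S.KS σ)

/-- The covariant derivative `∇^Q_ν T_{μ_1 … μ_n} = ∂_ν T_{μ_1 … μ_n} - ∑_i T_{… ρ …} Γ^ρ_{ν μ_i}`
of a covariant `n`-tensor (with finitely many non-zero components). -/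
def covDeriv {n : ℕ} (Q : S.PseudoOpposite) (T : (Fin n → Idx N) →₀ S.RegRing) (ν : Idx N)
    (μ : Fin n → Idx N) : S.RegRing :=
  S.dTot ν (T μ) - ∑ i, ∑ᶠ ρ, T (Function.update μ i ρ) * christoffel Q ρ ν (μ i)

variable (S)

/-! ### Fock spaces -/

/-- The residual matrix `C_i(t,0)`, pulled back to `pr⁻¹(U)°`. -/
def residTot (i : Fin (N + 1)) : Matrix (Fin (N + 1)) (Fin (N + 1)) S.RegRing :=
  (S.pullMat (S.C i)).map PowerSeries.constantCoeff

/-- The coefficient `x_1 = (𝐱/z)|_{z=0}`. -/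
def x₁ : Fin (N + 1) → S.RegRing := fun i => S.coord (0, i)

/-- The pairing on `F_0 = F/zF`, pulled back to `pr⁻¹(U)°`. -/
def pairing₀ (v w : Fin (N + 1) → S.RegRing) : S.RegRing :=
  ∑ a, ∑ b, v a * PowerSeries.constantCoeff (S.pullMat S.G a b) * w b

/-- The Yukawa coupling: `C^{(0)}_{ijh} = (C_i(t,0) x_1, C_j(t,0) C_h(t,0) x_1)_{F_0}` in the
directions `dt^i ⊗ dt^j ⊗ dt^h`; all other components vanish. -/
def yukawa : Idx N → Idx N → Idx N → S.RegRing
  | Sum.inl i, Sum.inl j, Sum.inl h =>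
      S.pairing₀ ((S.residTot i).mulVec S.x₁) ((S.residTot j * S.residTot h).mulVec S.x₁)
  | _, _, _ => 0

/-- `f ∈ 𝒪^d_l(pr⁻¹(U)°)`: `f = p / P^k` with `p` homogeneous in the fibre coordinates, of degree
`d + k (N + 1)`, and `p` in the `l`-th filter, where `x_{n+1}^i` has filter weight `n`. -/
def IsGradedFiltered (d l : ℤ) (f : S.RegRing) : Prop :=
  ∃ (k m : ℕ) (p : Poly U), (m : ℤ) = d + k * (N + 1) ∧ p.IsHomogeneous m ∧
    (∀ s ∈ p.support, (((s.sum fun v e => e * v.1 : ℕ) : ℤ) ≤ l)) ∧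
    f * S.res S.disc ^ k = S.res p

variable {S}

/-- The elements of the local Fock space `𝔉𝔬𝔠𝔨(U; P)`: collections of correlation functions
`C^{(g)}_{μ_1 … μ_n}`, `2g - 2 + n > 0`.  By convention, the (undefined) unstable ones are `0`. -/
structure FockSpace (P : S.PseudoOpposite) where
  /-- The tensor `∇^n C^{(g)}` with components `C^{(g)}_{μ_1 … μ_n}`. -/
  corr : ℕ → ∀ n : ℕ, (Fin n → Idx N) →₀ S.RegRing
  unstable : ∀ g n : ℕ, 2 * g + n ≤ 2 → corr g n = 0
  /-- The tensors are completely symmetric. -/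
  symm : ∀ (g n : ℕ) (σ : Equiv.Perm (Fin n)) (μ : Fin n → Idx N), corr g n (μ ∘ σ) = corr g n μ
  /-- (Yukawa) -/
  yukawa : ∀ i j h, corr 0 3 ![i, j, h] = S.yukawa i j h
  /-- (Jetness) -/
  jet : ∀ g n : ℕ, 2 < 2 * g + n → ∀ ν μ, corr g (n + 1) (Fin.cons ν μ) = covDeriv P (corr g n) ν μ
  /-- (Grading & Filtration): `∇^n C^{(g)}` has degree `2 - 2g` and lies in the filter `3g - 3`,
  where `dt^i` has degree `0` and filter `-1` and `dx_n^i` has degree `1` and filter `n - 1`. -/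
  graded : ∀ g n : ℕ, 2 < 2 * g + n → ∀ μ : Fin n → Idx N,
    S.IsGradedFiltered (2 - 2 * g - ∑ i, ((μ i).deg : ℤ))
      (3 * g - 3 - ∑ i, (((μ i).level : ℤ) - 1)) (corr g n μ)
  /-- (Pole) in genus one: `P ∇C^{(1)}` is regular on `pr⁻¹(U)`. -/
  pole_one : ∀ μ, ∃ p : Poly U, S.res S.disc * corr 1 1 (fun _ => μ) = S.res p
  /-- (Pole) in genus `g ≥ 2`:
  `P^{5g-5} C^{(g)} ∈ 𝒪(U)[x_1, x_2, P x_3, P² x_4, …, P^{3g-4} x_{3g-2}]`. -/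
  pole : ∀ g, 2 ≤ g → ∃ p : Poly U, (∀ v ∈ p.vars, v.1 ≤ 3 * g - 3) ∧
    S.res S.disc ^ (5 * g - 5) * corr g 0 Fin.elim0 =
      S.res (MvPolynomial.aeval (fun v => S.disc ^ (v.1 - 1) * MvPolynomial.X v) p)

/-- The correlation functions `𝒞_Q = T(P, Q) 𝒞` under the (possibly curved) pseudo-opposite module
`Q` corresponding to `𝒞 ∈ 𝔉𝔬𝔠𝔨(U; P)`, given by the Feynman rule with propagator `Δ(P, Q)`.  For
`2g - 2 + n ≤ 0` there are no stable graphs and the sum is `0`. -/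
def FockSpace.under {P : S.PseudoOpposite} (C : FockSpace P) (Q : S.PseudoOpposite) (g n : ℕ) :
    (Fin n → Idx N) →₀ S.RegRing :=
  FGraph.feynman C.corr (propagator P Q) g n

/-- `½ ∑ C^{(k)}_{S₁, α} Λ_ν^{αβ} C^{(l)}_{S₂, β}`, the sum being over `k + l = g`, the ordered
decompositions `S₁ ⊔ S₂` of the indices `μ_1, …, μ_n`, and `α`, `β`. -/
def splitTerm (C : ℕ → ∀ n : ℕ, (Fin n → Idx N) →₀ S.RegRing) (Q : S.PseudoOpposite) (g n : ℕ)
    (ν : Idx N) (μ : Fin n → Idx N) : S.RegRing :=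
  (1 / 2 : ℂ) • ∑ kl ∈ Finset.HasAntidiagonal.antidiagonal g, ∑ A : Finset (Fin n), ∑ᶠ αβ : Idx N × Idx N,
    C kl.1 (A.card + 1) (Fin.snoc (fun j => μ (A.orderEmbOfFin rfl j)) αβ.1)
      * torsion Q ν αβ.1 αβ.2
      * C kl.2 (Aᶜ.card + 1) (Fin.snoc (fun j => μ (Aᶜ.orderEmbOfFin rfl j)) αβ.2)

/-- `½ C^{(g-1)}_{μ_1 … μ_n α β} Λ_ν^{αβ}`, which is `0` for `g = 0`. -/
def loopTerm (C : ℕ → ∀ n : ℕ, (Fin n → Idx N) →₀ S.RegRing) (Q : S.PseudoOpposite) (n : ℕ)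
    (ν : Idx N) (μ : Fin n → Idx N) : ℕ → S.RegRing
  | 0 => 0
  | g + 1 => (1 / 2 : ℂ) • ∑ᶠ αβ : Idx N × Idx N,
      C g (n + 2) (Fin.snoc (Fin.snoc μ αβ.1 : Fin (n + 1) → Idx N) αβ.2)
        * torsion Q ν αβ.1 αβ.2

end CTP

end CTPFock

end

/-! Collect the correlation functions in a generating function F = Σ h^g C^{(g)}_{μ_1…μ_n}
y^{μ_1}…y^{μ_n}/n! and give each edge of a Feynman graph a factor s. The resulting family F_s joins
the generating function of 𝒞 (s = 0) to that of the correlation functions under Q (s = 1). Cutting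
one edge of a connected graph either leaves a connected graph with one loop less or produces two
connected graphs. Hence, with ∂_a = ∂/∂y^a and Δ = Δ(P,Q), 2 ∂_s F = h Δ^{ab} ∂_a∂_b F + Δ^{ab} ∂_aF
∂_bF. Degree by degree in s this is `edgeSum_succ`, which rests on `ite_isConn_addEdge`. It applies
to the Feynman rule because an isomorphism class with automorphism group Aut has V! E! 2^E / |Aut|
labelled representatives (`card_fiber`, `feynman_eq_edgeSum`).

The geometry enters through the representation of Π_P^* d𝗑^α and Π_Q^* d𝗑^α by sections of pr^*P and
pr^*Q with the help of Ω (`exists_dualVec`). Their difference is Ω-orthogonal to F, hence lies in F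
(`diffVec_mem`), and its coordinates are the components of Δ (`pair_diffVec`). Write Y_{ab} =
C^{(0)}_{νab} for the Yukawa coupling with one fixed index ν. Since ∇ is compatible with the pairing
and Ω(∇_ν h, h') is a Yukawa coupling for h, h' in F (`Om_nablaTot_hol`), it follows that Γ_P - Γ_Q
= ΔY (`christoffel_sub`) and, P being parallel, Λ_Q = ΔYΔ - ∇^PΔ (`torsion_eq_sub`).

Now let D = ∂_ν - Γ^c_a y^a ∂_c be the covariant derivative for P acting on generating functions, q
= Y_{ab} y^a y^b and c = h C^{(1)}_ν. The defect A(s) = 2(∂F/∂y^ν - DF - c) - q - s Δ^{ab} ∂_aq ∂_bF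
+ h M^{ab} ∂_a∂_bF + M^{ab} ∂_aF ∂_bF - s h Δ^{ab} Y_{ab}, with M = s ∇^PΔ - s² ΔYΔ, vanishes at s =
0 by jetness (`hasOrder_defect_zero`); the terms c and q are the stable functions which are not
derivatives of stable ones. The key computation `anomaly_heat` shows that A satisfies the linearised
equation 2 ∂_s A = h Δ^{ab} ∂_a∂_b A + 2 Δ^{ab} ∂_aF ∂_bA. Therefore A vanishes identically
(`hasOrder_defect`). At s = 1 the components of A = 0 with 2g + n > 2 are the anomaly equation, in
view of the formulas for Γ_Q and Λ_Q.

There are infinitely many coordinates, but for given g and n only finitely many indices matter. The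
argument is run over a finite set of indices and for components of bounded weight 2g + n; the
linearised equation propagates vanishing in low weight, because h compensates two derivatives and F
starts in weight 3. -/

noncomputable section
namespace CTPFock

/-! ### Symmetric tensors as Hurwitz series -/

/-- Families of symmetric tensors with indices in `I`, as functions of the multiset of indices; with
the shuffle product. -/
def Hz (I K : Type) : Type := Multiset I → K

namespace Hz

variable {I K : Type} [CommRing K]

instance : AddCommGroup (Hz I K) := inferInstanceAs (AddCommGroup (Multiset I → K))

theorem add_apply (f g : Hz I K) (m : Multiset I) : (f + g) m = f m + g m := rfl

theorem sub_apply (f g : Hz I K) (m : Multiset I) : (f - g) m = f m - g m := rfl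

theorem zero_apply (m : Multiset I) : (0 : Hz I K) m = 0 := rfl

theorem sum_apply {J : Type} (s : Finset J) (f : J → Hz I K) (m : Multiset I) :
    (∑ j ∈ s, f j) m = ∑ j ∈ s, f j m :=
  map_sum (AddMonoidHom.mk' (fun f : Hz I K => f m) fun _ _ => rfl) f s

/-- Insertion of the index `a`. -/
def shift (a : I) (f : Hz I K) : Hz I K := fun m => f (a ::ₘ m)

/-- The splittings in `Multiset.antidiagonal` are counted with multiplicity. This is the product of
generating functions with divided powers, so that no denominators appear. -/
instance : Mul (Hz I K) := ⟨fun f g m => (m.antidiagonal.map fun p => f p.1 * g p.2).sum⟩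

theorem mul_apply (f g : Hz I K) (m : Multiset I) :
    (f * g) m = (m.antidiagonal.map fun p => f p.1 * g p.2).sum := rfl

theorem mul_zero_apply (f g : Hz I K) : (f * g) 0 = f 0 * g 0 := by simp [mul_apply]

/-- A new index goes to one of the two factors. Together with `mul_zero_apply` this Leibniz rule
determines the product, and the ring axioms follow from it by induction on the multiset. -/
theorem shift_mul (a : I) (f g : Hz I K) : shift a (f * g) = f * shift a g + shift a f * g := by
  funext m
  change (f * g) (a ::ₘ m) = (f * shift a g) m + (shift a f * g) m
  rw [mul_apply, Multiset.antidiagonal_cons, Multiset.map_add, Multiset.sum_add, Multiset.map_map,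
    Multiset.map_map]
  rfl

theorem mul_add_aux (f g h : Hz I K) : f * (g + h) = f * g + f * h := by
  funext m
  rw [add_apply, mul_apply, mul_apply, mul_apply, ← Multiset.sum_map_add]
  simp only [add_apply, mul_add]

theorem mul_comm_aux (f g : Hz I K) : f * g = g * f := by
  funext m
  induction m using Multiset.induction_on generalizing f g with
  | empty => rw [mul_zero_apply, mul_zero_apply, mul_comm]
  | cons a m ih =>
    change shift a (f * g) m = shift a (g * f) m
    rw [shift_mul, shift_mul, add_apply, add_apply, ih, ih (shift a f), add_comm]

theorem mul_assoc_aux (f g h : Hz I K) : f * g * h = f * (g * h) := by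
  have add_mul' : ∀ f g h : Hz I K, (f + g) * h = f * h + g * h := fun f g h => by
    rw [mul_comm_aux, mul_add_aux, mul_comm_aux, mul_comm_aux h]
  funext m
  induction m using Multiset.induction_on generalizing f g h with
  | empty => simp only [mul_zero_apply, mul_assoc]
  | cons a m ih =>
    change shift a (f * g * h) m = shift a (f * (g * h)) m
    simp only [shift_mul, mul_add_aux, add_mul', add_apply, ih]
    abel

open scoped Classical in
/-- The tensors with only a component without indices. -/
def const (c : K) : Hz I K := fun m => if m = 0 then c else 0

theorem const_zero_apply (c : K) : (const c : Hz I K) 0 = c := if_pos rfl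

theorem const_cons_apply (c : K) (a : I) (m : Multiset I) : (const c : Hz I K) (a ::ₘ m) = 0 :=
  if_neg (Multiset.cons_ne_zero)

theorem shift_const (c : K) (a : I) : shift a (const c : Hz I K) = 0 :=
  funext fun m => const_cons_apply c a m

theorem zero_mul_aux (f : Hz I K) : 0 * f = 0 := by
  have h := mul_add_aux f 0 0
  rw [add_zero] at h
  rw [mul_comm_aux]
  simpa using h

theorem const_mul_apply (c : K) (f : Hz I K) (m : Multiset I) : ((const c : Hz I K) * f) m = c * f m := by
  induction m using Multiset.induction_on generalizing f with
  | empty => rw [mul_zero_apply, const_zero_apply]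
  | cons a m ih =>
    change shift a ((const c : Hz I K) * f) m = _
    rw [shift_mul, shift_const, zero_mul_aux, add_zero, ih]
    rfl

instance : CommRing (Hz I K) where
  __ := (inferInstance : AddCommGroup (Hz I K))
  mul := (· * ·)
  one := const 1
  left_distrib := mul_add_aux
  right_distrib f g h := by rw [mul_comm_aux, mul_add_aux, mul_comm_aux, mul_comm_aux h]
  zero_mul := zero_mul_aux
  mul_zero f := by rw [mul_comm_aux, zero_mul_aux]
  mul_assoc := mul_assoc_aux
  mul_comm := mul_comm_aux
  one_mul f := funext fun m => by
    change ((const 1 : Hz I K) * f) m = f m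
    rw [const_mul_apply, one_mul]
  mul_one f := funext fun m => by
    change (f * (const 1 : Hz I K)) m = f m
    rw [mul_comm_aux, const_mul_apply, one_mul]

/-- The derivation inserting an index. -/
def dIdx (a : I) : Derivation ℤ (Hz I K) (Hz I K) :=
  Derivation.mk' (AddMonoidHom.toIntLinearMap (AddMonoidHom.mk' (shift a) fun _ _ => rfl))
    fun f g => by
      change shift a (f * g) = f * shift a g + g * shift a f
      rw [shift_mul, mul_comm g]

theorem dIdx_apply (a : I) (f : Hz I K) (m : Multiset I) : dIdx a f m = f (a ::ₘ m) := rfl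

theorem dIdx_comm (a b : I) (f : Hz I K) : dIdx a (dIdx b f) = dIdx b (dIdx a f) :=
  funext fun _ => congrArg f (Multiset.cons_swap _ _ _)

theorem dIdx_const (a : I) (c : K) : dIdx a (const c : Hz I K) = 0 := shift_const c a

theorem map_mul_coeff (D : Derivation ℤ K K) (f g f' g' : Hz I K) (hf : ∀ m, f' m = D (f m))
    (hg : ∀ m, g' m = D (g m)) (m : Multiset I) : D ((f * g) m) = (f * g' + g * f') m := by
  rw [mul_comm g, add_apply, mul_apply, mul_apply, mul_apply, map_multiset_sum, Multiset.map_map,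
    ← Multiset.sum_map_add]
  congr 1
  refine Multiset.map_congr rfl fun p _ => ?_
  simp only [Function.comp_apply, Derivation.leibniz, smul_eq_mul, hf, hg, mul_comm (g p.2)]

/-- The componentwise action of a derivation of the coefficients. -/
def dCoeff (D : Derivation ℤ K K) : Derivation ℤ (Hz I K) (Hz I K) :=
  Derivation.mk' (AddMonoidHom.toIntLinearMap (AddMonoidHom.mk' (fun f m => D (f m))
    fun _ _ => funext fun _ => map_add D _ _))
    fun f g => funext fun m => map_mul_coeff D f g _ _ (fun _ => rfl) (fun _ => rfl) m

theorem dCoeff_apply (D : Derivation ℤ K K) (f : Hz I K) (m : Multiset I) :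
    dCoeff D f m = D (f m) := rfl

theorem dIdx_dCoeff (D : Derivation ℤ K K) (a : I) (f : Hz I K) :
    dIdx a (dCoeff D f) = dCoeff D (dIdx a f) := rfl

theorem dCoeff_const (D : Derivation ℤ K K) (c : K) :
    dCoeff D (const c : Hz I K) = const (D c) := by
  funext m
  induction m using Multiset.induction_on with
  | empty => rfl
  | cons a m _ =>
    rw [const_cons_apply]
    change D (const c (a ::ₘ m)) = 0
    rw [const_cons_apply, map_zero]

open scoped Classical in
/-- The variable dual to the index `a`. -/
def var (a : I) : Hz I K := fun m => if m = {a} then 1 else 0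

open scoped Classical in
theorem dIdx_var (a b : I) : dIdx b (var a : Hz I K) = if b = a then 1 else 0 := by
  have h1 : ∀ m, (1 : Hz I K) m = if m = 0 then 1 else 0 := fun _ => rfl
  funext m
  rw [dIdx_apply]
  unfold var
  by_cases hb : b = a
  · subst hb
    rw [if_pos rfl, h1]
    congr 1
    rw [← Multiset.cons_zero, Multiset.cons_inj_right]
  · rw [if_neg hb, if_neg, zero_apply]
    intro h
    have : b ∈ ({a} : Multiset I) := h ▸ Multiset.mem_cons_self b m
    exact hb (Multiset.mem_singleton.1 this)

theorem var_zero (a : I) : (var a : Hz I K) 0 = 0 :=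
  if_neg fun h => by simpa using congrArg Multiset.card h

theorem dCoeff_var (D : Derivation ℤ K K) (a : I) : dCoeff D (var a : Hz I K) = 0 := by
  classical
  funext m
  rw [dCoeff_apply, zero_apply]
  unfold var
  split_ifs <;> simp

end Hz

namespace Heat

/-! ### The heat equation and the anomaly operator -/

variable {𝔸 I : Type} [CommRing 𝔸] [Fintype I] (d : I → Derivation ℤ 𝔸 𝔸)

/-- The second order operator `M^{ab} ∂_a ∂_b`. -/
def lap (M : I → I → 𝔸) (f : 𝔸) : 𝔸 := ∑ a, ∑ b, M a b * d a (d b f)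

/-- The bilinear operator `M^{ab} ∂_a f ∂_b g`. -/
def bil (M : I → I → 𝔸) (f g : 𝔸) : 𝔸 := ∑ a, ∑ b, M a b * (d a f * d b g)

/-- The quadratic operator `h M^{ab} ∂_a ∂_b f + M^{ab} ∂_a f ∂_b f`. -/
def quad (h : 𝔸) (M : I → I → 𝔸) (f : 𝔸) : 𝔸 := h * lap d M f + bil d M f f

/-- The matrix is annihilated by all `∂_a`. -/
def IsConstMat (M : I → I → 𝔸) : Prop := ∀ a b c, d c (M a b) = 0

variable {d}

theorem lap_add (M : I → I → 𝔸) (f g : 𝔸) : lap d M (f + g) = lap d M f + lap d M g := by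
  simp only [lap, map_add, mul_add, Finset.sum_add_distrib]

theorem bil_add (M : I → I → 𝔸) (f g g' : 𝔸) :
    bil d M f (g + g') = bil d M f g + bil d M f g' := by
  simp only [bil, map_add, mul_add, Finset.sum_add_distrib]

theorem lap_sub (M : I → I → 𝔸) (f g : 𝔸) : lap d M (f - g) = lap d M f - lap d M g := by
  simp only [lap, map_sub, mul_sub, Finset.sum_sub_distrib]

theorem bil_sub (M : I → I → 𝔸) (f g g' : 𝔸) :
    bil d M f (g - g') = bil d M f g - bil d M f g' := by
  simp only [bil, map_sub, mul_sub, Finset.sum_sub_distrib]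

theorem lap_const_mul (M : I → I → 𝔸) {c : 𝔸} (hc : ∀ a, d a c = 0) (f : 𝔸) :
    lap d M (c * f) = c * lap d M f := by
  simp only [lap, Derivation.leibniz, smul_eq_mul, hc, mul_zero, add_zero,
    Finset.mul_sum]
  exact Finset.sum_congr rfl fun a _ => Finset.sum_congr rfl fun b _ => by ring

theorem bil_const_mul (M : I → I → 𝔸) {c : 𝔸} (hc : ∀ a, d a c = 0) (f g : 𝔸) :
    bil d M f (c * g) = c * bil d M f g := by
  simp only [bil, Derivation.leibniz, smul_eq_mul, hc, mul_zero, add_zero, Finset.mul_sum]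
  exact Finset.sum_congr rfl fun a _ => Finset.sum_congr rfl fun b _ => by ring

theorem bil_comm {M : I → I → 𝔸} (hM : ∀ a b, M a b = M b a) (f g : 𝔸) :
    bil d M f g = bil d M g f := by
  rw [bil, Finset.sum_comm]
  exact Finset.sum_congr rfl fun a _ => Finset.sum_congr rfl fun b _ => by rw [hM]; ring

theorem lap_sum (M : I → I → 𝔸) {J : Type} (s : Finset J) (f : J → 𝔸) :
    lap d M (∑ j ∈ s, f j) = ∑ j ∈ s, lap d M (f j) :=
  map_sum (AddMonoidHom.mk' (lap d M) (lap_add M)) f s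

theorem bil_sum (M : I → I → 𝔸) {J : Type} (s : Finset J) (f : 𝔸) (g : J → 𝔸) :
    bil d M f (∑ j ∈ s, g j) = ∑ j ∈ s, bil d M f (g j) :=
  map_sum (AddMonoidHom.mk' (bil d M f) (bil_add M f)) g s

theorem sum_swap_pairs {A : Type} [AddCommMonoid A] (G : I → I → I → I → A) :
    ∑ a, ∑ b, ∑ c, ∑ e, G a b c e = ∑ a, ∑ b, ∑ c, ∑ e, G c e a b := by
  have h : ∀ G : I → I → I → I → A, ∑ a, ∑ b, ∑ c, ∑ e, G a b c e
      = ∑ p : I × I, ∑ q : I × I, G p.1 p.2 q.1 q.2 := fun G => by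
    rw [Fintype.sum_prod_type]
    exact Finset.sum_congr rfl fun a _ => Finset.sum_congr rfl fun b _ =>
      (Fintype.sum_prod_type (fun q : I × I => G a b q.1 q.2)).symm
  rw [h, h, Finset.sum_comm]

theorem deriv_bil (M : I → I → 𝔸) (X : Derivation ℤ 𝔸 𝔸) (hX : ∀ a f, X (d a f) = d a (X f))
    (f g : 𝔸) : X (bil d M f g) = bil d (fun a b => X (M a b)) f g + bil d M (X f) g
      + bil d M f (X g) := by
  simp only [bil, map_sum, Derivation.leibniz, smul_eq_mul, hX, ← Finset.sum_add_distrib]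
  exact Finset.sum_congr rfl fun a _ => Finset.sum_congr rfl fun b _ => by ring

theorem deriv_lap (M : I → I → 𝔸) (X : Derivation ℤ 𝔸 𝔸) (hX : ∀ a f, X (d a f) = d a (X f))
    (f : 𝔸) : X (lap d M f) = lap d (fun a b => X (M a b)) f + lap d M (X f) := by
  simp only [lap, map_sum, Derivation.leibniz, smul_eq_mul, hX, ← Finset.sum_add_distrib]
  exact Finset.sum_congr rfl fun a _ => Finset.sum_congr rfl fun b _ => by ring

/-- The two Leibniz terms of `bil` agree because `M` is symmetric. The bracket is the linearisation
of `quad` at `f`, applied to `X f`. -/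
theorem deriv_quad {h : 𝔸} (M : I → I → 𝔸) (X : Derivation ℤ 𝔸 𝔸)
    (hX : ∀ a f, X (d a f) = d a (X f)) (hh : X h = 0) (hM : ∀ a b, M a b = M b a) (f : 𝔸) :
    X (quad d h M f) = quad d h (fun a b => X (M a b)) f
      + (h * lap d M (X f) + 2 * bil d M f (X f)) := by
  rw [quad, map_add, Derivation.leibniz, smul_eq_mul, smul_eq_mul, hh, deriv_lap M X hX,
    deriv_bil M X hX, bil_comm hM (X f) f, quad]
  ring

theorem lap_congr_zero {M : I → I → 𝔸} (hM : ∀ a b, M a b = 0) (f : 𝔸) : lap d M f = 0 := by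
  simp [lap, hM]

theorem bil_congr_zero {M : I → I → 𝔸} (hM : ∀ a b, M a b = 0) (f g : 𝔸) : bil d M f g = 0 := by
  simp [bil, hM]

theorem d_bil (hd : ∀ a b f, d a (d b f) = d b (d a f)) {M : I → I → 𝔸} (hM : IsConstMat d M)
    (c : I) (f g : 𝔸) : d c (bil d M f g) = bil d M (d c f) g + bil d M f (d c g) := by
  rw [deriv_bil M (d c) (fun _ _ => hd _ _ _), bil_congr_zero (fun a b => hM a b c), zero_add]

theorem d_lap (hd : ∀ a b f, d a (d b f) = d b (d a f)) {M : I → I → 𝔸} (hM : IsConstMat d M)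
    (c : I) (f : 𝔸) : d c (lap d M f) = lap d M (d c f) := by
  rw [deriv_lap M (d c) (fun _ _ => hd _ _ _), lap_congr_zero (fun a b => hM a b c), zero_add]

section Commuting

variable (hd : ∀ a b f, d a (d b f) = d b (d a f))
include hd

theorem lap_lap {M N : I → I → 𝔸} (hM : IsConstMat d M) (hN : IsConstMat d N) (f : 𝔸) :
    lap d N (lap d M f) = lap d M (lap d N f) := by
  conv_rhs => rw [show lap d N f = ∑ a, ∑ b, N a b * d a (d b f) from rfl]
  simp only [lap_sum, lap_const_mul M (hN _ _)]
  conv_lhs => rw [lap]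
  simp only [d_lap hd hM]

/-- The second order Leibniz rule. There are two mixed terms, which become equal after renaming the
indices of the symmetric matrix `M`. -/
theorem lap_bil {M N : I → I → 𝔸} (hM : IsConstMat d M) (hN : IsConstMat d N)
    (hMs : ∀ a b, M a b = M b a) (f g : 𝔸) :
    lap d M (bil d N f g) = bil d N (lap d M f) g + bil d N f (lap d M g)
      + 2 * ∑ a, ∑ b, M a b * bil d N (d a f) (d b g) := by
  have h1 : ∀ a b, d a (d b (bil d N f g)) = bil d N (d a (d b f)) g + bil d N f (d a (d b g))
      + (bil d N (d b f) (d a g) + bil d N (d a f) (d b g)) := by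
    intro a b
    rw [d_bil hd hN, map_add, d_bil hd hN, d_bil hd hN]
    ring
  have h2 : bil d N f (lap d M g) = ∑ a, ∑ b, M a b * bil d N f (d a (d b g)) := by
    rw [lap]
    simp only [bil_sum, bil_const_mul N (hM _ _)]
  have h3 : bil d N (lap d M f) g = ∑ a, ∑ b, M a b * bil d N (d a (d b f)) g := by
    have e : ∀ M f g, bil d M f g = bil d (fun a b => M b a) g f := fun M f g => by
      rw [bil, Finset.sum_comm]
      exact Finset.sum_congr rfl fun a _ => Finset.sum_congr rfl fun b _ => by ring
    rw [e, lap]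
    simp only [bil_sum, bil_const_mul _ (hM _ _)]
    simp only [← e N]
  have h4 : ∑ a, ∑ b, M a b * bil d N (d b f) (d a g)
      = ∑ a, ∑ b, M a b * bil d N (d a f) (d b g) := by
    rw [Finset.sum_comm]
    simp only [hMs]
  rw [h2, h3, lap]
  simp only [h1, mul_add, Finset.sum_add_distrib]
  rw [h4]
  ring

/-- Both sides are the full contraction M^{ab} N^{ce} ∂_a∂_c f ∂_b∂_e f, since the derivations
commute. -/
theorem cross_comm (M N : I → I → 𝔸) (f : 𝔸) :
    ∑ a, ∑ b, M a b * bil d N (d a f) (d b f) = ∑ a, ∑ b, N a b * bil d M (d a f) (d b f) := by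
  simp only [bil, Finset.mul_sum]
  rw [sum_swap_pairs]
  refine Finset.sum_congr rfl fun a _ => Finset.sum_congr rfl fun b _ =>
    Finset.sum_congr rfl fun c _ => Finset.sum_congr rfl fun e _ => ?_
  rw [hd a c, hd b e]
  ring

/-- By the product rule and the symmetry of the inner matrix, both sides are 2 M^{ab} N^{ce} ∂_af
∂_cf ∂_b∂_ef. -/
theorem bil_bil_comm {M N : I → I → 𝔸} (hM : IsConstMat d M) (hN : IsConstMat d N)
    (hMs : ∀ a b, M a b = M b a) (hNs : ∀ a b, N a b = N b a) (f : 𝔸) :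
    bil d M f (bil d N f f) = bil d N f (bil d M f f) := by
  have h : ∀ {M N : I → I → 𝔸} (_ : IsConstMat d N) (_ : ∀ a b, N a b = N b a),
      bil d M f (bil d N f f) = ∑ a, ∑ b, ∑ c, ∑ e,
        2 * (M a b * (d a f * (N c e * (d c f * d e (d b f))))) := by
    intro M N hN hNs
    rw [bil]
    refine Finset.sum_congr rfl fun a _ => Finset.sum_congr rfl fun b _ => ?_
    rw [d_bil hd hN, bil_comm hNs (d b f) f, ← two_mul]
    simp only [bil, Finset.mul_sum]
    refine Finset.sum_congr rfl fun c _ => Finset.sum_congr rfl fun e _ => ?_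
    ring
  rw [h hN hNs, h hM hMs, sum_swap_pairs]
  refine Finset.sum_congr rfl fun a _ => Finset.sum_congr rfl fun b _ =>
    Finset.sum_congr rfl fun c _ => Finset.sum_congr rfl fun e _ => ?_
  rw [hd b e]
  ring

/-- Quadratic operators with constant coefficients commute infinitesimally. -/
theorem quad_comm {h : 𝔸} (hh : ∀ a, d a h = 0) {M N : I → I → 𝔸} (hM : IsConstMat d M)
    (hN : IsConstMat d N) (hMs : ∀ a b, M a b = M b a) (hNs : ∀ a b, N a b = N b a) (f : 𝔸) :
    h * lap d M (quad d h N f) + 2 * bil d M f (quad d h N f) =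
      h * lap d N (quad d h M f) + 2 * bil d N f (quad d h M f) := by
  -- An expansion in which each summand is invariant under the exchange of `M` and `N`, by the
  -- preceding lemmas.
  have h1 : ∀ {M N : I → I → 𝔸} (_ : IsConstMat d M) (_ : IsConstMat d N)
      (_ : ∀ a b, M a b = M b a) (_ : ∀ a b, N a b = N b a),
      h * lap d M (quad d h N f) + 2 * bil d M f (quad d h N f) =
      h * (h * lap d M (lap d N f)) + 2 * h * (bil d N f (lap d M f) + bil d M f (lap d N f))
        + 2 * h * (∑ a, ∑ b, M a b * bil d N (d a f) (d b f))
        + 2 * bil d M f (bil d N f f) := by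
    intro M N hM hN hMs hNs
    rw [quad, lap_add, bil_add, lap_const_mul M hh, bil_const_mul M hh, lap_bil hd hM hN hMs,
      bil_comm hNs (lap d M f) f]
    ring
  rw [h1 hM hN hMs hNs, h1 hN hM hNs hMs, lap_lap hd hN hM, cross_comm hd,
    bil_bil_comm hd hM hN hMs hNs]
  ring

variable {h s F q c : 𝔸} {Δ Y Γ ND : I → I → 𝔸} {T D : Derivation ℤ 𝔸 𝔸} (ν : I)

set_option maxHeartbeats 1000000 in
/-- A quadratic function `q`, with Hessian `2 Y`. -/
theorem linear_term (hh : ∀ a, d a h = 0) (hΔ : IsConstMat d Δ) (hY : IsConstMat d Y)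
    (hΔs : ∀ a b, Δ a b = Δ b a) (hYs : ∀ a b, Y a b = Y b a)
    (hq : ∀ a b, d a (d b q) = 2 * Y a b) :
    h * lap d Δ (bil d Δ q F) + 2 * bil d Δ F (bil d Δ q F) =
      4 * quad d h (fun b e => ∑ a, ∑ c, Δ a b * Y a c * Δ c e) F + bil d Δ q (quad d h Δ F) := by
  set Z : I → I → 𝔸 := fun b e => ∑ a, ∑ c, Δ a b * Y a c * Δ c e with hZ
  -- The Hessian of `q` and the matrix `Δ` are constant, so the Laplacian of `q` is a constant.
  have hlq : ∀ g, bil d Δ (lap d Δ q) g = 0 := by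
    intro g
    have : ∀ a, d a (lap d Δ q) = 0 := fun a => by
      have h2 : d a (2 : 𝔸) = 0 := Derivation.map_natCast (d a) 2
      simp only [lap, hq, map_sum, Derivation.leibniz, hΔ _ _ a, hY _ _ a, h2, smul_zero, add_zero,
        Finset.sum_const_zero]
    simp [bil, this]
  have e1 : ∀ a g, bil d Δ (d a q) g = 2 * ∑ c, ∑ e, Δ c e * Y c a * d e g := by
    intro a g
    simp only [bil, hq, Finset.mul_sum]
    exact Finset.sum_congr rfl fun c _ => Finset.sum_congr rfl fun e _ => by ring
  have e2 : ∑ a, ∑ b, Δ a b * bil d Δ (d a q) (d b F) = 2 * lap d Z F := by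
    simp only [e1, lap, hZ, Finset.mul_sum, Finset.sum_mul]
    calc _ = ∑ b, ∑ a, ∑ c, ∑ e, Δ a b * (2 * (Δ c e * Y c a * d e (d b F))) := Finset.sum_comm
      _ = ∑ b, ∑ e, ∑ a, ∑ c, Δ a b * (2 * (Δ c e * Y c a * d e (d b F))) := by
        refine Finset.sum_congr rfl fun b _ => ?_
        rw [Finset.sum_comm]
        conv_lhs =>
          enter [2, c]
          rw [Finset.sum_comm]
        rw [Finset.sum_comm]
        exact Finset.sum_congr rfl fun _ _ => Finset.sum_comm
      _ = _ := by
        refine Finset.sum_congr rfl fun b _ => Finset.sum_congr rfl fun e _ =>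
          Finset.sum_congr rfl fun a _ => Finset.sum_congr rfl fun c _ => ?_
        rw [hYs c a, hd e b]
        ring
  -- The outer derivative falls on `q`, where the Hessian 2Y produces `Z` = ΔYΔ, or on `F`.
  have e3 : bil d Δ F (bil d Δ q F) = 2 * bil d Z F F + ∑ a, ∑ b, Δ a b *
      (d a F * bil d Δ q (d b F)) := by
    have : bil d Δ F (bil d Δ q F) = (∑ a, ∑ b, Δ a b * (d a F * bil d Δ (d b q) F)) +
        ∑ a, ∑ b, Δ a b * (d a F * bil d Δ q (d b F)) := by
      simp only [← Finset.sum_add_distrib]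
      refine Finset.sum_congr rfl fun a _ => Finset.sum_congr rfl fun b _ => ?_
      rw [d_bil hd hΔ]
      ring
    rw [this]
    congr 1
    simp only [e1]
    simp only [bil, hZ, Finset.mul_sum, Finset.sum_mul]
    calc _ = ∑ a, ∑ b, ∑ e, ∑ c, Δ a b * (d a F * (2 * (Δ c e * Y c b * d e F))) :=
          Finset.sum_congr rfl fun a _ => Finset.sum_congr rfl fun b _ => Finset.sum_comm
      _ = ∑ a, ∑ e, ∑ b, ∑ c, Δ a b * (d a F * (2 * (Δ c e * Y c b * d e F))) :=
          Finset.sum_congr rfl fun a _ => Finset.sum_comm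
      _ = _ := by
        refine Finset.sum_congr rfl fun a _ => Finset.sum_congr rfl fun e _ =>
          Finset.sum_congr rfl fun b _ => Finset.sum_congr rfl fun c _ => ?_
        rw [hYs c b, hΔs a b]
        ring
  -- The sum left over in `e3` is half of this one, as a derivative of Δ^{ab} ∂_aF ∂_bF hits two
  -- equal factors.
  have e4 : bil d Δ q (bil d Δ F F) = 2 * ∑ a, ∑ b, Δ a b * (d a F * bil d Δ q (d b F)) := by
    simp only [bil, Finset.mul_sum]
    rw [sum_swap_pairs]
    simp only [← Finset.mul_sum]
    have : ∀ a, d a (∑ a, ∑ b, Δ a b * (d a F * d b F)) =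
        2 * ∑ c, ∑ e, Δ c e * (d c F * d e (d a F)) := by
      intro a
      have h1 := d_bil hd hΔ a F F
      rw [bil_comm hΔs (d a F) F, ← two_mul] at h1
      exact h1
    simp only [this, Finset.mul_sum]
    refine Finset.sum_congr rfl fun a _ => Finset.sum_congr rfl fun b _ =>
      Finset.sum_congr rfl fun c _ => Finset.sum_congr rfl fun e _ => ?_
    rw [hd e b]
    ring
  rw [lap_bil hd hΔ hΔ hΔs, hlq, e2, e3, quad, quad, bil_add, bil_const_mul Δ hh, e4]
  ring

omit hd in
/-- The covariant derivative of a bivector, for a derivation `D` with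
`[∂_a, D] = - Γ^c_a ∂_c`. -/
theorem covariant_term (hDh : D h = 0)
    (hΔs : ∀ a b, Δ a b = Δ b a) (hΓ : IsConstMat d Γ)
    (hD : ∀ a f, d a (D f) = D (d a f) - ∑ c, Γ c a * d c f)
    (hND : ∀ a b, ND a b = D (Δ a b) + ∑ c, Γ a c * Δ c b + ∑ c, Γ b c * Δ a c) :
    D (quad d h Δ F) = quad d h ND F + (h * lap d Δ (D F) + 2 * bil d Δ F (D F)) := by
  have hD' : ∀ a f, D (d a f) = d a (D f) + ∑ c, Γ c a * d c f := fun a f => by rw [hD]; ring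
  -- Relabelling moves the Christoffel symbol from an upper index of `Δ` to the derivative
  -- contracted with it. The Γ-terms of `ND` then match the commutators of `D` with the two
  -- derivatives.
  have s1 : ∀ G : I → I → 𝔸, ∑ a, ∑ b, (∑ c, Γ a c * Δ c b) * G a b
      = ∑ a, ∑ b, Δ a b * ∑ c, Γ c a * G c b := by
    intro G
    simp only [Finset.mul_sum, Finset.sum_mul]
    calc _ = ∑ b, ∑ a, ∑ c, Γ a c * Δ c b * G a b := Finset.sum_comm
      _ = ∑ b, ∑ c, ∑ a, Γ a c * Δ c b * G a b := Finset.sum_congr rfl fun b _ => Finset.sum_comm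
      _ = ∑ c, ∑ b, ∑ a, Γ a c * Δ c b * G a b := Finset.sum_comm
      _ = _ := Finset.sum_congr rfl fun a _ => Finset.sum_congr rfl fun b _ =>
        Finset.sum_congr rfl fun c _ => by ring
  have s2 : ∀ G : I → I → 𝔸, ∑ a, ∑ b, (∑ c, Γ b c * Δ a c) * G a b
      = ∑ a, ∑ b, Δ a b * ∑ c, Γ c b * G a c := by
    intro G
    rw [Finset.sum_comm]
    have := s1 (fun a b => G b a)
    simp only [hΔs] at this ⊢
    rw [this, Finset.sum_comm]
    simp only [hΔs]
  have hl : D (lap d Δ F) = lap d ND F + lap d Δ (D F) := by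
    have e1 : ∀ a b, D (d a (d b F)) = d a (d b (D F)) + ∑ c, Γ c b * d a (d c F)
        + ∑ c, Γ c a * d c (d b F) := by
      intro a b
      rw [hD' a, hD' b, map_add, map_sum]
      simp only [Derivation.leibniz, smul_eq_mul, hΓ _ _ a, mul_zero, add_zero]
    have := s1 (fun a b => d a (d b F))
    have h2 := s2 (fun a b => d a (d b F))
    simp only [lap, hND, map_sum, Derivation.leibniz, smul_eq_mul, e1, add_mul, mul_add,
      Finset.sum_add_distrib, this, h2]
    have : ∑ a, ∑ b, D (Δ a b) * d a (d b F) = ∑ a, ∑ b, d a (d b F) * D (Δ a b) := by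
      simp only [mul_comm]
    rw [this]
    ring
  have hb : D (bil d Δ F F) = bil d ND F F + 2 * bil d Δ F (D F) := by
    have := s1 (fun a b => d a F * d b F)
    have h2 := s2 (fun a b => d a F * d b F)
    rw [two_mul]
    nth_rw 2 [bil_comm hΔs]
    simp only [bil, hND, map_sum, Derivation.leibniz, smul_eq_mul, hD', add_mul, mul_add,
      Finset.sum_add_distrib, this, h2]
    have e1 : ∑ a, ∑ b, D (Δ a b) * (d a F * d b F) = ∑ a, ∑ b, d a F * d b F * D (Δ a b) := by
      simp only [mul_comm]
    have e2 : ∀ a b, d a F * ∑ c, Γ c b * d c F = ∑ c, Γ c b * (d a F * d c F) := fun a b => by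
      rw [Finset.mul_sum]
      exact Finset.sum_congr rfl fun c _ => by ring
    have e3 : ∑ a, ∑ b, Δ a b * ∑ c, Γ c a * (d b F * d c F)
        = ∑ a, ∑ b, Δ a b * ∑ c, Γ c a * (d c F * d b F) :=
      Finset.sum_congr rfl fun a _ => Finset.sum_congr rfl fun b _ => congrArg _
        (Finset.sum_congr rfl fun c _ => by rw [mul_comm (d b F)])
    have e4 : ∑ a, ∑ b, Δ a b * (d b F * d a (D F)) = ∑ a, ∑ b, Δ a b * (d a (D F) * d b F) := by
      simp only [mul_comm (d _ (D F))]
    simp only [e1, e2, e3, e4]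
    ring
  rw [quad, map_add, Derivation.leibniz, smul_eq_mul, smul_eq_mul, hDh, hl, hb, quad]
  ring

variable (d) in
/-- The defect of the anomaly equation, multiplied by two. -/
def anomaly (h s F q c : 𝔸) (Δ Y ND : I → I → 𝔸) (D : Derivation ℤ 𝔸 𝔸) (ν : I) : 𝔸 :=
  2 * (d ν F - D F - c) - q - s * bil d Δ q F
    + quad d h (fun a b => s * ND a b - s ^ 2 * ∑ a', ∑ b', Δ a' a * Y a' b' * Δ b' b) F
    - s * h * ∑ a, ∑ b, Δ a b * Y a b

/-- Here `T` is ∂/∂s. Each summand of the defect is compared with the linearised heat equation, and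
the failures cancel. The derivative `d ν F` is itself a solution. `D F` fails by the `quad` of the
covariant derivative `ND` of `Δ`, which is compensated by ∂_s of the coefficient `s * ND`. The
function `q` fails by its pairing with `F` and by the trace of ΔY, which are compensated by ∂_s of
the two terms linear in `s`. Finally `s * bil d Δ q F` produces `4 * s` times the `quad` of ΔYΔ,
compensated by ∂_s of the term with `s ^ 2`. -/
theorem anomaly_heat (hh : ∀ a, d a h = 0) (hTh : T h = 0) (hDh : D h = 0)
    (hs : ∀ a, d a s = 0) (hTs : T s = 1)
    (hΔ : IsConstMat d Δ) (hY : IsConstMat d Y) (hΓ : IsConstMat d Γ)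
    (hΔs : ∀ a b, Δ a b = Δ b a) (hYs : ∀ a b, Y a b = Y b a)
    (hTΔ : ∀ a b, T (Δ a b) = 0) (hTY : ∀ a b, T (Y a b) = 0) (hTΓ : ∀ a b, T (Γ a b) = 0)
    (hq : ∀ a b, d a (d b q) = 2 * Y a b) (hTq : T q = 0) (hc : ∀ a, d a c = 0) (hTc : T c = 0)
    (hTd : ∀ a f, T (d a f) = d a (T f)) (hTD : ∀ f, T (D f) = D (T f))
    (hD : ∀ a f, d a (D f) = D (d a f) - ∑ c, Γ c a * d c f)
    (hND : ∀ a b, ND a b = D (Δ a b) + ∑ c, Γ a c * Δ c b + ∑ c, Γ b c * Δ a c)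
    (hTF : 2 * T F = quad d h Δ F) :
    2 * T (anomaly d h s F q c Δ Y ND D ν) = h * lap d Δ (anomaly d h s F q c Δ Y ND D ν)
      + 2 * bil d Δ F (anomaly d h s F q c Δ Y ND D ν) := by
  set Z : I → I → 𝔸 := fun b e => ∑ a, ∑ c, Δ a b * Y a c * Δ c e with hZ
  have two_c : ∀ X : Derivation ℤ 𝔸 𝔸, X 2 = 0 := fun X => Derivation.map_natCast X 2
  have hZc : IsConstMat d Z := fun a b c => by
    simp only [hZ, map_sum, Derivation.leibniz, hΔ _ _ c, hY _ _ c, smul_zero, add_zero,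
      Finset.sum_const_zero]
  have hTZ : ∀ a b, T (Z a b) = 0 := fun a b => by
    simp only [hZ, map_sum, Derivation.leibniz, hTΔ, hTY, smul_zero, add_zero,
      Finset.sum_const_zero]
  have hZs : ∀ a b, Z a b = Z b a := fun a b => by
    simp only [hZ]
    rw [Finset.sum_comm]
    exact Finset.sum_congr rfl fun c _ => Finset.sum_congr rfl fun e _ => by
      rw [hYs, hΔs c b, hΔs e a]; ring
  have hNDs : ∀ a b, ND a b = ND b a := fun a b => by
    have e : ∀ a b, ∑ c, Γ a c * Δ c b = ∑ c, Γ a c * Δ b c := fun a b =>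
      Finset.sum_congr rfl fun c _ => by rw [hΔs]
    rw [hND, hND, hΔs a b, e, e]
    ring
  have hNDc : IsConstMat d ND := fun a b c => by
    rw [hND]
    simp only [map_add, map_sum, Derivation.leibniz, hD, hΔ _ _ _, hΓ _ _ c, smul_zero, add_zero,
      Finset.sum_const_zero, map_zero, mul_zero, sub_zero]
  have hTND : ∀ a b, T (ND a b) = 0 := fun a b => by
    rw [hND]
    simp only [map_add, map_sum, Derivation.leibniz, hTD, hTΔ, hTΓ, smul_zero, add_zero,
      Finset.sum_const_zero, map_zero]
  set W : I → I → 𝔸 := fun a b => s * ND a b - s ^ 2 * Z a b with hW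
  have hWc : IsConstMat d W := fun a b c => by
    simp only [hW, map_sub, Derivation.leibniz, Derivation.leibniz_pow, hs, hNDc _ _ _, hZc _ _ _,
      smul_zero, add_zero, sub_zero]
  have hWs : ∀ a b, W a b = W b a := fun a b => by
    simp only [hW]
    rw [hNDs, hZs]
  have hYtr : ∀ a, d a (∑ a, ∑ b, Δ a b * Y a b) = 0 := fun c => by
    simp only [map_sum, Derivation.leibniz, hΔ _ _ c, hY _ _ c, smul_zero, add_zero,
      Finset.sum_const_zero]
  have hTYtr : T (∑ a, ∑ b, Δ a b * Y a b) = 0 := by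
    simp only [map_sum, Derivation.leibniz, hTΔ, hTY, smul_zero, add_zero,
      Finset.sum_const_zero]
  set y : 𝔸 := ∑ a, ∑ b, Δ a b * Y a b with hy
  have two_d : ∀ a, d a (2 : 𝔸) = 0 := fun a => two_c _
  have hshy : ∀ a, d a (s * h * y) = 0 := fun a => by
    simp only [Derivation.leibniz, hs, hh, hYtr, smul_zero, add_zero]
  -- the six terms of the anomaly
  have t1 : 2 * T (d ν F) = h * lap d Δ (d ν F) + 2 * bil d Δ F (d ν F) := by
    have := deriv_quad (d := d) (h := h) Δ (d ν) (fun a f => hd ν a f) (hh ν) hΔs F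
    have h0 : quad d h (fun a b => d ν (Δ a b)) F = 0 := by
      rw [quad, lap_congr_zero (fun a b => hΔ a b ν), bil_congr_zero (fun a b => hΔ a b ν), mul_zero,
        add_zero]
    rw [h0, zero_add, ← hTF, Derivation.leibniz, two_d, smul_zero, add_zero, smul_eq_mul] at this
    rw [hTd, this]
  have t2 : 2 * T (D F) = quad d h ND F + (h * lap d Δ (D F) + 2 * bil d Δ F (D F)) := by
    have := covariant_term hDh hΔs hΓ hD hND (F := F)
    rw [← hTF, Derivation.leibniz, two_c, smul_zero, add_zero, smul_eq_mul] at this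
    rw [hTD, this]
  have l3 : lap d Δ c = 0 := by simp [lap, hc]
  have b3 : bil d Δ F c = 0 := by simp [bil, hc]
  have l4 : lap d Δ q = 2 * y := by
    simp only [lap, hq, hy, Finset.mul_sum]
    exact Finset.sum_congr rfl fun a _ => Finset.sum_congr rfl fun b _ => by ring
  have t5 : 2 * T (s * bil d Δ q F) = 2 * bil d Δ q F + s * bil d Δ q (quad d h Δ F) := by
    have h2 : bil d Δ q (2 * T F) = 2 * bil d Δ q (T F) := bil_const_mul Δ two_d q (T F)
    rw [← hTF, h2, Derivation.leibniz, deriv_bil Δ T hTd, bil_congr_zero hTΔ, hTq, hTs]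
    have : bil d Δ 0 F = 0 := by simp [bil]
    rw [this, smul_eq_mul, smul_eq_mul]
    ring
  have l5 := linear_term hd hh hΔ hY hΔs hYs hq (F := F) (h := h)
  rw [← hZ] at l5
  have t6 : 2 * T (quad d h W F) = 2 * quad d h (fun a b => T (W a b)) F +
      (h * lap d W (quad d h Δ F) + 2 * bil d W F (quad d h Δ F)) := by
    rw [deriv_quad W T hTd hTh hWs, ← hTF, lap_const_mul W two_d, bil_const_mul W two_d]
    ring
  -- As `W` has constant entries, its quadratic operator commutes infinitesimally with the one
  -- generating the flow. Only the dependence of `W` on `s` contributes to the failure.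
  have l6 := quad_comm hd hh hWc hΔ hWs hΔs F
  have q6 : quad d h (fun a b => T (W a b)) F = quad d h ND F - 2 * s * quad d h Z F := by
    have : ∀ a b, T (W a b) = ND a b - 2 * s * Z a b := fun a b => by
      simp only [hW, map_sub, Derivation.leibniz, Derivation.leibniz_pow, hTs, hTND, hTZ,
        smul_eq_mul, nsmul_eq_mul]
      push_cast
      ring
    simp only [this, quad, lap, bil, sub_mul, Finset.sum_sub_distrib, mul_assoc, ← Finset.mul_sum]
    ring
  have t7 : T (s * h * y) = h * y := by
    simp only [Derivation.leibniz, hTs, hTh, hTYtr, smul_eq_mul]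
    ring
  have l7 : lap d Δ (s * h * y) = 0 := by simp [lap, hshy]
  have b7 : bil d Δ F (s * h * y) = 0 := by simp [bil, hshy]
  have hA : anomaly d h s F q c Δ Y ND D ν =
      2 * (d ν F - D F - c) - q - s * bil d Δ q F + quad d h W F - s * h * y := rfl
  rw [hA]
  simp only [map_sub, map_add, lap_sub, lap_add, bil_sub, bil_add, lap_const_mul Δ two_d,
    lap_const_mul Δ hs, bil_const_mul Δ two_d, bil_const_mul Δ hs, l3, b3, l4, l7, b7,
    t7, hTq, Derivation.leibniz T 2, two_c, hTc, smul_eq_mul, mul_zero, add_zero]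
  have e5 : bil d Δ F q = bil d Δ q F := bil_comm hΔs _ _
  rw [e5]
  linear_combination 2 * t1 - 2 * t2 - t5 + t6 + s * l5 + l6 + 2 * q6

end Commuting
end Heat

namespace Wick

/-! ### Connected graphs and edge cutting -/

section Connectivity

variable {V E : Type}

/-- A set of vertices which contains both or none of the ends of each edge. -/
def IsClosedUnder (f : E → V × V) (A : Set V) : Prop := ∀ e, (f e).1 ∈ A ↔ (f e).2 ∈ A

/-- The graph with edges `e` joining `(f e).1` to `(f e).2` is non-empty and connected. -/
def IsConn (f : E → V × V) : Prop :=
  Nonempty V ∧ ∀ A : Set V, IsClosedUnder f A → A = ∅ ∨ A = Set.univ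

/-- Adding an edge from `x` to `y`. -/
def addEdge (x y : V) (f : E → V × V) : Option E → V × V := fun e => e.elim (x, y) f

/-- Gluing of two functions along a partition of the domain. -/
def glue {H X Y Z : Type} [DecidableEq H] (i : X → Z) (j : Y → Z) (B : Finset H)
    (f₁ : {h // h ∈ B} → X) (f₂ : {h // h ∉ B} → Y) : H → Z :=
  fun h => if hp : h ∈ B then i (f₁ ⟨h, hp⟩) else j (f₂ ⟨h, hp⟩)

theorem glue_mem {H X Y Z : Type} [DecidableEq H] (i : X → Z) (j : Y → Z) (B : Finset H)
    (f₁ : {h // h ∈ B} → X) (f₂ : {h // h ∉ B} → Y) (h : {h // h ∈ B}) :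
    glue i j B f₁ f₂ h = i (f₁ h) := by simp [glue, h.2]

theorem glue_not_mem {H X Y Z : Type} [DecidableEq H] (i : X → Z) (j : Y → Z) (B : Finset H)
    (f₁ : {h // h ∈ B} → X) (f₂ : {h // h ∉ B} → Y) (h : {h // h ∉ B}) :
    glue i j B f₁ f₂ h = j (f₂ h) := by simp [glue, h.2]

/-- The set `B` is recovered from the glued function as the set of arguments with value in the range
of `i`, because the two ranges are disjoint. -/
theorem glue_injective {H X Y Z : Type} [DecidableEq H] {i : X → Z} {j : Y → Z}
    (hi : Function.Injective i) (hj : Function.Injective j) (hij : ∀ x y, i x ≠ j y) :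
    Function.Injective
      (fun s : Σ B : Finset H, ({h // h ∈ B} → X) × ({h // h ∉ B} → Y) =>
        glue i j s.1 s.2.1 s.2.2) := by
  rintro ⟨B, f₁, f₂⟩ ⟨B', g₁, g₂⟩ h
  simp only at h
  have hB : B = B' := by
    ext e
    have he := congrFun h e
    by_cases h1 : e ∈ B <;> by_cases h2 : e ∈ B' <;> simp [glue, h1, h2] at he ⊢
    · exact hij _ _ he
    · exact hij _ _ he.symm
  subst hB
  have e1 : f₁ = g₁ := by
    funext x
    apply hi
    have := congrFun h x
    rwa [glue_mem, glue_mem] at this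
  have e2 : f₂ = g₂ := by
    funext x
    apply hj
    have := congrFun h x
    rwa [glue_not_mem, glue_not_mem] at this
  rw [e1, e2]

/-- By `hG` only functions with values in the two disjoint ranges contribute, and each of these is
glued from exactly one triple. It serves to distribute edges, and later legs, over the two pieces of
a cut graph. -/
theorem sum_glue {H X Y Z K : Type} [DecidableEq H] [Fintype H] [Fintype X] [Fintype Y]
    [Fintype Z] [AddCommMonoid K]
    {i : X → Z} {j : Y → Z} (hi : Function.Injective i) (hj : Function.Injective j)
    (hij : ∀ x y, i x ≠ j y) (G : (H → Z) → K)
    (hG : ∀ k, G k ≠ 0 → ∀ h, k h ∈ Set.range i ∪ Set.range j) :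
    ∑ k, G k = ∑ B : Finset H, ∑ f₁ : {h // h ∈ B} → X, ∑ f₂ : {h // h ∉ B} → Y,
      G (glue i j B f₁ f₂) := by
  classical
  have h1 := Fintype.sum_of_injective _ (glue_injective (H := H) hi hj hij)
    (fun s => G (glue i j s.1 s.2.1 s.2.2)) G (by
      intro k hk
      by_contra h0
      have hr := hG k h0
      apply hk
      have hc1 : ∀ h : {h // h ∈ Finset.univ.filter (fun h => k h ∈ Set.range i)},
          ∃ x, i x = k h := fun h => (Finset.mem_filter.1 h.2).2
      have hc2 : ∀ h : {h // h ∉ Finset.univ.filter (fun h => k h ∈ Set.range i)},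
          ∃ y, j y = k h := fun h => (hr h).resolve_left (fun h' => h.2 (by simpa using h'))
      choose f₁ hf₁ using hc1
      choose f₂ hf₂ using hc2
      refine ⟨⟨_, f₁, f₂⟩, ?_⟩
      funext h
      simp only
      by_cases hh : h ∈ Finset.univ.filter (fun h => k h ∈ Set.range i)
      · rw [show h = ((⟨h, hh⟩ : {h // h ∈ Finset.univ.filter (fun h => k h ∈ Set.range i)}) : H)
          from rfl, glue_mem, hf₁]
      · rw [show h = ((⟨h, hh⟩ : {h // h ∉ Finset.univ.filter (fun h => k h ∈ Set.range i)}) : H)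
          from rfl, glue_not_mem, hf₂]) (fun _ => rfl)
  rw [← h1, Fintype.sum_sigma]
  exact Finset.sum_congr rfl fun B _ => Fintype.sum_prod_type _

/-- The graph `f` splits into connected graphs on `A` and on its complement. -/
def SplitsAlong [DecidableEq E] (A : Finset V) (f : E → V × V) : Prop :=
  ∃ (B : Finset E) (f₁ : {e // e ∈ B} → {v // v ∈ A} × {v // v ∈ A})
    (f₂ : {e // e ∉ B} → {v // v ∉ A} × {v // v ∉ A}), IsConn f₁ ∧ IsConn f₂ ∧
    f = glue (Prod.map Subtype.val Subtype.val) (Prod.map Subtype.val Subtype.val) B f₁ f₂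

theorem IsClosedUnder.compl {f : E → V × V} {A : Set V} (h : IsClosedUnder f A) :
    IsClosedUnder f Aᶜ := fun e => not_congr (h e)

theorem IsClosedUnder.inter {f : E → V × V} {A B : Set V} (h : IsClosedUnder f A)
    (h' : IsClosedUnder f B) : IsClosedUnder f (A ∩ B) := fun e => and_congr (h e) (h' e)

theorem isConn_addEdge {x y : V} {f : E → V × V} :
    IsConn (addEdge x y f) ↔ ∀ A : Set V, IsClosedUnder f A → (x ∈ A ↔ y ∈ A) →
      A = ∅ ∨ A = Set.univ := by
  have : ∀ A : Set V, IsClosedUnder (addEdge x y f) A ↔ IsClosedUnder f A ∧ (x ∈ A ↔ y ∈ A) :=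
    fun A => ⟨fun h => ⟨fun e => h (some e), h none⟩, fun h e => by cases e; exacts [h.2, h.1 _]⟩
  simp only [IsConn, this, and_imp]
  exact ⟨fun h => h.2, fun h => ⟨⟨x⟩, h⟩⟩

/-- The set of edges in `SplitsAlong` is forced: it consists of the edges starting in `A`. This
leaves a condition on closed sets of the whole graph, the form in which connectedness is tested. -/
theorem splitsAlong_iff [DecidableEq E] [Fintype E] (A : Finset V) (f : E → V × V) :
    SplitsAlong A f ↔ IsClosedUnder f (A : Set V) ∧ ((A : Set V).Nonempty ∧
      ∀ C ⊆ (A : Set V), IsClosedUnder f C → C = ∅ ∨ C = A) ∧ ((A : Set V)ᶜ.Nonempty ∧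
      ∀ C ⊆ (A : Set V)ᶜ, IsClosedUnder f C → C = ∅ ∨ C = (A : Set V)ᶜ) := by
  classical
  constructor
  · rintro ⟨B, f₁, f₂, ⟨h₁, h₁'⟩, ⟨h₂, h₂'⟩, rfl⟩
    refine ⟨fun e => ?_, ⟨?_, fun C hC hcl => ?_⟩, ⟨?_, fun C hC hcl => ?_⟩⟩
    · by_cases he : e ∈ B
      · simp [glue, he]
      · simp only [glue, he, dif_neg, not_false_eq_true, Prod.map_fst, Prod.map_snd]
        exact iff_of_false (f₂ ⟨e, he⟩).1.2 (f₂ ⟨e, he⟩).2.2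
    · obtain ⟨v⟩ := h₁
      exact ⟨v, v.2⟩
    · rcases h₁' (Subtype.val ⁻¹' C) (fun e => by
        have := hcl e
        rwa [glue_mem] at this) with h | h
      · left
        ext v
        exact iff_of_false (fun hv => by
          have : (⟨v, hC hv⟩ : {v // v ∈ A}) ∈ (∅ : Set {v // v ∈ A}) := h ▸ hv
          exact this) (fun h => h)
      · right
        refine hC.antisymm fun v hv => ?_
        have : (⟨v, hv⟩ : {v // v ∈ A}) ∈ (Subtype.val ⁻¹' C : Set {v // v ∈ A}) := by
          rw [h]; trivial
        exact this
    · obtain ⟨v⟩ := h₂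
      exact ⟨v, v.2⟩
    · rcases h₂' (Subtype.val ⁻¹' C) (fun e => by
        have := hcl e
        rwa [glue_not_mem] at this) with h | h
      · left
        ext v
        exact iff_of_false (fun hv => by
          have : (⟨v, hC hv⟩ : {v // v ∉ A}) ∈ (∅ : Set {v // v ∉ A}) := h ▸ hv
          exact this) (fun h => h)
      · right
        refine hC.antisymm fun v hv => ?_
        have : (⟨v, hv⟩ : {v // v ∉ A}) ∈ (Subtype.val ⁻¹' C : Set {v // v ∉ A}) := by
          rw [h]; trivial
        exact this
  · rintro ⟨hcl, ⟨⟨v, hv⟩, h₁⟩, ⟨⟨w, hw⟩, h₂⟩⟩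
    have hB : ∀ e, e ∈ Finset.univ.filter (fun e => (f e).1 ∈ A) ↔ (f e).1 ∈ A := by simp
    refine ⟨Finset.univ.filter (fun e => (f e).1 ∈ A),
      fun e => (⟨(f e).1, (hB _).1 e.2⟩, ⟨(f e).2, (hcl e).1 ((hB _).1 e.2)⟩),
      fun e => (⟨(f e).1, fun h => e.2 ((hB _).2 h)⟩,
        ⟨(f e).2, fun h => e.2 ((hB _).2 ((hcl e).2 h))⟩), ⟨⟨⟨v, hv⟩⟩, fun C hC => ?_⟩,
        ⟨⟨⟨w, hw⟩⟩, fun C hC => ?_⟩, ?_⟩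
    · have hsub : Subtype.val '' C ⊆ (A : Set V) := by rintro _ ⟨u, -, rfl⟩; exact u.2
      rcases h₁ (Subtype.val '' C) hsub (fun e => by
        by_cases he : (f e).1 ∈ A
        · have := hC ⟨e, (hB _).2 he⟩
          constructor
          · rintro ⟨u, hu, hu'⟩
            exact ⟨_, this.1 (by convert hu; exact Subtype.ext hu'.symm), rfl⟩
          · rintro ⟨u, hu, hu'⟩
            exact ⟨_, this.2 (by convert hu; exact Subtype.ext hu'.symm), rfl⟩
        · exact iff_of_false (fun h => he (hsub h)) (fun h => he ((hcl e).2 (hsub h)))) with h | h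
      · left
        exact Set.image_eq_empty.1 h
      · right
        ext u
        have : (u : V) ∈ Subtype.val '' C := h ▸ u.2
        simpa using this
    · have hsub : Subtype.val '' C ⊆ (A : Set V)ᶜ := by rintro _ ⟨u, -, rfl⟩; exact u.2
      rcases h₂ (Subtype.val '' C) hsub (fun e => by
        by_cases he : (f e).1 ∈ A
        · exact iff_of_false (fun h => hsub h he) (fun h => hsub h ((hcl e).1 he))
        · have := hC ⟨e, fun h => he ((hB _).1 h)⟩
          constructor
          · rintro ⟨u, hu, hu'⟩
            exact ⟨_, this.1 (by convert hu; exact Subtype.ext hu'.symm), rfl⟩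
          · rintro ⟨u, hu, hu'⟩
            exact ⟨_, this.2 (by convert hu; exact Subtype.ext hu'.symm), rfl⟩) with h | h
      · left
        exact Set.image_eq_empty.1 h
      · right
        ext u
        have : (u : V) ∈ Subtype.val '' C := h ▸ u.2
        obtain ⟨u', hu', e⟩ := this
        exact iff_of_true (Subtype.ext e ▸ hu') trivial
    · funext e
      by_cases he : (f e).1 ∈ A <;> simp [glue, he]

/-- After adding an edge from `x` to `y`, a graph is connected if and only if it was connected or it
has two components, separating `x` from `y`. -/
theorem ite_isConn_addEdge {K : Type} [AddCommMonoid K] [Fintype V] [DecidableEq V]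
    [DecidableEq E] [Fintype E] (x y : V) (f : E → V × V) (k : K)
    [Decidable (IsConn (addEdge x y f))] [Decidable (IsConn f)]
    [∀ A : Finset V, Decidable (SplitsAlong A f)] :
    (if IsConn (addEdge x y f) then k else 0) = (if IsConn f then k else 0) +
      ∑ A : Finset V, if x ∈ A ∧ y ∉ A ∧ SplitsAlong A f then k else 0 := by
  have hne : ∀ A : Finset V, x ∈ A → y ∉ A → (A : Set V) ≠ ∅ ∧ (A : Set V) ≠ Set.univ :=
    fun A hx hy => ⟨fun h => by
      have : x ∈ (A : Set V) := hx
      rw [h] at this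
      exact this, fun h => by
      have : y ∈ (A : Set V) := h ▸ Set.mem_univ y
      exact hy this⟩
  -- A closed set contains all or nothing of each of the two components; the edge from `x` to `y`
  -- forces the same choice for both.
  have himp : ∀ A : Finset V, x ∈ A → y ∉ A → SplitsAlong A f → IsConn (addEdge x y f) := by
    intro A hx hy hA
    obtain ⟨hcl, ⟨-, h₁⟩, -, h₂⟩ := (splitsAlong_iff A f).1 hA
    rw [isConn_addEdge]
    intro C hC hxy
    rcases h₁ (C ∩ A) Set.inter_subset_right (hC.inter hcl) with h | h <;>
      rcases h₂ (C ∩ (A : Set V)ᶜ) Set.inter_subset_right (hC.inter hcl.compl) with h' | h'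
    · left
      rw [← Set.inter_union_compl C A, h, h', Set.union_empty]
    · exfalso
      have hyC : y ∈ C ∩ (A : Set V)ᶜ := by rw [h']; exact hy
      have : x ∈ C ∩ A := ⟨hxy.2 hyC.1, hx⟩
      rw [h] at this
      exact this
    · exfalso
      have hxC : x ∈ C ∩ A := by rw [h]; exact hx
      have : y ∈ C ∩ (A : Set V)ᶜ := ⟨hxy.1 hxC.1, hy⟩
      rw [h'] at this
      exact this
    · right
      rw [← Set.inter_union_compl C A, h, h', Set.union_compl_self]
  by_cases hf : IsConn f
  · have hf' : IsConn (addEdge x y f) := isConn_addEdge.2 fun A hA _ => hf.2 A hA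
    rw [if_pos hf, if_pos hf', Finset.sum_eq_zero, add_zero]
    intro A _
    rw [if_neg]
    rintro ⟨hx, hy, hA⟩
    rcases hf.2 _ ((splitsAlong_iff A f).1 hA).1 with h | h
    exacts [(hne A hx hy).1 h, (hne A hx hy).2 h]
  · rw [if_neg hf, zero_add]
    by_cases hf' : IsConn (addEdge x y f)
    · rw [if_pos hf']
      have hc := isConn_addEdge.1 hf'
      -- A proper closed set of `f` must separate `x` from `y`, since otherwise it would stay closed
      -- after adding the edge. Up to passing to the complement it contains `x`.
      obtain ⟨A, hcl, hx, hy⟩ : ∃ A : Set V, IsClosedUnder f A ∧ x ∈ A ∧ y ∉ A := by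
        have : ∃ A : Set V, IsClosedUnder f A ∧ ¬ (A = ∅ ∨ A = Set.univ) := by
          by_contra! h
          exact hf ⟨⟨x⟩, h⟩
        obtain ⟨A, hA, hA'⟩ := this
        by_cases hx : x ∈ A <;> by_cases hy : y ∈ A
        · exact absurd (hc A hA (iff_of_true hx hy)) hA'
        · exact ⟨A, hA, hx, hy⟩
        · exact ⟨Aᶜ, hA.compl, hx, fun h => h hy⟩
        · exact absurd (hc A hA (iff_of_false hx hy)) hA'
      have hAe : ((A.toFinite.toFinset : Finset V) : Set V) = A := by simp
      rw [Finset.sum_eq_single A.toFinite.toFinset, if_pos]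
      · refine ⟨by simpa using hx, by simpa using hy, (splitsAlong_iff _ f).2 ?_⟩
        rw [hAe]
        refine ⟨hcl, ⟨⟨x, hx⟩, fun C hC hcl' => ?_⟩, ⟨⟨y, hy⟩, fun C hC hcl' => ?_⟩⟩
        · by_cases hxC : x ∈ C
          · right
            rcases hc (A ∩ Cᶜ) (hcl.inter hcl'.compl)
              (iff_of_false (fun h => h.2 hxC) (fun h => hy h.1)) with h | h
            · exact hC.antisymm (Set.sdiff_eq_empty.1 h)
            · have : y ∈ A ∩ Cᶜ := h ▸ Set.mem_univ y
              exact absurd this.1 hy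
          · left
            rcases hc C hcl' (iff_of_false hxC (fun h => hy (hC h))) with h | h
            · exact h
            · exact absurd (h ▸ Set.mem_univ x) hxC
        · by_cases hyC : y ∈ C
          · right
            rcases hc (Aᶜ ∩ Cᶜ) (hcl.compl.inter hcl'.compl)
              (iff_of_false (fun h => h.1 hx) (fun h => h.2 hyC)) with h | h
            · exact hC.antisymm (Set.sdiff_eq_empty.1 h)
            · have : x ∈ Aᶜ ∩ Cᶜ := h ▸ Set.mem_univ x
              exact absurd hx this.1
          · left
            rcases hc C hcl' (iff_of_false (fun h => hC h hx) hyC) with h | h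
            · exact h
            · exact absurd (h ▸ Set.mem_univ y) hyC
      -- No other set contributes: `A ∩ A'ᶜ` and `A' ∩ Aᶜ` contain neither `x` nor `y`, so they are
      -- closed in the enlarged connected graph and hence empty.
      · intro A' _ hA'
        rw [if_neg]
        rintro ⟨hx', hy', hs⟩
        apply hA'
        obtain ⟨hcl', -⟩ := (splitsAlong_iff A' f).1 hs
        have h1 : A ⊆ (A' : Set V) := by
          rcases hc (A ∩ (A' : Set V)ᶜ) (hcl.inter hcl'.compl)
            (iff_of_false (fun h => h.2 hx') (fun h => hy h.1)) with h | h
          · exact Set.sdiff_eq_empty.1 h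
          · have : y ∈ A ∩ (A' : Set V)ᶜ := h ▸ Set.mem_univ y
            exact absurd this.1 hy
        have h2 : (A' : Set V) ⊆ A := by
          rcases hc ((A' : Set V) ∩ Aᶜ) (hcl'.inter hcl.compl)
            (iff_of_false (fun h => h.2 hx) (fun h => hy' h.1)) with h | h
          · exact Set.sdiff_eq_empty.1 h
          · have : y ∈ (A' : Set V) ∩ Aᶜ := h ▸ Set.mem_univ y
            exact absurd this.1 hy'
        apply Finset.coe_injective
        rw [hAe]
        exact h2.antisymm h1
      · intro h
        exact absurd (Finset.mem_univ _) h
    · rw [if_neg hf', Finset.sum_eq_zero]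
      intro A _
      rw [if_neg]
      rintro ⟨hx, hy, hA⟩
      exact hf' (himp A hx hy hA)

end Connectivity

end Wick

namespace Wick

/-! ### Sums over labelled graphs -/

section Weights

open scoped Classical in
theorem prod_mem_mul_prod_not_mem {H M : Type} [Fintype H] [CommMonoid M] (B : Finset H)
    [Fintype {h // h ∈ B}] [Fintype {h // h ∉ B}] (F : H → M) :
    ∏ h, F h = (∏ h : {h // h ∈ B}, F h) * ∏ h : {h // h ∉ B}, F h := by
  rw [← Fintype.prod_subtype_mul_prod_subtype (fun h => h ∈ B) F]
  congr!

open scoped Classical in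
theorem sum_mem_add_sum_not_mem {H M : Type} [Fintype H] [AddCommMonoid M] (B : Finset H)
    [Fintype {h // h ∈ B}] [Fintype {h // h ∉ B}] (F : H → M) :
    ∑ h, F h = (∑ h : {h // h ∈ B}, F h) + ∑ h : {h // h ∉ B}, F h := by
  rw [← Fintype.sum_subtype_add_sum_subtype (fun h => h ∈ B) F]
  congr!

variable {V E L I K : Type} [CommRing K]

/-- The indices at the vertex `v` coming from the edges. -/
def edgeIdx [Fintype E] [DecidableEq V] (f : E → V × V) (a : E → I × I) (v : V) : Multiset I :=
  ∑ e, ((if (f e).1 = v then {(a e).1} else 0) + (if (f e).2 = v then {(a e).2} else 0))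

/-- The indices at the vertex `v` coming from the legs. -/
def legIdx [Fintype L] [DecidableEq V] (l : L → V) (μ : L → I) (v : V) : Multiset I :=
  ∑ h, if l h = v then {μ h} else 0

/-- The contraction of a graph, with further indices `m v` at the vertex `v`. -/
def graphWeight [Fintype V] [DecidableEq V] [Fintype E] [DecidableEq E] [Fintype I]
    (T : Multiset I → K) (Δ : I → I → K) (f : E → V × V) (m : V → Multiset I) : K :=
  ∑ a : E → I × I, (∏ e, Δ (a e).1 (a e).2) * ∏ v, T (edgeIdx f a v + m v)

open scoped Classical in
/-- The sum of the contractions of all connected graphs with vertices `V` and edges `E`. -/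
def connSum (V E : Type) [Fintype V] [DecidableEq V] [Fintype E] [DecidableEq E] [Fintype I]
    (T : Multiset I → K) (Δ : I → I → K) (m : V → Multiset I) : K :=
  ∑ f : E → V × V, if IsConn f then graphWeight T Δ f m else 0

/-- The sum of the contractions of all connected graphs with vertices `V`, edges `E` and legs `L`,
with the indices `μ` on the legs. -/
def legSum (V E : Type) [Fintype V] [DecidableEq V] [Fintype E] [DecidableEq E] [Fintype L]
    [DecidableEq L] [Fintype I] (T : Multiset I → K) (Δ : I → I → K) (μ : L → I) : K :=
  ∑ l : L → V, connSum V E T Δ (legIdx l μ)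

/-- No edge joins the two parts, so each vertex only sees the indices of the edges on its own side,
and both products factor. -/
theorem graphWeight_glue [Fintype V] [DecidableEq V] [Fintype E] [DecidableEq E] [Fintype I]
    (T : Multiset I → K) (Δ : I → I → K) (m : V → Multiset I) (A : Finset V) (B : Finset E)
    (f₁ : {e // e ∈ B} → {v // v ∈ A} × {v // v ∈ A})
    (f₂ : {e // e ∉ B} → {v // v ∉ A} × {v // v ∉ A}) :
    graphWeight T Δ
      (glue (Prod.map Subtype.val Subtype.val) (Prod.map Subtype.val Subtype.val) B f₁ f₂) m =
    graphWeight T Δ f₁ (fun v => m v) * graphWeight T Δ f₂ (fun v => m v) := by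
  unfold graphWeight
  rw [← Equiv.sum_comp (Equiv.piEquivPiSubtypeProd (fun e => e ∈ B) (fun _ => I × I)).symm,
    Fintype.sum_prod_type, Finset.sum_mul_sum]
  refine Finset.sum_congr (by congr!) fun a₁ _ => Finset.sum_congr (by congr!) fun a₂ _ => ?_
  rw [prod_mem_mul_prod_not_mem B, prod_mem_mul_prod_not_mem A, mul_mul_mul_comm]
  have ha₁ : ∀ e : {e // e ∈ B}, (Equiv.piEquivPiSubtypeProd (fun e => e ∈ B)
      (fun _ => I × I)).symm (a₁, a₂) e = a₁ e := fun e => by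
    simp [Equiv.piEquivPiSubtypeProd, e.2]
  have ha₂ : ∀ e : {e // e ∉ B}, (Equiv.piEquivPiSubtypeProd (fun e => e ∈ B)
      (fun _ => I × I)).symm (a₁, a₂) e = a₂ e := fun e => by
    simp [Equiv.piEquivPiSubtypeProd, e.2]
  simp only [ha₁, ha₂]
  congr 2
  · refine Finset.prod_congr rfl fun v _ => ?_
    congr 2
    unfold edgeIdx
    rw [sum_mem_add_sum_not_mem B]
    simp only [ha₁, ha₂, glue_mem, glue_not_mem, Prod.map_fst, Prod.map_snd, Subtype.ext_iff]
    rw [Finset.sum_eq_zero (s := (Finset.univ : Finset {e // e ∉ B})), add_zero]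
    intro e _
    rw [if_neg (mt (fun h => by rw [h]; exact v.2) (f₂ e).1.2),
      if_neg (mt (fun h => by rw [h]; exact v.2) (f₂ e).2.2), add_zero]
  · refine Finset.prod_congr rfl fun v _ => ?_
    congr 2
    unfold edgeIdx
    rw [sum_mem_add_sum_not_mem B]
    simp only [ha₁, ha₂, glue_mem, glue_not_mem, Prod.map_fst, Prod.map_snd, Subtype.ext_iff]
    rw [Finset.sum_eq_zero (s := (Finset.univ : Finset {e // e ∈ B})), zero_add]
    intro e _
    rw [if_neg (mt (fun h => by rw [← h]; exact (f₁ e).1.2) v.2),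
      if_neg (mt (fun h => by rw [← h]; exact (f₁ e).2.2) v.2), add_zero]

theorem prodMap_val_ne (A : Finset V) (x : {v // v ∈ A} × {v // v ∈ A})
    (y : {v // v ∉ A} × {v // v ∉ A}) :
    Prod.map Subtype.val Subtype.val x ≠ Prod.map Subtype.val Subtype.val y := by
  intro h
  have h1 : (x.1 : V) = y.1 := congrArg Prod.fst h
  exact y.1.2 (h1 ▸ x.1.2)

theorem splitsAlong_glue [DecidableEq E] (A : Finset V) (B : Finset E)
    (f₁ : {e // e ∈ B} → {v // v ∈ A} × {v // v ∈ A})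
    (f₂ : {e // e ∉ B} → {v // v ∉ A} × {v // v ∉ A}) :
    SplitsAlong A
      (glue (Prod.map Subtype.val Subtype.val) (Prod.map Subtype.val Subtype.val) B f₁ f₂) ↔
    IsConn f₁ ∧ IsConn f₂ := by
  constructor
  · rintro ⟨B', g₁, g₂, h₁, h₂, h⟩
    have := @glue_injective E _ _ (V × V) _ _ _
      (Function.Injective.prodMap (Subtype.val_injective (p := fun v => v ∈ A))
        (Subtype.val_injective (p := fun v => v ∈ A)))
      (Function.Injective.prodMap (Subtype.val_injective (p := fun v => v ∉ A))
        (Subtype.val_injective (p := fun v => v ∉ A)))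
      (prodMap_val_ne A) ⟨B, f₁, f₂⟩ ⟨B', g₁, g₂⟩ h
    cases this
    exact ⟨h₁, h₂⟩
  · rintro ⟨h₁, h₂⟩
    exact ⟨B, f₁, f₂, h₁, h₂, rfl⟩

open scoped Classical in
theorem sum_splitsAlong [Fintype V] [DecidableEq V] [Fintype E] [DecidableEq E] [Fintype I]
    (T : Multiset I → K) (Δ : I → I → K) (m : V → Multiset I) (A : Finset V) :
    ∑ f : E → V × V, (if SplitsAlong A f then graphWeight T Δ f m else 0) =
      ∑ B : Finset E, connSum {v // v ∈ A} {e // e ∈ B} T Δ (fun v => m v) *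
        connSum {v // v ∉ A} {e // e ∉ B} T Δ (fun v => m v) := by
  rw [sum_glue (Function.Injective.prodMap (Subtype.val_injective (p := fun v => v ∈ A))
        (Subtype.val_injective (p := fun v => v ∈ A)))
      (Function.Injective.prodMap (Subtype.val_injective (p := fun v => v ∉ A))
        (Subtype.val_injective (p := fun v => v ∉ A)))
      (prodMap_val_ne A)]
  · refine Finset.sum_congr rfl fun B _ => ?_
    unfold connSum
    rw [Finset.sum_mul_sum]
    refine Finset.sum_congr rfl fun f₁ _ => Finset.sum_congr rfl fun f₂ _ => ?_
    rw [graphWeight_glue]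
    by_cases h₁ : IsConn f₁ <;> by_cases h₂ : IsConn f₂ <;> simp [splitsAlong_glue, h₁, h₂]
  · intro f hf e
    have : SplitsAlong A f := by
      by_contra h
      exact hf (if_neg h)
    obtain ⟨B, f₁, f₂, -, -, rfl⟩ := this
    by_cases he : e ∈ B
    · left
      exact ⟨f₁ ⟨e, he⟩, (glue_mem _ _ B f₁ f₂ ⟨e, he⟩).symm⟩
    · right
      exact ⟨f₂ ⟨e, he⟩, (glue_not_mem _ _ B f₁ f₂ ⟨e, he⟩).symm⟩

/-- The functions on `Option H` are the pairs of a value at `none` and a function on `H`. -/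
theorem sum_option_fun {H X M : Type} [Fintype H] [DecidableEq H] [Fintype X] [AddCommMonoid M]
    (G : (Option H → X) → M) :
    ∑ k, G k = ∑ x : X, ∑ k : H → X, G (fun h => h.elim x k) := by
  rw [← Fintype.sum_prod_type']
  refine Fintype.sum_equiv
    ⟨fun k => (k none, fun h => k (some h)), fun p h => h.elim p.1 p.2, ?_, ?_⟩ _ _ ?_
  · intro k
    funext h
    cases h <;> rfl
  · intro p
    rfl
  · intro k
    congr 1
    funext h
    cases h <;> rfl

/-- Cutting an edge. -/
theorem connSum_option [Fintype V] [DecidableEq V] [Fintype E] [DecidableEq E] [Fintype I]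
    (T : Multiset I → K) (Δ : I → I → K) (m : V → Multiset I) :
    connSum V (Option E) T Δ m = ∑ α, ∑ β, Δ α β * ∑ x : V, ∑ y : V,
      (connSum V E T Δ
          (fun v => m v + ((if x = v then {α} else 0) + (if y = v then {β} else 0))) +
        ∑ A : Finset V, if x ∈ A ∧ y ∉ A then ∑ B : Finset E,
          connSum {v // v ∈ A} {e // e ∈ B} T Δ
            (fun v => m v + ((if x = v then {α} else 0) + (if y = v then {β} else 0))) *
          connSum {v // v ∉ A} {e // e ∉ B} T Δ
            (fun v => m v + ((if x = v then {α} else 0) + (if y = v then {β} else 0)))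
          else 0) := by
  classical
  -- The pair of indices on the new edge is split off the sum. It leaves the factor `Δ α β` and an
  -- extra index at each of the vertices `x` and `y`.
  have h1 : ∀ x y (f : E → V × V), graphWeight T Δ (addEdge x y f) m = ∑ α, ∑ β, Δ α β *
      graphWeight T Δ f
        (fun v => m v + ((if x = v then {α} else 0) + (if y = v then {β} else 0))) := by
    intro x y f
    unfold graphWeight
    rw [sum_option_fun, Fintype.sum_prod_type]
    refine Finset.sum_congr rfl fun α _ => Finset.sum_congr rfl fun β _ => ?_
    rw [Finset.mul_sum]
    refine Finset.sum_congr rfl fun a _ => ?_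
    rw [Fintype.prod_option, mul_assoc]
    simp only [Option.elim]
    congr 2
    refine Finset.prod_congr rfl fun v _ => ?_
    congr 1
    unfold edgeIdx
    rw [Fintype.sum_option]
    simp only [addEdge, Option.elim]
    ac_rfl
  have h2 : connSum V (Option E) T Δ m = ∑ x : V, ∑ y : V, ∑ f : E → V × V,
      if IsConn (addEdge x y f) then graphWeight T Δ (addEdge x y f) m else 0 := by
    rw [connSum, sum_option_fun, Fintype.sum_prod_type]
    rfl
  rw [h2]
  have h3 : ∀ x y, (∑ f : E → V × V,
      if IsConn (addEdge x y f) then graphWeight T Δ (addEdge x y f) m else 0) =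
      ∑ α, ∑ β, Δ α β * (connSum V E T Δ
          (fun v => m v + ((if x = v then {α} else 0) + (if y = v then {β} else 0))) +
        ∑ A : Finset V, if x ∈ A ∧ y ∉ A then ∑ B : Finset E,
          connSum {v // v ∈ A} {e // e ∈ B} T Δ
            (fun v => m v + ((if x = v then {α} else 0) + (if y = v then {β} else 0))) *
          connSum {v // v ∉ A} {e // e ∉ B} T Δ
            (fun v => m v + ((if x = v then {α} else 0) + (if y = v then {β} else 0)))
          else 0) := by
    intro x y
    have h4 : ∀ f : E → V × V, (if IsConn (addEdge x y f) then
        graphWeight T Δ (addEdge x y f) m else 0) = ∑ α, ∑ β, Δ α β *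
        (if IsConn (addEdge x y f) then graphWeight T Δ f
        (fun v => m v + ((if x = v then {α} else 0) + (if y = v then {β} else 0))) else 0) := by
      intro f
      by_cases h : IsConn (addEdge x y f) <;> simp [h, h1]
    simp only [h4]
    rw [Finset.sum_comm]
    refine Finset.sum_congr rfl fun α _ => ?_
    rw [Finset.sum_comm]
    refine Finset.sum_congr rfl fun β _ => ?_
    rw [← Finset.mul_sum]
    congr 1
    simp only [ite_isConn_addEdge]
    rw [Finset.sum_add_distrib, Finset.sum_comm (s := (Finset.univ : Finset (E → V × V)))]
    congr 1
    refine Finset.sum_congr rfl fun A _ => ?_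
    by_cases hx : x ∈ A <;> by_cases hy : y ∈ A <;> simp [hx, hy, sum_splitsAlong]
  simp only [h3]
  have h5 : ∀ G : V → V → I → I → K, ∑ x, ∑ y, ∑ α, ∑ β, G x y α β
      = ∑ α, ∑ β, ∑ x, ∑ y, G x y α β := by
    intro G
    calc _ = ∑ x, ∑ α, ∑ y, ∑ β, G x y α β := Finset.sum_congr rfl fun x _ => Finset.sum_comm
      _ = ∑ α, ∑ x, ∑ y, ∑ β, G x y α β := Finset.sum_comm
      _ = ∑ α, ∑ x, ∑ β, ∑ y, G x y α β :=
        Finset.sum_congr rfl fun x _ => Finset.sum_congr rfl fun x _ => Finset.sum_comm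
      _ = _ := Finset.sum_congr rfl fun x _ => Finset.sum_comm
  rw [h5]
  simp only [Finset.mul_sum]

end Weights

end Wick

namespace Wick

/-! ### Connectedness through walks, and the bound on the number of vertices. -/

section ConnectedGraphs

variable {V E : Type}

/-- The set of vertices reachable from a given one is closed, hence everything. Conversely a closed
set is preserved along walks. -/
theorem isConn_iff_connected (f : E → V × V) :
    IsConn f ↔ (SimpleGraph.fromRel fun v w => ∃ e, (f e).1 = v ∧ (f e).2 = w).Connected := by
  set G := SimpleGraph.fromRel fun v w => ∃ e, (f e).1 = v ∧ (f e).2 = w with hG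
  constructor
  · rintro ⟨⟨v⟩, h⟩
    rw [SimpleGraph.connected_iff_exists_forall_reachable]
    refine ⟨v, fun w => ?_⟩
    have he : ∀ e, G.Reachable (f e).1 (f e).2 := by
      intro e
      by_cases h : (f e).1 = (f e).2
      · rw [h]
      · exact SimpleGraph.Adj.reachable ((SimpleGraph.fromRel_adj _ _ _).2
          ⟨h, Or.inl ⟨e, rfl, rfl⟩⟩)
    rcases h {w | G.Reachable v w} (fun e => ⟨fun h => h.trans (he e),
      fun h => h.trans (he e).symm⟩) with h | h
    · exact absurd (SimpleGraph.Reachable.refl v) (fun h' => by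
        have : v ∈ {w | G.Reachable v w} := h'
        rw [h] at this
        exact this)
    · have : w ∈ {w | G.Reachable v w} := h ▸ Set.mem_univ w
      exact this
  · intro h
    refine ⟨h.nonempty, fun A hA => ?_⟩
    rcases A.eq_empty_or_nonempty with h0 | ⟨v, hv⟩
    · exact Or.inl h0
    · right
      ext w
      refine iff_of_true ?_ trivial
      obtain ⟨p⟩ := h.preconnected v w
      induction p with
      | nil => exact hv
      | cons hadj _ ih =>
        apply ih
        obtain ⟨-, ⟨e, rfl, rfl⟩ | ⟨e, rfl, rfl⟩⟩ := (SimpleGraph.fromRel_adj _ _ _).1 hadj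
        · exact (hA e).1 hv
        · exact (hA e).2 hv

/-- Distinct edges of the underlying simple graph come from distinct elements of `E`, so the bound
for connected simple graphs applies. It makes the truncated difference |E| + 1 - |V| an honest loop
number. -/
theorem IsConn.card_le [Fintype V] [Fintype E] {f : E → V × V} (h : IsConn f) :
    Fintype.card V ≤ Fintype.card E + 1 := by
  classical
  have h1 := ((isConn_iff_connected f).1 h).card_vert_le_card_edgeSet_add_one
  rw [Nat.card_eq_fintype_card] at h1
  refine h1.trans (Nat.succ_le_succ ?_)
  rw [← Nat.card_eq_fintype_card]
  have h2 : ∀ s : (SimpleGraph.fromRel fun v w => ∃ e, (f e).1 = v ∧ (f e).2 = w).edgeSet,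
      ∃ e, s((f e).1, (f e).2) = (s : Sym2 V) := by
    rintro ⟨s, hs⟩
    induction s with
    | _ a b =>
      rw [SimpleGraph.mem_edgeSet, SimpleGraph.fromRel_adj] at hs
      obtain ⟨-, ⟨e, rfl, rfl⟩ | ⟨e, rfl, rfl⟩⟩ := hs
      · exact ⟨e, rfl⟩
      · exact ⟨e, Sym2.eq_swap⟩
  choose g hg using h2
  refine Nat.card_le_card_of_injective g fun a b hab => Subtype.ext ?_
  rw [← hg a, ← hg b, hab]

end ConnectedGraphs

/-! ### Independence of the labelling sets. -/

section Invariance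

variable {V V' E E' L L' I K : Type} [CommRing K]

/-- Two families of indices with the same multiset of values are related by a bijection. -/
theorem exists_equiv_of_map_eq [Fintype L] [Fintype L'] (μ : L → I) (μ' : L' → I)
    (h : Finset.univ.val.map μ = Finset.univ.val.map μ') : ∃ e : L ≃ L', ∀ x, μ' (e x) = μ x := by
  classical
  have hc : ∀ i, Nonempty ({x // μ x = i} ≃ {x // μ' x = i}) := by
    intro i
    rw [← Fintype.card_eq, Fintype.card_subtype, Fintype.card_subtype]
    have := congrArg (Multiset.count i) h
    rw [Multiset.count_map, Multiset.count_map] at this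
    simpa only [Finset.card_def, Finset.filter_val, eq_comm] using this
  have e := fun i => (hc i).some
  refine ⟨(Equiv.sigmaFiberEquiv μ).symm.trans ((Equiv.sigmaCongrRight e).trans
    (Equiv.sigmaFiberEquiv μ')), fun x => ?_⟩
  exact (e (μ x) ⟨x, rfl⟩).2

theorem isConn_congr (eV : V ≃ V') (eE : E ≃ E') (f : E → V × V) :
    IsConn (fun e' => Prod.map eV eV (f (eE.symm e'))) ↔ IsConn f := by
  constructor
  · rintro ⟨⟨v⟩, h⟩
    refine ⟨⟨eV.symm v⟩, fun A hA => ?_⟩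
    rcases h (eV.symm ⁻¹' A) (fun e => by simpa using hA (eE.symm e)) with h | h
    · left
      rwa [Set.preimage_eq_empty_iff, Equiv.range_eq_univ, Set.disjoint_univ] at h
    · right
      rwa [Set.preimage_eq_univ_iff, Equiv.range_eq_univ, Set.univ_subset_iff] at h
  · rintro ⟨⟨v⟩, h⟩
    refine ⟨⟨eV v⟩, fun A hA => ?_⟩
    rcases h (eV ⁻¹' A) (fun e => by simpa using hA (eE e)) with h | h
    · left
      rwa [Set.preimage_eq_empty_iff, Equiv.range_eq_univ, Set.disjoint_univ] at h
    · right
      rwa [Set.preimage_eq_univ_iff, Equiv.range_eq_univ, Set.univ_subset_iff] at h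

variable [Fintype V] [DecidableEq V] [Fintype V'] [DecidableEq V'] [Fintype E] [DecidableEq E]
  [Fintype E'] [DecidableEq E'] [Fintype L] [DecidableEq L] [Fintype L'] [DecidableEq L'] [Fintype I]

theorem graphWeight_congr (T : Multiset I → K) (Δ : I → I → K) (eV : V ≃ V') (eE : E ≃ E')
    (f : E → V × V) (m : V' → Multiset I) :
    graphWeight T Δ (fun e' => Prod.map eV eV (f (eE.symm e'))) m
      = graphWeight T Δ f (fun v => m (eV v)) := by
  unfold graphWeight
  refine Fintype.sum_equiv (Equiv.arrowCongr eE.symm (Equiv.refl _)) _ _ fun a => ?_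
  congr 1
  · exact Fintype.prod_equiv eE.symm _ _ fun e => by simp
  · refine Fintype.prod_equiv eV.symm _ _ fun v => ?_
    simp only [Equiv.apply_symm_apply]
    congr 2
    unfold edgeIdx
    refine Fintype.sum_equiv eE.symm _ _ fun e => ?_
    simp [Equiv.eq_symm_apply]

theorem connSum_congr (T : Multiset I → K) (Δ : I → I → K) (eV : V ≃ V') (eE : E ≃ E')
    (m : V' → Multiset I) :
    connSum V' E' T Δ m = connSum V E T Δ (fun v => m (eV v)) := by
  classical
  unfold connSum
  symm
  refine Fintype.sum_equiv ⟨fun f e' => Prod.map eV eV (f (eE.symm e')),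
    fun f e => Prod.map eV.symm eV.symm (f (eE e)), fun f => ?_, fun f => ?_⟩ _ _ fun f => ?_
  · funext e; ext <;> simp
  · funext e; ext <;> simp
  · simp only [Equiv.coe_fn_mk]
    rw [graphWeight_congr]
    simp only [isConn_congr]

theorem legSum_congr (T : Multiset I → K) (Δ : I → I → K) (eV : V ≃ V') (eE : E ≃ E')
    (eL : L ≃ L') (μ : L → I) (μ' : L' → I) (hμ : ∀ x, μ' (eL x) = μ x) :
    legSum V E T Δ μ = legSum V' E' T Δ μ' := by
  unfold legSum
  refine Fintype.sum_equiv (Equiv.arrowCongr eL eV) _ _ fun l => ?_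
  rw [connSum_congr T Δ eV eE]
  congr 1
  funext v
  unfold legIdx
  refine Fintype.sum_equiv eL _ _ fun x => ?_
  simp [hμ]

/-- The sum of the contractions of all connected graphs with `v` labelled vertices and `k` labelled
edges, with the indices in the multiset `m` on the legs. -/
def labSum (v k : ℕ) (T : Multiset I → K) (Δ : I → I → K) (m : Multiset I) : K :=
  legSum (Fin v) (Fin k) T Δ m.toList.get

/-- A reduction to standard labels: the pieces of a cut graph are labelled by subtypes, and only the
cardinalities and the multiset of indices on the legs matter for them. -/
theorem legSum_eq_labSum (T : Multiset I → K) (Δ : I → I → K) (μ : L → I) {v k : ℕ}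
    (hv : Fintype.card V = v) (hk : Fintype.card E = k) :
    legSum V E T Δ μ = labSum v k T Δ (Finset.univ.val.map μ) := by
  obtain ⟨e, he⟩ := exists_equiv_of_map_eq μ (Finset.univ.val.map μ).toList.get (by
    rw [Fin.univ_val_map, List.ofFn_get, Multiset.coe_toList])
  exact legSum_congr T Δ (Fintype.equivFinOfCardEq hv) (Fintype.equivFinOfCardEq hk) e _ _ he

theorem labSum_eq_zero (T : Multiset I → K) (Δ : I → I → K) (m : Multiset I) {v k : ℕ}
    (h : k + 1 < v) : labSum v k T Δ m = 0 := by
  refine Finset.sum_eq_zero fun l _ => Finset.sum_eq_zero fun f _ => if_neg fun hf => ?_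
  have := hf.card_le
  simp only [Fintype.card_fin] at this
  omega

end Invariance

/-! ### The shuffle product as a sum over subsets of labels. -/

section Antidiagonal

/-- By induction on `s`, a new label goes to one of the two sides. This translates products in `Hz`
into distributions of labelled legs over two graphs. -/
theorem sum_antidiagonal_map {L I K : Type} [DecidableEq L] [AddCommMonoid K] (μ : L → I)
    (φ : Multiset I → Multiset I → K) (s : Finset L) :
    ((s.val.map μ).antidiagonal.map (fun p => φ p.1 p.2)).sum =
      ∑ A ∈ s.powerset, φ (A.val.map μ) ((s \ A).val.map μ) := by
  induction s using Finset.induction_on generalizing φ with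
  | empty => simp
  | insert a s ha ih =>
    rw [Finset.insert_val_of_notMem ha, Multiset.map_cons, Multiset.antidiagonal_cons,
      Multiset.map_add, Multiset.sum_add, Multiset.map_map, Multiset.map_map,
      Finset.sum_powerset_insert ha]
    have h1 := ih (fun p q => φ p (μ a ::ₘ q))
    have h2 := ih (fun p q => φ (μ a ::ₘ p) q)
    refine congr_arg₂ _ (h1.trans ?_) (h2.trans ?_)
    · refine Finset.sum_congr rfl fun A hA => ?_
      have haA : a ∉ A := fun h => ha (Finset.mem_powerset.1 hA h)
      rw [Finset.insert_sdiff_of_notMem _ haA, Finset.insert_val_of_notMem (by simp [ha]),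
        Multiset.map_cons]
    · refine Finset.sum_congr rfl fun A hA => ?_
      have haA : a ∉ A := fun h => ha (Finset.mem_powerset.1 hA h)
      rw [Finset.insert_val_of_notMem haA, Multiset.map_cons, Finset.insert_sdiff_insert,
        Finset.sdiff_insert_of_notMem ha]

end Antidiagonal

end Wick

namespace Wick

/-! ### Cutting an edge of a labelled graph with legs. -/

section Cutting

variable {V E L I K : Type} [CommRing K] [Fintype V] [DecidableEq V] [Fintype E] [DecidableEq E]
  [Fintype L] [DecidableEq L] [Fintype I]

theorem legIdx_option {V L I : Type} [DecidableEq V] [Fintype L] (x : V) (l : L → V) (α : I) (μ : L → I) (v : V) :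
    legIdx (fun h : Option L => h.elim x l) (fun h => h.elim α μ) v
      = (if x = v then {α} else 0) + legIdx l μ v := by
  unfold legIdx
  rw [Fintype.sum_option]
  rfl

theorem legSum_option (T : Multiset I → K) (Δ : I → I → K) (α : I) (μ : L → I) :
    legSum V E T Δ (fun h : Option L => h.elim α μ) =
      ∑ x : V, ∑ l : L → V, connSum V E T Δ
        (fun v => (if x = v then {α} else 0) + legIdx l μ v) := by
  unfold legSum
  rw [sum_option_fun]
  refine Finset.sum_congr rfl fun x _ => Finset.sum_congr rfl fun l _ => ?_
  congr 1
  funext v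
  exact legIdx_option x l α μ v

/-- The contribution of the graphs which fall apart along `A`. Here `S` is the set of legs attached
to `A`, and the cut edge becomes a leg with index `α` on `A` and one with index `β` on the
complement. -/
theorem legSum_cut_disconnected (T : Multiset I → K) (Δ : I → I → K) (α β : I) (μ : L → I)
    (A : Finset V) :
    ∑ l : L → V, ∑ x : V, ∑ y : V, (if x ∈ A ∧ y ∉ A then ∑ B : Finset E,
          connSum {v // v ∈ A} {e // e ∈ B} T Δ (fun v => legIdx l μ v +
            ((if x = v then {α} else 0) + (if y = v then {β} else 0))) *
          connSum {v // v ∉ A} {e // e ∉ B} T Δ (fun v => legIdx l μ v +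
            ((if x = v then {α} else 0) + (if y = v then {β} else 0)))
          else 0) =
    ∑ S : Finset L, ∑ B : Finset E,
      legSum {v // v ∈ A} {e // e ∈ B} T Δ
        (fun h : Option {s // s ∈ S} => h.elim α (fun s => μ s)) *
      legSum {v // v ∉ A} {e // e ∉ B} T Δ
        (fun h : Option {s // s ∉ S} => h.elim β (fun s => μ s)) := by
  rw [sum_glue (Subtype.val_injective (p := fun v => v ∈ A))
    (Subtype.val_injective (p := fun v => v ∉ A)) (fun x y h => y.2 (h ▸ x.2))]
  swap
  · intro k _ h
    by_cases hk : k h ∈ A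
    · exact Or.inl ⟨⟨k h, hk⟩, rfl⟩
    · exact Or.inr ⟨⟨k h, hk⟩, rfl⟩
  refine Finset.sum_congr rfl fun S _ => ?_
  have key : ∀ (l₁ : {s // s ∈ S} → {v // v ∈ A}) (l₂ : {s // s ∉ S} → {v // v ∉ A}),
      (∑ x : V, ∑ y : V, (if x ∈ A ∧ y ∉ A then ∑ B : Finset E,
          connSum {v // v ∈ A} {e // e ∈ B} T Δ
            (fun v => legIdx (glue Subtype.val Subtype.val S l₁ l₂) μ v +
            ((if x = v then {α} else 0) + (if y = v then {β} else 0))) *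
          connSum {v // v ∉ A} {e // e ∉ B} T Δ
            (fun v => legIdx (glue Subtype.val Subtype.val S l₁ l₂) μ v +
            ((if x = v then {α} else 0) + (if y = v then {β} else 0)))
          else 0)) =
      ∑ x : {v // v ∈ A}, ∑ y : {v // v ∉ A}, ∑ B : Finset E,
        connSum {v // v ∈ A} {e // e ∈ B} T Δ
          (fun v => (if x = v then {α} else 0) + legIdx l₁ (fun s => μ s) v) *
        connSum {v // v ∉ A} {e // e ∉ B} T Δ
          (fun v => (if y = v then {β} else 0) + legIdx l₂ (fun s => μ s) v) := by
    intro l₁ l₂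
    rw [sum_mem_add_sum_not_mem A]
    rw [Finset.sum_eq_zero (s := (Finset.univ : Finset {v // v ∉ A}))
      (fun x _ => Finset.sum_eq_zero fun y _ => if_neg fun h => x.2 h.1), add_zero]
    refine Finset.sum_congr rfl fun x _ => ?_
    rw [sum_mem_add_sum_not_mem A]
    rw [Finset.sum_eq_zero (s := (Finset.univ : Finset {v // v ∈ A}))
      (fun y _ => if_neg fun h => h.2 y.2), zero_add]
    refine Finset.sum_congr rfl fun y _ => ?_
    rw [if_pos ⟨x.2, y.2⟩]
    refine Finset.sum_congr rfl fun B _ => ?_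
    congr 2
    · funext v
      rw [if_neg (show ¬ (y : V) = v from fun h => y.2 (h ▸ v.2)), add_zero, add_comm]
      congr 1
      · simp only [Subtype.ext_iff]
      · unfold legIdx
        rw [sum_mem_add_sum_not_mem S]
        simp only [glue_mem, glue_not_mem, Subtype.ext_iff]
        rw [Finset.sum_eq_zero (s := (Finset.univ : Finset {v // v ∉ S}))
          (fun s _ => if_neg (mt (fun h => by rw [h]; exact v.2) (l₂ s).2)), add_zero]
    · funext v
      rw [if_neg (show ¬ (x : V) = v from fun h => v.2 (h ▸ x.2)), zero_add, add_comm]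
      congr 1
      · simp only [Subtype.ext_iff]
      · unfold legIdx
        rw [sum_mem_add_sum_not_mem S]
        simp only [glue_mem, glue_not_mem, Subtype.ext_iff]
        rw [Finset.sum_eq_zero (s := (Finset.univ : Finset {v // v ∈ S}))
          (fun s _ => if_neg (mt (fun h => by rw [← h]; exact (l₁ s).2) v.2)), zero_add]
  simp only [key, legSum_option, Finset.sum_mul_sum]
  calc _ = ∑ l₁ : {s // s ∈ S} → {v // v ∈ A}, ∑ x : {v // v ∈ A},
        ∑ l₂ : {s // s ∉ S} → {v // v ∉ A}, ∑ y : {v // v ∉ A}, ∑ B : Finset E, _ :=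
      Finset.sum_congr rfl fun _ _ => Finset.sum_comm
    _ = ∑ x : {v // v ∈ A}, ∑ l₁ : {s // s ∈ S} → {v // v ∈ A},
        ∑ y : {v // v ∉ A}, ∑ l₂ : {s // s ∉ S} → {v // v ∉ A}, ∑ B : Finset E, _ := by
      rw [Finset.sum_comm]
      exact Finset.sum_congr rfl fun _ _ => Finset.sum_congr rfl fun _ _ => Finset.sum_comm
    _ = ∑ x : {v // v ∈ A}, ∑ y : {v // v ∉ A}, ∑ l₁ : {s // s ∈ S} → {v // v ∈ A},
        ∑ l₂ : {s // s ∉ S} → {v // v ∉ A}, ∑ B : Finset E, _ :=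
      Finset.sum_congr rfl fun _ _ => Finset.sum_comm
    _ = ∑ x : {v // v ∈ A}, ∑ y : {v // v ∉ A}, ∑ B : Finset E,
        ∑ l₁ : {s // s ∈ S} → {v // v ∈ A}, ∑ l₂ : {s // s ∉ S} → {v // v ∉ A}, _ := by
      refine Finset.sum_congr rfl fun _ _ => Finset.sum_congr rfl fun _ _ => ?_
      rw [Finset.sum_comm]
      conv_lhs =>
        enter [2, l₂]
        rw [Finset.sum_comm]
      rw [Finset.sum_comm]
      exact Finset.sum_congr rfl fun _ _ => Finset.sum_comm
    _ = _ := by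
      conv_lhs =>
        enter [2, x]
        rw [Finset.sum_comm]
      rw [Finset.sum_comm]

/-- Without the distinguished edge, what remains is a connected graph with two more legs, or two
connected graphs with one more leg each. -/
theorem legSum_cut (T : Multiset I → K) (Δ : I → I → K) (μ : L → I) :
    legSum V (Option E) T Δ μ = ∑ α, ∑ β, Δ α β *
      (legSum V E T Δ (fun h : Option (Option L) => h.elim α (fun h => h.elim β μ)) +
        ∑ A : Finset V, ∑ B : Finset E, ∑ S : Finset L,
          legSum {v // v ∈ A} {e // e ∈ B} T Δ
            (fun h : Option {s // s ∈ S} => h.elim α (fun s => μ s)) *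
          legSum {v // v ∉ A} {e // e ∉ B} T Δ
            (fun h : Option {s // s ∉ S} => h.elim β (fun s => μ s))) := by
  rw [legSum]
  simp only [connSum_option]
  rw [Finset.sum_comm]
  refine Finset.sum_congr rfl fun α _ => ?_
  rw [Finset.sum_comm]
  refine Finset.sum_congr rfl fun β _ => ?_
  rw [← Finset.mul_sum]
  congr 1
  simp only [Finset.sum_add_distrib]
  congr 1
  · rw [legSum_option]
    simp only [sum_option_fun, legIdx_option]
    rw [Finset.sum_comm]
    refine Finset.sum_congr rfl fun x _ => ?_
    rw [Finset.sum_comm]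
    refine Finset.sum_congr rfl fun y _ => Finset.sum_congr rfl fun l _ => ?_
    congr 1
    funext v
    ac_rfl
  · simp only [Finset.sum_comm (s := (Finset.univ : Finset (Finset E)))
      (t := (Finset.univ : Finset (Finset L)))]
    simp only [← legSum_cut_disconnected]
    conv_lhs =>
      enter [2, l, 2, x]
      rw [Finset.sum_comm]
    conv_lhs =>
      enter [2, l]
      rw [Finset.sum_comm]
    rw [Finset.sum_comm]

/-- The summands of `legSum_cut` depend on the sets of vertices and edges only through their
cardinalities, which are chosen in `v.choose a` and `k.choose b` ways; the sum over sets of legs is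
a shuffle product. -/
theorem labSum_cut (T : Multiset I → K) (Δ : I → I → K) (v k : ℕ) (m : Multiset I) :
    labSum v (k + 1) T Δ m = ∑ α, ∑ β, Δ α β * (labSum v k T Δ (α ::ₘ β ::ₘ m) +
      ∑ a ∈ Finset.range (v + 1), ∑ b ∈ Finset.range (k + 1), v.choose a • k.choose b •
        (m.antidiagonal.map (fun p => labSum a b T Δ (α ::ₘ p.1) *
          labSum (v - a) (k - b) T Δ (β ::ₘ p.2))).sum) := by
  have hm : Finset.univ.val.map m.toList.get = m := by
    rw [Fin.univ_val_map, List.ofFn_get, Multiset.coe_toList]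
  have h0 := legSum_eq_labSum T Δ m.toList.get (V := Fin v) (E := Option (Fin k)) (v := v)
    (k := k + 1) (by simp) (by simp)
  rw [hm] at h0
  rw [← h0, legSum_cut]
  refine Finset.sum_congr rfl fun α _ => Finset.sum_congr rfl fun β _ => ?_
  have hopt : ∀ {M : Type} [Fintype M] (μ : M → I) (α : I),
      Finset.univ.val.map (fun h : Option M => h.elim α μ) = α ::ₘ Finset.univ.val.map μ := by
    intro M _ μ α
    rw [show (Finset.univ : Finset (Option M)).val = none ::ₘ Finset.univ.val.map some from rfl]
    rw [Multiset.map_cons, Multiset.map_map]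
    rfl
  congr 2
  · rw [legSum_eq_labSum T Δ _ (v := v) (k := k) (by simp) (by simp), hopt, hopt, hm]
  · have h1 : ∀ (A : Finset (Fin v)) (B : Finset (Fin k)), ∑ S : Finset (Fin m.toList.length),
        legSum {v // v ∈ A} {e // e ∈ B} T Δ
            (fun h : Option {s // s ∈ S} => h.elim α (fun s => m.toList.get s)) *
          legSum {v // v ∉ A} {e // e ∉ B} T Δ
            (fun h : Option {s // s ∉ S} => h.elim β (fun s => m.toList.get s)) =
        (m.antidiagonal.map (fun p => labSum A.card B.card T Δ (α ::ₘ p.1) *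
          labSum (v - A.card) (k - B.card) T Δ (β ::ₘ p.2))).sum := by
      intro A B
      conv_rhs => rw [← hm]
      rw [sum_antidiagonal_map (K := K) m.toList.get
        (fun p q => labSum A.card B.card T Δ (α ::ₘ p) *
          labSum (v - A.card) (k - B.card) T Δ (β ::ₘ q)), Finset.powerset_univ]
      refine Finset.sum_congr rfl fun S _ => ?_
      rw [legSum_eq_labSum T Δ _ (v := A.card) (k := B.card) (by simp) (by simp), hopt,
        legSum_eq_labSum T Δ _ (v := v - A.card) (k := k - B.card)
          (by rw [Fintype.card_subtype_compl]; simp) (by rw [Fintype.card_subtype_compl]; simp),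
        hopt]
      have e1 : Finset.univ.val.map (fun s : {s // s ∈ S} => m.toList.get s)
          = S.val.map m.toList.get :=
        (Multiset.map_map m.toList.get Subtype.val _).symm.trans
          (congrArg _ (Multiset.attach_map_val S.val))
      have e2 : Finset.univ.val.map (fun s : {s // s ∉ S} => m.toList.get s)
          = (Finset.univ \ S).val.map m.toList.get := by
        refine (Multiset.map_map m.toList.get Subtype.val _).symm.trans (congrArg _ ?_)
        rw [Finset.univ_val_map_subtype_val]
        congr 1
        ext s
        simp
      rw [e1, e2]
    simp only [h1]
    rw [← Finset.powerset_univ, Finset.sum_powerset_apply_card (fun a =>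
      ∑ B : Finset (Fin k), (m.antidiagonal.map (fun p => labSum a B.card T Δ (α ::ₘ p.1) *
          labSum (v - a) (k - B.card) T Δ (β ::ₘ p.2))).sum), Finset.card_univ, Fintype.card_fin]
    refine Finset.sum_congr rfl fun a _ => ?_
    rw [← Finset.powerset_univ, Finset.sum_powerset_apply_card (fun b =>
      (m.antidiagonal.map (fun p => labSum a b T Δ (α ::ₘ p.1) *
          labSum (v - a) (k - b) T Δ (β ::ₘ p.2))).sum), Finset.card_univ, Fintype.card_fin,
      Finset.smul_sum]

end Cutting

end Wick

/-! ### Symmetry factors, loop counting and the edge recursion. -/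

namespace Wick

open Hz Nat

/-- A Cauchy product of finite sums. The cutoff `n` loses nothing, as the non-zero products have
total index at most `p + q - 2`. -/
theorem sum_range_mul_sum_range {A : Type} [CommRing A] (f g : ℕ → A) {p q n : ℕ}
    (hf : ∀ a, p ≤ a → f a = 0) (hg : ∀ a, q ≤ a → g a = 0) (hn : p + q ≤ n + 1) :
    ∑ v ∈ Finset.range n, ∑ a ∈ Finset.range (v + 1), f a * g (v - a) =
      (∑ a ∈ Finset.range p, f a) * ∑ a ∈ Finset.range q, g a := by
  rw [Finset.sum_mul_sum, ← Finset.sum_product',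
    ← Finset.sum_fiberwise_of_maps_to (s := Finset.range p ×ˢ Finset.range q)
      (t := Finset.range n) (g := fun x => x.1 + x.2)]
  · refine Finset.sum_congr rfl fun v _ => ?_
    rw [← Finset.Nat.sum_antidiagonal_eq_sum_range_succ (fun i j => f i * g j)]
    symm
    refine Finset.sum_subset (fun x hx => ?_) (fun x hx hx' => ?_)
    · exact Finset.HasAntidiagonal.mem_antidiagonal.2 (Finset.mem_filter.1 hx).2
    · simp only [Finset.mem_filter, Finset.mem_product, Finset.mem_range, not_and] at hx'
      rw [Finset.HasAntidiagonal.mem_antidiagonal] at hx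
      by_cases h1 : p ≤ x.1
      · rw [hf _ h1, zero_mul]
      · by_cases h2 : q ≤ x.2
        · rw [hg _ h2, mul_zero]
        · exact absurd hx (hx' ⟨by omega, by omega⟩)
  · intro x hx
    simp only [Finset.mem_product, Finset.mem_range] at hx ⊢
    omega

theorem sum_singleton {L I : Type} [Fintype L] (μ : L → I) :
    ∑ x, ({μ x} : Multiset I) = Finset.univ.val.map μ := by
  rw [Finset.sum, ← Multiset.sum_map_singleton (Finset.univ.val.map μ), Multiset.map_map]
  rfl

section Recursion

variable {I K : Type} [CommRing K] [Algebra ℂ K] [Fintype I]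

/-- The sum over the connected graphs with `a` vertices and `b` edges, divided by the orders of
their automorphism groups, and with a factor `h` for each loop. -/
def graphSum (h : K) (T : Multiset I → K) (Δ : I → I → K) (a b : ℕ) : Hz I K :=
  const (algebraMap ℂ K ((a ! * b ! * 2 ^ b : ℂ)⁻¹) * h ^ (b + 1 - a)) *
    (show Hz I K from labSum a b T Δ)

/-- The sum over the connected graphs with `k` edges. -/
def edgeSum (h : K) (T : Multiset I → K) (Δ : I → I → K) (k : ℕ) : Hz I K :=
  ∑ a ∈ Finset.range (k + 2), graphSum h T Δ a k

theorem graphSum_eq_zero (h : K) (T : Multiset I → K) (Δ : I → I → K) {a b : ℕ} (hab : b + 2 ≤ a) :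
    graphSum h T Δ a b = 0 := by
  have : (show Hz I K from labSum a b T Δ) = 0 := funext fun m => labSum_eq_zero T Δ m (by omega)
  rw [graphSum, this, mul_zero]

theorem const_mul {I K : Type} [CommRing K] (a b : K) : (const (a * b) : Hz I K) = const a * const b := by
  funext m
  rw [const_mul_apply]
  unfold const
  split_ifs <;> simp

theorem const_natCast_mul {I K : Type} [CommRing K] (n : ℕ) (f : Hz I K) : (const (n : K) : Hz I K) * f = n * f := by
  congr 1
  induction n with
  | zero => funext m; simp [const]; rfl
  | succ n ih =>
    rw [Nat.cast_succ, Nat.cast_succ, ← ih]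
    have h1 : (1 : Hz I K) = const 1 := rfl
    rw [h1]
    funext m
    rw [Hz.add_apply]
    unfold const
    split_ifs <;> simp

theorem labSum_cut' {I K : Type} [CommRing K] [Fintype I] (T : Multiset I → K) (Δ : I → I → K) (v k : ℕ) :
    (show Hz I K from labSum v (k + 1) T Δ) = ∑ α, ∑ β, const (Δ α β) *
      (dIdx α (dIdx β (show Hz I K from labSum v k T Δ)) +
      ∑ a ∈ Finset.range (v + 1), ∑ b ∈ Finset.range (k + 1), const (v.choose a : K) *
        (const (k.choose b : K) * (dIdx α (show Hz I K from labSum a b T Δ) *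
          dIdx β (show Hz I K from labSum (v - a) (k - b) T Δ)))) := by
  funext m
  refine (labSum_cut T Δ v k m).trans ?_
  simp only [Hz.sum_apply, const_mul_apply, Hz.add_apply]
  refine Finset.sum_congr rfl fun α _ => Finset.sum_congr rfl fun β _ => ?_
  congr 2
  · exact congrArg (labSum v k T Δ) (Multiset.cons_swap _ _ _)
  · refine Finset.sum_congr rfl fun a _ => Finset.sum_congr rfl fun b _ => ?_
    rw [nsmul_eq_mul, nsmul_eq_mul]
    rfl

theorem dIdx_const_mul {I K : Type} [CommRing K] (a : I) (c : K) (f : Hz I K) :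
    dIdx a (const c * f) = const c * dIdx a f := by
  rw [Derivation.leibniz, dIdx_const, smul_zero, add_zero, smul_eq_mul]

/-- The binomial coefficients distribute the symmetry factor of the whole graph over its two pieces.
-/
theorem factor_split {v k a b : ℕ} (ha : a ≤ v) (hb : b ≤ k) :
    (v ! * k ! * 2 ^ k : ℂ)⁻¹ * (v.choose a * k.choose b) =
      (a ! * b ! * 2 ^ b : ℂ)⁻¹ * ((v - a)! * (k - b)! * 2 ^ (k - b) : ℂ)⁻¹ := by
  have h1 : (v.choose a * a ! * (v - a)! : ℂ) = v ! := by
    exact_mod_cast Nat.choose_mul_factorial_mul_factorial ha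
  have h2 : (k.choose b * b ! * (k - b)! : ℂ) = k ! := by
    exact_mod_cast Nat.choose_mul_factorial_mul_factorial hb
  have h3 : (2 : ℂ) ^ k = 2 ^ b * 2 ^ (k - b) := by rw [← pow_add, Nat.add_sub_cancel' hb]
  have nz : ∀ n : ℕ, (n ! : ℂ) ≠ 0 := fun n => by exact_mod_cast Nat.factorial_ne_zero n
  have c1 : (v.choose a : ℂ) ≠ 0 := by exact_mod_cast (Nat.choose_pos ha).ne'
  have c2 : (k.choose b : ℂ) ≠ 0 := by exact_mod_cast (Nat.choose_pos hb).ne'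
  rw [← h1, ← h2, h3]
  have := nz a
  have := nz b
  have := nz (v - a)
  have := nz (k - b)
  field_simp

/-- The factor `2 * (k + 1)` is the ratio of the symmetry factors before and after cutting an edge:
the choice of the edge and of its direction. A cut which keeps the graph connected removes a loop,
whence the factor `h`. A disconnecting cut preserves the total number of loops. -/
theorem graphSum_succ (h : K) (T : Multiset I → K) (Δ : I → I → K) {v k : ℕ} (hv : v < k + 3) :
    (2 * (k + 1) : Hz I K) * graphSum h T Δ v (k + 1) = ∑ α, ∑ β, const (Δ α β) *
      (const h * dIdx α (dIdx β (graphSum h T Δ v k)) +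
      ∑ b ∈ Finset.range (k + 1), ∑ a ∈ Finset.range (v + 1),
        dIdx α (graphSum h T Δ a b) * dIdx β (graphSum h T Δ (v - a) (k - b))) := by
  have e1 : (2 * (k + 1) : Hz I K) * graphSum h T Δ v (k + 1) =
      const (algebraMap ℂ K ((v ! * k ! * 2 ^ k : ℂ)⁻¹) * h ^ (k + 2 - v)) *
        (show Hz I K from labSum v (k + 1) T Δ) := by
    have : (2 * (k + 1) : Hz I K) = ((2 * (k + 1) : ℕ) : Hz I K) := by push_cast; ring
    rw [this, graphSum, ← const_natCast_mul, ← mul_assoc, ← const_mul, ← mul_assoc]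
    congr 3
    rw [← map_natCast (algebraMap ℂ K), ← map_mul]
    congr 1
    have nz : ∀ n : ℕ, (n ! : ℂ) ≠ 0 := fun n => by exact_mod_cast Nat.factorial_ne_zero n
    have h1 := nz v
    have h2 := nz k
    have h3 : (k + 1 : ℂ) ≠ 0 := by exact_mod_cast Nat.succ_ne_zero k
    rw [Nat.factorial_succ, pow_succ]
    push_cast
    field_simp
  rw [e1, labSum_cut', Finset.mul_sum]
  refine Finset.sum_congr rfl fun α _ => ?_
  rw [Finset.mul_sum]
  refine Finset.sum_congr rfl fun β _ => ?_
  rw [mul_left_comm]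
  congr 1
  rw [mul_add]
  congr 1
  -- For too many vertices there is no connected graph and both sides vanish; otherwise the
  -- truncated subtraction is exact and the exponents of `h` differ by one.
  · by_cases hvk : k + 2 ≤ v
    · have h0 : (show Hz I K from labSum v k T Δ) = 0 :=
        funext fun m => labSum_eq_zero T Δ m (by omega)
      simp only [graphSum_eq_zero h T Δ hvk, h0, map_zero, mul_zero]
    · rw [graphSum, dIdx_const_mul, dIdx_const_mul, ← mul_assoc, ← const_mul]
      congr 2
      rw [show k + 2 - v = (k + 1 - v) + 1 by omega, pow_succ]
      ring
  · rw [Finset.sum_comm, Finset.mul_sum]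
    refine Finset.sum_congr rfl fun b hb => ?_
    rw [Finset.mul_sum]
    refine Finset.sum_congr rfl fun a ha => ?_
    rw [Finset.mem_range] at ha hb
    -- Splittings in which a piece has too many vertices to be connected are set aside first, since
    -- the truncated loop numbers would not add up for them.
    by_cases h1 : b + 2 ≤ a
    · have h0 : (show Hz I K from labSum a b T Δ) = 0 :=
        funext fun m => labSum_eq_zero T Δ m (by omega)
      rw [graphSum_eq_zero h T Δ h1, h0, map_zero]
      simp only [zero_mul, mul_zero]
    by_cases h2 : (k - b) + 2 ≤ v - a
    · have h0 : (show Hz I K from labSum (v - a) (k - b) T Δ) = 0 :=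
        funext fun m => labSum_eq_zero T Δ m (by omega)
      rw [graphSum_eq_zero h T Δ h2, h0, map_zero]
      simp only [mul_zero]
    have e2 : (const (algebraMap ℂ K ((v ! * k ! * 2 ^ k : ℂ)⁻¹) * h ^ (k + 2 - v)) : Hz I K) *
        (const (v.choose a : K) * const (k.choose b : K)) =
        const (algebraMap ℂ K ((a ! * b ! * 2 ^ b : ℂ)⁻¹) * h ^ (b + 1 - a)) *
        const (algebraMap ℂ K (((v - a)! * (k - b)! * 2 ^ (k - b) : ℂ)⁻¹) *
          h ^ (k - b + 1 - (v - a))) := by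
      rw [← const_mul, ← const_mul, ← const_mul]
      congr 1
      have := congrArg (algebraMap ℂ K) (factor_split (show a ≤ v by omega) (show b ≤ k by omega))
      rw [map_mul, map_mul, map_mul, map_natCast, map_natCast] at this
      rw [show k + 2 - v = (b + 1 - a) + (k - b + 1 - (v - a)) by omega, pow_add]
      linear_combination h ^ (b + 1 - a) * h ^ (k - b + 1 - (v - a)) * this
    rw [graphSum, graphSum, dIdx_const_mul, dIdx_const_mul, mul_mul_mul_comm, ← e2]
    ring

/-- The edge recursion. -/
theorem edgeSum_succ (h : K) (T : Multiset I → K) (Δ : I → I → K) (k : ℕ) :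
    (2 * (k + 1) : Hz I K) * edgeSum h T Δ (k + 1) = ∑ α, ∑ β, const (Δ α β) *
      (const h * dIdx α (dIdx β (edgeSum h T Δ k)) +
      ∑ b ∈ Finset.range (k + 1), dIdx α (edgeSum h T Δ b) * dIdx β (edgeSum h T Δ (k - b))) := by
  have hsum : ∀ (α β : I) (b : ℕ), b < k + 1 →
      ∑ v ∈ Finset.range (k + 3), ∑ a ∈ Finset.range (v + 1),
        dIdx α (graphSum h T Δ a b) * dIdx β (graphSum h T Δ (v - a) (k - b)) =
      dIdx α (edgeSum h T Δ b) * dIdx β (edgeSum h T Δ (k - b)) := by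
    intro α β b hb
    rw [edgeSum, edgeSum, map_sum, map_sum]
    exact sum_range_mul_sum_range (fun a => dIdx α (graphSum h T Δ a b))
      (fun a => dIdx β (graphSum h T Δ a (k - b)))
      (fun a ha => by simp only [graphSum_eq_zero h T Δ ha, map_zero])
      (fun a ha => by simp only [graphSum_eq_zero h T Δ ha, map_zero]) (by omega)
  have hF : ∑ v ∈ Finset.range (k + 3), graphSum h T Δ v k = edgeSum h T Δ k := by
    rw [Finset.sum_range_succ, graphSum_eq_zero h T Δ le_rfl, add_zero, edgeSum]
  rw [edgeSum, Finset.mul_sum]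
  rw [Finset.sum_congr rfl (fun v hv => graphSum_succ h T Δ (k := k) (Finset.mem_range.1 hv))]
  rw [Finset.sum_comm]
  refine Finset.sum_congr rfl fun α _ => ?_
  rw [Finset.sum_comm]
  refine Finset.sum_congr rfl fun β _ => ?_
  rw [← Finset.mul_sum, Finset.sum_add_distrib, ← Finset.mul_sum, ← map_sum, ← map_sum, hF,
    Finset.sum_comm]
  congr 2
  exact Finset.sum_congr rfl fun b hb => hsum α β b (Finset.mem_range.1 hb)

/-- Without edges a connected graph is a single vertex; the empty graph is not connected by
convention. -/
theorem edgeSum_zero (h : K) (T : Multiset I → K) (Δ : I → I → K) :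
    edgeSum h T Δ 0 = (show Hz I K from T) := by
  classical
  have h0 : labSum 0 0 T Δ = 0 := by
    funext m
    refine Finset.sum_eq_zero fun l _ => Finset.sum_eq_zero fun f _ => if_neg fun hf => ?_
    exact hf.1.elim fun v => v.elim0
  have hc : ∀ f : Fin 0 → Fin 1 × Fin 1, IsConn f := fun f =>
    ⟨⟨0⟩, fun A _ => Set.eq_empty_or_nonempty A |>.imp id fun ⟨v, hv⟩ => by
      ext w
      exact iff_of_true (Subsingleton.elim v w ▸ hv) trivial⟩
  have h1 : labSum 1 0 T Δ = T := by
    funext m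
    have hm : Finset.univ.val.map m.toList.get = m := by
      rw [Fin.univ_val_map, List.ofFn_get, Multiset.coe_toList]
    unfold labSum legSum connSum
    rw [Fintype.sum_unique, Fintype.sum_unique, if_pos (hc _)]
    unfold graphWeight
    rw [Fintype.sum_unique]
    simp only [Finset.univ_eq_empty, Finset.prod_empty, one_mul, Fintype.prod_unique]
    congr 1
    unfold edgeIdx legIdx
    rw [Finset.univ_eq_empty, Finset.sum_empty, zero_add]
    conv_rhs => rw [← hm]
    have : ∀ h : Fin m.toList.length, ((default : Fin m.toList.length → Fin 1) h
        = (default : Fin 1)) := fun h => Subsingleton.elim _ _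
    simp only [this, if_true]
    exact sum_singleton _
  rw [edgeSum, Finset.sum_range_succ, Finset.sum_range_one, graphSum, graphSum, h0, h1]
  have : (show Hz I K from (0 : Multiset I → K)) = 0 := rfl
  rw [this, mul_zero, zero_add]
  funext m
  rw [const_mul_apply]
  simp

end Recursion

end Wick

namespace FGraph

open Wick

variable {n : ℕ}

/-! ### Relabelling of graphs -/

/-- The ends of an edge. -/
def ends (Γ : FGraph n) (e : Fin Γ.nE) : Fin Γ.nV × Fin Γ.nV :=
  (Γ.edgeFlag (e, false), Γ.edgeFlag (e, true))

theorem isConnected_iff (Γ : FGraph n) : Γ.IsConnected ↔ IsConn Γ.ends :=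
  (isConn_iff_connected Γ.ends).symm

/-- A form of closedness which ignores the direction of the edges, as isomorphisms may exchange the
two flags of an edge. -/
theorem ends_symm_or (Γ : FGraph n) (A : Set (Fin Γ.nV)) :
    IsClosedUnder Γ.ends A ↔ ∀ e b b', Γ.edgeFlag (e, b) ∈ A ↔ Γ.edgeFlag (e, b') ∈ A := by
  constructor
  · intro h e b b'
    have := h e
    cases b <;> cases b' <;> first | exact Iff.rfl | exact this | exact this.symm
  · intro h e
    exact h e _ _

theorem IsConnected.of_iso {Γ Γ' : FGraph n} (φ : Iso Γ Γ') (h : Γ.IsConnected) :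
    Γ'.IsConnected := by
  rw [isConnected_iff] at h ⊢
  obtain ⟨⟨v⟩, h⟩ := h
  refine ⟨⟨φ.vert v⟩, fun A hA => ?_⟩
  rw [ends_symm_or] at hA
  rcases h (φ.vert ⁻¹' A) ((ends_symm_or _ _).2 fun e b b' => by
    simp only [Set.mem_preimage, ← φ.flag_vert]
    have h1 : φ.flag (e, b) = (φ.edge e, (φ.flag (e, b)).2) := Prod.ext (φ.flag_edge _) rfl
    have h2 : φ.flag (e, b') = (φ.edge e, (φ.flag (e, b')).2) := Prod.ext (φ.flag_edge _) rfl
    rw [h1, h2]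
    exact hA _ _ _) with h | h
  · left
    rwa [Set.preimage_eq_empty_iff, Equiv.range_eq_univ, Set.disjoint_univ] at h
  · right
    rwa [Set.preimage_eq_univ_iff, Equiv.range_eq_univ, Set.univ_subset_iff] at h

theorem HasGenus.of_iso {Γ Γ' : FGraph n} (φ : Iso Γ Γ') {g : ℕ} (h : Γ.HasGenus g) :
    Γ'.HasGenus g := by
  have hV : Γ.nV = Γ'.nV := by simpa using Fintype.card_congr φ.vert
  have hE : Γ.nE = Γ'.nE := by simpa using Fintype.card_congr φ.edge
  unfold HasGenus at h ⊢
  have hs : ∑ v, (Γ.genus v : ℤ) = ∑ v, (Γ'.genus v : ℤ) :=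
    Fintype.sum_equiv φ.vert _ _ fun v => by rw [φ.genus_vert]
  rw [h, hs]
  omega

/-- The bijection on flags. -/
def Iso.flags {Γ Γ' : FGraph n} (φ : Iso Γ Γ') : Γ.Flag ≃ Γ'.Flag :=
  Equiv.sumCongr φ.flag (Equiv.refl _)

theorem Iso.att_flags {Γ Γ' : FGraph n} (φ : Iso Γ Γ') (h : Γ.Flag) :
    Γ'.att (φ.flags h) = φ.vert (Γ.att h) := by
  rcases h with h | l
  · exact φ.flag_vert h
  · exact φ.leg_vert l

theorem IsStable.of_iso {Γ Γ' : FGraph n} (φ : Iso Γ Γ') (h : Γ.IsStable) : Γ'.IsStable := by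
  intro v
  have h1 := h (φ.vert.symm v)
  rw [← φ.genus_vert, Equiv.apply_symm_apply] at h1
  have h2 : Fintype.card (Γ.FlagAt (φ.vert.symm v)) = Fintype.card (Γ'.FlagAt v) :=
    Fintype.card_congr (Equiv.subtypeEquiv φ.flags fun x => by
      rw [φ.att_flags, Equiv.eq_symm_apply])
  rwa [h2] at h1

/-- The relabellings of the vertices, edges and flags of a graph. -/
abbrev Relabelling (Γ : FGraph n) : Type :=
  Equiv.Perm (Fin Γ.nV) × Equiv.Perm (Fin Γ.nE) × (Fin Γ.nE → Equiv.Perm Bool)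

/-- The relabelled graph. -/
def relabel (Γ : FGraph n) (r : Γ.Relabelling) : FGraph n where
  nV := Γ.nV
  nE := Γ.nE
  edgeFlag h := r.1 (Γ.edgeFlag ((Equiv.prodShear r.2.1 r.2.2).symm h))
  leg l := r.1 (Γ.leg l)
  genus v := Γ.genus (r.1.symm v)

/-- The tautological isomorphism to the relabelled graph. -/
def relabelIso (Γ : FGraph n) (r : Γ.Relabelling) : Iso Γ (Γ.relabel r) where
  vert := r.1
  edge := r.2.1
  flag := Equiv.prodShear r.2.1 r.2.2
  flag_edge _ := rfl
  flag_vert h := by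
    change r.1 (Γ.edgeFlag ((Equiv.prodShear r.2.1 r.2.2).symm (Equiv.prodShear r.2.1 r.2.2 h))) = _
    rw [Equiv.symm_apply_apply]
    rfl
  leg_vert _ := rfl
  genus_vert v := by
    change Γ.genus (r.1.symm (r.1 v)) = _
    rw [Equiv.symm_apply_apply]

@[ext]
theorem Iso.ext {Γ Γ' : FGraph n} {φ ψ : Iso Γ Γ'} (h1 : φ.vert = ψ.vert) (h2 : φ.edge = ψ.edge)
    (h3 : φ.flag = ψ.flag) : φ = ψ := by
  cases φ; cases ψ; simp_all

/-- An isomorphism determines its target by transport of structure, and on flags it is a permutation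
of the edges together with a permutation of the two ends of each edge. Thus isomorphisms out of `Γ`,
with arbitrary target, are the same as relabellings. -/
theorem relabel_bijective (Γ : FGraph n) : Function.Bijective
    (fun r : Γ.Relabelling => (⟨Γ.relabel r, Γ.relabelIso r⟩ : Σ Γ' : FGraph n, Iso Γ Γ')) := by
  constructor
  · rintro ⟨σ, τ, ρ⟩ ⟨σ', τ', ρ'⟩ h
    have h1 := congrArg (fun x : Σ Γ' : FGraph n, Iso Γ Γ' => fun v => (x.2.vert v).val) h
    have h2 := congrArg (fun x : Σ Γ' : FGraph n, Iso Γ Γ' => fun e => (x.2.edge e).val) h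
    have h3 := congrArg (fun x : Σ Γ' : FGraph n, Iso Γ Γ' => fun e => (x.2.flag e).2) h
    refine Prod.ext (Equiv.ext fun v => Fin.ext (congrFun h1 v))
      (Prod.ext (Equiv.ext fun v => Fin.ext (congrFun h2 v))
        (funext fun e => Equiv.ext fun b => congrFun h3 (e, b)))
  · rintro ⟨⟨V, E, ef, l, g⟩, φ⟩
    obtain rfl : Γ.nV = V := by simpa using Fintype.card_congr φ.vert
    obtain rfl : Γ.nE = E := by simpa using Fintype.card_congr φ.edge
    have hinj : ∀ e, Function.Injective fun b => (φ.flag (e, b)).2 := fun e b b' h => by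
      have : φ.flag (e, b) = φ.flag (e, b') :=
        Prod.ext ((φ.flag_edge (e, b)).trans (φ.flag_edge (e, b')).symm) h
      exact congrArg Prod.snd (φ.flag.injective this)
    let ρ : Fin Γ.nE → Equiv.Perm Bool := fun e =>
      Equiv.ofBijective _ (Finite.injective_iff_bijective.1 (hinj e))
    have hflag : φ.flag = Equiv.prodShear φ.edge ρ :=
      Equiv.ext fun h => Prod.ext (φ.flag_edge h) rfl
    refine ⟨(φ.vert, φ.edge, ρ), ?_⟩
    have hΓ : Γ.relabel (φ.vert, φ.edge, ρ) = ⟨Γ.nV, Γ.nE, ef, l, g⟩ := by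
      unfold relabel
      congr 1
      · funext h
        have := φ.flag_vert (φ.flag.symm h)
        rw [Equiv.apply_symm_apply] at this
        rw [← hflag]
        exact this.symm
      · funext i
        exact (φ.leg_vert i).symm
      · funext v
        have := φ.genus_vert (φ.vert.symm v)
        rw [Equiv.apply_symm_apply] at this
        exact this.symm
    refine Sigma.ext hΓ ?_
    -- The two isomorphisms have targets which are equal only propositionally, so they are compared
    -- through the underlying numbers of their values.
    have key : ∀ (Γ' : FGraph n) (hΓ' : Γ' = ⟨Γ.nV, Γ.nE, ef, l, g⟩) (ψ : Iso Γ Γ'),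
        (∀ v, (ψ.vert v).val = (φ.vert v).val) → (∀ v, (ψ.edge v).val = (φ.edge v).val) →
        (∀ h, (ψ.flag h).1.val = (φ.flag h).1.val) → (∀ h, (ψ.flag h).2 = (φ.flag h).2) →
        HEq ψ φ := by
      rintro _ rfl ψ h1 h2 h3 h4
      exact heq_of_eq (Iso.ext (Equiv.ext fun v => Fin.ext (h1 v))
        (Equiv.ext fun v => Fin.ext (h2 v))
        (Equiv.ext fun v => Prod.ext (Fin.ext (h3 v)) (h4 v)))
    refine key _ hΓ _ (fun _ => rfl) (fun _ => rfl) (fun h => ?_) (fun h => ?_)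
    · change ((Equiv.prodShear φ.edge ρ) h).1.val = _
      rw [hflag]
    · rfl

theorem card_sigma_iso (Γ : FGraph n) : Nat.card (Σ Γ' : FGraph n, Iso Γ Γ') =
    Γ.nV.factorial * Γ.nE.factorial * 2 ^ Γ.nE := by
  rw [← Nat.card_congr (Equiv.ofBijective _ Γ.relabel_bijective), Nat.card_eq_fintype_card]
  simp only [Fintype.card_prod, Fintype.card_perm, Fintype.card_fin, Fintype.card_pi,
    Fintype.card_bool, Finset.prod_const, Finset.card_univ]
  rw [mul_assoc]
  rfl

/-- The graphs isomorphic to an admissible graph, with an isomorphism. -/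
def fiberEquiv {g : ℕ} (Γ : Admissible g n) :
    ({Γ' : Admissible g n // (⟦Γ'⟧ : IsoClass g n) = ⟦Γ⟧} × Iso Γ.1 Γ.1) ≃
      Σ Γ' : FGraph n, Iso Γ.1 Γ' := by
  have hiso : ∀ x : {Γ' : Admissible g n // (⟦Γ'⟧ : IsoClass g n) = ⟦Γ⟧},
      Nonempty (Iso Γ.1 x.1.1) := fun x => Quotient.exact x.2.symm
  exact
  { toFun := fun p => ⟨p.1.1.1, p.2.trans (hiso p.1).some⟩
    invFun := fun p =>
      let x : {Γ' : Admissible g n // (⟦Γ'⟧ : IsoClass g n) = ⟦Γ⟧} :=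
        ⟨⟨p.1, Γ.2.1.of_iso p.2, Γ.2.2.1.of_iso p.2, Γ.2.2.2.of_iso p.2⟩,
          Quotient.sound ⟨p.2.symm⟩⟩
      ⟨x, p.2.trans (hiso x).some.symm⟩
    left_inv := fun p => by
      refine Prod.ext rfl ?_
      ext1 <;> ext1 x <;> simp [Iso.trans, Iso.symm]
    right_inv := fun p => by
      refine Sigma.ext rfl (heq_of_eq ?_)
      ext1 <;> ext1 x <;> simp [Iso.trans, Iso.symm] }

/-- The orbit-stabiliser formula: after a choice of one isomorphism to each graph in the class,
every isomorphism out of `Γ` is an automorphism followed by a chosen one. -/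
theorem card_fiber {g : ℕ} (Γ : Admissible g n) :
    Nat.card {Γ' : Admissible g n // (⟦Γ'⟧ : IsoClass g n) = ⟦Γ⟧} * Nat.card (Iso Γ.1 Γ.1) =
      Γ.1.nV.factorial * Γ.1.nE.factorial * 2 ^ Γ.1.nE := by
  rw [← Nat.card_prod, Nat.card_congr (fiberEquiv Γ), card_sigma_iso]

/-! ### Symmetric tensors -/

section SymmetricTensors

variable {I R : Type} [CommRing R] {C : ℕ → ∀ m : ℕ, (Fin m → I) →₀ R}

/-- The component of a symmetric tensor with a given multiset of indices. -/
def symComp (C : ℕ → ∀ m : ℕ, (Fin m → I) →₀ R) (g : ℕ) (m : Multiset I) : R :=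
  C g m.toList.length m.toList.get

variable (hC : ∀ (g n : ℕ) (σ : Equiv.Perm (Fin n)) (μ : Fin n → I), C g n (μ ∘ σ) = C g n μ)
include hC

theorem eq_of_map_eq {g a b : ℕ} (x : Fin a → I) (y : Fin b → I)
    (h : Finset.univ.val.map x = Finset.univ.val.map y) : C g a x = C g b y := by
  have hab : a = b := by simpa using congrArg Multiset.card h
  subst hab
  obtain ⟨e, he⟩ := exists_equiv_of_map_eq x y h
  have : x = y ∘ e := funext fun i => (he i).symm
  rw [this, hC]

theorem eq_symComp {H : Type} [Fintype H] {g a : ℕ} (e : Fin a ≃ H) (ν : H → I) :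
    C g a (fun i => ν (e i)) = symComp C g (Finset.univ.val.map ν) := by
  apply eq_of_map_eq hC
  rw [Fin.univ_val_map (Multiset.toList _).get, List.ofFn_get, Multiset.coe_toList]
  refine (Multiset.map_map ν (fun i => e i) _).symm.trans (congrArg _ ?_)
  exact congrArg Finset.val (Finset.map_univ_equiv e)

end SymmetricTensors

/-! ### Invariance of contractions, and the Feynman rule on labelled graphs. -/

section Contractions

variable {I R : Type} [CommRing R] {C : ℕ → ∀ m : ℕ, (Fin m → I) →₀ R}

/-- The indices at the vertex `v`. -/
def flagIdx (Γ : FGraph n) (a : Fin Γ.nE × Bool → I) (μ : Fin n → I) (v : Fin Γ.nV) : Multiset I :=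
  ∑ h : Γ.Flag, if Γ.att h = v then {Sum.elim a μ h} else 0

theorem map_flagAt (Γ : FGraph n) (a : Fin Γ.nE × Bool → I) (μ : Fin n → I) (v : Fin Γ.nV) :
    (Finset.univ : Finset (Γ.FlagAt v)).val.map (fun h => Sum.elim a μ h.1) =
      Γ.flagIdx a μ v := by
  rw [← sum_singleton, flagIdx, ← Finset.sum_filter]
  exact (Finset.sum_subtype (Finset.univ.filter fun h => Γ.att h = v) (by simp)
    (fun h => ({Sum.elim a μ h} : Multiset I))).symm

variable (hC : ∀ (g n : ℕ) (σ : Equiv.Perm (Fin n)) (μ : Fin n → I), C g n (μ ∘ σ) = C g n μ)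
include hC

theorem cont_eq (Γ : FGraph n) (Δ : I → I → R) (μ : Fin n → I) :
    Γ.cont C Δ μ = ∑ᶠ a : Fin Γ.nE × Bool → I, (∏ e, Δ (a (e, false)) (a (e, true))) *
      ∏ v, symComp C (Γ.genus v) (Γ.flagIdx a μ v) := by
  unfold cont
  refine finsum_congr fun a => congrArg _ (Finset.prod_congr rfl fun v _ => ?_)
  rw [← map_flagAt]
  exact eq_symComp hC (Fintype.equivFin (Γ.FlagAt v)).symm (fun h => Sum.elim a μ h.1)

/-- The sum over the indices is reparametrised along the bijection of flags. An exchange of the two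
flags of an edge is absorbed by the symmetry of `Δ`. -/
theorem cont_congr {Γ Γ' : FGraph n} (φ : Iso Γ Γ') {Δ : I → I → R} (hΔ : ∀ a b, Δ a b = Δ b a)
    (μ : Fin n → I) : Γ'.cont C Δ μ = Γ.cont C Δ μ := by
  rw [cont_eq hC, cont_eq hC]
  rw [← finsum_comp_equiv (Equiv.arrowCongr φ.flag (Equiv.refl I))]
  refine finsum_congr fun a => ?_
  congr 1
  · refine (Fintype.prod_equiv φ.edge _ _ fun e => ?_).symm
    simp only [Equiv.arrowCongr_apply, Function.comp_apply, Equiv.refl_apply]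
    have hb : ∀ b, φ.flag.symm (φ.edge e, b) = (e, (φ.flag.symm (φ.edge e, b)).2) := fun b => by
      refine Prod.ext ?_ rfl
      have := φ.flag_edge (φ.flag.symm (φ.edge e, b))
      rw [Equiv.apply_symm_apply] at this
      exact (φ.edge.injective this).symm
    have hne : (φ.flag.symm (φ.edge e, false)).2 ≠ (φ.flag.symm (φ.edge e, true)).2 := fun h => by
      have h1 := (hb false).trans ((congrArg (Prod.mk e) h).trans (hb true).symm)
      have h2 := congrArg Prod.snd (φ.flag.symm.injective h1)
      exact Bool.noConfusion h2
    rw [hb false, hb true]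
    cases h1 : (φ.flag.symm (φ.edge e, false)).2 <;>
      cases h2 : (φ.flag.symm (φ.edge e, true)).2 <;> simp_all
  · refine (Fintype.prod_equiv φ.vert _ _ fun v => ?_).symm
    rw [φ.genus_vert]
    congr 1
    unfold flagIdx
    refine Fintype.sum_equiv φ.flags _ _ fun h => ?_
    rw [φ.att_flags]
    simp only [φ.vert.injective.eq_iff]
    rcases h with h | l <;> simp [Iso.flags]

/-- The Feynman sum as a sum over labelled graphs. -/
theorem feynman_apply [Algebra ℂ R] {Δ : I → I → R} (hΔ : ∀ a b, Δ a b = Δ b a) (g : ℕ)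
    (μ : Fin n → I) [Fintype (Admissible g n)] :
    feynman C Δ g n μ = ∑ Γ : Admissible g n,
      ((Γ.1.nV.factorial * Γ.1.nE.factorial * 2 ^ Γ.1.nE : ℂ)⁻¹) • Γ.1.cont C Δ μ := by
  classical
  have : Fintype (IsoClass g n) := Fintype.ofFinite _
  unfold feynman
  rw [finsum_eq_sum_of_fintype, Finsupp.finsetSum_apply,
    ← Finset.sum_fiberwise Finset.univ (fun Γ : Admissible g n => (⟦Γ⟧ : IsoClass g n))]
  refine Finset.sum_congr rfl fun c _ => ?_
  -- All labelled graphs in one isomorphism class contribute equally, so the class contributes its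
  -- size times one term, and `card_fiber` turns this into the inverse order of the automorphism
  -- group.
  have hc : ∀ Γ ∈ Finset.univ.filter (fun Γ : Admissible g n => (⟦Γ⟧ : IsoClass g n) = c),
      ((Γ.1.nV.factorial * Γ.1.nE.factorial * 2 ^ Γ.1.nE : ℂ)⁻¹) • Γ.1.cont C Δ μ =
      ((c.out.1.nV.factorial * c.out.1.nE.factorial * 2 ^ c.out.1.nE : ℂ)⁻¹) •
        c.out.1.cont C Δ μ := by
    intro Γ hΓ
    obtain ⟨φ⟩ : Nonempty (Iso Γ.1 c.out.1) := Quotient.exact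
      ((Finset.mem_filter.1 hΓ).2.trans (Quotient.out_eq c).symm)
    have hV : Γ.1.nV = c.out.1.nV := by simpa using Fintype.card_congr φ.vert
    have hE : Γ.1.nE = c.out.1.nE := by simpa using Fintype.card_congr φ.edge
    rw [cont_congr hC φ hΔ, hV, hE]
  rw [Finset.sum_congr rfl hc, Finset.sum_const, ← Nat.cast_smul_eq_nsmul ℂ, smul_smul]
  change (Nat.card (Iso c.out.1 c.out.1) : ℂ)⁻¹ • c.out.1.cont C Δ μ = _
  congr 1
  have h1 := card_fiber c.out
  rw [Quotient.out_eq] at h1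
  have h2 : (Finset.univ.filter (fun Γ : Admissible g n => (⟦Γ⟧ : IsoClass g n) = c)).card =
      Nat.card {Γ' : Admissible g n // (⟦Γ'⟧ : IsoClass g n) = c} := by
    rw [Nat.card_eq_fintype_card, Fintype.card_subtype]
  rw [h2]
  have h3 : (Nat.card {Γ' : Admissible g n // (⟦Γ'⟧ : IsoClass g n) = c} : ℂ) *
      (Nat.card (Iso c.out.1 c.out.1) : ℂ) =
      c.out.1.nV.factorial * c.out.1.nE.factorial * 2 ^ c.out.1.nE := by exact_mod_cast h1
  rw [← h3]
  have hne : (Nat.card {Γ' : Admissible g n // (⟦Γ'⟧ : IsoClass g n) = c} : ℂ) *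
      (Nat.card (Iso c.out.1 c.out.1) : ℂ) ≠ 0 := by
    rw [h3]
    exact mul_ne_zero (mul_ne_zero (by exact_mod_cast Nat.factorial_ne_zero _)
      (by exact_mod_cast Nat.factorial_ne_zero _)) (pow_ne_zero _ two_ne_zero)
  have := left_ne_zero_of_mul hne
  have := right_ne_zero_of_mul hne
  field_simp

end Contractions

end FGraph

/-- The coefficient of order `g` distributes the genus over `k` loops and the vertices. No vertex
genus exceeds `g`, so any `B > g` gives enough decorations. -/
theorem coeff_X_pow_mul_prod {R ι : Type} [CommRing R] [Fintype ι] [DecidableEq ι] (c : ι → ℕ → R)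
    {g k B : ℕ} (hB : g < B) :
    PowerSeries.coeff g (PowerSeries.X ^ k * ∏ v, PowerSeries.mk (c v)) =
      ∑ γ : ι → Fin B, if k + ∑ v, (γ v : ℕ) = g then ∏ v, c v (γ v) else 0 := by
  rw [PowerSeries.coeff_X_pow_mul', ← Finset.sum_filter]
  split_ifs with h
  · rw [PowerSeries.coeff_prod]
    simp only [PowerSeries.coeff_mk]
    refine Finset.sum_bij' (fun l hl v => ⟨l v, ?_⟩)
      (fun γ _ => Finsupp.equivFunOnFinite.symm fun v => (γ v : ℕ)) ?_ ?_ ?_ ?_ ?_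
    · have h1 : ∑ v, l v = g - k := (Finset.mem_finsuppAntidiag.1 hl).1
      have h2 : l v ≤ ∑ v, l v := Finset.single_le_sum (fun _ _ => Nat.zero_le _) (Finset.mem_univ v)
      omega
    · intro l hl
      have h1 : ∑ v, l v = g - k := (Finset.mem_finsuppAntidiag.1 hl).1
      simp only [Finset.mem_filter, Finset.mem_univ, true_and]
      omega
    · intro γ hγ
      simp only [Finset.mem_filter, Finset.mem_univ, true_and] at hγ
      rw [Finset.mem_finsuppAntidiag]
      refine ⟨?_, Finset.subset_univ _⟩
      simp only [Finsupp.equivFunOnFinite_symm_apply_apply]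
      omega
    · intro l _
      ext v
      simp
    · intro γ _
      funext v
      simp
    · intro l _
      simp
  · symm
    refine Finset.sum_eq_zero fun γ hγ => ?_
    simp only [Finset.mem_filter, Finset.mem_univ, true_and] at hγ
    omega

/-! ### The Feynman rule as a sum over the number of edges. -/

namespace FGraph

open Wick

variable {n : ℕ}

/-- The data of a graph, with bounds on the numbers of edges and vertices and on the genera. -/
abbrev Code (n M B : ℕ) : Type :=
  Σ E : Fin M, Σ V : Fin ((E : ℕ) + 2),
    (Fin n → Fin V) × (Fin E → Fin V × Fin V) × (Fin V → Fin B)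

/-- The graph with given data. -/
def ofCode {M B : ℕ} (x : Code n M B) : FGraph n where
  nV := x.2.1
  nE := x.1
  edgeFlag h := if h.2 then (x.2.2.2.1 h.1).2 else (x.2.2.2.1 h.1).1
  leg := x.2.2.1
  genus v := x.2.2.2.2 v

theorem nV_lt {Γ : FGraph n} (h : Γ.IsConnected) : Γ.nV < Γ.nE + 2 := by
  have := ((isConnected_iff Γ).1 h).card_le
  simp only [Fintype.card_fin] at this
  omega

/-- The data of an admissible graph. -/
def code {g M B : ℕ} (hM : 3 * g + n + 1 ≤ M) (hB : 3 * g + n + 1 ≤ B) (Γ : Admissible g n) :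
    Code n M B :=
  ⟨⟨Γ.1.nE, (bounds Γ.1 Γ.2.2.1 Γ.2.2.2).2.1.trans_le hM⟩, ⟨Γ.1.nV, nV_lt Γ.2.1⟩,
    Γ.1.leg, Γ.1.ends, fun v => ⟨Γ.1.genus v, ((bounds Γ.1 Γ.2.2.1 Γ.2.2.2).2.2 v).trans_le hB⟩⟩

theorem ofCode_code {g M B : ℕ} (hM : 3 * g + n + 1 ≤ M) (hB : 3 * g + n + 1 ≤ B)
    (Γ : Admissible g n) : ofCode (code hM hB Γ) = Γ.1 := by
  obtain ⟨⟨V, E, f, l, γ⟩, h⟩ := Γ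
  unfold ofCode code
  congr 1
  funext ⟨e, b⟩
  cases b <;> rfl

theorem code_injective {g M B : ℕ} (hM : 3 * g + n + 1 ≤ M) (hB : 3 * g + n + 1 ≤ B) :
    Function.Injective (code (n := n) hM hB) := fun Γ Γ' h =>
  Subtype.ext ((ofCode_code hM hB Γ).symm.trans ((congrArg ofCode h).trans (ofCode_code hM hB Γ')))

theorem code_ofCode {g M B : ℕ} (hM : 3 * g + n + 1 ≤ M) (hB : 3 * g + n + 1 ≤ B) (x : Code n M B)
    (h : (ofCode x).IsConnected ∧ (ofCode x).IsStable ∧ (ofCode x).HasGenus g) :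
    code hM hB ⟨ofCode x, h⟩ = x := rfl

/-- Under the vertex bound the truncated subtraction is the first Betti number, so the genus
condition can be read as a degree in the formal variable counting loops. -/
theorem hasGenus_iff {Γ : FGraph n} (h : Γ.nV < Γ.nE + 2) (g : ℕ) :
    Γ.HasGenus g ↔ (Γ.nE + 1 - Γ.nV) + ∑ v, Γ.genus v = g := by
  unfold HasGenus
  rw [← Nat.cast_sum]
  omega

section

variable {I J R : Type} [CommRing R] {C : ℕ → ∀ m : ℕ, (Fin m → I) →₀ R}

theorem symComp_eq_zero (h0 : ∀ g n, 2 * g + n ≤ 2 → C g n = 0) {g : ℕ} {m : Multiset I}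
    (h : 2 * g + m.card ≤ 2) : symComp C g m = 0 := by
  unfold symComp
  rw [h0 _ _ (by simpa using h)]
  rfl

theorem card_flagIdx (Γ : FGraph n) (a : Fin Γ.nE × Bool → I) (μ : Fin n → I) (v : Fin Γ.nV) :
    (Γ.flagIdx a μ v).card = Fintype.card (Γ.FlagAt v) := by
  rw [← map_flagAt]
  simp

/-- The indices on the flags of the edges, from pairs of indices on the edges. -/
def flagIndices {Γ : FGraph n} (ι : J → I) (a : Fin Γ.nE → J × J) : Fin Γ.nE × Bool → I :=
  fun h => ι (if h.2 then (a h.1).2 else (a h.1).1)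

theorem flagIndices_injective {Γ : FGraph n} {ι : J → I} (hι : Function.Injective ι) :
    Function.Injective (flagIndices (Γ := Γ) ι) := by
  intro a b h
  funext e
  exact Prod.ext (hι (congrFun h (e, false))) (hι (congrFun h (e, true)))

theorem flagIdx_flagIndices (Γ : FGraph n) (ι : J → I) (a : Fin Γ.nE → J × J) (μ : Fin n → J)
    (v : Fin Γ.nV) : Γ.flagIdx (flagIndices ι a) (ι ∘ μ) v =
      (edgeIdx Γ.ends a v + legIdx Γ.leg μ v).map ι := by
  unfold flagIdx edgeIdx legIdx
  have h : ∀ (p : Prop) [Decidable p] (j : J),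
      (if p then ({ι j} : Multiset I) else 0) = Multiset.mapAddMonoidHom ι (if p then {j} else 0) := by
    intro p _ j
    split_ifs <;> simp
  change _ = Multiset.mapAddMonoidHom ι _
  rw [map_add, map_sum, map_sum, Fintype.sum_sum_type, Fintype.sum_prod_type]
  congr 1
  · refine Finset.sum_congr rfl fun e _ => ?_
    rw [map_add, ← h, ← h, Fintype.sum_bool, add_comm]
    rfl
  · refine Finset.sum_congr rfl fun e _ => ?_
    rw [← h]
    rfl

theorem card_flagAt_le (Γ : FGraph n) (v : Fin Γ.nV) :
    Fintype.card (Γ.FlagAt v) ≤ 2 * Γ.nE + n := by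
  refine (Fintype.card_subtype_le _).trans ?_
  simp [mul_comm]

variable (hC : ∀ (g n : ℕ) (σ : Equiv.Perm (Fin n)) (μ : Fin n → I), C g n (μ ∘ σ) = C g n μ)
  (h0 : ∀ g n, 2 * g + n ≤ 2 → C g n = 0) {ι : J → I} (hι : Function.Injective ι)

-- Every flag of an edge sits at some vertex, whose tensor vanishes unless the index of the flag
-- lies in the range of `ι`. So the index sum, a priori infinite, is a finite sum over pairs in `J`.
include hC hι in
theorem cont_restrict [Fintype J] (Γ : FGraph n) (Δ : I → I → R) (μ : Fin n → J)
    (hJ : ∀ v x, C (Γ.genus v) (Fintype.card (Γ.FlagAt v)) x ≠ 0 → ∀ i, x i ∈ Set.range ι) :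
    Γ.cont C Δ (ι ∘ μ) = ∑ a : Fin Γ.nE → J × J, (∏ e, Δ (ι (a e).1) (ι (a e).2)) *
      ∏ v, symComp C (Γ.genus v) ((edgeIdx Γ.ends a v + legIdx Γ.leg μ v).map ι) := by
  classical
  rw [cont_eq hC]
  have hterm : ∀ a : Fin Γ.nE × Bool → I, (∏ e, Δ (a (e, false)) (a (e, true))) *
      ∏ v, symComp C (Γ.genus v) (Γ.flagIdx a (ι ∘ μ) v) ≠ 0 →
      a ∈ (Finset.univ.image (flagIndices (Γ := Γ) ι) : Finset _) := by
    intro a ha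
    have h1 : ∀ h, a h ∈ Set.range ι := by
      intro h
      have h2 : symComp C (Γ.genus (Γ.att (Sum.inl h))) (Γ.flagIdx a (ι ∘ μ) (Γ.att (Sum.inl h))) ≠ 0 :=
        fun hz => right_ne_zero_of_mul ha (Finset.prod_eq_zero (Finset.mem_univ _) hz)
      rw [← map_flagAt, ← eq_symComp hC (Fintype.equivFin (Γ.FlagAt _)).symm] at h2
      have := hJ _ _ h2 (Fintype.equivFin _ ⟨Sum.inl h, rfl⟩)
      simpa using this
    choose j hj using h1
    refine Finset.mem_image.2 ⟨fun e => (j (e, false), j (e, true)), Finset.mem_univ _, ?_⟩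
    funext ⟨e, b⟩
    rw [← hj]
    cases b <;> rfl
  rw [finsum_eq_sum_of_support_subset _ (fun a ha => Finset.mem_coe.2 (hterm a ha)),
    Finset.sum_image (flagIndices_injective hι).injOn]
  simp only [flagIdx_flagIndices]
  rfl

theorem cont_eq_zero (Γ : FGraph n) (Δ : I → I → R) (μ : Fin n → I) (i : Fin n)
    (hJ : ∀ v x, C (Γ.genus v) (Fintype.card (Γ.FlagAt v)) x ≠ 0 → ∀ i, x i ∈ Set.range ι)
    (hi : μ i ∉ Set.range ι) : Γ.cont C Δ μ = 0 := by
  unfold cont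
  rw [finsum_congr (g := fun _ => 0), finsum_zero]
  intro a
  refine mul_eq_zero_of_right _ (Finset.prod_eq_zero (Finset.mem_univ (Γ.att (Sum.inr i))) ?_)
  by_contra h
  have := hJ _ _ h (Fintype.equivFin _ ⟨Sum.inr i, rfl⟩)
  simp only [Equiv.symm_apply_apply, Sum.elim_inr] at this
  exact hi this

-- The index of a leg is an index of the tensor at its vertex. The bound `B` exceeds all vertex
-- genera and valences which occur: an admissible graph has at most `3 * g + n` edges, hence at most
-- `6 * g + 3 * n` flags at a vertex.
include hC in
theorem feynman_eq_zero [Algebra ℂ R] {Δ : I → I → R} (hΔ : ∀ a b, Δ a b = Δ b a) {g B : ℕ}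
    (hB : 6 * g + 3 * n + 1 ≤ B)
    (hJ : ∀ g' < B, ∀ m < B, ∀ x, C g' m x ≠ 0 → ∀ i, x i ∈ Set.range ι)
    (μ : Fin n → I) (i : Fin n) (hi : μ i ∉ Set.range ι) : feynman C Δ g n μ = 0 := by
  have : Fintype (Admissible g n) := Fintype.ofFinite _
  rw [feynman_apply hC hΔ]
  refine Finset.sum_eq_zero fun Γ _ => ?_
  have hb := bounds Γ.1 Γ.2.2.1 Γ.2.2.2
  rw [cont_eq_zero (ι := ι) _ _ _ i _ hi, smul_zero]
  intro v x
  have h1 := card_flagAt_le Γ.1 v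
  exact hJ _ (by have := hb.2.2 v; omega) _ (by omega) x

include hC h0 hι in
/-- The Feynman sum in terms of the sums over the connected graphs with a given number of edges. -/
theorem feynman_eq_edgeSum [Algebra ℂ R] [Fintype J] {Δ : I → I → R} (hΔ : ∀ a b, Δ a b = Δ b a)
    {g M B : ℕ} (hM : 3 * g + n + 1 ≤ M) (hB : 6 * g + 3 * n + 1 ≤ B)
    (hJ : ∀ g' < B, ∀ m < B, ∀ x, C g' m x ≠ 0 → ∀ i, x i ∈ Set.range ι)
    (μ : Fin n → J) :
    feynman C Δ g n (ι ∘ μ) = ∑ E ∈ Finset.range M, PowerSeries.coeff g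
      (edgeSum PowerSeries.X (fun m => PowerSeries.mk fun g => symComp C g (m.map ι))
        (fun a b => PowerSeries.C (Δ (ι a) (ι b))) E (Finset.univ.val.map μ)) := by
  classical
  have : Fintype (Admissible g n) := Fintype.ofFinite _
  rw [feynman_apply hC hΔ]
  let G : Code n M B → R := fun x =>
    if (ofCode x).IsConnected ∧ (ofCode x).HasGenus g then
      (((ofCode x).nV.factorial * (ofCode x).nE.factorial * 2 ^ (ofCode x).nE : ℂ)⁻¹) •
      ∑ a : Fin (ofCode x).nE → J × J, (∏ e, Δ (ι (a e).1) (ι (a e).2)) *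
      ∏ v, symComp C ((ofCode x).genus v)
        ((edgeIdx (ofCode x).ends a v + legIdx (ofCode x).leg μ v).map ι) else 0
  have hB' : 3 * g + n + 1 ≤ B := by omega
  have hL : ∑ Γ : Admissible g n, ((Γ.1.nV.factorial * Γ.1.nE.factorial * 2 ^ Γ.1.nE : ℂ)⁻¹) •
      Γ.1.cont C Δ (ι ∘ μ) = ∑ x, G x := by
    refine Fintype.sum_of_injective (code hM hB') (code_injective hM hB') _ _ ?_ ?_
    · intro x hx
      by_cases h : (ofCode x).IsConnected ∧ (ofCode x).HasGenus g
      -- A connected graph of genus `g` outside the image of `code` is unstable. At an offending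
      -- vertex it carries an unstable correlation function, which is zero by convention, so
      -- stability need not be imposed.
      · have hs : ¬ (ofCode x).IsStable := fun hs =>
          hx ⟨⟨ofCode x, h.1, hs, h.2⟩, code_ofCode hM hB' x ⟨h.1, hs, h.2⟩⟩
        unfold IsStable at hs
        push Not at hs
        obtain ⟨v, hv⟩ := hs
        simp only [G, if_pos h]
        rw [Finset.sum_eq_zero, smul_zero]
        intro a _
        refine mul_eq_zero_of_right _ (Finset.prod_eq_zero (Finset.mem_univ v) ?_)
        rw [← flagIdx_flagIndices]
        refine symComp_eq_zero h0 ?_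
        rw [card_flagIdx]
        exact hv
      · exact if_neg h
    · intro Γ
      have hb := bounds Γ.1 Γ.2.2.1 Γ.2.2.2
      rw [cont_restrict hC hι]
      · simp only [G]
        rw [ofCode_code, if_pos ⟨Γ.2.1, Γ.2.2.2⟩]
      · intro v x
        have h1 := card_flagAt_le Γ.1 v
        exact hJ _ (by have := hb.2.2 v; omega) _ (by omega) x
  rw [hL, Fintype.sum_sigma, ← Fin.sum_univ_eq_sum_range (fun E => PowerSeries.coeff g
      (edgeSum PowerSeries.X (fun m => PowerSeries.mk fun g => symComp C g (m.map ι))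
        (fun a b => PowerSeries.C (Δ (ι a) (ι b))) E (Finset.univ.val.map μ)))]
  refine Finset.sum_congr rfl fun E _ => ?_
  rw [Fintype.sum_sigma, edgeSum, Hz.sum_apply, map_sum, ← Fin.sum_univ_eq_sum_range (fun V =>
    PowerSeries.coeff g (graphSum PowerSeries.X
      (fun m => PowerSeries.mk fun g => symComp C g (m.map ι))
        (fun a b => PowerSeries.C (Δ (ι a) (ι b))) V E (Finset.univ.val.map μ)))]
  refine Finset.sum_congr rfl fun V _ => ?_
  rw [graphSum, Hz.const_mul_apply, ← legSum_eq_labSum (V := Fin V) (E := Fin E) _ _ μ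
    (Fintype.card_fin _) (Fintype.card_fin _), Fintype.sum_prod_type, mul_assoc,
    ← Algebra.smul_def, PowerSeries.coeff_smul, legSum, Finset.mul_sum, map_sum, Finset.smul_sum]
  refine Finset.sum_congr rfl fun l _ => ?_
  rw [Fintype.sum_prod_type, connSum, Finset.mul_sum, map_sum, Finset.smul_sum]
  refine Finset.sum_congr rfl fun f _ => ?_
  -- With edges and legs fixed only the vertex genera vary. Their sum, restricted by the genus
  -- condition, is the coefficient of order `g` of a product of power series.
  have hcode : ∀ γ : Fin V → Fin B, G ⟨E, V, l, f, γ⟩ = if IsConn f then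
      (((V : ℕ).factorial * (E : ℕ).factorial * 2 ^ (E : ℕ) : ℂ)⁻¹) •
        ∑ a : Fin E → J × J, (∏ e, Δ (ι (a e).1) (ι (a e).2)) *
        if (E + 1 - V : ℕ) + ∑ v, (γ v : ℕ) = g then
          ∏ v, symComp C (γ v) ((edgeIdx f a v + legIdx l μ v).map ι) else 0 else 0 := by
    intro γ
    have h1 := hasGenus_iff (Γ := ofCode (⟨E, V, l, f, γ⟩ : Code n M B)) V.2 g
    have h2 := isConnected_iff (ofCode (⟨E, V, l, f, γ⟩ : Code n M B))
    change _ ↔ (E + 1 - V : ℕ) + ∑ v, (γ v : ℕ) = g at h1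
    change _ ↔ IsConn f at h2
    simp only [G, h1, h2]
    by_cases hc : IsConn f
    · by_cases hg : (E + 1 - V : ℕ) + ∑ v, (γ v : ℕ) = g
      · rw [if_pos ⟨hc, hg⟩, if_pos hc]
        simp only [if_pos hg]
        rfl
      · rw [if_neg (fun h => hg h.2), if_pos hc]
        simp only [if_neg hg, mul_zero, Finset.sum_const_zero, smul_zero]
    · rw [if_neg (fun h => hc h.1), if_neg hc]
  simp only [hcode]
  by_cases hc : IsConn f
  · simp only [if_pos hc]
    rw [← Finset.smul_sum, Finset.sum_comm]
    congr 1
    rw [graphWeight, Finset.mul_sum, map_sum]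
    refine Finset.sum_congr rfl fun a _ => ?_
    rw [← Finset.mul_sum, ← map_prod, mul_left_comm, PowerSeries.coeff_C_mul,
      coeff_X_pow_mul_prod _ (by omega : g < B)]
  · simp only [if_neg hc, Finset.sum_const_zero, mul_zero, map_zero, smul_zero]

end

end FGraph

namespace Laurent

open HahnSeries

variable {N : ℕ} {A : Type} [CommRing A]

/-! ### Operations on Laurent series -/

theorem coeff_mul_of_subset {f g : LaurentSeries A} {s t : Set ℤ} (hs : s.IsPWO) (ht : t.IsPWO)
    (hfs : f.support ⊆ s) (hgt : g.support ⊆ t) (a : ℤ) :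
    (f * g).coeff a = ∑ ij ∈ Finset.antidiagonal hs ht a, f.coeff ij.1 * g.coeff ij.2 := by
  rw [coeff_mul_left' hs hfs]
  refine Finset.sum_subset (fun x hx => ?_) (fun x hx hx' => ?_)
  · simp only [Finset.mem_antidiagonal] at hx ⊢
    exact ⟨hx.1, hgt hx.2.1, hx.2.2⟩
  · simp only [Finset.mem_antidiagonal, not_and] at hx hx'
    by_cases h : g.coeff x.2 = 0
    · rw [h, mul_zero]
    · exact absurd hx.2.2 (hx' hx.1 h)

theorem map_mul_derivation [Algebra ℂ A] (D : Derivation ℂ A A) (f g : LaurentSeries A) :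
    (f * g).map D = f.map D * g + f * g.map D := by
  have hf : (f.map D).support ⊆ f.support := fun n hn h => hn (by simp [h])
  have hg : (g.map D).support ⊆ g.support := fun n hn h => hn (by simp [h])
  ext a
  rw [map_coeff, coeff_add', Pi.add_apply, coeff_mul_of_subset f.isPWO_support g.isPWO_support hf le_rfl,
    coeff_mul_of_subset f.isPWO_support g.isPWO_support le_rfl hg, coeff_mul, map_sum,
    ← Finset.sum_add_distrib]
  refine Finset.sum_congr rfl fun x _ => ?_
  rw [D.leibniz, map_coeff, map_coeff]
  simp only [smul_eq_mul]
  ring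

theorem map_add_derivation [Algebra ℂ A] (D : Derivation ℂ A A) (f g : LaurentSeries A) :
    (f + g).map D = f.map D + g.map D := by
  ext a
  simp

theorem map_sum_derivation [Algebra ℂ A] {ι : Type} (D : Derivation ℂ A A) (s : Finset ι)
    (f : ι → LaurentSeries A) : (∑ i ∈ s, f i).map D = ∑ i ∈ s, (f i).map D := by
  ext a
  simp [coeff_sum]

/-- `f(z) ↦ f(-z)` as a ring homomorphism. -/
def negZHom : LaurentSeries A →+* LaurentSeries A where
  toFun := negZ
  map_zero' := by ext; simp [negZ]
  map_add' f g := by ext; simp [negZ, smul_add]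
  map_one' := by
    ext n
    by_cases h : n = 0 <;> simp [negZ, coeff_one, h]
  map_mul' f g := by
    have hs : ∀ f : LaurentSeries A, (negZ f).support ⊆ f.support := fun f n hn h =>
      hn (by simp [negZ, h])
    ext a
    rw [coeff_mul_of_subset f.isPWO_support g.isPWO_support (hs f) (hs g)]
    simp only [negZ]
    rw [coeff_mul, Finset.smul_sum]
    refine Finset.sum_congr rfl fun x hx => ?_
    rw [← (Finset.mem_antidiagonal.1 hx).2.2, Int.negOnePow_add, Units.val_mul, mul_smul,
      _root_.smul_mul_assoc, _root_.mul_smul_comm, smul_comm]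

theorem negZHom_apply (f : LaurentSeries A) : negZHom f = negZ f := rfl

theorem negZ_coeff (f : LaurentSeries A) (n : ℤ) :
    (negZ f).coeff n = (n.negOnePow : ℤ) • f.coeff n := rfl

theorem negZ_negZ (f : LaurentSeries A) : negZ (negZ f) = f := by
  ext n
  rw [negZ_coeff, negZ_coeff, smul_smul, ← Units.val_mul, Int.units_mul_self, Units.val_one, one_smul]

theorem negZ_map {B F : Type} [CommRing B] [FunLike F A B] [AddMonoidHomClass F A B] (D : F)
    (f : LaurentSeries A) : (negZ f).map D = negZ (f.map D) := by
  ext n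
  rw [map_coeff, negZ_coeff, negZ_coeff, map_coeff, map_zsmul]

theorem negZ_smul (c : A) (f : LaurentSeries A) : negZ (c • f) = c • negZ f := by
  ext n
  rw [negZ_coeff, coeff_smul, coeff_smul, negZ_coeff, smul_comm]

theorem smul_mul (c : A) (f g : LaurentSeries A) : c • f * g = c • (f * g) := by
  rw [← C_mul_eq_smul, ← C_mul_eq_smul, mul_assoc]

theorem mul_smul (c : A) (f g : LaurentSeries A) : f * c • g = c • (f * g) := by
  rw [← C_mul_eq_smul, ← C_mul_eq_smul, mul_left_comm]

theorem zPow_mul_coeff (m : ℤ) (f : LaurentSeries A) (n : ℤ) :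
    (zPow m * f).coeff n = f.coeff (n - m) := by
  rw [zPow, coeff_single_mul, one_mul]

theorem mul_zPow_coeff (m : ℤ) (f : LaurentSeries A) (n : ℤ) :
    (f * zPow m).coeff n = f.coeff (n - m) := by
  rw [zPow, coeff_mul_single, mul_one]

theorem zPow_mul_zPow (m n : ℤ) : (zPow m * zPow n : LaurentSeries A) = zPow (m + n) := by
  rw [zPow, zPow, single_mul_single, mul_one]
  rfl

theorem zPow_zero : (zPow 0 : LaurentSeries A) = 1 := rfl

theorem negZ_zPow (m : ℤ) : negZ (zPow m : LaurentSeries A) = (m.negOnePow : ℤ) • zPow m := by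
  ext n
  rw [negZ_coeff, coeff_smul, zPow]
  by_cases h : n = m
  · rw [h]
  · rw [coeff_single_of_ne h, smul_zero, smul_zero]

theorem coeff_ofPowerSeries (f : PowerSeries A) (n : ℤ) :
    (ofPowerSeries ℤ A f).coeff n = if n < 0 then 0 else PowerSeries.coeff n.toNat f := by
  rw [PowerSeries.coeff_coe]
  split_ifs with h
  · rfl
  · rw [show n.natAbs = n.toNat by omega]

theorem ofPowerSeries_of_neg (f : PowerSeries A) {n : ℤ} (hn : n < 0) :
    (ofPowerSeries ℤ A f).coeff n = 0 := by rw [coeff_ofPowerSeries, if_pos hn]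

theorem ofPowerSeries_coeff_zero (f : PowerSeries A) :
    (ofPowerSeries ℤ A f).coeff 0 = PowerSeries.constantCoeff f := by
  rw [coeff_ofPowerSeries, if_neg (by omega), Int.toNat_zero, PowerSeries.coeff_zero_eq_constantCoeff_apply]

theorem exists_ofPowerSeries {f : LaurentSeries A} (h : ∀ n < 0, f.coeff n = 0) :
    ∃ p, f = ofPowerSeries ℤ A p := by
  refine ⟨PowerSeries.mk fun n => f.coeff n, ?_⟩
  ext n
  rw [coeff_ofPowerSeries]
  split_ifs with hn
  · exact h n hn
  · rw [PowerSeries.coeff_mk, Int.toNat_of_nonneg (by omega)]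

theorem negZ_ofPowerSeries (p : PowerSeries A) :
    negZ (ofPowerSeries ℤ A p) = ofPowerSeries ℤ A (PowerSeries.evalNegHom p) := by
  ext n
  rw [negZ_coeff, coeff_ofPowerSeries, coeff_ofPowerSeries]
  split_ifs with h
  · exact smul_zero _
  · lift n to ℕ using (by omega)
    rw [PowerSeries.evalNegHom, PowerSeries.coeff_rescale, Int.toNat_natCast]
    rcases Nat.even_or_odd n with hn | hn
    · rw [hn.neg_one_pow, Int.negOnePow_even _ (by exact_mod_cast hn), Units.val_one, one_smul, one_mul]
    · rw [hn.neg_one_pow, Int.negOnePow_odd _ (by exact_mod_cast hn), Units.val_neg, Units.val_one,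
        neg_smul, one_smul, neg_mul, one_mul]

theorem map_ofPowerSeries {B F : Type} [CommRing B] [FunLike F A B] [AddMonoidHomClass F A B] (D : F)
    (p : PowerSeries A) : (ofPowerSeries ℤ A p).map D =
      ofPowerSeries ℤ B (PowerSeries.mk fun n => D (PowerSeries.coeff n p)) := by
  ext n
  rw [map_coeff, coeff_ofPowerSeries, coeff_ofPowerSeries, PowerSeries.coeff_mk]
  split_ifs <;> simp

theorem exists_bound (s : LVec N A) : ∃ m : ℤ, ∀ n < m, ∀ j, (s j).coeff n = 0 := by
  refine ⟨-∑ j, |(s j).order|, fun n hn j => coeff_eq_zero_of_lt_order ?_⟩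
  have h1 := Finset.single_le_sum (f := fun j => |(s j).order|) (fun _ _ => abs_nonneg _)
    (Finset.mem_univ j)
  have h2 := neg_abs_le (s j).order
  omega

theorem coeff_mul_eq_finsum (f g : LaurentSeries A) (a : ℤ) :
    (f * g).coeff a = ∑ᶠ n, f.coeff (a - n) * g.coeff n := by
  rw [coeff_mul, finsum_eq_sum_of_support_subset (s :=
    (Finset.antidiagonal f.isPWO_support g.isPWO_support a).image Prod.snd), Finset.sum_image]
  · refine Finset.sum_congr rfl fun x hx => ?_
    rw [← (Finset.mem_antidiagonal.1 hx).2.2, add_sub_cancel_right]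
  · intro x hx y hy h
    have h1 := (Finset.mem_antidiagonal.1 hx).2.2
    have h2 := (Finset.mem_antidiagonal.1 hy).2.2
    have h' : x.2 = y.2 := h
    exact Prod.ext (by omega) h'
  · intro n hn
    refine Finset.mem_coe.2 (Finset.mem_image.2 ⟨(a - n, n), ?_, rfl⟩)
    exact Finset.mem_antidiagonal.2 ⟨left_ne_zero_of_mul hn, right_ne_zero_of_mul hn, by simp⟩

/-! ### The pairing -/

/-- The row vector `(-)^* b · G`. -/
def row (G : PMat N A) (b : LVec N A) (j : Fin (N + 1)) : LaurentSeries A :=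
  ∑ i, negZ (b i) * ofPowerSeries ℤ A (G i j)

variable (G : PMat N A)

theorem pairing_eq (b s : LVec N A) : pairing G b s = ∑ j, row G b j * s j := by
  unfold pairing row
  rw [Finset.sum_comm]
  exact Finset.sum_congr rfl fun j _ => (Finset.sum_mul _ _ _).symm

theorem Om_eq (b s : LVec N A) : Om G b s = ∑ j, (row G b j * s j).coeff (-1) := by
  rw [Om, pairing_eq, coeff_sum]

theorem row_frame_mul (b : LVec N A) (j : Fin (N + 1)) (n : ℤ) :
    ∑ k, row G b k * frame (A := A) j n k = row G b j * zPow n := by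
  rw [Finset.sum_eq_single j]
  · rw [frame, Pi.single_eq_same]
  · intro k _ hk
    rw [frame, Pi.single_eq_of_ne hk, mul_zero]
  · simp

/-- The residue against `e_j z^n` reads the coefficient of degree -1 - n of the covector. The
functional thus lists the coefficients of `row G b` backwards. -/
theorem flat_apply (b : LVec N A) (m : ℤ × Fin (N + 1)) :
    flat G b m = (row G b m.2).coeff (-1 - m.1) := by
  rw [flat, Om, pairing_eq, row_frame_mul, mul_zPow_coeff]

theorem row_add (b b' : LVec N A) : row G (b + b') = row G b + row G b' := by
  funext j
  simp only [row, Pi.add_apply, ← negZHom_apply, map_add, add_mul, Finset.sum_add_distrib]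

theorem row_smul (c : A) (b : LVec N A) : row G (c • b) = c • row G b := by
  funext j
  simp only [row, Pi.smul_apply, negZ_smul, Finset.smul_sum, smul_mul]

/-- The symplectic form as a bilinear form. -/
def OmHom : LVec N A →ₗ[A] LVec N A →ₗ[A] A :=
  LinearMap.mk₂ A (Om G)
    (fun b b' s => by
      simp only [Om_eq, row_add, Pi.add_apply, add_mul, coeff_add', Finset.sum_add_distrib])
    (fun c b s => by
      simp only [Om_eq, row_smul, Pi.smul_apply, smul_mul, coeff_smul, Finset.smul_sum])
    (fun b s s' => by
      simp only [Om_eq, Pi.add_apply, mul_add, coeff_add', Finset.sum_add_distrib])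
    (fun c b s => by
      simp only [Om_eq, Pi.smul_apply, mul_smul, coeff_smul, Finset.smul_sum])

theorem OmHom_apply (b s : LVec N A) : OmHom G b s = Om G b s := rfl

theorem evalDual_finite_support {ψ : ℤ × Fin (N + 1) → A} {s : LVec N A}
    (hψ : ∃ m : ℤ, ∀ n > m, ∀ j, ψ (n, j) = 0) :
    (Function.support fun m : ℤ × Fin (N + 1) => ψ m * (s m.2).coeff m.1).Finite := by
  obtain ⟨m, hm⟩ := hψ
  obtain ⟨l, hl⟩ := exists_bound s
  refine ((Set.finite_Icc l m).prod (Set.finite_univ (α := Fin (N + 1)))).subset ?_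
  rintro ⟨n, j⟩ hn
  refine ⟨⟨?_, ?_⟩, Set.mem_univ _⟩
  · by_contra h
    exact right_ne_zero_of_mul hn (hl n (by simpa using h) j)
  · by_contra h
    exact left_ne_zero_of_mul hn (hm n (by simpa using h) j)

theorem flat_bounded (b : LVec N A) : ∃ m : ℤ, ∀ n > m, ∀ j, flat G b (n, j) = 0 := by
  obtain ⟨l, hl⟩ := exists_bound (row G b)
  refine ⟨-1 - l, fun n hn j => ?_⟩
  rw [flat_apply]
  exact hl _ (by simp only; omega) j

theorem evalDual_flat (b s : LVec N A) : evalDual (flat G b) s = Om G b s := by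
  have hfin := evalDual_finite_support (s := s) (flat_bounded G b)
  have h1 : Om G b s = ∑ᶠ j, ∑ᶠ n, flat G b (n, j) * (s j).coeff n := by
    rw [Om_eq, finsum_eq_sum_of_fintype]
    refine Finset.sum_congr rfl fun j _ => ?_
    rw [coeff_mul_eq_finsum]
    simp only [flat_apply]
  rw [h1, evalDual, ← finsum_comp_equiv (Equiv.prodComm _ _), finsum_curry]
  · rfl
  · refine (hfin.preimage (Equiv.prodComm _ _).injective.injOn).subset ?_
    intro x hx
    exact hx

theorem pairing_hol {h h' : LVec N A} (hh : h ∈ holPart) (hh' : h' ∈ holPart) :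
    ∃ p, pairing G h h' = ofPowerSeries ℤ A p := by
  choose p hp using fun j => exists_ofPowerSeries (hh j)
  choose p' hp' using fun j => exists_ofPowerSeries (hh' j)
  refine ⟨∑ i, ∑ j, PowerSeries.evalNegHom (p i) * G i j * p' j, ?_⟩
  simp only [pairing, hp, hp', negZ_ofPowerSeries, map_sum, map_mul]

/-- F is isotropic, as a power series has no residue. -/
theorem Om_hol {h h' : LVec N A} (hh : h ∈ holPart) (hh' : h' ∈ holPart) : Om G h h' = 0 := by
  obtain ⟨p, hp⟩ := pairing_hol G hh hh'
  rw [Om, hp, ofPowerSeries_of_neg _ (by omega)]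

theorem frame_mem_holPart (j : Fin (N + 1)) {n : ℤ} (hn : 0 ≤ n) :
    (frame j n : LVec N A) ∈ holPart := by
  intro i m hm
  by_cases h : i = j
  · rw [h, frame, Pi.single_eq_same, zPow, coeff_single_of_ne (by omega)]
  · rw [frame, Pi.single_eq_of_ne h, coeff_zero]

section Nondegenerate

variable {G} (hG : IsUnit (G.map PowerSeries.constantCoeff).det)
include hG

theorem isUnit_of_constantCoeff : IsUnit G := by
  rw [Matrix.isUnit_iff_isUnit_det, PowerSeries.isUnit_iff_constantCoeff]
  rwa [RingHom.map_det]

/-- Non-degeneracy at z = 0 makes the Gram matrix invertible over power series, and `H` is its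
inverse. -/
theorem exists_inverse : ∃ H : PMat N A, ∀ b : LVec N A, ∀ i,
    b i = negZ (∑ j, row G b j * ofPowerSeries ℤ A (H j i)) := by
  obtain ⟨u, hu⟩ := isUnit_of_constantCoeff hG
  refine ⟨(u⁻¹ : (PMat N A)ˣ).1, fun b i => ?_⟩
  have hGH : G * (u⁻¹ : (PMat N A)ˣ).1 = 1 := by rw [← hu, Units.mul_inv]
  rw [← negZ_negZ (b i)]
  congr 1
  simp only [row, Finset.sum_mul]
  rw [Finset.sum_comm]
  simp only [mul_assoc, ← map_mul, ← Finset.mul_sum, ← map_sum, ← Matrix.mul_apply, hGH]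
  rw [Finset.sum_eq_single i]
  · rw [Matrix.one_apply_eq, map_one, mul_one]
  · intro k _ hk
    rw [Matrix.one_apply_ne hk, map_zero, mul_zero]
  · simp

theorem flat_injective : Function.Injective (flat G) := by
  intro b b' h
  obtain ⟨H, hH⟩ := exists_inverse hG
  have : row G b = row G b' := by
    funext j
    ext n
    have := congrFun h (-1 - n, j)
    rw [flat_apply, flat_apply] at this
    simpa using this
  funext i
  rw [hH b, hH b', this]

theorem sharp_flat (b : LVec N A) : sharp G (flat G b) = b :=
  Function.leftInverse_invFun (flat_injective hG) b

/-- F is its own Ω-orthogonal: the hypothesis kills the polar part of the covector, and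
multiplication by the inverse Gram matrix preserves power series. -/
theorem mem_holPart_of_flat {b : LVec N A} (hb : ∀ (n : ℕ) j, flat G b (n, j) = 0) :
    b ∈ holPart := by
  obtain ⟨H, hH⟩ := exists_inverse hG
  have hr : ∀ j, ∀ n < 0, (row G b j).coeff n = 0 := by
    intro j n hn
    have := hb (-1 - n).toNat j
    rw [flat_apply, Int.toNat_of_nonneg (by omega)] at this
    simpa using this
  choose p hp using fun j => exists_ofPowerSeries (hr j)
  intro i n hn
  rw [hH b i]
  simp only [hp, ← map_mul, ← map_sum, negZ_ofPowerSeries]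
  exact ofPowerSeries_of_neg _ hn

/-- Read backwards, the values of `ψ` are coefficients of Laurent series with bounded pole. The
inverse Gram matrix turns this covector into a representing vector. -/
theorem exists_flat_eq {ψ : ℤ × Fin (N + 1) → A} (hψ : ∃ m : ℤ, ∀ n > m, ∀ j, ψ (n, j) = 0) :
    ∃ b, flat G b = ψ := by
  obtain ⟨u, hu⟩ := isUnit_of_constantCoeff hG
  obtain ⟨m, hm⟩ := hψ
  let r : Fin (N + 1) → LaurentSeries A := fun j =>
    ofSuppBddBelow (fun n => ψ (-1 - n, j)) ⟨-1 - m, fun n hn => by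
      by_contra h
      exact hn (hm _ (by omega) j)⟩
  refine ⟨fun i => negZ (∑ j, r j * ofPowerSeries ℤ A ((u⁻¹ : (PMat N A)ˣ).1 j i)), ?_⟩
  have hHG : (u⁻¹ : (PMat N A)ˣ).1 * G = 1 := by rw [← hu, Units.inv_mul]
  funext ⟨n, j⟩
  have h1 : row G (fun i => negZ (∑ j, r j * ofPowerSeries ℤ A ((u⁻¹ : (PMat N A)ˣ).1 j i))) j = r j := by
    simp only [row, negZ_negZ, Finset.sum_mul]
    rw [Finset.sum_comm]
    simp only [mul_assoc, ← map_mul, ← Finset.mul_sum, ← map_sum, ← Matrix.mul_apply, hHG]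
    rw [Finset.sum_eq_single j]
    · rw [Matrix.one_apply_eq, map_one, mul_one]
    · intro k _ hk
      rw [Matrix.one_apply_ne hk, map_zero, mul_zero]
    · simp
  rw [flat_apply, h1]
  change ψ (-1 - (-1 - n), j) = _
  rw [sub_sub_cancel]

end Nondegenerate

section Symmetric

variable {G}

theorem pairing_swap (hG : ∀ i j, negZ (ofPowerSeries ℤ A (G i j)) = ofPowerSeries ℤ A (G j i))
    (s s' : LVec N A) : pairing G s s' = negZ (pairing G s' s) := by
  unfold pairing
  rw [Finset.sum_comm]
  simp only [← negZHom_apply, map_sum, map_mul]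
  simp only [negZHom_apply, negZ_negZ, hG]
  exact Finset.sum_congr rfl fun i _ => Finset.sum_congr rfl fun j _ => by ring

/-- The substitution z ↦ -z changes the sign of the coefficient of z⁻¹, so a symmetric pairing has a
skew residue form. -/
theorem Om_swap (hG : ∀ i j, negZ (ofPowerSeries ℤ A (G i j)) = ofPowerSeries ℤ A (G j i))
    (s s' : LVec N A) : Om G s s' = -Om G s' s := by
  rw [Om, pairing_swap hG, negZ_coeff, Om, Int.negOnePow_odd _ (by decide)]
  simp

end Symmetric

end Laurent

namespace Laurent

open HahnSeries

variable {N : ℕ} {A B : Type} [CommRing A] [CommRing B]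

/-! ### Change of the coefficient ring -/

/-- A ring homomorphism acts coefficientwise on Laurent series. -/
def mapHom (f : A →+* B) : LaurentSeries A →+* LaurentSeries B where
  toFun x := x.map f
  map_zero' := by ext; simp
  map_add' x y := by ext; simp
  map_one' := by
    ext n
    by_cases h : n = 0 <;> simp [coeff_one, h]
  map_mul' x y := HahnSeries.map_mul (f : A →ₙ+* B)

theorem mapHom_apply (f : A →+* B) (x : LaurentSeries A) : mapHom f x = x.map f := rfl

/-- A ring homomorphism acts coefficientwise on Laurent vectors. -/
def mapVec (f : A →+* B) (s : LVec N A) : LVec N B := fun i => (s i).map f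

theorem mapHom_ofPowerSeries (f : A →+* B) (p : PowerSeries A) :
    mapHom f (ofPowerSeries ℤ A p) = ofPowerSeries ℤ B (PowerSeries.map f p) := by
  rw [mapHom_apply, map_ofPowerSeries]
  congr 1
  ext n
  simp

theorem mapHom_negZ (f : A →+* B) (x : LaurentSeries A) : mapHom f (negZ x) = negZ (mapHom f x) :=
  negZ_map f x

theorem mapHom_zPow (f : A →+* B) (n : ℤ) : mapHom f (zPow n) = zPow n := by
  ext m
  rw [mapHom_apply, map_coeff, zPow, zPow]
  by_cases h : m = n
  · rw [h, coeff_single_same, coeff_single_same, map_one]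
  · rw [coeff_single_of_ne h, coeff_single_of_ne h, map_zero]

theorem mapVec_frame (f : A →+* B) (j : Fin (N + 1)) (n : ℤ) :
    mapVec f (frame j n : LVec N A) = frame j n := by
  funext i
  change mapHom f _ = _
  by_cases h : i = j
  · rw [h, frame, frame, Pi.single_eq_same, Pi.single_eq_same, mapHom_zPow]
  · rw [frame, frame, Pi.single_eq_of_ne h, Pi.single_eq_of_ne h, map_zero]

theorem pairing_mapVec (f : A →+* B) (G : PMat N A) (s s' : LVec N A) :
    pairing (G.map (PowerSeries.map f)) (mapVec f s) (mapVec f s') = mapHom f (pairing G s s') := by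
  simp only [pairing, map_sum, map_mul, mapHom_negZ, mapHom_ofPowerSeries]
  rfl

theorem Om_mapVec (f : A →+* B) (G : PMat N A) (s s' : LVec N A) :
    Om (G.map (PowerSeries.map f)) (mapVec f s) (mapVec f s') = f (Om G s s') := by
  rw [Om, pairing_mapVec]
  rfl

theorem flat_mapVec (f : A →+* B) (G : PMat N A) (s : LVec N A) (m : ℤ × Fin (N + 1)) :
    flat (G.map (PowerSeries.map f)) (mapVec f s) m = f (flat G s m) := by
  rw [flat, ← mapVec_frame f, Om_mapVec]
  rfl

theorem isUnit_det_map {f : A →+* B} {G : PMat N A}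
    (hG : IsUnit (G.map PowerSeries.constantCoeff).det) :
    IsUnit ((G.map (PowerSeries.map f)).map PowerSeries.constantCoeff).det := by
  have h : (G.map (PowerSeries.map f)).map PowerSeries.constantCoeff =
      f.mapMatrix (G.map PowerSeries.constantCoeff) := by
    ext i j
    simp only [Matrix.map_apply, RingHom.mapMatrix_apply]
    rw [← PowerSeries.coeff_zero_eq_constantCoeff_apply, PowerSeries.coeff_map,
      PowerSeries.coeff_zero_eq_constantCoeff_apply]
  rw [h, ← RingHom.map_det]
  exact hG.map f

theorem negZ_eq_map {f : A →+* B} {G : PMat N A}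
    (hG : ∀ i j, negZ (ofPowerSeries ℤ A (G i j)) = ofPowerSeries ℤ A (G j i)) (i j : Fin (N + 1)) :
    negZ (ofPowerSeries ℤ B (G.map (PowerSeries.map f) i j)) =
      ofPowerSeries ℤ B (G.map (PowerSeries.map f) j i) := by
  rw [Matrix.map_apply, Matrix.map_apply, ← mapHom_ofPowerSeries, ← mapHom_ofPowerSeries,
    ← mapHom_negZ, hG]

theorem negZ_sub (f g : LaurentSeries A) : negZ (f - g) = negZ f - negZ g := map_sub negZHom f g
theorem negZ_mul (f g : LaurentSeries A) : negZ (f * g) = negZ f * negZ g := map_mul negZHom f g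
theorem negZ_sum {ι : Type} (s : Finset ι) (f : ι → LaurentSeries A) :
    negZ (∑ i ∈ s, f i) = ∑ i ∈ s, negZ (f i) := map_sum negZHom f s

theorem negZ_zPow_neg_one : negZ (zPow (-1) : LaurentSeries A) = -zPow (-1) := by
  rw [negZ_zPow, Int.negOnePow_odd _ (by decide)]
  simp

theorem pairing_frame (G : PMat N A) (a b : Fin (N + 1)) :
    pairing G (frame a 0) (frame b 0) = ofPowerSeries ℤ A (G a b) := by
  rw [pairing, Finset.sum_eq_single a, Finset.sum_eq_single b]
  · rw [frame, frame, Pi.single_eq_same, Pi.single_eq_same, zPow_zero, ← negZHom_apply, map_one,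
      one_mul, mul_one]
  · intro j _ hj
    rw [frame, frame, Pi.single_eq_of_ne hj, mul_zero]
  · simp
  · intro i _ hi
    refine Finset.sum_eq_zero fun j _ => ?_
    rw [frame, Pi.single_eq_of_ne hi, ← negZHom_apply, map_zero, zero_mul, zero_mul]
  · simp

theorem mulLaurent_ofPowerSeries (M : PMat N A) (p : Fin (N + 1) → PowerSeries A) :
    mulLaurent M (fun i => ofPowerSeries ℤ A (p i)) =
      fun k => ofPowerSeries ℤ A (M.mulVec p k) := by
  funext k
  simp only [mulLaurent, Matrix.mulVec, dotProduct, map_sum, map_mul, Matrix.map_apply]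

/-! ### Connections -/

section Connection

variable [Algebra ℂ A] [Algebra ℂ B] (D : Derivation ℂ A A) (M : PMat N A)

theorem conn_add (s s' : LVec N A) : conn D M (s + s') = conn D M s + conn D M s' := by
  funext k
  simp only [conn, mulLaurent, Matrix.mulVec_add, Pi.add_apply, map_add_derivation]
  ring

theorem conn_smul (c : A) (s : LVec N A) : conn D M (c • s) = D c • s + c • conn D M s := by
  have h1 : mulLaurent M (c • s) = c • mulLaurent M s := by
    funext k
    simp only [mulLaurent, Matrix.mulVec, dotProduct, Pi.smul_apply, mul_smul, Finset.smul_sum]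
  funext k
  simp only [conn, h1, Pi.add_apply, Pi.smul_apply, mul_smul, smul_sub]
  have h2 : (c • s k).map D = D c • s k + c • (s k).map D := by
    ext n
    rw [map_coeff, coeff_smul, coeff_add', Pi.add_apply, coeff_smul, coeff_smul, map_coeff,
      smul_eq_mul, D.leibniz]
    simp only [smul_eq_mul]
    ring
  rw [h2, add_sub_assoc]

theorem conn_mapVec {f : A →+* B} {D' : Derivation ℂ B B} (h : ∀ a, D' (f a) = f (D a))
    (s : LVec N A) :
    conn D' (M.map (PowerSeries.map f)) (mapVec f s) = mapVec f (conn D M s) := by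
  funext k
  change _ = mapHom f (_ - _)
  rw [map_sub, map_mul, mapHom_zPow]
  unfold conn mulLaurent Matrix.mulVec dotProduct
  rw [map_sum]
  congr 1
  · ext n
    exact h _
  · congr 1
    refine Finset.sum_congr rfl fun j _ => ?_
    rw [map_mul]
    change ofPowerSeries ℤ B (PowerSeries.map f (M k j)) * mapHom f (s j) =
      mapHom f (ofPowerSeries ℤ A (M k j)) * mapHom f (s j)
    rw [mapHom_ofPowerSeries]

omit [Algebra ℂ A] in
theorem conn_mapVec_zero {f : A →+* B} {D' : Derivation ℂ B B} (h : ∀ a, D' (f a) = 0)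
    (s : LVec N A) : conn D' (0 : PMat N B) (mapVec f s) = 0 := by
  funext k
  have h0 : (0 : PMat N B).map (ofPowerSeries ℤ B) = 0 := by ext; simp
  simp only [conn, mulLaurent, h0, Matrix.zero_mulVec, Pi.zero_apply, mul_zero, sub_zero]
  ext n
  exact h _

/-- The compatibility of a connection with a pairing, in terms of matrices. -/
def IsFlatFor (D : Derivation ℂ A A) (M G : PMat N A) : Prop :=
  ∀ a b, (ofPowerSeries ℤ A (G a b)).map D =
    zPow (-1) * (∑ k, negZ (ofPowerSeries ℤ A (M k a)) * ofPowerSeries ℤ A (G k b)) -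
      zPow (-1) * ∑ k, ofPowerSeries ℤ A (G a k) * ofPowerSeries ℤ A (M k b)

variable {D M} {G : PMat N A}

theorem IsFlatFor.pairing (h : IsFlatFor D M G) (s s' : LVec N A) :
    (CTPFock.pairing G s s').map D =
      CTPFock.pairing G (conn D M s) s' + CTPFock.pairing G s (conn D M s') := by
  have e : ∀ u v : LVec N A, CTPFock.pairing G u v =
      (fun i => negZ (u i)) ⬝ᵥ (G.map (ofPowerSeries ℤ A)).mulVec v := by
    intro u v
    simp only [CTPFock.pairing, dotProduct, Matrix.mulVec, Finset.mul_sum, Matrix.map_apply, mul_assoc]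
  have hM : (G.map (ofPowerSeries ℤ A)).map (fun x => x.map D) =
      (zPow (-1) : LaurentSeries A) • ((M.map fun p => negZ (ofPowerSeries ℤ A p)).transpose *
        G.map (ofPowerSeries ℤ A)) -
      (zPow (-1) : LaurentSeries A) • (G.map (ofPowerSeries ℤ A) * M.map (ofPowerSeries ℤ A)) := by
    ext1 a b
    simp only [Matrix.map_apply, h a b, Matrix.sub_apply, Matrix.smul_apply, Matrix.mul_apply,
      Matrix.transpose_apply, smul_eq_mul]
  have e1 : (CTPFock.pairing G s s').map D =
      (fun i => negZ ((s i).map D)) ⬝ᵥ (G.map (ofPowerSeries ℤ A)).mulVec s' +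
      ((fun i => negZ (s i)) ⬝ᵥ ((G.map (ofPowerSeries ℤ A)).map (fun x => x.map D)).mulVec s' +
      (fun i => negZ (s i)) ⬝ᵥ (G.map (ofPowerSeries ℤ A)).mulVec fun i => (s' i).map D) := by
    simp only [CTPFock.pairing, dotProduct, Matrix.mulVec, Finset.mul_sum, Matrix.map_apply,
      map_sum_derivation, map_mul_derivation, ← Finset.sum_add_distrib, negZ_map]
    exact Finset.sum_congr rfl fun i _ => Finset.sum_congr rfl fun j _ => by ring
  have e2 : (fun i => negZ (conn D M s i)) = (fun i => negZ ((s i).map D)) +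
      (zPow (-1) : LaurentSeries A) • (M.map fun p => negZ (ofPowerSeries ℤ A p)).mulVec
        fun i => negZ (s i) := by
    funext i
    simp only [conn, mulLaurent, Matrix.mulVec, dotProduct, negZ_sub, negZ_mul, negZ_sum,
      negZ_zPow_neg_one, Pi.add_apply, Pi.smul_apply, Matrix.map_apply, smul_eq_mul]
    ring
  have e3 : conn D M s' = (fun i => (s' i).map D) -
      (zPow (-1) : LaurentSeries A) • (M.map (ofPowerSeries ℤ A)).mulVec s' := rfl
  rw [e1, e, e, e2, e3, hM]
  simp only [Matrix.sub_mulVec, Matrix.smul_mulVec, dotProduct_sub, add_dotProduct, dotProduct_smul,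
    smul_dotProduct, Matrix.mulVec_sub, Matrix.mulVec_smul, ← Matrix.mulVec_mulVec]
  rw [Matrix.dotProduct_mulVec _ (Matrix.transpose _), Matrix.vecMul_transpose]
  ring

theorem IsFlatFor.Om (h : IsFlatFor D M G) (s s' : LVec N A) :
    D (Om G s s') = CTPFock.Om G (conn D M s) s' + CTPFock.Om G s (conn D M s') := by
  have := congrArg (fun x => HahnSeries.coeff x (-1)) (h.pairing s s')
  exact this

theorem conn_frame (a k : Fin (N + 1)) :
    conn D M (frame a 0) k = -(zPow (-1) * ofPowerSeries ℤ A (M k a)) := by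
  have h1 : (frame (A := A) a 0 k).map D = 0 := by
    ext n
    rw [map_coeff]
    by_cases h : k = a
    · rw [h, frame, Pi.single_eq_same, zPow_zero, coeff_one]
      split_ifs <;> simp
    · rw [frame, Pi.single_eq_of_ne h]
      simp
  rw [conn, h1, zero_sub]
  congr 2
  simp only [mulLaurent, Matrix.mulVec, dotProduct]
  rw [Finset.sum_eq_single a]
  · rw [frame, Pi.single_eq_same, zPow_zero, mul_one, Matrix.map_apply]
  · intro j _ hj
    rw [frame, Pi.single_eq_of_ne hj, mul_zero]
  · simp

/-- Testing on the frame gives an identity of matrices. Unlike the identity for all sections, it can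
be transported along a homomorphism of the coefficient ring. -/
theorem isFlatFor_of_pairing (h : ∀ s s' : LVec N A, (pairing G s s').map D =
    pairing G (conn D M s) s' + pairing G s (conn D M s')) : IsFlatFor D M G := by
  intro a b
  rw [← pairing_frame, h]
  have e1 : pairing G (conn D M (frame a 0)) (frame b 0) =
      zPow (-1) * ∑ k, negZ (ofPowerSeries ℤ A (M k a)) * ofPowerSeries ℤ A (G k b) := by
    simp only [pairing, conn_frame, Finset.mul_sum]
    refine Finset.sum_congr rfl fun i _ => ?_
    rw [Finset.sum_eq_single b]
    · rw [frame, Pi.single_eq_same, zPow_zero, mul_one, ← negZHom_apply, map_neg, negZHom_apply,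
        negZ_mul, negZ_zPow_neg_one]
      ring
    · intro j _ hj
      rw [frame, Pi.single_eq_of_ne hj, mul_zero]
    · simp
  have e2 : pairing G (frame a 0) (conn D M (frame b 0)) =
      -(zPow (-1) * ∑ k, ofPowerSeries ℤ A (G a k) * ofPowerSeries ℤ A (M k b)) := by
    simp only [pairing, conn_frame, Finset.mul_sum]
    rw [Finset.sum_eq_single a, ← Finset.sum_neg_distrib]
    · refine Finset.sum_congr rfl fun j _ => ?_
      rw [frame, Pi.single_eq_same, zPow_zero, ← negZHom_apply, map_one]
      ring
    · intro i _ hi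
      refine Finset.sum_eq_zero fun j _ => ?_
      rw [frame, Pi.single_eq_of_ne hi, ← negZHom_apply, map_zero, zero_mul, zero_mul]
    · simp
  rw [e1, e2, sub_eq_add_neg]

theorem IsFlatFor.map {f : A →+* B} {D' : Derivation ℂ B B} (hD : ∀ a, D' (f a) = f (D a))
    (h : IsFlatFor D M G) :
    IsFlatFor D' (M.map (PowerSeries.map f)) (G.map (PowerSeries.map f)) := by
  intro a b
  have := congrArg (mapHom f) (h a b)
  simp only [map_sub, map_mul, map_sum, mapHom_zPow, mapHom_negZ, mapHom_ofPowerSeries] at this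
  simp only [Matrix.map_apply]
  rw [← this]
  ext n
  rw [map_coeff, mapHom_apply, map_coeff, map_coeff, ← hD]
  rw [← mapHom_ofPowerSeries]
  rfl

omit [Algebra ℂ A] in
theorem isFlatFor_zero {f : A →+* B} {D' : Derivation ℂ B B} (hD : ∀ a, D' (f a) = 0) :
    IsFlatFor D' 0 (G.map (PowerSeries.map f)) := by
  intro a b
  simp only [Matrix.zero_apply, map_zero, mul_zero, Finset.sum_const_zero, sub_zero,
    ← negZHom_apply, zero_mul, Matrix.map_apply, ← mapHom_ofPowerSeries]
  ext n
  exact hD _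

/-- The symplectic form of the derivative of a section of `F` with a section of `F`. -/
theorem Om_conn_hol {h h' : LVec N A} (hh : h ∈ holPart) (hh' : h' ∈ holPart) :
    Om G (conn D M h) h' = ∑ i, ∑ j, (∑ k, PowerSeries.constantCoeff (M i k) * (h k).coeff 0) *
      PowerSeries.constantCoeff (G i j) * (h' j).coeff 0 := by
  choose p hp using fun j => exists_ofPowerSeries (hh j)
  choose p' hp' using fun j => exists_ofPowerSeries (hh' j)
  obtain rfl : h = _ := funext hp
  obtain rfl : h' = _ := funext hp'
  have e : conn D M (fun i => ofPowerSeries ℤ A (p i)) =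
      (fun i => (ofPowerSeries ℤ A (p i)).map D) +
        fun i => -(zPow (-1) * ofPowerSeries ℤ A (M.mulVec p i)) := by
    funext i
    rw [conn, mulLaurent_ofPowerSeries]
    exact sub_eq_add_neg _ _
  -- The derivative of the coefficients stays in F and does not contribute. What is left is a simple
  -- pole, whose residue involves only values at z = 0; its minus sign is undone by z ↦ -z.
  rw [e, ← OmHom_apply, map_add, LinearMap.add_apply, OmHom_apply, OmHom_apply, Om_hol, zero_add]
  · have : pairing G (fun i => -(zPow (-1) * ofPowerSeries ℤ A (M.mulVec p i)))
        (fun i => ofPowerSeries ℤ A (p' i)) = zPow (-1) * ofPowerSeries ℤ A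
          (∑ i, ∑ j, PowerSeries.evalNegHom (M.mulVec p i) * G i j * p' j) := by
      simp only [pairing, map_sum, Finset.mul_sum]
      refine Finset.sum_congr rfl fun i _ => Finset.sum_congr rfl fun j _ => ?_
      rw [← negZHom_apply, map_neg, negZHom_apply, negZ_mul, negZ_zPow_neg_one, negZ_ofPowerSeries,
        map_mul, map_mul]
      ring
    rw [Om, this, zPow_mul_coeff, sub_self, ofPowerSeries_coeff_zero]
    have h0 : ∀ q : PowerSeries A, PowerSeries.constantCoeff (PowerSeries.evalNegHom q) =
        PowerSeries.constantCoeff q := by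
      intro q
      rw [← PowerSeries.coeff_zero_eq_constantCoeff_apply, PowerSeries.evalNegHom,
        PowerSeries.coeff_rescale, pow_zero, one_mul, PowerSeries.coeff_zero_eq_constantCoeff_apply]
    simp only [map_sum, map_mul, h0, ofPowerSeries_coeff_zero, Matrix.mulVec, dotProduct]
  · intro i n hn
    rw [map_coeff, ofPowerSeries_of_neg _ hn, map_zero]
  · exact fun i n hn => ofPowerSeries_of_neg _ hn

end Connection

end Laurent

/-! ### Functionals on F and on F[z⁻¹]. -/

namespace Laurent

open HahnSeries

variable {N : ℕ} {A : Type} [CommRing A]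

/-- Linear maps on Laurent vectors are determined by their values on the sections of `F` and on the
polar part of the frame. -/
theorem linearMap_ext {W : Type} [AddCommGroup W] [Module A W] {f g : LVec N A →ₗ[A] W}
    (h₁ : ∀ h ∈ holPart, f h = g h) (h₂ : ∀ (n : ℤ) j, n < 0 → f (frame j n) = g (frame j n)) :
    f = g := by
  refine LinearMap.ext fun s => ?_
  obtain ⟨m, hm⟩ := exists_bound s
  set p : LVec N A := ∑ n ∈ Finset.Ico m 0, ∑ j, (s j).coeff n • frame j n with hp
  have hs : s - p ∈ holPart := by
    intro i n hn
    have h3 : (p i).coeff n = if m ≤ n then (s i).coeff n else 0 := by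
      simp only [hp, Finset.sum_apply, Pi.smul_apply, coeff_sum, coeff_smul]
      have h4 : ∀ n' : ℤ, ∑ j, (s j).coeff n' • (frame (A := A) j n' i).coeff n =
          if n' = n then (s i).coeff n else 0 := by
        intro n'
        rw [Finset.sum_eq_single i]
        · rw [frame, Pi.single_eq_same, zPow]
          split_ifs with h
          · rw [h, coeff_single_same, smul_eq_mul, mul_one]
          · rw [coeff_single_of_ne (Ne.symm h), smul_zero]
        · intro j _ hj
          rw [frame, Pi.single_eq_of_ne hj.symm, coeff_zero, smul_zero]
        · simp
      simp only [h4, Finset.sum_ite_eq', Finset.mem_Ico]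
      simp only [hn, and_true]
    rw [Pi.sub_apply, coeff_sub', Pi.sub_apply, h3]
    split_ifs with h
    · exact sub_self _
    · rw [hm n (by omega), sub_zero]
  have h5 : f p = g p := by
    simp only [hp, map_sum, map_smul]
    refine Finset.sum_congr rfl fun n hn => Finset.sum_congr rfl fun j _ => ?_
    rw [h₂ n j (Finset.mem_Ico.1 hn).2]
  have h6 : s = (s - p) + p := by abel
  rw [h6, map_add, map_add, h₁ _ hs, h5]

/-- The value of a functional in `F^∨` on (the holomorphic part of) a Laurent vector. -/
def pair (s : LVec N A) : (ℕ × Fin (N + 1) →₀ A) →ₗ[A] A where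
  toFun φ := φ.sum fun m c => c * (s m.2).coeff (m.1 : ℤ)
  map_add' φ φ' := Finsupp.sum_add_index' (by simp) (by intros; ring)
  map_smul' c φ := by
    rw [Finsupp.sum_smul_index' (by simp)]
    simp only [smul_eq_mul, Finsupp.sum, Finset.mul_sum, mul_assoc, RingHom.id_apply]

theorem pair_apply (s : LVec N A) (φ : ℕ × Fin (N + 1) →₀ A) :
    pair s φ = φ.sum fun m c => c * (s m.2).coeff (m.1 : ℤ) := rfl

theorem pair_single (s : LVec N A) (m : ℕ × Fin (N + 1)) (c : A) :
    pair s (Finsupp.single m c) = c * (s m.2).coeff (m.1 : ℤ) := by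
  rw [pair_apply, Finsupp.sum_single_index (zero_mul _)]

theorem Om_eq_pair {G : PMat N A} {b : LVec N A} {φ : ℕ × Fin (N + 1) →₀ A}
    (hb : ∀ (n : ℕ) j, flat G b (n, j) = φ (n, j)) {h : LVec N A} (hh : h ∈ holPart) :
    Om G b h = pair h φ := by
  rw [← evalDual_flat, evalDual]
  let e : ℕ × Fin (N + 1) → ℤ × Fin (N + 1) := fun m => (m.1, m.2)
  have he : Function.Injective e := by
    rintro ⟨a, b⟩ ⟨c, d⟩ h
    simp only [e, Prod.mk.injEq, Nat.cast_inj] at h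
    exact Prod.ext h.1 h.2
  rw [finsum_eq_sum_of_support_subset (s := φ.support.image e), Finset.sum_image he.injOn]
  · exact Finset.sum_congr rfl fun m _ => by rw [hb]
  · rintro ⟨n, j⟩ hm
    have h1 := left_ne_zero_of_mul hm
    have h2 := right_ne_zero_of_mul hm
    have hn : 0 ≤ n := by
      by_contra hn
      exact h2 (hh j n (by simpa using hn))
    lift n to ℕ using hn
    rw [hb] at h1
    exact Finset.mem_coe.2 (Finset.mem_image.2 ⟨(n, j), Finsupp.mem_support_iff.2 h1, rfl⟩)

theorem exists_finsupp_flat (G : PMat N A) (b : LVec N A) :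
    ∃ φ : ℕ × Fin (N + 1) →₀ A, ∀ (n : ℕ) j, flat G b (n, j) = φ (n, j) := by
  obtain ⟨m, hm⟩ := flat_bounded G b
  refine ⟨Finsupp.ofSupportFinite (fun x => flat G b (x.1, x.2)) ?_, fun n j => rfl⟩
  refine ((Set.finite_Iic m.toNat).prod (Set.finite_univ (α := Fin (N + 1)))).subset ?_
  rintro ⟨n, j⟩ hn
  refine ⟨?_, Set.mem_univ _⟩
  by_contra h
  exact hn (hm n (by simp only [Set.mem_Iic, not_le] at h; omega) j)

end Laurent

namespace CTP

open TopologicalSpace Laurent HahnSeries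

variable {N : ℕ} {U : Opens (Base N)} (S : CTP N U)

/-! ### Derivatives on the total space -/

variable {S} in
theorem RegRing.ext {f g : S.RegRing} (h : ∀ q, RegRing.eval q f = RegRing.eval q g) : f = g :=
  Subtype.ext (funext h)

theorem eval_dTot {μ : Idx N} {f : S.RegRing} {q : S.LLo} {d : ℂ} {F : ℂ → ℂ} (hF : HasDerivAt F d 0)
    (hf : ∀ (s : ℂ) (h : q.1 + s • (Pi.single μ 1 : Idx N → ℂ) ∈ S.LLo),
      q.1 + s • (Pi.single μ 1 : Idx N → ℂ) ∈ LL U → RegRing.eval ⟨_, h⟩ f = F s) :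
    RegRing.eval q (S.dTot μ f) = d := by
  refine HasDerivAt.deriv (hF.congr_of_eventuallyEq ?_)
  filter_upwards [S.line_mem_LLo μ q, line_mem_LL μ ⟨q.1, LLo.mem_LL q⟩] with s hs hs'
  have e := Subtype.val_injective.extend_apply (fun q => RegRing.eval q f)
    (0 : (Idx N → ℂ) → ℂ) ⟨_, hs⟩
  exact e.trans (hf s hs hs')

theorem eval_dTot_pull (μ : Idx N) (a : HolRing U) (q : S.LLo) :
    ∃ (g : Base N → ℂ), (∀ t : U, HolRing.eval t a = g t) ∧ AnalyticOnNhd ℂ g U ∧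
    RegRing.eval q (S.dTot μ (S.pull a)) = fderiv ℂ g (LL.base ⟨q.1, LLo.mem_LL q⟩)
      (fun i => (Pi.single μ 1 : Idx N → ℂ) (Sum.inl i)) := by
  obtain ⟨g, hg, hag⟩ : ∃ g : Base N → ℂ, AnalyticOnNhd ℂ g U ∧
      ∀ t : U, HolRing.eval t a = g t := a.2
  refine ⟨g, hag, hg, S.eval_dTot (hasDerivAt_hol_line (f := fun t => HolRing.eval t a) hg hag _ _) ?_⟩
  intro s h h'
  have e2 := Subtype.val_injective.extend_apply (fun t : U => HolRing.eval t a) 0 (LL.base ⟨_, h'⟩)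
  have e3 : RegRing.eval ⟨_, h⟩ (S.pull a) = HolRing.eval (LL.base ⟨_, h'⟩) a := evalLL_C _ a
  rw [e3]
  exact e2.symm

theorem dTot_pull_inl (i : Fin (N + 1)) (a : HolRing U) :
    S.dTot (Sum.inl i) (S.pull a) = S.pull (dBase i a) := by
  refine RegRing.ext fun q => ?_
  obtain ⟨g, hag, hg, h⟩ := S.eval_dTot_pull (Sum.inl i) a q
  have e : (fun j => (Pi.single (Sum.inl i) 1 : Idx N → ℂ) (Sum.inl j)) = Pi.single i 1 := by
    funext j
    simp [Pi.single_apply]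
  rw [h, e]
  have h' : HolRing.eval (LL.base ⟨q.1, LLo.mem_LL q⟩) (dBase i a) = _ :=
    (hasDerivAt_hol_line (f := fun t => HolRing.eval t a) hg hag (LL.base ⟨q.1, LLo.mem_LL q⟩)
      (Pi.single i 1)).deriv
  rw [← h']
  exact (evalLL_C _ _).symm

theorem dTot_pull_inr (m : ℕ × Fin (N + 1)) (a : HolRing U) :
    S.dTot (Sum.inr m) (S.pull a) = 0 := by
  refine RegRing.ext fun q => ?_
  obtain ⟨g, hag, hg, h⟩ := S.eval_dTot_pull (Sum.inr m) a q
  have e : (fun j => (Pi.single (Sum.inr m) 1 : Idx N → ℂ) (Sum.inl j)) = 0 := by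
    funext j
    simp
  rw [h, e, map_zero, map_zero]

theorem dTot_coord (μ : Idx N) (m : ℕ × Fin (N + 1)) :
    S.dTot μ (S.coord m) = if μ = Sum.inr m then 1 else 0 := by
  refine RegRing.ext fun q => ?_
  have h1 : HasDerivAt (fun s : ℂ => (q.1 + s • (Pi.single μ 1 : Idx N → ℂ)) (Sum.inr m))
      ((Pi.single μ 1 : Idx N → ℂ) (Sum.inr m)) 0 := by
    simp only [Pi.add_apply, Pi.smul_apply, smul_eq_mul]
    simpa using ((hasDerivAt_id (0 : ℂ)).mul_const
      ((Pi.single μ 1 : Idx N → ℂ) (Sum.inr m))).const_add (q.1 (Sum.inr m))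
  rw [S.eval_dTot h1]
  · split_ifs with h
    · rw [h, Pi.single_eq_same, map_one]
    · rw [Pi.single_eq_of_ne (Ne.symm h), map_zero]
  · intro s h h'
    exact evalLL_X _ m

theorem isUnit_disc : IsUnit (S.res S.disc) := by
  have hmem : (fun q => (S.ev q S.disc)⁻¹) ∈ S.Reg :=
    ⟨1, 1, fun q => by rw [pow_one, map_one, inv_mul_cancel₀ (S.ev_disc_ne_zero q)]⟩
  refine IsUnit.of_mul_eq_one (b := (⟨_, hmem⟩ : S.RegRing)) ?_
  refine RegRing.ext fun q => ?_
  exact mul_inv_cancel₀ (S.ev_disc_ne_zero q)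

/-- The matrix with columns `C_j(t,0) x_1`. -/
def residCols : Matrix (Fin (N + 1)) (Fin (N + 1)) S.RegRing :=
  fun a j => (S.residTot j).mulVec S.x₁ a

/-- Up to sign its determinant is the discriminant, which is inverted in the ring of regular
functions. -/
theorem isUnit_residCols : IsUnit S.residCols := by
  have h1 : S.residCols = S.res.mapMatrix S.colMatrix := by
    ext a j
    rw [RingHom.mapMatrix_apply, Matrix.map_apply, colMatrix, map_sum]
    simp only [map_mul]
    unfold residCols residTot pullMat Matrix.mulVec dotProduct
    refine Finset.sum_congr rfl fun b _ => ?_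
    change PowerSeries.constantCoeff (PowerSeries.map S.pull (S.C j a b)) * _ = _
    rw [← PowerSeries.coeff_zero_eq_constantCoeff_apply, PowerSeries.coeff_map,
      PowerSeries.coeff_zero_eq_constantCoeff_apply]
    rfl
  have h2 := S.isUnit_disc
  rw [disc, map_mul, RingHom.map_det] at h2
  rw [h1, Matrix.isUnit_iff_isUnit_det]
  exact isUnit_of_mul_isUnit_right h2

/-! ### The Kodaira–Spencer map -/

theorem taut_eq (i : Fin (N + 1)) : S.taut i =
    zPow 1 * ofPowerSeries ℤ S.RegRing (PowerSeries.mk fun l => S.coord (l, i)) := rfl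

theorem taut_coeff (i : Fin (N + 1)) (n : ℤ) : (S.taut i).coeff n =
    if n < 1 then 0 else S.coord ((n - 1).toNat, i) := by
  rw [taut_eq, zPow_mul_coeff, coeff_ofPowerSeries, PowerSeries.coeff_mk]
  by_cases h : n < 1
  · rw [if_pos h, if_pos (by omega)]
  · rw [if_neg h, if_neg (by omega)]

theorem KS_inr (m : ℕ × Fin (N + 1)) : S.KS (Sum.inr m) = frame m.2 (m.1 + 1) := by
  have h0 : (0 : PMat N S.RegRing).map (ofPowerSeries ℤ S.RegRing) = 0 := by ext; simp
  funext i
  simp only [KS, nablaTot, Sum.elim_inr, conn, mulLaurent, h0, Matrix.zero_mulVec, Pi.zero_apply,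
    mul_zero, sub_zero]
  ext n
  rw [map_coeff, taut_coeff, apply_ite (S.dTot (Sum.inr m)), map_zero, dTot_coord]
  by_cases h : i = m.2
  · rw [h, frame, Pi.single_eq_same, zPow]
    by_cases hn : n = m.1 + 1
    · rw [hn, coeff_single_same, if_neg (by omega), if_pos]
      simp
    · rw [coeff_single_of_ne hn, ite_eq_left_iff]
      intro h1
      rw [if_neg]
      rintro h2
      have := congrArg Prod.fst (Sum.inr_injective h2)
      simp only at this
      omega
  · rw [frame, Pi.single_eq_of_ne h, coeff_zero, ite_eq_left_iff]
    intro _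
    rw [if_neg]
    rintro h2
    exact h (congrArg Prod.snd (Sum.inr_injective h2)).symm

theorem KS_inl (i : Fin (N + 1)) : S.KS (Sum.inl i) = fun k => -ofPowerSeries ℤ S.RegRing
    ((S.pullMat (S.C i)).mulVec (fun j => PowerSeries.mk fun l => S.coord (l, j)) k) := by
  funext k
  have h1 : (S.taut k).map (S.dTot (Sum.inl i)) = 0 := by
    ext n
    rw [map_coeff, taut_coeff, apply_ite (S.dTot (Sum.inl i)), map_zero, dTot_coord,
      if_neg (fun h => Sum.inl_ne_inr h), ite_self, coeff_zero]
  have h2 : S.taut = (zPow 1 : LaurentSeries S.RegRing) • fun j =>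
      ofPowerSeries ℤ S.RegRing (PowerSeries.mk fun l => S.coord (l, j)) := rfl
  have h3 := congrFun (mulLaurent_ofPowerSeries (S.pullMat (S.C i))
    (fun j => PowerSeries.mk fun l => S.coord (l, j))) k
  simp only [KS, nablaTot, Sum.elim_inl, conn, h1, zero_sub]
  rw [← h3, h2]
  simp only [mulLaurent, Matrix.mulVec_smul, Pi.smul_apply, smul_eq_mul]
  rw [← mul_assoc, zPow_mul_zPow, neg_add_cancel, zPow_zero, one_mul]

theorem KS_mem_holPart (μ : Idx N) : S.KS μ ∈ holPart := by
  rcases μ with i | m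
  · intro k n hn
    rw [KS_inl, coeff_neg', Pi.neg_apply, ofPowerSeries_of_neg _ hn, neg_zero]
  · rw [KS_inr]
    exact frame_mem_holPart _ (by omega)

theorem KS_inl_coeff_zero (i k : Fin (N + 1)) :
    (S.KS (Sum.inl i) k).coeff 0 = -S.residCols k i := by
  rw [KS_inl, coeff_neg', Pi.neg_apply, ofPowerSeries_coeff_zero]
  congr 1
  unfold residCols residTot Matrix.mulVec dotProduct
  rw [map_sum]
  refine Finset.sum_congr rfl fun b _ => ?_
  rw [map_mul]
  change _ * PowerSeries.constantCoeff (PowerSeries.mk fun l => S.coord (l, b)) =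
    _ * S.coord (0, b)
  rw [← PowerSeries.coeff_zero_eq_constantCoeff_apply (PowerSeries.mk _), PowerSeries.coeff_mk]
  rfl

theorem KS_inr_coeff_zero (m : ℕ × Fin (N + 1)) (k : Fin (N + 1)) :
    (S.KS (Sum.inr m) k).coeff 0 = 0 := by
  rw [KS_inr]
  by_cases h : k = m.2
  · rw [h, frame, Pi.single_eq_same, zPow, coeff_single_of_ne (by omega)]
  · rw [frame, Pi.single_eq_of_ne h, coeff_zero]

theorem KSstar_eq (φ : ℕ × Fin (N + 1) →₀ S.RegRing) (μ : Idx N) :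
    S.KSstar φ μ = pair (S.KS μ) φ := rfl

theorem pair_frame {A : Type} [CommRing A] (φ : ℕ × Fin (N + 1) →₀ A) (n : ℕ) (j : Fin (N + 1)) :
    pair (frame j (n : ℤ)) φ = φ (n, j) := by
  rw [pair_apply, Finsupp.sum_eq_single (n, j)]
  · simp only
    rw [frame, Pi.single_eq_same, zPow, coeff_single_same, mul_one]
  · rintro ⟨a, b⟩ _ h
    simp only
    by_cases hb : b = j
    · subst hb
      rw [frame, Pi.single_eq_same, zPow, coeff_single_of_ne, mul_zero]
      intro h1
      exact h (Prod.ext (by exact_mod_cast h1) rfl)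
    · rw [frame, Pi.single_eq_of_ne hb, coeff_zero, mul_zero]
  · simp

theorem KSstar_inr (φ : ℕ × Fin (N + 1) →₀ S.RegRing) (m : ℕ × Fin (N + 1)) :
    S.KSstar φ (Sum.inr m) = φ (m.1 + 1, m.2) := by
  rw [KSstar_eq, KS_inr]
  exact_mod_cast pair_frame φ (m.1 + 1) m.2

theorem KSstar_sub (φ φ' : ℕ × Fin (N + 1) →₀ S.RegRing) :
    S.KSstar (φ - φ') = S.KSstar φ - S.KSstar φ' := funext fun μ => map_sub (pair (S.KS μ)) φ φ'

/-- The map is triangular: the components along the fibre coordinates are the coefficients of φ of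
positive z-degree. Once these vanish, the components along `dt^i` determine the rest through the
invertible matrix `residCols`. -/
theorem KSstar_injective : Function.Injective S.KSstar := by
  intro φ φ' h
  rw [← sub_eq_zero]
  set ψ := φ - φ' with hψ
  have h0 : S.KSstar ψ = 0 := by rw [hψ, KSstar_sub, h, sub_self]
  have h1 : ∀ l j, ψ (l + 1, j) = 0 := fun l j => by
    rw [← S.KSstar_inr ψ (l, j), h0, Pi.zero_apply]
  have h2 : Matrix.vecMul (fun a => ψ (0, a)) S.residCols = 0 := by
    funext i
    have h3 : S.KSstar ψ (Sum.inl i) = 0 := by rw [h0, Pi.zero_apply]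
    have h4 : S.KSstar ψ (Sum.inl i) = ∑ a, ψ (0, a) * (S.KS (Sum.inl i) a).coeff 0 := by
      rw [KSstar_eq, pair_apply, Finsupp.sum_of_support_subset (s := Finset.univ.image fun a => ((0 : ℕ), a)),
        Finset.sum_image]
      · rfl
      · exact fun a _ b _ h => congrArg Prod.snd h
      · rintro ⟨l, j⟩ hl
        rcases l with _ | l
        · exact Finset.mem_image.2 ⟨j, Finset.mem_univ _, rfl⟩
        · exact absurd (h1 l j) (Finsupp.mem_support_iff.1 hl)
      · intro i _
        exact zero_mul _
    rw [h4] at h3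
    simp only [KS_inl_coeff_zero, mul_neg, Finset.sum_neg_distrib, neg_eq_zero] at h3
    exact h3
  have h5 : (fun a => ψ (0, a)) = 0 := by
    obtain ⟨u, hu⟩ := S.isUnit_residCols
    have := congrArg (fun v => Matrix.vecMul v (u⁻¹ : (Matrix _ _ S.RegRing)ˣ).1) h2
    simp only [Matrix.vecMul_vecMul, ← hu, Units.mul_inv, Matrix.vecMul_one, Matrix.zero_vecMul] at this
    exact this
  ext ⟨l, j⟩
  rcases l with _ | l
  · exact congrFun h5 j
  · exact h1 l j

/-- The explicit dual basis vectors for `dt^i`. -/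
theorem KSstar_sum_single {H : Matrix (Fin (N + 1)) (Fin (N + 1)) S.RegRing}
    (hH : H * S.residCols = 1) (i : Fin (N + 1)) :
    S.KSstar (∑ a, Finsupp.single (0, a) (-H i a)) = Pi.single (Sum.inl i) 1 := by
  funext μ
  rw [KSstar_eq, map_sum]
  simp only [pair_single, Nat.cast_zero]
  rcases μ with j | m
  · simp only [KS_inl_coeff_zero, neg_mul_neg, ← Matrix.mul_apply, hH]
    by_cases h : i = j
    · rw [h, Matrix.one_apply_eq, Pi.single_eq_same]
    · rw [Matrix.one_apply_ne h, Pi.single_eq_of_ne]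
      exact fun h' => h (Sum.inl_injective h').symm
  · simp [KS_inr_coeff_zero]

theorem KSstar_conormal (μ : Idx N) : S.KSstar (S.conormal μ) = Pi.single μ 1 := by
  refine Function.invFun_eq ?_
  obtain ⟨u, hu⟩ := S.isUnit_residCols
  have hH : (u⁻¹ : (Matrix _ _ S.RegRing)ˣ).1 * S.residCols = 1 := by rw [← hu, Units.inv_mul]
  rcases μ with i | m
  · exact ⟨_, S.KSstar_sum_single hH i⟩
  -- The coordinate functional has the right components along the fibre; its unwanted components
  -- along `dt^i` are subtracted with the preimages already constructed.
  · refine ⟨Finsupp.single (m.1 + 1, m.2) 1 - ∑ i, S.KSstar (Finsupp.single (m.1 + 1, m.2) 1)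
      (Sum.inl i) • ∑ a, Finsupp.single (0, a) (-(u⁻¹ : (Matrix _ _ S.RegRing)ˣ).1 i a), ?_⟩
    funext μ
    have h1 : ∀ i, pair (S.KS μ) (∑ a, Finsupp.single (0, a)
        (-(u⁻¹ : (Matrix _ _ S.RegRing)ˣ).1 i a)) = (Pi.single (Sum.inl i) 1 : Idx N → S.RegRing) μ :=
      fun i => congrFun (S.KSstar_sum_single hH i) μ
    rw [KSstar_eq, map_sub, map_sum]
    simp only [map_smul, h1, smul_eq_mul]
    rcases μ with j | m'
    · rw [Finset.sum_eq_single j, Pi.single_eq_same, mul_one, Pi.single_eq_of_ne (by simp)]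
      · exact sub_self _
      · intro i _ hi
        rw [Pi.single_eq_of_ne (fun h => hi (Sum.inl_injective h).symm), mul_zero]
      · simp
    · rw [Finset.sum_eq_zero, sub_zero, ← KSstar_eq, KSstar_inr]
      · rw [Finsupp.single_apply, Pi.single_apply]
        by_cases h : m = m'
        · rw [h, if_pos rfl, if_pos rfl]
        · rw [if_neg, if_neg (fun h' => h (Sum.inr_injective h').symm)]
          intro h'
          simp only [Prod.mk.injEq, Nat.add_right_cancel_iff] at h'
          exact h (Prod.ext h'.1 h'.2)
      · intro i _
        rw [Pi.single_eq_of_ne (by simp), mul_zero]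

theorem pair_conormal_KS (μ σ : Idx N) :
    pair (S.KS σ) (S.conormal μ) = (Pi.single μ 1 : Idx N → S.RegRing) σ :=
  congrFun (S.KSstar_conormal μ) σ

theorem KSstar_support (φ : ℕ × Fin (N + 1) →₀ S.RegRing) :
    (Function.support (S.KSstar φ)).Finite := by
  refine ((Set.finite_range (Sum.inl : Fin (N + 1) → Idx N)).union
    ((φ.support.image fun m => (Sum.inr (m.1 - 1, m.2) : Idx N)).finite_toSet)).subset ?_
  rintro (i | m) h
  · exact Or.inl ⟨i, rfl⟩
  · right
    refine Finset.mem_coe.2 (Finset.mem_image.2 ⟨(m.1 + 1, m.2), Finsupp.mem_support_iff.2 ?_, rfl⟩)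
    rwa [← KSstar_inr]

theorem eq_sum_conormal (φ : ℕ × Fin (N + 1) →₀ S.RegRing) {s : Finset (Idx N)}
    (hs : ∀ μ, S.KSstar φ μ ≠ 0 → μ ∈ s) : φ = ∑ μ ∈ s, S.KSstar φ μ • S.conormal μ := by
  refine S.KSstar_injective (funext fun σ => ?_)
  rw [KSstar_eq S (∑ _ ∈ _, _), map_sum]
  simp only [map_smul, pair_conormal_KS, smul_eq_mul]
  by_cases h : σ ∈ s
  · rw [Finset.sum_eq_single σ, Pi.single_eq_same, mul_one]
    · intro τ _ hτ
      rw [Pi.single_eq_of_ne hτ.symm, mul_zero]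
    · exact fun h' => absurd h h'
  · rw [Finset.sum_eq_zero]
    · by_contra h'
      exact h (hs _ h')
    · intro τ hτ
      rw [Pi.single_eq_of_ne (by rintro rfl; exact h hτ), mul_zero]

/-- The constant term of a section of `F` in terms of the vectors `KS(∂/∂t^i)`. -/
theorem coeff_zero_eq (h : LVec N S.RegRing) (k : Fin (N + 1)) :
    (h k).coeff 0 = -∑ i, pair h (S.conormal (Sum.inl i)) * S.residCols k i := by
  obtain ⟨u, hu⟩ := S.isUnit_residCols
  have hH : (u⁻¹ : (Matrix _ _ S.RegRing)ˣ).1 * S.residCols = 1 := by rw [← hu, Units.inv_mul]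
  have hH' : S.residCols * (u⁻¹ : (Matrix _ _ S.RegRing)ˣ).1 = 1 := by rw [← hu, Units.mul_inv]
  have h1 : ∀ i, S.conormal (Sum.inl i) = ∑ a, Finsupp.single (0, a)
      (-(u⁻¹ : (Matrix _ _ S.RegRing)ˣ).1 i a) := fun i =>
    S.KSstar_injective ((S.KSstar_conormal _).trans (S.KSstar_sum_single hH i).symm)
  simp only [h1, map_sum, pair_single, Nat.cast_zero, Finset.sum_mul]
  rw [Finset.sum_comm, ← Finset.sum_neg_distrib]
  have h2 : ∀ a, -∑ i, -(u⁻¹ : (Matrix _ _ S.RegRing)ˣ).1 i a * (h a).coeff 0 * S.residCols k i =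
      (S.residCols * (u⁻¹ : (Matrix _ _ S.RegRing)ˣ).1) k a * (h a).coeff 0 := by
    intro a
    rw [Matrix.mul_apply, Finset.sum_mul, ← Finset.sum_neg_distrib]
    exact Finset.sum_congr rfl fun i _ => by ring
  simp only [h2, hH']
  rw [Finset.sum_eq_single k, Matrix.one_apply_eq, one_mul]
  · intro a _ ha
    rw [Matrix.one_apply_ne ha.symm, zero_mul]
  · simp

end CTP

namespace CTP

open TopologicalSpace Laurent HahnSeries

variable {N : ℕ} {U : Opens (Base N)} {S : CTP N U}

/-! ### Representing vectors of the projections -/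

theorem gram_symm (S : CTP N U) (i j : Fin (N + 1)) :
    negZ (ofPowerSeries ℤ _ (S.G i j)) = ofPowerSeries ℤ _ (S.G j i) := by
  rw [← pairing_frame, ← pairing_frame, ← S.pairing_symm]

theorem flat_eq_OmHom {A : Type} [CommRing A] (G : PMat N A) (b : LVec N A) (m : ℤ × Fin (N + 1)) :
    flat G b m = OmHom G b (frame m.2 m.1) := rfl

theorem flat_pull (a : LVec N (HolRing U)) (m : ℤ × Fin (N + 1)) :
    flat (S.pullMat S.G) (mapVec S.pull a) m = S.pull (flat S.G a m) :=
  flat_mapVec S.pull S.G a m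

namespace PseudoOpposite

variable (P : S.PseudoOpposite)

theorem proj_hol {h : LVec N (HolRing U)} (hh : h ∈ holPart) : P.proj h = h :=
  Submodule.projection_apply_of_mem_left P.isCompl hh

/-- On F the projection is the identity, so the functional vanishes on high powers of z and is Ω(a,
·) for some a. Write a = h + p along F ⊕ P. Then h is orthogonal to F by isotropy of F. It is
orthogonal to P as well, because the projection kills P and P is isotropic. By non-degeneracy h = 0,
so a lies in P. -/
theorem exists_dualVec (k : ℕ × Fin (N + 1)) : ∃ a ∈ P.carrier,
    ∀ s, Om S.G a s = (P.proj s k.2).coeff (k.1 : ℤ) := by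
  classical
  obtain ⟨a, ha⟩ := exists_flat_eq S.nondeg
    (ψ := fun m => (P.proj (frame m.2 m.1) k.2).coeff (k.1 : ℤ)) ⟨k.1, fun n hn j => by
      rw [P.proj_hol (frame_mem_holPart _ (by omega))]
      by_cases hj : k.2 = j
      · simp only
        rw [← hj, frame, Pi.single_eq_same, zPow, coeff_single_of_ne (by omega)]
      · simp only
        rw [frame, Pi.single_eq_of_ne hj, coeff_zero]⟩
  have h1 : ∀ (n : ℕ) j, flat S.G a (n, j) = Finsupp.single k 1 (n, j) := by
    intro n j
    rw [ha]
    simp only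
    rw [P.proj_hol (frame_mem_holPart _ (by omega)), Finsupp.single_apply]
    by_cases hj : k.2 = j
    · rw [← hj, frame, Pi.single_eq_same, zPow]
      by_cases hn : k.1 = n
      · rw [hn, coeff_single_same, if_pos]
        exact Prod.ext hn rfl
      · rw [coeff_single_of_ne (by exact_mod_cast hn), if_neg (fun h => hn (congrArg Prod.fst h))]
    · rw [frame, Pi.single_eq_of_ne hj, coeff_zero, if_neg (fun h => hj (congrArg Prod.snd h))]
  let f : LVec N (HolRing U) →ₗ[HolRing U] HolRing U :=
    { toFun := fun s => (P.proj s k.2).coeff (k.1 : ℤ)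
      map_add' := fun s s' => by rw [map_add]; rfl
      map_smul' := fun c s => by rw [map_smul]; rfl }
  have h2 : OmHom S.G a = f := by
    refine linearMap_ext (fun h hh => ?_) (fun n j _ => ?_)
    · rw [OmHom_apply, Om_eq_pair h1 hh, pair_single, one_mul]
      change _ = (P.proj h k.2).coeff (k.1 : ℤ)
      rw [P.proj_hol hh]
    · rw [OmHom_apply]
      exact congrFun ha (n, j)
  have h3 : ∀ s, Om S.G a s = (P.proj s k.2).coeff (k.1 : ℤ) := fun s => LinearMap.congr_fun h2 s
  refine ⟨a, ?_, h3⟩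
  have htop : a ∈ (holPart ⊔ P.carrier : Submodule (HolRing U) (LVec N (HolRing U))) := by
    rw [P.isCompl.sup_eq_top]
    trivial
  obtain ⟨h, hh, p, hp, rfl⟩ := Submodule.mem_sup.1 htop
  have h4 : OmHom S.G h = 0 := by
    refine LinearMap.ext fun s => ?_
    have hs : s ∈ (holPart ⊔ P.carrier : Submodule (HolRing U) (LVec N (HolRing U))) := by
      rw [P.isCompl.sup_eq_top]
      trivial
    obtain ⟨h', hh', p', hp', rfl⟩ := Submodule.mem_sup.1 hs
    have h5 : OmHom S.G h h' = 0 := Om_hol _ hh hh'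
    have h6 : OmHom S.G p p' = 0 := P.isotropic _ hp _ hp'
    have h7 : OmHom S.G (h + p) p' = 0 := by
      refine (h3 p').trans ?_
      have h8 : P.proj p' = 0 := Submodule.projection_apply_of_mem_right P.isCompl hp'
      rw [h8, Pi.zero_apply, coeff_zero]
    rw [map_add, LinearMap.add_apply, h6, add_zero] at h7
    rw [map_add, h5, h7, add_zero, LinearMap.zero_apply]
  have h9 : h = 0 := by
    refine flat_injective S.nondeg (funext fun m => ?_)
    have h10 := LinearMap.congr_fun h4 (frame m.2 m.1)
    have h11 : flat S.G (0 : LVec N (HolRing U)) m = OmHom S.G 0 (frame m.2 m.1) := rfl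
    rw [h11, map_zero]
    exact h10
  rw [h9, zero_add]
  exact hp

/-- The element of `P` which represents the `k`-th coordinate of the projection along `P`. -/
def dualVec (k : ℕ × Fin (N + 1)) : LVec N (HolRing U) := (P.exists_dualVec k).choose

theorem dualVec_mem (k : ℕ × Fin (N + 1)) : P.dualVec k ∈ P.carrier :=
  (P.exists_dualVec k).choose_spec.1

theorem Om_dualVec (k : ℕ × Fin (N + 1)) (s : LVec N (HolRing U)) :
    Om S.G (P.dualVec k) s = (P.proj s k.2).coeff (k.1 : ℤ) :=
  (P.exists_dualVec k).choose_spec.2 s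

/-- The section of `pr^* P` which represents `Π^* φ`. -/
def lift : (ℕ × Fin (N + 1) →₀ S.RegRing) →ₗ[S.RegRing] LVec N S.RegRing :=
  Finsupp.linearCombination S.RegRing fun k => mapVec S.pull (P.dualVec k)

theorem flat_lift (φ : ℕ × Fin (N + 1) →₀ S.RegRing) :
    flat (S.pullMat S.G) (P.lift φ) = piStar P φ := by
  funext m
  rw [flat_eq_OmHom, lift, Finsupp.linearCombination_apply, map_finsuppSum, Finsupp.sum,
    LinearMap.sum_apply, piStar, Finsupp.sum]
  refine Finset.sum_congr rfl fun k _ => ?_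
  rw [map_smul, LinearMap.smul_apply, smul_eq_mul, ← flat_eq_OmHom, flat_pull, flat, Om_dualVec]

theorem piStar_natCast (φ : ℕ × Fin (N + 1) →₀ S.RegRing) (n : ℕ) (j : Fin (N + 1)) :
    piStar P φ (n, j) = φ (n, j) := by
  rw [piStar]
  simp only
  rw [P.proj_hol (frame_mem_holPart _ (by omega)), ← pair_frame φ n j, pair_apply]
  refine Finset.sum_congr rfl fun k _ => ?_
  exact congrArg (fun v => φ k * HahnSeries.coeff v (k.1 : ℤ))
    (congrFun (mapVec_frame S.pull j (n : ℤ)) k.2)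

theorem Om_lift_hol (φ : ℕ × Fin (N + 1) →₀ S.RegRing) {h : LVec N S.RegRing} (hh : h ∈ holPart) :
    Om (S.pullMat S.G) (P.lift φ) h = pair h φ :=
  Om_eq_pair (fun n j => by rw [flat_lift, piStar_natCast]) hh

/-- The span of the pull-back of `P`. -/
def tot : Submodule S.RegRing (LVec N S.RegRing) :=
  Submodule.span S.RegRing (mapVec S.pull '' (P.carrier : Set (LVec N (HolRing U))))

theorem lift_mem (φ : ℕ × Fin (N + 1) →₀ S.RegRing) : P.lift φ ∈ P.tot := by
  rw [lift, Finsupp.linearCombination_apply]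
  exact Submodule.sum_mem _ fun k _ => Submodule.smul_mem _ _
    (Submodule.subset_span ⟨_, P.dualVec_mem k, rfl⟩)

theorem tot_isotropic {s s' : LVec N S.RegRing} (hs : s ∈ P.tot) (hs' : s' ∈ P.tot) :
    Om (S.pullMat S.G) s s' = 0 := by
  rw [← OmHom_apply]
  induction hs using Submodule.span_induction with
  | mem x hx =>
    obtain ⟨a, ha, rfl⟩ := hx
    induction hs' using Submodule.span_induction with
    | mem y hy =>
      obtain ⟨b, hb, rfl⟩ := hy
      have := Om_mapVec S.pull S.G a b
      rw [P.isotropic a ha b hb, map_zero] at this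
      exact this
    | zero => rw [map_zero]
    | add x y _ _ hx hy => rw [map_add, hx, hy, add_zero]
    | smul c x _ hx => rw [map_smul, hx, smul_zero]
  | zero => rw [map_zero, LinearMap.zero_apply]
  | add x y _ _ hx hy => rw [map_add, LinearMap.add_apply, hx, hy, add_zero]
  | smul c x _ hx => rw [map_smul, LinearMap.smul_apply, hx, smul_zero]

variable {P}

theorem nablaTot_mem_tot (hP : P.IsParallel) (ν : Idx N) {s : LVec N S.RegRing} (hs : s ∈ P.tot) :
    S.nablaTot ν s ∈ P.tot := by
  unfold nablaTot
  induction hs using Submodule.span_induction with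
  | mem x hx =>
    obtain ⟨a, ha, rfl⟩ := hx
    rcases ν with i | m
    · have h : conn (S.dTot (Sum.inl i)) (S.pullMat (S.C i)) (mapVec S.pull a) = _ :=
        conn_mapVec (dBase i) (S.C i) (S.dTot_pull_inl i) a
      rw [Sum.elim_inl, h]
      exact Submodule.subset_span ⟨_, hP i a ha, rfl⟩
    · rw [Sum.elim_inr, conn_mapVec_zero (S.dTot_pull_inr m)]
      exact Submodule.zero_mem _
  | zero =>
    have := conn_smul (S.dTot ν) (Sum.elim (fun i => S.pullMat (S.C i)) (fun _ => 0) ν) 0 0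
    rw [zero_smul, map_zero, zero_smul, zero_smul, zero_add] at this
    rw [this]
    exact Submodule.zero_mem _
  | add x y _ _ hx hy =>
    rw [conn_add]
    exact Submodule.add_mem _ hx hy
  | smul c x hx' hx =>
    rw [conn_smul]
    exact Submodule.add_mem _ (Submodule.smul_mem _ _ hx') (Submodule.smul_mem _ _ hx)

end PseudoOpposite

/-! ### The connection on the total space -/

theorem nondeg_tot (S : CTP N U) : IsUnit ((S.pullMat S.G).map PowerSeries.constantCoeff).det :=
  isUnit_det_map S.nondeg

theorem gram_symm_tot (S : CTP N U) (i j : Fin (N + 1)) :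
    negZ (ofPowerSeries ℤ _ (S.pullMat S.G i j)) = ofPowerSeries ℤ _ (S.pullMat S.G j i) :=
  negZ_eq_map S.gram_symm i j

/-- Along the base this is the pulled back flatness of the pairing. Along the fibres the Gram matrix
is constant and the connection is plain differentiation. -/
theorem Om_nablaTot (S : CTP N U) (ν : Idx N) (s s' : LVec N S.RegRing) :
    S.dTot ν (Om (S.pullMat S.G) s s') = Om (S.pullMat S.G) (S.nablaTot ν s) s' +
      Om (S.pullMat S.G) s (S.nablaTot ν s') := by
  refine IsFlatFor.Om ?_ s s'
  rcases ν with i | m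
  · exact (isFlatFor_of_pairing (S.pairing_flat i)).map (S.dTot_pull_inl i)
  · exact isFlatFor_zero (S.dTot_pull_inr m)

/-- Because Ω is compatible with the connection, the dual connection corresponds to the connection
itself. Christoffel symbols and torsion thereby become Ω-products involving derivatives of lifts. -/
theorem dualNabla_flat (S : CTP N U) (ν : Idx N) (b : LVec N S.RegRing) :
    S.dualNabla ν (flat (S.pullMat S.G) b) = flat (S.pullMat S.G) (S.nablaTot ν b) := by
  funext m
  rw [dualNabla, evalDual_flat, sub_eq_iff_eq_add]
  exact S.Om_nablaTot ν b _

theorem propagator_eq (P Q : S.PseudoOpposite) (α β : Idx N) : propagator P Q α β =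
    Om (S.pullMat S.G) (P.lift (S.conormal α)) (Q.lift (S.conormal β)) := by
  rw [propagator, OmDual, ← P.flat_lift, ← Q.flat_lift, sharp_flat S.nondeg_tot,
    sharp_flat S.nondeg_tot]

theorem christoffel_eq (Q : S.PseudoOpposite) (ρ ν σ : Idx N) : christoffel Q ρ ν σ =
    -Om (S.pullMat S.G) (S.nablaTot ν (Q.lift (S.conormal ρ))) (S.KS σ) := by
  rw [christoffel, ← Q.flat_lift, dualNabla_flat, evalDual_flat]

theorem torsion_eq (Q : S.PseudoOpposite) (ν α β : Idx N) : torsion Q ν α β =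
    Om (S.pullMat S.G) (S.nablaTot ν (Q.lift (S.conormal α))) (Q.lift (S.conormal β)) := by
  rw [torsion, OmDual, ← Q.flat_lift, ← Q.flat_lift, dualNabla_flat, sharp_flat S.nondeg_tot,
    sharp_flat S.nondeg_tot]

theorem christoffel_finite (Q : S.PseudoOpposite) (ρ ν : Idx N) :
    (Function.support (christoffel Q ρ ν)).Finite := by
  obtain ⟨φ, hφ⟩ := exists_finsupp_flat (S.pullMat S.G) (S.nablaTot ν (Q.lift (S.conormal ρ)))
  refine (S.KSstar_support φ).subset fun σ hσ => ?_
  rw [Function.mem_support, christoffel_eq, neg_ne_zero, Om_eq_pair hφ (S.KS_mem_holPart σ)] at hσ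
  exact hσ

/-- The expansion of the derivative of `Π^* d𝗑^α` on sections of `F`. -/
theorem Om_nablaTot_lift (P : S.PseudoOpposite) (α ν : Idx N) {h : LVec N S.RegRing}
    (hh : h ∈ holPart) {s : Finset (Idx N)} (hs : ∀ ρ, christoffel P α ν ρ ≠ 0 → ρ ∈ s) :
    Om (S.pullMat S.G) (S.nablaTot ν (P.lift (S.conormal α))) h =
      -∑ ρ ∈ s, christoffel P α ν ρ * pair h (S.conormal ρ) := by
  obtain ⟨φ, hφ⟩ := exists_finsupp_flat (S.pullMat S.G) (S.nablaTot ν (P.lift (S.conormal α)))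
  have h1 : ∀ ρ, christoffel P α ν ρ = -S.KSstar φ ρ := fun ρ => by
    rw [christoffel_eq, Om_eq_pair hφ (S.KS_mem_holPart ρ), KSstar_eq]
  have h2 := congrArg (pair h) (S.eq_sum_conormal φ (s := s) fun ρ hρ => hs ρ (by
    rwa [h1, neg_ne_zero]))
  rw [Om_eq_pair hφ hh, h2, map_sum, ← Finset.sum_neg_distrib]
  refine Finset.sum_congr rfl fun ρ _ => ?_
  rw [h1, map_smul, smul_eq_mul, neg_mul, neg_neg]

/-! ### The difference of two pseudo-opposite modules -/

section Difference

variable (P Q : S.PseudoOpposite)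

/-- The difference of the representatives of `Π_Q^* d𝗑^α` and of `Π_P^* d𝗑^α`. -/
def diffVec (α : Idx N) : LVec N S.RegRing := Q.lift (S.conormal α) - P.lift (S.conormal α)

/-- Both lifts represent functionals with the same restriction to F, so their difference is
orthogonal to F. -/
theorem diffVec_mem (α : Idx N) : diffVec P Q α ∈ holPart := by
  refine mem_holPart_of_flat S.nondeg_tot fun n j => ?_
  have h : flat (S.pullMat S.G) (diffVec P Q α) (n, j) =
      OmHom (S.pullMat S.G) (diffVec P Q α) (frame j n) := rfl
  rw [h, diffVec, map_sub, LinearMap.sub_apply]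
  have h1 := congrFun (Q.flat_lift (S.conormal α)) (n, j)
  have h2 := congrFun (P.flat_lift (S.conormal α)) (n, j)
  rw [PseudoOpposite.piStar_natCast] at h1 h2
  exact sub_eq_zero.2 (h1.trans h2.symm)

/-- The form `d𝗑^α` applied to a section of F is Ω of its P-lift with that section. Inserting the
difference, the product of two P-lifts vanishes and the propagator remains. -/
theorem pair_diffVec (α β : Idx N) :
    pair (diffVec P Q β) (S.conormal α) = propagator P Q α β := by
  rw [← P.Om_lift_hol _ (diffVec_mem P Q β), diffVec, ← OmHom_apply, map_sub, OmHom_apply,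
    OmHom_apply, ← propagator_eq, P.tot_isotropic (P.lift_mem _) (P.lift_mem _), sub_zero]

/-- Expand the vanishing product of two Q-lifts, each written as a P-lift plus a difference in F.
The P-P and F-F products vanish, and the two mixed ones are the propagators with opposite signs. -/
theorem propagator_symm (α β : Idx N) : propagator P Q α β = propagator P Q β α := by
  have h : OmHom (S.pullMat S.G) (Q.lift (S.conormal α)) (Q.lift (S.conormal β)) = 0 :=
    Q.tot_isotropic (Q.lift_mem _) (Q.lift_mem _)
  have e : ∀ γ, Q.lift (S.conormal γ) = P.lift (S.conormal γ) + diffVec P Q γ := fun γ => by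
    rw [diffVec, add_sub_cancel]
  simp only [e, map_add, LinearMap.add_apply, OmHom_apply] at h
  rw [P.tot_isotropic (P.lift_mem _) (P.lift_mem _), Om_hol _ (diffVec_mem P Q α) (diffVec_mem P Q β),
    P.Om_lift_hol _ (diffVec_mem P Q β), Om_swap S.gram_symm_tot (diffVec P Q α),
    P.Om_lift_hol _ (diffVec_mem P Q α), pair_diffVec, pair_diffVec] at h
  linear_combination h

theorem pairing₀_symm (v w : Fin (N + 1) → S.RegRing) : S.pairing₀ v w = S.pairing₀ w v := by
  have h0 : ∀ i j, PowerSeries.constantCoeff (S.pullMat S.G i j) =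
      PowerSeries.constantCoeff (S.pullMat S.G j i) := by
    intro i j
    have := congrArg (fun f => HahnSeries.coeff f 0) (S.gram_symm_tot i j)
    simp only [negZ_coeff, ofPowerSeries_coeff_zero] at this
    simpa using this
  unfold pairing₀
  rw [Finset.sum_comm]
  refine Finset.sum_congr rfl fun i _ => Finset.sum_congr rfl fun j _ => ?_
  rw [h0 j i]
  ring

variable (S) in
/-- The pairing on `F_0` as a bilinear form. -/
def pairing₀Hom : (Fin (N + 1) → S.RegRing) →ₗ[S.RegRing] (Fin (N + 1) → S.RegRing) →ₗ[S.RegRing]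
    S.RegRing :=
  Matrix.toLinearMap₂' S.RegRing ((S.pullMat S.G).map PowerSeries.constantCoeff)

theorem pairing₀Hom_apply (v w : Fin (N + 1) → S.RegRing) :
    S.pairing₀Hom v w = S.pairing₀ v w := by
  rw [pairing₀Hom, Matrix.toLinearMap₂'_apply, pairing₀]
  refine Finset.sum_congr rfl fun i _ => Finset.sum_congr rfl fun j _ => ?_
  simp only [smul_eq_mul, Matrix.map_apply]
  ring

theorem coeff_zero_eq_sum (h : LVec N S.RegRing) : (fun k => (h k).coeff 0) =
    -∑ i, pair h (S.conormal (Sum.inl i)) • (S.residTot i).mulVec S.x₁ := by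
  funext k
  rw [S.coeff_zero_eq h k, Pi.neg_apply, Finset.sum_apply]
  rfl

/-- The symplectic form of the derivative of a section of `F` with a section of `F` is given by the
Yukawa coupling. -/
theorem Om_nablaTot_hol (ν : Idx N) {h h' : LVec N S.RegRing} (hh : h ∈ holPart)
    (hh' : h' ∈ holPart) : Om (S.pullMat S.G) (S.nablaTot ν h) h' =
      ∑ i, ∑ k, pair h (S.conormal (Sum.inl i)) * pair h' (S.conormal (Sum.inl k)) *
        S.yukawa (Sum.inl k) ν (Sum.inl i) := by
  rw [nablaTot, Om_conn_hol hh hh']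
  rcases ν with j | m
  · have e : ∑ a, ∑ b, (∑ k, PowerSeries.constantCoeff (S.pullMat (S.C j) a k) * (h k).coeff 0) *
        PowerSeries.constantCoeff (S.pullMat S.G a b) * (h' b).coeff 0 =
        S.pairing₀Hom ((S.residTot j).mulVec fun k => (h k).coeff 0) (fun k => (h' k).coeff 0) :=
      (pairing₀Hom_apply _ _).symm
    refine e.trans ?_
    -- Both values at z = 0 are expanded in the vectors `C_i(t,0) x_1`; the two minus signs cancel.
    rw [coeff_zero_eq_sum, coeff_zero_eq_sum, Matrix.mulVec_neg, map_neg, map_neg,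
      LinearMap.neg_apply, neg_neg, map_sum, ← Matrix.mulVecLin_apply, map_sum, map_sum]
    simp only [LinearMap.sum_apply, map_smul, LinearMap.smul_apply, Matrix.mulVecLin_apply,
      Matrix.mulVec_mulVec, smul_eq_mul, pairing₀Hom_apply]
    simp only [Finset.mul_sum]
    rw [Finset.sum_comm]
    refine Finset.sum_congr rfl fun i _ => Finset.sum_congr rfl fun k _ => ?_
    rw [pairing₀_symm, yukawa]
    ring
  · simp [yukawa]

/-- The difference is Ω of the derivative of `diffVec` with `KS σ`. Both vectors lie in F, so this
is a Yukawa coupling with one index contracted with the propagator. -/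
theorem christoffel_sub (ρ ν σ : Idx N) : christoffel P ρ ν σ - christoffel Q ρ ν σ =
    ∑ i, propagator P Q (Sum.inl i) ρ * S.yukawa σ ν (Sum.inl i) := by
  have e : Om (S.pullMat S.G) (S.nablaTot ν (Q.lift (S.conormal ρ))) (S.KS σ) =
      Om (S.pullMat S.G) (S.nablaTot ν (P.lift (S.conormal ρ))) (S.KS σ) +
      Om (S.pullMat S.G) (S.nablaTot ν (diffVec P Q ρ)) (S.KS σ) := by
    have h : Q.lift (S.conormal ρ) = P.lift (S.conormal ρ) + diffVec P Q ρ := by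
      rw [diffVec, add_sub_cancel]
    rw [h, nablaTot, conn_add, ← OmHom_apply, map_add]
    rfl
  have e2 : christoffel P ρ ν σ - christoffel Q ρ ν σ =
      Om (S.pullMat S.G) (S.nablaTot ν (diffVec P Q ρ)) (S.KS σ) := by
    rw [christoffel_eq, christoffel_eq, e]
    ring
  rw [e2, Om_nablaTot_hol ν (diffVec_mem P Q ρ) (S.KS_mem_holPart σ)]
  refine Finset.sum_congr rfl fun i _ => ?_
  simp only [pair_diffVec, pair_conormal_KS]
  rcases σ with s | m
  · rw [Finset.sum_eq_single s, Pi.single_eq_same, mul_one]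
    · intro k _ hk
      rw [Pi.single_eq_of_ne (fun h => hk (Sum.inl_injective h).symm), mul_zero, zero_mul]
    · simp
  · rw [Finset.sum_eq_zero]
    · simp [yukawa]
    · intro k _
      rw [Pi.single_eq_of_ne (by simp), mul_zero, zero_mul]

/-- The background torsion in terms of the covariant derivative of the propagator. -/
theorem torsion_eq_sub (hP : P.IsParallel) (ν α β : Idx N) {s s' : Finset (Idx N)}
    (hs : ∀ ρ, christoffel P α ν ρ ≠ 0 → ρ ∈ s) (hs' : ∀ ρ, christoffel P β ν ρ ≠ 0 → ρ ∈ s') :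
    torsion Q ν α β = ∑ i, ∑ k, propagator P Q (Sum.inl i) α * propagator P Q (Sum.inl k) β *
        S.yukawa (Sum.inl k) ν (Sum.inl i) -
      (S.dTot ν (propagator P Q α β) + ∑ ρ ∈ s, christoffel P α ν ρ * propagator P Q ρ β +
        ∑ ρ ∈ s', christoffel P β ν ρ * propagator P Q ρ α) := by
  have e : ∀ γ, Q.lift (S.conormal γ) = P.lift (S.conormal γ) + diffVec P Q γ := fun γ => by
    rw [diffVec, add_sub_cancel]
  have h1 : torsion Q ν α β =
      Om (S.pullMat S.G) (S.nablaTot ν (P.lift (S.conormal α))) (diffVec P Q β) +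
      (Om (S.pullMat S.G) (S.nablaTot ν (diffVec P Q α)) (P.lift (S.conormal β)) +
      Om (S.pullMat S.G) (S.nablaTot ν (diffVec P Q α)) (diffVec P Q β)) := by
    -- The P-P part vanishes because P is parallel and isotropic. The curvature of Q thus enters
    -- only through the differences in F.
    have h0 : OmHom (S.pullMat S.G) (S.nablaTot ν (P.lift (S.conormal α)))
        (P.lift (S.conormal β)) = 0 :=
      P.tot_isotropic (PseudoOpposite.nablaTot_mem_tot hP ν (P.lift_mem _)) (P.lift_mem _)
    have h2 : S.nablaTot ν (Q.lift (S.conormal α)) =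
        S.nablaTot ν (P.lift (S.conormal α)) + S.nablaTot ν (diffVec P Q α) := by
      rw [e, nablaTot, conn_add]
    rw [torsion_eq, h2, e, ← OmHom_apply, map_add, map_add, LinearMap.add_apply,
      LinearMap.add_apply, h0]
    simp only [OmHom_apply]
    ring
  have h2 : Om (S.pullMat S.G) (diffVec P Q α) (P.lift (S.conormal β)) = -propagator P Q α β := by
    rw [Om_swap S.gram_symm_tot, P.Om_lift_hol _ (diffVec_mem P Q α), pair_diffVec, propagator_symm]
  -- The Leibniz rule trades the derivative of the difference, paired with a P-lift, for the
  -- derivative of the propagator and the second Christoffel term.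
  have h3 := S.Om_nablaTot ν (diffVec P Q α) (P.lift (S.conormal β))
  rw [h2, map_neg, Om_swap S.gram_symm_tot (diffVec P Q α),
    Om_nablaTot_lift P β ν (diffVec_mem P Q α) hs'] at h3
  rw [h1, Om_nablaTot_lift P α ν (diffVec_mem P Q β) hs,
    Om_nablaTot_hol ν (diffVec_mem P Q α) (diffVec_mem P Q β)]
  simp only [pair_diffVec] at h3 ⊢
  linear_combination -h3

end Difference

end CTP

/-! ### Derivations acting coefficientwise -/

/-- The derivations of a commutative ring. -/
abbrev IntDer (A : Type) [CommRing A] : Type := Derivation ℤ A A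

/-- The derivation given by an additive map with the Leibniz rule. -/
def IntDer.ofLeibniz {A : Type} [CommRing A] (D : A →+ A)
    (h : ∀ x y, D (x * y) = x * D y + y * D x) : IntDer A :=
  Derivation.mk' D.toIntLinearMap h

section Coefficientwise

variable {A : Type} [CommRing A]

/-- The coefficientwise action of a derivation on power series. -/
def psDeriv (D : IntDer A) : IntDer (PowerSeries A) :=
  IntDer.ofLeibniz
    { toFun := fun f => PowerSeries.mk fun n => D (PowerSeries.coeff n f)
      map_zero' := by ext; simp
      map_add' := fun f g => by ext; simp }
    (fun f g => by
      ext n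
      change PowerSeries.coeff n (PowerSeries.mk fun n => D (PowerSeries.coeff n (f * g))) =
        PowerSeries.coeff n (f * (PowerSeries.mk fun n => D (PowerSeries.coeff n g)) +
          g * (PowerSeries.mk fun n => D (PowerSeries.coeff n f)))
      rw [mul_comm g, map_add, PowerSeries.coeff_mk, PowerSeries.coeff_mul, PowerSeries.coeff_mul,
        PowerSeries.coeff_mul, map_sum, ← Finset.sum_add_distrib]
      refine Finset.sum_congr rfl fun p _ => ?_
      simp only [PowerSeries.coeff_mk, D.leibniz, smul_eq_mul]
      ring)

theorem coeff_psDeriv (D : Derivation ℤ A A) (f : PowerSeries A) (n : ℕ) :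
    PowerSeries.coeff n (psDeriv D f) = D (PowerSeries.coeff n f) := by
  change PowerSeries.coeff n (PowerSeries.mk fun n => D (PowerSeries.coeff n f)) = _
  rw [PowerSeries.coeff_mk]

theorem psDeriv_X (D : Derivation ℤ A A) : psDeriv D (PowerSeries.X : PowerSeries A) = 0 := by
  ext n
  rw [coeff_psDeriv, PowerSeries.coeff_X]
  split_ifs <;> simp

theorem psDeriv_C (D : Derivation ℤ A A) (a : A) :
    psDeriv D (PowerSeries.C a) = PowerSeries.C (D a) := by
  ext n
  rw [coeff_psDeriv, PowerSeries.coeff_C, PowerSeries.coeff_C]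
  split_ifs <;> simp

/-- The coefficientwise action of a derivation on a polynomial. -/
def polyMap (D : Derivation ℤ A A) (f : Polynomial A) : Polynomial A :=
  ∑ n ∈ f.support, Polynomial.monomial n (D (f.coeff n))

theorem coeff_polyMap (D : Derivation ℤ A A) (f : Polynomial A) (n : ℕ) :
    (polyMap D f).coeff n = D (f.coeff n) := by
  rw [polyMap, Polynomial.finsetSum_coeff]
  simp only [Polynomial.coeff_monomial, Finset.sum_ite_eq', Polynomial.mem_support_iff]
  split_ifs with h
  · rfl
  · rw [Polynomial.notMem_support_iff.1 h, map_zero]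

/-- The coefficientwise action of a derivation on polynomials. -/
def polyDeriv (D : IntDer A) : IntDer (Polynomial A) :=
  IntDer.ofLeibniz
    { toFun := polyMap D
      map_zero' := by ext; simp [coeff_polyMap]
      map_add' := fun f g => by ext; simp [coeff_polyMap] }
    (fun f g => by
      ext n
      change (polyMap D (f * g)).coeff n = (f * polyMap D g + g * polyMap D f).coeff n
      rw [mul_comm g, Polynomial.coeff_add, coeff_polyMap, Polynomial.coeff_mul, Polynomial.coeff_mul,
        Polynomial.coeff_mul, map_sum, ← Finset.sum_add_distrib]
      refine Finset.sum_congr rfl fun p _ => ?_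
      simp only [coeff_polyMap, D.leibniz, smul_eq_mul]
      ring)

theorem coeff_polyDeriv (D : Derivation ℤ A A) (f : Polynomial A) (n : ℕ) :
    (polyDeriv D f).coeff n = D (f.coeff n) := coeff_polyMap D f n

theorem eval_polyDeriv (D : Derivation ℤ A A) {r : A} (hr : D r = 0) (f : Polynomial A) :
    (polyDeriv D f).eval r = D (f.eval r) := by
  induction f using Polynomial.induction_on' with
  | add p q hp hq => rw [map_add, Polynomial.eval_add, Polynomial.eval_add, map_add, hp, hq]
  | monomial n a =>
    have h : polyDeriv D (Polynomial.monomial n a) = Polynomial.monomial n (D a) := by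
      ext m
      rw [coeff_polyDeriv, Polynomial.coeff_monomial, Polynomial.coeff_monomial]
      split_ifs <;> simp
    rw [h, Polynomial.eval_monomial, Polynomial.eval_monomial, D.leibniz, D.leibniz_pow, hr]
    simp [mul_comm]

end Coefficientwise

/-! ### Change of coefficients, covariant derivatives and quadratic forms for generating functions.
-/

namespace Hz

variable {I K K' : Type} [CommRing K] [CommRing K']

/-- The action of a homomorphism of the coefficients. -/
def map (φ : K →+* K') : Hz I K →+* Hz I K' where
  toFun f := fun m => φ (f m)
  map_zero' := funext fun _ => map_zero φ
  map_add' f g := funext fun _ => map_add φ _ _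
  map_one' := funext fun m => by
    change φ (const 1 m) = const 1 m
    unfold const
    split_ifs <;> simp
  map_mul' f g := funext fun m => by
    refine Eq.trans ?_ (mul_apply (K := K') (fun m => φ (f m)) (fun m => φ (g m)) m).symm
    change φ ((f * g) m) = _
    rw [mul_apply, map_multiset_sum, Multiset.map_map]
    simp only [Function.comp_def, map_mul]

theorem map_apply (φ : K →+* K') (f : Hz I K) (m : Multiset I) : map φ f m = φ (f m) := rfl

theorem dIdx_map (φ : K →+* K') (a : I) (f : Hz I K) : dIdx a (map φ f) = map φ (dIdx a f) := rfl

theorem map_const (φ : K →+* K') (c : K) : map φ (const c : Hz I K) = const (φ c) := by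
  funext m
  rw [map_apply]
  unfold const
  split_ifs <;> simp

theorem map_var (φ : K →+* K') (a : I) : map φ (var a : Hz I K) = var a := by
  classical
  funext m
  rw [map_apply]
  unfold var
  split_ifs <;> simp

theorem map_dCoeff {φ : K →+* K'} {D : Derivation ℤ K K} {D' : Derivation ℤ K' K'}
    (h : ∀ x, φ (D x) = D' (φ x)) (f : Hz I K) : map φ (dCoeff D f) = dCoeff D' (map φ f) :=
  funext fun _ => h _

theorem const_add (a b : K) : (const (a + b) : Hz I K) = const a + const b := by
  funext m
  rw [add_apply]
  unfold const
  split_ifs <;> simp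

theorem const_zero : (const 0 : Hz I K) = 0 := by
  funext m
  unfold const
  split_ifs <;> rfl

theorem const_one : (const 1 : Hz I K) = 1 := rfl

variable [Fintype I]

/-- The covariant derivative `D - ∑ Γ^c_a y^a ∂_c`. -/
def covD (D : Derivation ℤ K K) (Γ : I → I → K) : Derivation ℤ (Hz I K) (Hz I K) :=
  dCoeff D - ∑ c, ∑ a, (const (Γ c a) * var a : Hz I K) • dIdx c

theorem covD_apply (D : Derivation ℤ K K) (Γ : I → I → K) (f : Hz I K) :
    covD D Γ f = dCoeff D f - ∑ c, ∑ a, const (Γ c a) * var a * dIdx c f := by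
  unfold covD
  rw [Derivation.sub_apply]
  congr 1
  have h : ∀ {ι : Type} (s : Finset ι) (X : ι → Derivation ℤ (Hz I K) (Hz I K)),
      (∑ i ∈ s, X i) f = ∑ i ∈ s, X i f := fun s X => by
    rw [← Derivation.coeFnAddMonoidHom_apply, map_sum, Finset.sum_apply]
    rfl
  simp only [h, Derivation.smul_apply, smul_eq_mul]

/-- The commutator arises only when the derivative hits the variable in a coefficient Γ^c_e y^e. -/
theorem dIdx_covD (D : Derivation ℤ K K) (Γ : I → I → K) (a : I) (f : Hz I K) :
    dIdx a (covD D Γ f) = covD D Γ (dIdx a f) - ∑ c, const (Γ c a) * dIdx c f := by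
  classical
  have h : ∀ c e, dIdx a (const (Γ c e) * var e * dIdx c f) =
      const (Γ c e) * var e * dIdx c (dIdx a f) + if a = e then const (Γ c a) * dIdx c f else 0 := by
    intro c e
    rw [Derivation.leibniz, Derivation.leibniz, dIdx_const, dIdx_var, dIdx_comm]
    by_cases hae : a = e
    · subst hae
      simp only [smul_eq_mul, if_true]
      ring
    · simp [hae]
  rw [covD_apply, covD_apply, map_sub, dIdx_dCoeff, map_sum]
  simp only [map_sum, h, Finset.sum_add_distrib, Finset.sum_ite_eq, Finset.mem_univ, if_true]
  ring

theorem covD_const (D : Derivation ℤ K K) (Γ : I → I → K) (c : K) :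
    covD D Γ (const c) = const (D c) := by
  rw [covD_apply, dCoeff_const]
  simp [dIdx_const]

theorem map_covD {φ : K →+* K'} {D : Derivation ℤ K K} {D' : Derivation ℤ K' K'}
    (h : ∀ x, φ (D x) = D' (φ x)) (Γ : I → I → K) (f : Hz I K) :
    map φ (covD D Γ f) = covD D' (fun a b => φ (Γ a b)) (map φ f) := by
  rw [covD_apply, covD_apply, map_sub, map_dCoeff h, map_sum]
  simp only [map_sum, map_mul, map_const, map_var, dIdx_map]

/-- The quadratic form of a symmetric matrix. -/
def quadForm (Y : I → I → K) : Hz I K := ∑ a, ∑ b, const (Y a b) * (var a * var b)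

theorem dIdx_quadForm {Y : I → I → K} (hY : ∀ a b, Y a b = Y b a) (a : I) :
    dIdx a (quadForm Y) = 2 * ∑ b, const (Y a b) * var b := by
  classical
  have h : ∀ c e, dIdx a (const (Y c e) * (var c * var e)) =
      (if a = c then const (Y a e) * var e else 0) +
        if a = e then const (Y a c) * var c else 0 := by
    intro c e
    rw [Derivation.leibniz, Derivation.leibniz, dIdx_const, dIdx_var, dIdx_var]
    by_cases h1 : a = c <;> by_cases h2 : a = e <;> simp_all [mul_add]
  unfold quadForm
  rw [map_sum]
  simp only [map_sum, h, Finset.sum_add_distrib, Finset.sum_ite_eq, Finset.mem_univ, if_true]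
  rw [Finset.sum_comm]
  simp only [Finset.sum_ite_eq, Finset.mem_univ, if_true]
  ring

theorem dIdx_dIdx_quadForm {Y : I → I → K} (hY : ∀ a b, Y a b = Y b a) (a b : I) :
    dIdx a (dIdx b (quadForm Y)) = 2 * const (Y a b) := by
  classical
  rw [dIdx_quadForm hY]
  have h : ∀ c, dIdx a (const (Y b c) * var c : Hz I K) = if a = c then const (Y b a) else 0 := by
    intro c
    rw [Derivation.leibniz, dIdx_const, dIdx_var]
    by_cases h1 : a = c <;> simp_all
  rw [Derivation.leibniz, map_sum]
  simp only [h, Finset.sum_ite_eq, Finset.mem_univ, if_true]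
  rw [hY b a]
  have h2 : dIdx a (2 : Hz I K) = 0 := Derivation.map_natCast (dIdx a) 2
  rw [h2]
  simp

theorem map_quadForm (φ : K →+* K') (Y : I → I → K) :
    map φ (quadForm Y : Hz I K) = quadForm fun a b => φ (Y a b) := by
  unfold quadForm
  rw [map_sum]
  simp only [map_sum, map_mul, map_const, map_var]

theorem dCoeff_quadForm {D : Derivation ℤ K K} {Y : I → I → K} (hY : ∀ a b, D (Y a b) = 0) :
    dCoeff D (quadForm Y : Hz I K) = 0 := by
  unfold quadForm
  rw [map_sum]
  refine Finset.sum_eq_zero fun a _ => ?_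
  rw [map_sum]
  refine Finset.sum_eq_zero fun b _ => ?_
  rw [Derivation.leibniz, Derivation.leibniz, dCoeff_const, dCoeff_var, dCoeff_var, hY, const_zero]
  simp

end Hz

/-! ### The defect of the anomaly equation for generating functions. -/

namespace Heat

open Hz

variable {I K K' : Type} [CommRing K] [CommRing K'] [Fintype I]

/-- The covariant derivative of the propagator. -/
def covMat (D : Derivation ℤ K K) (Γ Δ : I → I → K) (a b : I) : K :=
  D (Δ a b) + ∑ c, Γ a c * Δ c b + ∑ c, Γ b c * Δ a c

/-- The defect of the anomaly equation. -/
def defect (h s c : K) (Δ Y Γ : I → I → K) (D : Derivation ℤ K K) (ν : I) (F : Hz I K) : Hz I K :=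
  anomaly dIdx (const h) (const s) F (quadForm Y) (const c) (fun a b => const (Δ a b))
    (fun a b => const (Y a b)) (fun a b => const (covMat D Γ Δ a b)) (covD D Γ) ν

theorem const_covMat (D : Derivation ℤ K K) (Γ Δ : I → I → K) (a b : I) :
    (const (covMat D Γ Δ a b) : Hz I K) = const (D (Δ a b)) + ∑ c, const (Γ a c) * const (Δ c b) +
      ∑ c, const (Γ b c) * const (Δ a c) := by
  have h : ∀ (f : I → K), (const (∑ c, f c) : Hz I K) = ∑ c, const (f c) := fun f =>
    map_sum (⟨⟨const, const_zero⟩, const_add⟩ : K →+ Hz I K) f _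
  simp only [covMat, const_add, h, Wick.const_mul]

theorem defect_heat {h s c : K} {Δ Y Γ : I → I → K} {T D : Derivation ℤ K K} (ν : I) {F : Hz I K}
    (hTh : T h = 0) (hDh : D h = 0) (hTs : T s = 1) (hΔs : ∀ a b, Δ a b = Δ b a)
    (hYs : ∀ a b, Y a b = Y b a) (hTΔ : ∀ a b, T (Δ a b) = 0) (hTY : ∀ a b, T (Y a b) = 0)
    (hTΓ : ∀ a b, T (Γ a b) = 0) (hTc : T c = 0) (hTD : ∀ x, T (D x) = D (T x))
    (hTF : 2 * dCoeff T F = quad dIdx (const h) (fun a b => const (Δ a b)) F) :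
    2 * dCoeff T (defect h s c Δ Y Γ D ν F) =
      const h * lap dIdx (fun a b => const (Δ a b)) (defect h s c Δ Y Γ D ν F) +
      2 * bil dIdx (fun a b => const (Δ a b)) F (defect h s c Δ Y Γ D ν F) := by
  have hz : ∀ {x : K}, T x = 0 → dCoeff T (const x : Hz I K) = 0 := fun hx => by
    rw [dCoeff_const, hx, const_zero]
  refine anomaly_heat (Γ := fun a b => const (Γ a b)) dIdx_comm ν (fun a => dIdx_const a h) (hz hTh)
    ?_ (fun a => dIdx_const a s) ?_ (fun a b c => dIdx_const c _) (fun a b c => dIdx_const c _)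
    (fun a b c => dIdx_const c _) (fun a b => by rw [hΔs]) (fun a b => by rw [hYs])
    (fun a b => hz (hTΔ a b)) (fun a b => hz (hTY a b)) (fun a b => hz (hTΓ a b))
    (dIdx_dIdx_quadForm hYs) (dCoeff_quadForm hTY) (fun a => dIdx_const a c) (hz hTc)
    (fun a f => (dIdx_dCoeff T a f).symm) ?_ (fun a f => dIdx_covD D Γ a f) ?_ hTF
  · rw [covD_const, hDh, const_zero]
  · rw [dCoeff_const, hTs, const_one]
  · intro f
    rw [covD_apply, covD_apply, map_sub, map_sum]
    congr 1
    · exact funext fun m => hTD (f m)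
    · refine Finset.sum_congr rfl fun x _ => ?_
      rw [map_sum]
      refine Finset.sum_congr rfl fun y _ => ?_
      rw [Derivation.leibniz, Derivation.leibniz, hz (hTΓ x y), dCoeff_var, dIdx_dCoeff]
      simp
  · intro a b
    rw [const_covMat, covD_const]

/-- Naturality in the coefficient ring, needed to set the edge-counting variable to 0 and to 1. -/
theorem map_defect {φ : K →+* K'} {D : Derivation ℤ K K} {D' : Derivation ℤ K' K'}
    (hφ : ∀ x, φ (D x) = D' (φ x)) (h s c : K) (Δ Y Γ : I → I → K) (ν : I) (F : Hz I K) :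
    map φ (defect h s c Δ Y Γ D ν F) = defect (φ h) (φ s) (φ c) (fun a b => φ (Δ a b))
      (fun a b => φ (Y a b)) (fun a b => φ (Γ a b)) D' ν (map φ F) := by
  have hm : ∀ a b, φ (covMat D Γ Δ a b) =
      covMat D' (fun a b => φ (Γ a b)) (fun a b => φ (Δ a b)) a b := by
    intro a b
    simp only [covMat, map_add, map_sum, map_mul, hφ]
  simp only [defect, anomaly, quad, lap, bil, map_add, map_sub, map_mul, map_sum, map_pow, map_ofNat,
    Hz.map_const, ← dIdx_map, map_covD hφ, map_quadForm, hm]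

end Heat

namespace Heat

open Hz Wick

variable {I R : Type} [CommRing R]

/-! ### Power series with polynomial coefficients -/

/-- The inclusion of the power series with constant coefficients. -/
def incl : PowerSeries R →+* PowerSeries (Polynomial R) := PowerSeries.map Polynomial.C

/-- The evaluation of the coefficients. -/
def evalAt (r : R) : PowerSeries (Polynomial R) →+* PowerSeries R :=
  PowerSeries.map (Polynomial.evalRingHom r)

theorem coeff_evalAt (r : R) (x : PowerSeries (Polynomial R)) (g : ℕ) :
    PowerSeries.coeff g (evalAt r x) = (PowerSeries.coeff g x).eval r := by
  rw [evalAt, PowerSeries.coeff_map]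
  rfl

theorem evalAt_incl (r : R) (x : PowerSeries R) : evalAt r (incl x) = x := by
  ext g
  rw [coeff_evalAt, incl, PowerSeries.coeff_map, Polynomial.eval_C]

/-- The part of a given degree. -/
def slice (E : ℕ) (x : PowerSeries (Polynomial R)) : PowerSeries R :=
  PowerSeries.mk fun g => (PowerSeries.coeff g x).coeff E

theorem coeff_slice (E : ℕ) (x : PowerSeries (Polynomial R)) (g : ℕ) :
    PowerSeries.coeff g (slice E x) = (PowerSeries.coeff g x).coeff E := PowerSeries.coeff_mk _ _

theorem slice_add (E : ℕ) (x y : PowerSeries (Polynomial R)) :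
    slice E (x + y) = slice E x + slice E y := by
  ext g
  simp [coeff_slice]

theorem slice_ext {x y : PowerSeries (Polynomial R)} (h : ∀ E, slice E x = slice E y) : x = y := by
  ext g E
  rw [← coeff_slice, h, coeff_slice]

theorem slice_incl_mul (E : ℕ) (k : PowerSeries R) (x : PowerSeries (Polynomial R)) :
    slice E (incl k * x) = k * slice E x := by
  ext g
  rw [coeff_slice, PowerSeries.coeff_mul, PowerSeries.coeff_mul, Polynomial.finsetSum_coeff]
  refine Finset.sum_congr rfl fun p _ => ?_
  rw [incl, PowerSeries.coeff_map, Polynomial.coeff_C_mul, coeff_slice]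

theorem slice_mul (E : ℕ) (x y : PowerSeries (Polynomial R)) :
    slice E (x * y) = ∑ p ∈ Finset.HasAntidiagonal.antidiagonal E, slice p.1 x * slice p.2 y := by
  ext g
  rw [coeff_slice, PowerSeries.coeff_mul, Polynomial.finsetSum_coeff, map_sum]
  simp only [PowerSeries.coeff_mul, Polynomial.coeff_mul, coeff_slice]
  exact Finset.sum_comm

theorem slice_zero (x : PowerSeries (Polynomial R)) : slice 0 x = evalAt 0 x := by
  ext g
  rw [coeff_slice, coeff_evalAt, Polynomial.coeff_zero_eq_eval_zero]

/-- The derivative with respect to the variable of the polynomials. -/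
def dPoly : IntDer (PowerSeries (Polynomial R)) :=
  psDeriv (IntDer.ofLeibniz (Polynomial.derivative (R := R)).toAddMonoidHom fun x y =>
    (Polynomial.derivative_mul (f := x) (g := y)).trans (by
      change _ = x * Polynomial.derivative y + y * Polynomial.derivative x
      ring))

theorem coeff_dPoly (x : PowerSeries (Polynomial R)) (g : ℕ) :
    PowerSeries.coeff g (dPoly x) = Polynomial.derivative (PowerSeries.coeff g x) :=
  coeff_psDeriv _ _ _

theorem slice_dPoly (E : ℕ) (x : PowerSeries (Polynomial R)) :
    slice E (dPoly x) = ((E + 1 : ℕ) : PowerSeries R) * slice (E + 1) x := by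
  ext g
  rw [coeff_slice, coeff_dPoly, Polynomial.coeff_derivative, ← nsmul_eq_mul, map_nsmul, coeff_slice,
    nsmul_eq_mul]
  push_cast
  ring

theorem dPoly_incl (x : PowerSeries R) : dPoly (incl x) = 0 := by
  ext1 g
  rw [coeff_dPoly, incl, PowerSeries.coeff_map, Polynomial.derivative_C, map_zero]

theorem incl_psDeriv (D : Derivation ℤ R R) (x : PowerSeries R) :
    incl (psDeriv D x) = psDeriv (polyDeriv D) (incl x) := by
  ext g E
  rw [coeff_psDeriv, coeff_polyDeriv, incl, PowerSeries.coeff_map, PowerSeries.coeff_map, coeff_psDeriv,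
    Polynomial.coeff_C, Polynomial.coeff_C]
  split_ifs <;> simp

theorem evalAt_psDeriv (D : Derivation ℤ R R) {r : R} (hr : D r = 0)
    (x : PowerSeries (Polynomial R)) :
    evalAt r (psDeriv (polyDeriv D) x) = psDeriv D (evalAt r x) := by
  ext g
  rw [coeff_evalAt, coeff_psDeriv, coeff_psDeriv, coeff_evalAt, eval_polyDeriv D hr]

theorem dPoly_psDeriv (D : Derivation ℤ R R) (x : PowerSeries (Polynomial R)) :
    dPoly (psDeriv (polyDeriv D) x) = psDeriv (polyDeriv D) (dPoly x) := by
  ext g E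
  rw [coeff_dPoly, coeff_psDeriv, coeff_psDeriv, coeff_dPoly, Polynomial.coeff_derivative,
    coeff_polyDeriv, coeff_polyDeriv, Polynomial.coeff_derivative, D.leibniz]
  have : D ((E : R) + 1) = 0 := by exact_mod_cast D.map_natCast (E + 1)
  rw [this]
  simp [mul_comm]

/-- The part of a given degree, componentwise. -/
def hslice (E : ℕ) : Hz I (PowerSeries (Polynomial R)) →+ Hz I (PowerSeries R) :=
  AddMonoidHom.mk' (fun f m => slice E (f m)) fun _ _ => funext fun _ => slice_add E _ _

theorem hslice_apply (E : ℕ) (f : Hz I (PowerSeries (Polynomial R))) (m : Multiset I) :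
    hslice E f m = slice E (f m) := rfl

theorem hslice_dIdx (E : ℕ) (a : I) (f : Hz I (PowerSeries (Polynomial R))) :
    hslice E (dIdx a f) = dIdx a (hslice E f) := rfl

theorem hslice_ext {f f' : Hz I (PowerSeries (Polynomial R))} (h : ∀ E, hslice E f = hslice E f') :
    f = f' := funext fun m => slice_ext fun E => congrFun (h E) m

/-- The part of a given degree as a homomorphism. -/
def sliceHom (E : ℕ) : PowerSeries (Polynomial R) →+ PowerSeries R :=
  AddMonoidHom.mk' (slice E) (slice_add E)

theorem hslice_map_mul (E : ℕ) (k : Hz I (PowerSeries R)) (f : Hz I (PowerSeries (Polynomial R))) :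
    hslice E (map incl k * f) = k * hslice E f := by
  funext m
  rw [hslice_apply, mul_apply, mul_apply]
  refine (map_multiset_sum (sliceHom E) _).trans ?_
  rw [Multiset.map_map]
  exact congrArg _ (Multiset.map_congr rfl fun p _ => slice_incl_mul E _ _)

theorem hslice_mul (E : ℕ) (f f' : Hz I (PowerSeries (Polynomial R))) :
    hslice E (f * f') =
      ∑ p ∈ Finset.HasAntidiagonal.antidiagonal E, hslice p.1 f * hslice p.2 f' := by
  funext m
  rw [hslice_apply, mul_apply, Hz.sum_apply]
  refine (map_multiset_sum (sliceHom E) _).trans ?_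
  rw [Multiset.map_map]
  simp only [mul_apply, Function.comp_def]
  rw [← Multiset.sum_map_sum]
  exact congrArg _ (Multiset.map_congr rfl fun p _ => slice_mul E _ _)

theorem hslice_zero (f : Hz I (PowerSeries (Polynomial R))) : hslice 0 f = map (evalAt 0) f :=
  funext fun _ => slice_zero _

theorem hslice_dPoly (E : ℕ) (f : Hz I (PowerSeries (Polynomial R))) :
    hslice E (dCoeff dPoly f) = ((E + 1 : ℕ) : Hz I (PowerSeries R)) * hslice (E + 1) f := by
  rw [← const_natCast_mul]
  funext m
  rw [const_mul_apply]
  exact slice_dPoly E _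

theorem hslice_two_mul (E : ℕ) (f : Hz I (PowerSeries (Polynomial R))) :
    hslice E (2 * f) = 2 * hslice E f := by
  rw [two_mul, two_mul, map_add]

/-! ### Orders -/

/-- The vanishing of the components of low weight; the weight of the coefficient of `h^g` with `n`
indices is `w g + n`. -/
def HasOrder (w k : ℕ) (f : Hz I (PowerSeries R)) : Prop :=
  ∀ g m, w * g + m.card < k → PowerSeries.coeff g (f m) = 0

theorem HasOrder.mono {w k l : ℕ} {f : Hz I (PowerSeries R)} (h : HasOrder w k f) (hl : l ≤ k) :
    HasOrder w l f := fun g m hm => h g m (by omega)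

theorem HasOrder.add {w k : ℕ} {f f' : Hz I (PowerSeries R)} (h : HasOrder w k f)
    (h' : HasOrder w k f') : HasOrder w k (f + f') := fun g m hm => by
  rw [Hz.add_apply, map_add, h g m hm, h' g m hm, add_zero]

theorem HasOrder.sum {w k : ℕ} {J : Type} {s : Finset J} {f : J → Hz I (PowerSeries R)}
    (h : ∀ j ∈ s, HasOrder w k (f j)) : HasOrder w k (∑ j ∈ s, f j) := fun g m hm => by
  rw [Hz.sum_apply, map_sum]
  exact Finset.sum_eq_zero fun j hj => h j hj g m hm

theorem HasOrder.dIdx {w k : ℕ} {f : Hz I (PowerSeries R)} (h : HasOrder w (k + 1) f) (a : I) :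
    HasOrder w k (dIdx a f) := fun g m hm => h g (a ::ₘ m) (by rw [Multiset.card_cons]; omega)

theorem HasOrder.mul {w k l : ℕ} {f f' : Hz I (PowerSeries R)} (h : HasOrder w k f)
    (h' : HasOrder w l f') : HasOrder w (k + l) (f * f') := fun g m hm => by
  rw [mul_apply, map_multiset_sum, Multiset.map_map]
  refine Multiset.sum_eq_zero fun x hx => ?_
  obtain ⟨p, hp, rfl⟩ := Multiset.mem_map.1 hx
  have hc := congrArg Multiset.card (Multiset.mem_antidiagonal.1 hp)
  rw [Multiset.card_add] at hc
  rw [Function.comp_apply, PowerSeries.coeff_mul]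
  refine Finset.sum_eq_zero fun q hq => ?_
  have hq' := Finset.HasAntidiagonal.mem_antidiagonal.1 hq
  have hw : w * q.1 + w * q.2 = w * g := by rw [← mul_add, hq']
  by_cases h1 : w * q.1 + p.1.card < k
  · rw [h _ _ h1, zero_mul]
  · rw [h' q.2 p.2 (by omega), mul_zero]

theorem HasOrder.const_mul {w k : ℕ} {f : Hz I (PowerSeries R)} (h : HasOrder w k f)
    (c : PowerSeries R) : HasOrder w k (const c * f) := by
  have h0 : HasOrder w 0 (const c : Hz I (PowerSeries R)) := fun g m hm => absurd hm (Nat.not_lt_zero _)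
  simpa using h0.mul h

theorem HasOrder.const_X_mul {w k : ℕ} {f : Hz I (PowerSeries R)} (h : HasOrder w k f) :
    HasOrder w (k + w) (const PowerSeries.X * f) := fun g m hm => by
  rw [const_mul_apply]
  rcases g with _ | g
  · simp
  · rw [PowerSeries.coeff_succ_X_mul]
    exact h g m (by rw [mul_add] at hm; omega)

theorem HasOrder.of_natCast_mul [Algebra ℂ R] {w k n : ℕ} (hn : n ≠ 0) {f : Hz I (PowerSeries R)}
    (h : HasOrder w k ((n : Hz I (PowerSeries R)) * f)) : HasOrder w k f := fun g m hm => by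
  have h1 := h g m hm
  rw [← const_natCast_mul, const_mul_apply, ← nsmul_eq_mul, map_nsmul, ← Nat.cast_smul_eq_nsmul ℂ] at h1
  have hc : (n : ℂ) ≠ 0 := by exact_mod_cast hn
  have h2 := congrArg (fun x => (n : ℂ)⁻¹ • x) h1
  simpa only [smul_smul, inv_mul_cancel₀ hc, one_smul, smul_zero] using h2

section Sums

variable [Fintype I]

theorem HasOrder.bil {w k l : ℕ} {f f' : Hz I (PowerSeries R)} (h : HasOrder w (k + 1) f)
    (h' : HasOrder w (l + 1) f') (M : I → I → PowerSeries R) :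
    HasOrder w (k + l) (bil Hz.dIdx (fun a b => const (M a b)) f f') :=
  HasOrder.sum fun a _ => HasOrder.sum fun b _ => ((h.dIdx a).mul (h'.dIdx b)).const_mul _

theorem HasOrder.lap {w k : ℕ} {f : Hz I (PowerSeries R)} (h : HasOrder w (k + 2) f)
    (M : I → I → PowerSeries R) : HasOrder w k (lap Hz.dIdx (fun a b => const (M a b)) f) :=
  HasOrder.sum fun a _ => HasOrder.sum fun b _ => ((h.dIdx b).dIdx a).const_mul _

variable [Algebra ℂ R]

/-- The sum over the connected graphs with a given number of edges. -/
def edgePart (T : Hz I (PowerSeries R)) (Δ : I → I → PowerSeries R) (E : ℕ) : Hz I (PowerSeries R) :=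
  edgeSum PowerSeries.X T Δ E

theorem edgePart_zero (T : Hz I (PowerSeries R)) (Δ : I → I → PowerSeries R) :
    edgePart T Δ 0 = T := edgeSum_zero _ _ _

theorem edgePart_succ (T : Hz I (PowerSeries R)) (Δ : I → I → PowerSeries R) (k : ℕ) :
    ((2 * (k + 1) : ℕ) : Hz I (PowerSeries R)) * edgePart T Δ (k + 1) =
      const PowerSeries.X * lap dIdx (fun a b => const (Δ a b)) (edgePart T Δ k) +
      ∑ p ∈ Finset.HasAntidiagonal.antidiagonal k, bil dIdx (fun a b => const (Δ a b))
        (edgePart T Δ p.1) (edgePart T Δ p.2) := by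
  have h := edgeSum_succ PowerSeries.X T Δ k
  change _ * edgePart T Δ (k + 1) = _ at h
  push_cast at h ⊢
  rw [h, Finset.Nat.sum_antidiagonal_eq_sum_range_succ (fun i j => bil dIdx
    (fun a b => const (Δ a b)) (edgePart T Δ i) (edgePart T Δ j))]
  simp only [bil, lap, edgePart, Finset.mul_sum, mul_add, Finset.sum_add_distrib]
  congr 1
  · exact Finset.sum_congr rfl fun a _ => Finset.sum_congr rfl fun b _ => by ring
  · symm
    rw [Finset.sum_comm]
    exact Finset.sum_congr rfl fun a _ => Finset.sum_comm

/-- Induction along the edge recursion. The loop term loses two indices and gains `h` of weight `u +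
2`, a net gain of `u`. The tree term loses two indices but combines two summands of order at least
3, a net gain of one, so `u ≤ 1` is needed. The case `u = 1` bounds the number of edges; the case `u
= 0` gives order 3 in the weight 2g + n. -/
theorem hasOrder_edgePart {T : Hz I (PowerSeries R)} (Δ : I → I → PowerSeries R) {u : ℕ}
    (hu : u ≤ 1) (hT : HasOrder (u + 2) 3 T) (E : ℕ) :
    HasOrder (u + 2) (u * E + 3) (edgePart T Δ E) := by
  induction E using Nat.strong_induction_on with
  | _ E ih =>
    rcases E with _ | E
    · rw [edgePart_zero]
      simpa using hT
    · refine HasOrder.of_natCast_mul (n := 2 * (E + 1)) (by omega) ?_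
      rw [edgePart_succ]
      refine HasOrder.add ?_ (HasOrder.sum fun p hp => ?_)
      · have h := (HasOrder.lap (k := u * E + 1) (ih E (by omega)) Δ).const_X_mul
        exact h.mono (by rw [mul_add]; omega)
      · have hp' := Finset.HasAntidiagonal.mem_antidiagonal.1 hp
        have h := HasOrder.bil (k := u * p.1 + 2) (l := u * p.2 + 2) (ih p.1 (by omega))
          (ih p.2 (by omega)) Δ
        refine h.mono ?_
        rw [← hp', mul_add, mul_add]
        omega

end Sums

end Heat

/-! ### The sum over all edge numbers and its heat flow. -/

namespace Heat

open Hz Wick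

variable {I R : Type} [CommRing R] [Fintype I]

theorem hslice_lap (E : ℕ) (M : I → I → PowerSeries R) (f : Hz I (PowerSeries (Polynomial R))) :
    hslice E (lap dIdx (fun a b => const (incl (M a b))) f) =
      lap dIdx (fun a b => const (M a b)) (hslice E f) := by
  simp only [lap, map_sum, ← Hz.map_const, hslice_map_mul, hslice_dIdx]

theorem hslice_bil (E : ℕ) (M : I → I → PowerSeries R)
    (f f' : Hz I (PowerSeries (Polynomial R))) :
    hslice E (bil dIdx (fun a b => const (incl (M a b))) f f') =
      ∑ p ∈ Finset.HasAntidiagonal.antidiagonal E,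
        bil dIdx (fun a b => const (M a b)) (hslice p.1 f) (hslice p.2 f') := by
  simp only [bil, map_sum, ← Hz.map_const, hslice_map_mul]
  simp only [hslice_mul, hslice_dIdx, Finset.mul_sum]
  symm
  rw [Finset.sum_comm]
  exact Finset.sum_congr rfl fun a _ => Finset.sum_comm

variable [Algebra ℂ R]

/-- The sum over all numbers of edges, as a polynomial in the variable which counts the edges. -/
def edgePoly (T : Hz I (PowerSeries R)) (Δ : I → I → PowerSeries R) :
    Hz I (PowerSeries (Polynomial R)) := fun m => PowerSeries.mk fun g =>
  ∑ E ∈ Finset.range (3 * g + m.card),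
    Polynomial.monomial E (PowerSeries.coeff g (edgePart T Δ E m))

/-- The sum over all numbers of edges. -/
def edgeTotal (T : Hz I (PowerSeries R)) (Δ : I → I → PowerSeries R) : Hz I (PowerSeries R) :=
  fun m => PowerSeries.mk fun g => ∑ E ∈ Finset.range (3 * g + m.card),
    PowerSeries.coeff g (edgePart T Δ E m)

variable {T : Hz I (PowerSeries R)}

/-- In the weight 3g + n the part with E edges has order E + 3, so for given genus and indices only
finitely many edge numbers contribute and the cutoff is immaterial. -/
theorem coeff_edgeTotal (hT : HasOrder 2 3 T)
    (Δ : I → I → PowerSeries R) (g : ℕ) (m : Multiset I) {M : ℕ} (hM : 3 * g + m.card ≤ M) :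
    PowerSeries.coeff g (edgeTotal T Δ m) =
      ∑ E ∈ Finset.range M, PowerSeries.coeff g (edgePart T Δ E m) := by
  rw [edgeTotal, PowerSeries.coeff_mk]
  refine Finset.sum_subset (Finset.range_subset_range.2 hM) fun E _ hE => ?_
  have hT' : HasOrder (1 + 2) 3 T := fun g m hm =>
    hT g m (by omega)
  refine hasOrder_edgePart Δ le_rfl hT' E g m ?_
  have := Finset.mem_range.not.1 hE
  omega

theorem map_edgePoly (Δ : I → I → PowerSeries R) :
    map (evalAt 1) (edgePoly T Δ) = edgeTotal T Δ := by
  funext m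
  ext g
  rw [map_apply, coeff_evalAt, edgePoly, edgeTotal, PowerSeries.coeff_mk, PowerSeries.coeff_mk,
    Polynomial.eval_finsetSum]
  simp

theorem hslice_edgePoly (hT : HasOrder 2 3 T)
    (Δ : I → I → PowerSeries R) (E : ℕ) :
    hslice E (edgePoly T Δ) = edgePart T Δ E := by
  funext m
  ext g
  rw [hslice_apply, coeff_slice, edgePoly, PowerSeries.coeff_mk, Polynomial.finsetSum_coeff]
  simp only [Polynomial.coeff_monomial, Finset.sum_ite_eq', Finset.mem_range]
  split_ifs with h
  · rfl
  · have hT' : HasOrder (1 + 2) 3 T := fun g m hm =>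
      hT g m (by omega)
    exact (hasOrder_edgePart Δ le_rfl hT' E g m (by omega)).symm

/-- Compared degree by degree in the edge-counting variable, this is the edge recursion. -/
theorem edgePoly_heat (hT : HasOrder 2 3 T)
    (Δ : I → I → PowerSeries R) :
    2 * dCoeff dPoly (edgePoly T Δ) =
      quad dIdx (const (incl PowerSeries.X)) (fun a b => const (incl (Δ a b))) (edgePoly T Δ) := by
  refine hslice_ext fun E => ?_
  rw [hslice_two_mul, hslice_dPoly, quad, map_add, ← Hz.map_const, hslice_map_mul, hslice_lap,
    hslice_bil]
  simp only [hslice_edgePoly hT]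
  rw [← edgePart_succ]
  push_cast
  ring

/-- The vanishing of the defect propagates along the heat flow. -/
theorem hasOrder_defect (hT : HasOrder 2 3 T)
    {c : PowerSeries R} {Δ Y Γ : I → I → PowerSeries R} {D : IntDer R} {ν : I}
    (hΔ : ∀ a b, Δ a b = Δ b a) (hY : ∀ a b, Y a b = Y b a) {W : ℕ}
    (h0 : HasOrder 2 (W + 2)
      (defect PowerSeries.X 0 c Δ Y Γ (psDeriv D) ν T)) :
    HasOrder 2 (W + 2) (defect PowerSeries.X 1 c Δ Y Γ (psDeriv D) ν (edgeTotal T Δ)) := by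
  -- The flow parameter s is the polynomial variable which counts edges; all other data are constant
  -- in it.
  set A := defect (incl PowerSeries.X) (PowerSeries.C Polynomial.X) (incl c)
    (fun a b => incl (Δ a b)) (fun a b => incl (Y a b)) (fun a b => incl (Γ a b))
    (psDeriv (polyDeriv D)) ν (edgePoly T Δ) with hA
  have hs : ∀ r : R, evalAt r (PowerSeries.C Polynomial.X) = PowerSeries.C r := fun r => by
    rw [evalAt, PowerSeries.map_C]
    simp
  have hev : ∀ r : R, D r = 0 → map (evalAt r) A = defect PowerSeries.X (PowerSeries.C r) c Δ Y Γ
      (psDeriv D) ν (map (evalAt r) (edgePoly T Δ)) := fun r hr => by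
    rw [hA, map_defect (evalAt_psDeriv D hr)]
    simp only [evalAt_incl, hs]
  have hheat : 2 * dCoeff dPoly A =
      const (incl PowerSeries.X) * lap dIdx (fun a b => const (incl (Δ a b))) A +
      2 * bil dIdx (fun a b => const (incl (Δ a b))) (edgePoly T Δ) A := by
    refine defect_heat ν (dPoly_incl _) ?_ ?_ (fun a b => by rw [hΔ]) (fun a b => by rw [hY])
      (fun a b => dPoly_incl _) (fun a b => dPoly_incl _) (fun a b => dPoly_incl _) (dPoly_incl _)
      (dPoly_psDeriv D) (edgePoly_heat hT Δ)
    · rw [← incl_psDeriv, psDeriv_X, map_zero]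
    · rw [dPoly, psDeriv_C]
      exact (congrArg PowerSeries.C Polynomial.derivative_X).trans (map_one _)
  have hrec : ∀ E, ((2 * (E + 1) : ℕ) : Hz I (PowerSeries R)) * hslice (E + 1) A =
      const PowerSeries.X * lap dIdx (fun a b => const (Δ a b)) (hslice E A) +
      ∑ p ∈ Finset.HasAntidiagonal.antidiagonal E, 2 * bil dIdx (fun a b => const (Δ a b))
        (edgePart T Δ p.1) (hslice p.2 A) := fun E => by
    have h := congrArg (hslice E) hheat
    rw [hslice_two_mul, hslice_dPoly, map_add, ← Hz.map_const, hslice_map_mul, hslice_lap,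
      hslice_two_mul, hslice_bil] at h
    simp only [hslice_edgePoly hT] at h
    rw [← Finset.mul_sum, ← h]
    push_cast
    ring
  -- The linear equation determines the coefficient of s^(E+1) from the lower ones, and the
  -- coefficient of s^0 is the initial defect.
  have hall : ∀ E, HasOrder 2 (W + 2) (hslice E A) := fun E => by
    induction E using Nat.strong_induction_on with
    | _ E ih =>
      rcases E with _ | E
      · rw [hslice_zero, hev 0 (map_zero _), map_zero, ← hslice_zero, hslice_edgePoly hT,
          edgePart_zero]
        exact h0
      · refine HasOrder.of_natCast_mul (n := 2 * (E + 1)) (by omega) ?_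
        rw [hrec]
        refine HasOrder.add (HasOrder.lap (ih E (by omega)) Δ).const_X_mul
          (HasOrder.sum fun p hp => ?_)
        have hp' := Finset.HasAntidiagonal.mem_antidiagonal.1 hp
        -- A derivative of `F` still has order 2, which outweighs the unit of order lost by
        -- differentiating the defect.
        have h := HasOrder.bil (k := 2) (l := W + 1) (w := 2)
          (hasOrder_edgePart (u := 0) Δ (by omega) hT p.1 |>.mono (by omega))
          (ih p.2 (by omega)) Δ
        rw [two_mul]
        exact (h.mono (by omega)).add (h.mono (by omega))
  have h1 := hev 1 (Derivation.map_one_eq_zero D)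
  rw [map_one, map_edgePoly] at h1
  rw [← h1]
  intro g m hm
  rw [map_apply, coeff_evalAt]
  have : PowerSeries.coeff g (A m) = 0 := Polynomial.ext fun E => by
    rw [← coeff_slice]
    exact hall E g m hm
  rw [this, Polynomial.eval_zero]

end Heat

/-! ### Components of the operators on generating functions. -/

namespace Hz

variable {I K : Type} [CommRing K]

/-- The inclusion of the tensors without indices. -/
def constHom : K →+* Hz I K where
  toFun := const
  map_zero' := const_zero
  map_add' := const_add
  map_one' := const_one
  map_mul' a b := Wick.const_mul a b

theorem const_eq_constHom (c : K) : (const c : Hz I K) = constHom c := rfl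

theorem map_update {n : ℕ} (μ : Fin n → I) (i : Fin n) (c : I) :
    (Finset.univ.val.map (Function.update μ i c)) =
      c ::ₘ (Finset.univ.erase i).val.map μ := by
  have h : (Finset.univ : Finset (Fin n)).val = i ::ₘ (Finset.univ.erase i).val := by
    rw [Finset.erase_val, Multiset.cons_erase (Finset.mem_univ_val i)]
  rw [h, Multiset.map_cons, Function.update_self]
  refine congrArg _ (Multiset.map_congr rfl fun j hj => ?_)
  rw [Function.update_of_ne (Finset.mem_erase.1 (show j ∈ Finset.univ.erase i from hj)).1]

-- Only splittings whose first part is a single index survive.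
open scoped Classical in
theorem var_mul_apply {n : ℕ} (a : I) (f : Hz I K) (μ : Fin n → I) :
    ((var a : Hz I K) * f) (Finset.univ.val.map μ) =
      ∑ i, if μ i = a then f ((Finset.univ.erase i).val.map μ) else 0 := by
  rw [mul_apply, Wick.sum_antidiagonal_map μ (fun x y => (var a : Hz I K) x * f y) Finset.univ]
  have h1 : ∀ A : Finset (Fin n), A ∉ Finset.univ.image (fun i : Fin n => ({i} : Finset (Fin n))) →
      (var a : Hz I K) (A.val.map μ) = 0 := fun A hA => by
    refine if_neg fun h => hA ?_
    have hc := congrArg Multiset.card h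
    rw [Multiset.card_map, Multiset.card_singleton] at hc
    obtain ⟨i, hi⟩ := Finset.card_eq_one.1 hc
    exact Finset.mem_image.2 ⟨i, Finset.mem_univ i, hi.symm⟩
  rw [← Finset.sum_subset (s₁ := Finset.univ.image fun i : Fin n => ({i} : Finset (Fin n)))
    (fun A _ => Finset.mem_powerset.2 (Finset.subset_univ A))
    (fun A _ hA => by rw [h1 A hA, zero_mul]), Finset.sum_image fun i _ j _ h => Finset.singleton_injective h]
  refine Finset.sum_congr rfl fun i _ => ?_
  rw [Finset.sdiff_singleton_eq_erase]
  unfold var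
  by_cases h : μ i = a <;> simp [h]

end Hz

namespace Heat

open Hz Wick

variable {J R : Type} [CommRing R] {n : ℕ}

theorem coeff_two_mul (x : PowerSeries R) (g : ℕ) :
    PowerSeries.coeff g (2 * x) = 2 * PowerSeries.coeff g x := by
  rw [two_mul, two_mul, map_add]

theorem two_mul_apply (f : Hz J (PowerSeries R)) (m : Multiset J) : (2 * f) m = 2 * f m := by
  rw [two_mul, two_mul, Hz.add_apply]

section Sums

variable [Fintype J]

theorem coeff_covD (D : IntDer R) (Γ : J → J → R) (F : Hz J (PowerSeries R)) (g : ℕ)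
    (μ : Fin n → J) : PowerSeries.coeff g
      (covD (psDeriv D) (fun a b => PowerSeries.C (Γ a b)) F (Finset.univ.val.map μ)) =
    D (PowerSeries.coeff g (F (Finset.univ.val.map μ))) - ∑ i, ∑ c, Γ c (μ i) *
      PowerSeries.coeff g (F (Finset.univ.val.map (Function.update μ i c))) := by
  classical
  rw [covD_apply, Hz.sub_apply, map_sub, dCoeff_apply, coeff_psDeriv, Hz.sum_apply, map_sum]
  congr 1
  rw [Finset.sum_comm]
  refine Finset.sum_congr rfl fun c _ => ?_
  simp only [Hz.sum_apply, map_sum, mul_assoc, const_mul_apply, PowerSeries.coeff_C_mul,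
    var_mul_apply, Finset.mul_sum]
  rw [Finset.sum_comm]
  refine Finset.sum_congr rfl fun i _ => ?_
  rw [Finset.sum_eq_single (μ i) (fun a _ ha => by rw [if_neg ha.symm, map_zero, mul_zero]) (by simp),
    if_pos rfl, map_update, dIdx_apply]

theorem coeff_bil_quadForm {Δ Y : J → J → R} (hY : ∀ a b, Y a b = Y b a)
    (F : Hz J (PowerSeries R)) (g : ℕ) (μ : Fin n → J) : PowerSeries.coeff g
      (bil dIdx (fun a b => const (PowerSeries.C (Δ a b)))
        (quadForm fun a b => PowerSeries.C (Y a b)) F (Finset.univ.val.map μ)) =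
    2 * ∑ i, ∑ c, (∑ a, Δ a c * Y a (μ i)) *
      PowerSeries.coeff g (F (Finset.univ.val.map (Function.update μ i c))) := by
  classical
  have hY' : ∀ a b, PowerSeries.C (Y a b) = PowerSeries.C (Y b a) := fun a b => by rw [hY]
  have h : ∀ a b, PowerSeries.coeff g (((const (PowerSeries.C (Δ a b)) : Hz J (PowerSeries R)) *
      (dIdx a (quadForm fun a b => PowerSeries.C (Y a b)) * dIdx b F)) (Finset.univ.val.map μ)) =
      2 * ∑ i, Δ a b * Y a (μ i) *
        PowerSeries.coeff g (F (Finset.univ.val.map (Function.update μ i b))) := by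
    intro a b
    rw [dIdx_quadForm hY', mul_assoc, mul_left_comm, two_mul_apply, coeff_two_mul, const_mul_apply,
      PowerSeries.coeff_C_mul, Finset.sum_mul, Hz.sum_apply, map_sum]
    simp only [mul_assoc, const_mul_apply, PowerSeries.coeff_C_mul, var_mul_apply, map_sum,
      Finset.mul_sum]
    rw [Finset.sum_comm]
    refine Finset.sum_congr rfl fun i _ => ?_
    rw [Finset.sum_eq_single (μ i) (fun a _ ha => by rw [if_neg ha.symm, map_zero, mul_zero, mul_zero, mul_zero])
      (by simp), if_pos rfl, map_update, dIdx_apply]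
  simp only [bil, Hz.sum_apply, map_sum, h]
  simp only [← Finset.mul_sum, Finset.sum_mul]
  congr 1
  rw [Finset.sum_comm]
  refine Eq.trans ?_ Finset.sum_comm
  exact Finset.sum_congr rfl fun y _ => Finset.sum_comm

/-- The first sum is the loop term, in which multiplication by `X` lowers the genus by one. The
second is the splitting term: the product in `Hz` distributes the indices and the product of power
series distributes the genus. -/
theorem coeff_quad (M : J → J → R) (F : Hz J (PowerSeries R)) (g : ℕ) (μ : Fin n → J) :
    PowerSeries.coeff g (quad dIdx (const PowerSeries.X)
      (fun a b => const (PowerSeries.C (M a b))) F (Finset.univ.val.map μ)) =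
    (∑ a, ∑ b, M a b * PowerSeries.coeff g
      (PowerSeries.X * F (b ::ₘ a ::ₘ Finset.univ.val.map μ))) +
    ∑ a, ∑ b, M a b * ∑ p ∈ Finset.HasAntidiagonal.antidiagonal g, ∑ A : Finset (Fin n),
      PowerSeries.coeff p.1 (F (a ::ₘ A.val.map μ)) *
        PowerSeries.coeff p.2 (F (b ::ₘ Aᶜ.val.map μ)) := by
  classical
  rw [quad, Hz.add_apply, map_add]
  congr 1
  · simp only [lap, Finset.mul_sum, Hz.sum_apply, map_sum]
    refine Finset.sum_congr rfl fun a _ => Finset.sum_congr rfl fun b _ => ?_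
    rw [mul_left_comm, const_mul_apply, PowerSeries.coeff_C_mul, const_mul_apply, dIdx_apply,
      dIdx_apply]
  · simp only [bil, Hz.sum_apply, map_sum]
    refine Finset.sum_congr rfl fun a _ => Finset.sum_congr rfl fun b _ => ?_
    rw [const_mul_apply, PowerSeries.coeff_C_mul, mul_apply,
      Wick.sum_antidiagonal_map μ (fun x y => dIdx a F x * dIdx b F y) Finset.univ, map_sum]
    congr 1
    rw [Finset.powerset_univ, Finset.sum_comm]
    refine Finset.sum_congr rfl fun A _ => ?_
    rw [PowerSeries.coeff_mul, Finset.compl_eq_univ_sdiff]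
    rfl

theorem quadForm_pair {Y : J → J → R} (hY : ∀ a b, Y a b = Y b a) (x y : J) :
    (quadForm fun a b => PowerSeries.C (Y a b) : Hz J (PowerSeries R)) {x, y} =
      PowerSeries.C (2 * Y x y) := by
  have hY' : ∀ a b, PowerSeries.C (Y a b) = PowerSeries.C (Y b a) := fun a b => by rw [hY]
  have h := congrFun (dIdx_dIdx_quadForm hY' y x) 0
  rw [two_mul_apply, const_zero_apply, hY] at h
  rw [map_mul]
  exact h

theorem coeff_quadForm_eq_zero {Y : J → J → R} (hY : ∀ a b, Y a b = Y b a) {g : ℕ} {m : Multiset J}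
    (h : ¬(g = 0 ∧ m.card = 2)) :
    PowerSeries.coeff g ((quadForm fun a b => PowerSeries.C (Y a b) : Hz J (PowerSeries R)) m) = 0 := by
  have hY' : ∀ a b, PowerSeries.C (Y a b) = PowerSeries.C (Y b a) := fun a b => by rw [hY]
  by_cases hm : m.card = 2
  · obtain ⟨x, y, rfl⟩ := Multiset.card_eq_two.1 hm
    rw [quadForm_pair hY, PowerSeries.coeff_C, if_neg fun hg => h ⟨hg, hm⟩]
  · suffices hz : (quadForm fun a b => PowerSeries.C (Y a b) : Hz J (PowerSeries R)) m = 0 by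
      rw [hz, map_zero]
    induction m using Multiset.induction_on with
    | empty =>
      unfold quadForm
      simp only [Hz.sum_apply, mul_zero_apply, var_zero, mul_zero, Finset.sum_const_zero]
    | cons x m _ =>
      induction m using Multiset.induction_on with
      | empty =>
        refine (congrFun (dIdx_quadForm hY' x) 0).trans ?_
        rw [two_mul_apply]
        simp only [Hz.sum_apply, const_mul_apply, var_zero, mul_zero, Finset.sum_const_zero]
      | cons y m _ =>
        refine (congrFun (dIdx_dIdx_quadForm hY' y x) m).trans ?_
        rw [two_mul_apply]
        induction m using Multiset.induction_on with
        | empty => exact absurd rfl hm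
        | cons z m _ => rw [const_cons_apply, mul_zero]

end Sums

theorem coeff_const_eq_zero {c : PowerSeries R} {g k : ℕ} (hc : ∀ g, g ≠ k → PowerSeries.coeff g c = 0)
    {m : Multiset J} (h : ¬(g = k ∧ m.card = 0)) :
    PowerSeries.coeff g ((const c : Hz J (PowerSeries R)) m) = 0 := by
  induction m using Multiset.induction_on with
  | empty =>
    rw [const_zero_apply]
    exact hc g fun hg => h ⟨hg, rfl⟩
  | cons x m _ => rw [const_cons_apply, map_zero]

end Heat

/-! ### The anomaly equation and its initial condition in components. -/

namespace Heat

open Hz Wick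

variable {J R : Type} [CommRing R] [Fintype J] {n : ℕ}

theorem covMat_C (D : IntDer R) (Γ Δ : J → J → R) (a b : J) :
    covMat (psDeriv D) (fun a b => PowerSeries.C (Γ a b)) (fun a b => PowerSeries.C (Δ a b)) a b =
      PowerSeries.C (covMat D Γ Δ a b) := by
  simp only [covMat, psDeriv_C, map_add, map_sum, map_mul]

/-- The background torsion in terms of the propagator. -/
def torMat (D : IntDer R) (Δ Y Γ : J → J → R) (a b : J) : R :=
  ∑ a', ∑ b', Δ a' a * Y a' b' * Δ b' b - covMat D Γ Δ a b

variable {Δ Y Γ : J → J → R} {D : IntDer R} {ν : J} {c : PowerSeries R} {W : ℕ}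

/-- The components of the anomaly equation. -/
theorem anomaly_components (hY : ∀ a b, Y a b = Y b a)
    (hc : ∀ g, g ≠ 1 → PowerSeries.coeff g c = 0) {F : Hz J (PowerSeries R)}
    (h : HasOrder 2 (W + 2) (defect PowerSeries.X 1 c (fun a b => PowerSeries.C (Δ a b))
      (fun a b => PowerSeries.C (Y a b)) (fun a b => PowerSeries.C (Γ a b)) (psDeriv D) ν F))
    {g : ℕ} (μ : Fin n → J) (h1 : 2 < 2 * g + n) (h2 : 2 * g + n < W + 2) :
    2 * PowerSeries.coeff g (F (ν ::ₘ Finset.univ.val.map μ)) =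
      2 * (D (PowerSeries.coeff g (F (Finset.univ.val.map μ))) -
        ∑ i, ∑ c, (Γ c (μ i) - ∑ a, Δ a c * Y a (μ i)) *
          PowerSeries.coeff g (F (Finset.univ.val.map (Function.update μ i c)))) +
      ((∑ a, ∑ b, torMat D Δ Y Γ a b * PowerSeries.coeff g
        (PowerSeries.X * F (b ::ₘ a ::ₘ Finset.univ.val.map μ))) +
      ∑ a, ∑ b, torMat D Δ Y Γ a b * ∑ p ∈ Finset.HasAntidiagonal.antidiagonal g,
        ∑ A : Finset (Fin n), PowerSeries.coeff p.1 (F (a ::ₘ A.val.map μ)) *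
          PowerSeries.coeff p.2 (F (b ::ₘ Aᶜ.val.map μ))) := by
  have hcard : (Finset.univ.val.map μ).card = n := by simp
  have h0 := h g (Finset.univ.val.map μ) (by rw [hcard]; exact h2)
  have hW : ∀ a b, (const (PowerSeries.C (-torMat D Δ Y Γ a b)) : Hz J (PowerSeries R)) =
      const (covMat (psDeriv D) (fun a b => PowerSeries.C (Γ a b))
        (fun a b => PowerSeries.C (Δ a b)) a b) - ∑ a', ∑ b', const (PowerSeries.C (Δ a' a)) *
        const (PowerSeries.C (Y a' b')) * const (PowerSeries.C (Δ b' b)) := by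
    intro a b
    simp only [covMat_C, const_eq_constHom, ← map_mul, ← map_sum, ← map_sub]
    rw [torMat, neg_sub]
  have hq := coeff_quad (fun a b => -torMat D Δ Y Γ a b) F g μ
  simp only [hW, neg_mul, Finset.sum_neg_distrib] at hq
  have hconst : (const PowerSeries.X * ∑ a, ∑ b, const (PowerSeries.C (Δ a b)) *
      const (PowerSeries.C (Y a b)) : Hz J (PowerSeries R)) =
      const (PowerSeries.X * PowerSeries.C (∑ a, ∑ b, Δ a b * Y a b)) := by
    simp only [const_eq_constHom, ← map_mul, ← map_sum]
  have hc' : ∀ g, g ≠ 1 → PowerSeries.coeff g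
      (PowerSeries.X * PowerSeries.C (∑ a, ∑ b, Δ a b * Y a b)) = 0 := by
    intro g hg
    rcases g with _ | g
    · simp
    · rw [PowerSeries.coeff_succ_X_mul, PowerSeries.coeff_C, if_neg (by omega)]
  rw [defect, anomaly, const_one] at h0
  simp only [one_mul, one_pow] at h0
  rw [hconst] at h0
  simp only [Hz.sub_apply, Hz.add_apply, two_mul_apply, map_sub, map_add, coeff_two_mul] at h0
  -- The constants live in genus one without indices and `q` in genus zero with two indices; both
  -- positions are excluded by `2 < 2 * g + n`.
  rw [coeff_const_eq_zero hc (by rw [hcard]; omega), coeff_const_eq_zero hc' (by rw [hcard]; omega),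
    coeff_quadForm_eq_zero hY (by rw [hcard]; omega), hq, coeff_covD, coeff_bil_quadForm hY,
    dIdx_apply] at h0
  simp only [sub_mul, Finset.sum_sub_distrib]
  linear_combination h0

omit [Fintype J] in
theorem exists_map_eq (m : Multiset J) : ∃ μ : Fin m.card → J, Finset.univ.val.map μ = m := by
  refine ⟨fun i => m.toList.get (i.cast (Multiset.length_toList m).symm), ?_⟩
  rw [Fin.univ_val_map]
  conv_rhs => rw [← Multiset.coe_toList m]
  congr 1
  refine List.ext_getElem (by simp) fun i h1 h2 => by simp

/-- The initial condition, from the jetness of the correlation functions. -/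
theorem hasOrder_defect_zero (hY : ∀ a b, Y a b = Y b a)
    (hc : ∀ g, g ≠ 1 → PowerSeries.coeff g c = 0) {T : Hz J (PowerSeries R)} (hT : HasOrder 2 3 T)
    (Δ : J → J → PowerSeries R)
    (hjet : ∀ (g n : ℕ) (μ : Fin n → J), 2 < 2 * g + n → 2 * g + n < W + 2 →
      PowerSeries.coeff g (T (ν ::ₘ Finset.univ.val.map μ)) =
        D (PowerSeries.coeff g (T (Finset.univ.val.map μ))) - ∑ i, ∑ c, Γ c (μ i) *
          PowerSeries.coeff g (T (Finset.univ.val.map (Function.update μ i c))))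
    (hc1 : PowerSeries.coeff 1 (T {ν}) = PowerSeries.coeff 1 c)
    (hYuk : ∀ x y, PowerSeries.coeff 0 (T {ν, x, y}) = Y x y) :
    HasOrder 2 (W + 2) (defect PowerSeries.X 0 c Δ (fun a b => PowerSeries.C (Y a b))
      (fun a b => PowerSeries.C (Γ a b)) (psDeriv D) ν T) := by
  intro g m hm
  have hz : (const 0 : Hz J (PowerSeries R)) = 0 := const_zero
  rw [defect, anomaly, hz]
  have hquad : ∀ M : J → J → Hz J (PowerSeries R), quad dIdx (const PowerSeries.X)
      (fun a b => 0 * M a b - 0 ^ 2 * ∑ a', ∑ b', const (Δ a' a) *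
        const (PowerSeries.C (Y a' b')) * const (Δ b' b)) T = 0 := by
    intro M
    simp [quad, lap, bil]
  rw [hquad]
  simp only [zero_mul, sub_zero, add_zero]
  simp only [Hz.sub_apply, two_mul_apply, map_sub, coeff_two_mul]
  obtain ⟨n, hn⟩ : ∃ n, m.card = n := ⟨_, rfl⟩
  obtain ⟨μ, rfl⟩ : ∃ μ : Fin n → J, Finset.univ.val.map μ = m := hn ▸ exists_map_eq m
  rw [coeff_covD, dIdx_apply]
  by_cases h1 : 2 < 2 * g + n
  · rw [hjet g n μ h1 (by omega), coeff_const_eq_zero hc (by omega),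
      coeff_quadForm_eq_zero hY (by omega)]
    ring
  · have hT' : ∀ μ : Fin n → J, PowerSeries.coeff g (T (Finset.univ.val.map μ)) = 0 := fun μ =>
      hT g _ (by rw [Multiset.card_map, Finset.card_val, Finset.card_fin]; omega)
    simp only [hT', map_zero, mul_zero, Finset.sum_const_zero, sub_zero]
    -- At an unstable position `T` vanishes, but with the extra index `ν` it need not. This happens
    -- only in genus one without indices, matched by `c`, and in genus zero with two indices,
    -- matched by the Yukawa coupling in `q`.
    by_cases h2 : g = 1 ∧ n = 0
    · obtain ⟨rfl, rfl⟩ := h2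
      rw [coeff_quadForm_eq_zero hY (by omega), Multiset.card_eq_zero.1 hn, const_zero_apply,
        ← hc1]
      simp
    by_cases h3 : g = 0 ∧ n = 2
    · obtain ⟨rfl, rfl⟩ := h3
      obtain ⟨x, y, hxy⟩ := Multiset.card_eq_two.1 hn
      rw [hxy, quadForm_pair hY, coeff_const_eq_zero hc (by simp), PowerSeries.coeff_C, if_pos rfl]
      have := hYuk x y
      simp only [Multiset.insert_eq_cons] at this ⊢
      rw [this]
      ring
    · rw [coeff_quadForm_eq_zero hY (by omega), coeff_const_eq_zero hc (by omega),
        hT g _ (by rw [Multiset.card_cons]; omega)]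
      ring

end Heat

/-! ### Multisets of indices and finite sums -/

section FinSums

variable {I R : Type}

theorem map_finCons {n : ℕ} (a : I) (x : Fin n → I) :
    Finset.univ.val.map (Fin.cons a x : Fin (n + 1) → I) = a ::ₘ Finset.univ.val.map x := by
  rw [Fin.univ_val_map, Fin.univ_val_map, List.ofFn_succ]
  rfl

theorem map_finSnoc {n : ℕ} (x : Fin n → I) (a : I) :
    Finset.univ.val.map (Fin.snoc x a : Fin (n + 1) → I) = a ::ₘ Finset.univ.val.map x := by
  rw [Fin.univ_val_map, Fin.univ_val_map, List.ofFn_succ', List.concat_eq_append]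
  simp only [Fin.snoc_castSucc, Fin.snoc_last]
  rw [Multiset.cons_coe, Multiset.coe_eq_coe]
  exact List.perm_append_singleton _ _

theorem map_orderEmbOfFin {n : ℕ} (A : Finset (Fin n)) (x : Fin n → I) :
    Finset.univ.val.map (fun j => x (A.orderEmbOfFin rfl j)) = A.val.map x := by
  have h := congrArg Finset.val (Finset.map_orderEmbOfFin_univ A rfl)
  rw [Finset.map_val] at h
  conv_rhs => rw [← h]
  rw [Multiset.map_map]
  rfl

theorem comp_finSnoc {I' : Type} {n : ℕ} (φ : I → I') (x : Fin n → I) (a : I) :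
    φ ∘ (Fin.snoc x a : Fin (n + 1) → I) = Fin.snoc (φ ∘ x) (φ a) := Fin.comp_snoc φ x a

variable [AddCommMonoid R]

theorem finsum_eq_sum_coe {s : Finset I} {G : I → R} (h : ∀ x, G x ≠ 0 → x ∈ s) :
    ∑ᶠ x, G x = ∑ a : s, G a := by
  rw [finsum_eq_sum_of_support_subset G (s := s) h, Finset.sum_coe_sort s G]

theorem finsum_pair_eq_sum_coe {s : Finset I} {G : I × I → R}
    (h : ∀ x, G x ≠ 0 → x.1 ∈ s ∧ x.2 ∈ s) : ∑ᶠ x, G x = ∑ a : s, ∑ b : s, G (a, b) := by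
  rw [finsum_eq_sum_of_support_subset G (s := s ×ˢ s) fun x hx => by
    simpa using h x hx, Finset.sum_product, ← Finset.sum_coe_sort s]
  exact Finset.sum_congr rfl fun a _ => (Finset.sum_coe_sort s fun b => G (a, b)).symm

theorem sum_coe_eq_sum_inl {α β : Type} [Fintype α] {s : Finset (α ⊕ β)} (hs : ∀ i, Sum.inl i ∈ s)
    {G : α ⊕ β → R} (h : ∀ m, G (Sum.inr m) = 0) : ∑ a : s, G a = ∑ i, G (Sum.inl i) := by
  classical
  rw [Finset.sum_coe_sort s G, ← Finset.sum_subset (s₁ := Finset.univ.map Function.Embedding.inl)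
    (fun x hx => ?_) (fun x _ hx => ?_), Finset.sum_map]
  · rfl
  · obtain ⟨i, -, rfl⟩ := Finset.mem_map.1 hx
    exact hs i
  · rcases x with i | m
    · exact absurd (Finset.mem_map.2 ⟨i, Finset.mem_univ i, rfl⟩) hx
    · exact h m

end FinSums

/-! ### Elements of the Fock space over a finite set of indices. -/

namespace CTP

variable {N : ℕ} {U : TopologicalSpace.Opens (Base N)} {S : CTP N U} {P : S.PseudoOpposite}

namespace FockSpace

open Heat

variable (C : FockSpace P)

/-- The indices of the non-zero components of finitely many correlation functions. -/
def coords (B : ℕ) : Set (Idx N) :=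
  ⋃ g ∈ Finset.range B, ⋃ n ∈ Finset.range B, ⋃ x ∈ (C.corr g n).support, Set.range x

theorem coords_finite (B : ℕ) : (C.coords B).Finite :=
  (Finset.range B).finite_toSet.biUnion fun _ _ => (Finset.range B).finite_toSet.biUnion fun _ _ =>
    (Finset.finite_toSet _).biUnion fun x _ => Set.finite_range x

variable {C} in
theorem mem_coords {B g n : ℕ} (hg : g < B) (hn : n < B) {x : Fin n → Idx N}
    (hx : C.corr g n x ≠ 0) (i : Fin n) : x i ∈ C.coords B :=
  Set.mem_biUnion (Finset.mem_coe.2 (Finset.mem_range.2 hg)) (Set.mem_biUnion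
    (Finset.mem_coe.2 (Finset.mem_range.2 hn)) (Set.mem_biUnion
      (Finset.mem_coe.2 (Finsupp.mem_support_iff.2 hx)) (Set.mem_range_self i)))

/-- A finite set over which no contraction is truncated. It contains the indices of all relevant
components, all `t^i`, which support the Yukawa coupling, and every index reached from the relevant
ones by a Christoffel symbol of P. -/
theorem exists_indexSet (B : ℕ) {n : ℕ} (ν : Idx N) (μ : Fin n → Idx N) :
    ∃ s : Finset (Idx N), ν ∈ s ∧ (∀ i, μ i ∈ s) ∧ (∀ i, Sum.inl i ∈ s) ∧ C.coords B ⊆ s ∧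
      ∀ α ∈ C.coords B, ∀ ρ, christoffel P α ν ρ ≠ 0 → ρ ∈ s := by
  have hf : ({ν} ∪ Set.range μ ∪ Set.range Sum.inl ∪ C.coords B ∪
      ⋃ α ∈ C.coords B, Function.support (christoffel P α ν)).Finite :=
    ((((Set.finite_singleton ν).union (Set.finite_range μ)).union (Set.finite_range _)).union
      (C.coords_finite B)).union
      ((C.coords_finite B).biUnion fun α _ => christoffel_finite P α ν)
  refine ⟨hf.toFinset, ?_, ?_, ?_, ?_, ?_⟩
  · simp
  · intro i
    simp
  · intro i
    simp
  · intro α hα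
    simp [hα]
  · intro α hα ρ hρ
    rw [Set.Finite.mem_toFinset]
    exact Or.inr (Set.mem_biUnion hα hρ)

/-- The generating function of the correlation functions. -/
def gen (s : Finset (Idx N)) : Hz s (PowerSeries S.RegRing) := fun m =>
  PowerSeries.mk fun g => FGraph.symComp C.corr g (m.map Subtype.val)

theorem coeff_gen (s : Finset (Idx N)) (g : ℕ) {n : ℕ} (μ : Fin n → s) :
    PowerSeries.coeff g (C.gen s (Finset.univ.val.map μ)) = C.corr g n fun i => (μ i : Idx N) := by
  rw [gen, PowerSeries.coeff_mk, Multiset.map_map]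
  exact (FGraph.eq_symComp C.symm (Equiv.refl (Fin n)) fun i => (μ i : Idx N)).symm

theorem hasOrder_gen (s : Finset (Idx N)) : HasOrder 2 3 (C.gen s) := fun g m hm => by
  rw [gen, PowerSeries.coeff_mk]
  exact FGraph.symComp_eq_zero C.unstable (by rw [Multiset.card_map]; omega)

/-- The correlation functions under `Q`, in terms of the sums over connected graphs. -/
theorem under_eq_edgeTotal (Q : S.PseudoOpposite) {B g n : ℕ} (hB : 6 * g + 3 * n + 1 ≤ B)
    {s : Finset (Idx N)} (hs : C.coords B ⊆ s) (μ : Fin n → s) :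
    C.under Q g n (fun i => (μ i : Idx N)) = PowerSeries.coeff g (edgeTotal (C.gen s)
      (fun a b => PowerSeries.C (propagator P Q a b)) (Finset.univ.val.map μ)) := by
  rw [coeff_edgeTotal (C.hasOrder_gen s) _ g _ (M := 3 * g + n + 1)
    (by rw [Multiset.card_map, Finset.card_val, Finset.card_fin]; omega)]
  exact FGraph.feynman_eq_edgeSum C.symm C.unstable Subtype.val_injective (propagator_symm P Q)
    le_rfl hB (fun g' hg' m hm x hx i => Subtype.range_coe.symm ▸ hs (mem_coords hg' hm hx i)) μ

theorem mem_coords_of_under (Q : S.PseudoOpposite) {B g n : ℕ} (hB : 6 * g + 3 * n + 1 ≤ B)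
    {x : Fin n → Idx N} (hx : C.under Q g n x ≠ 0) (i : Fin n) : x i ∈ C.coords B := by
  by_contra hi
  refine hx (FGraph.feynman_eq_zero (ι := (Subtype.val : C.coords B → Idx N)) C.symm
    (propagator_symm P Q) hB (fun g' hg' m hm x hx i => ?_) x i ?_)
  · rw [Subtype.range_coe]
    exact mem_coords hg' hm hx i
  · rwa [Subtype.range_coe]

-- The symmetry of the Yukawa coupling comes from that of the genus-zero three-point function.
include C in
theorem yukawa_swap (i j h : Idx N) : S.yukawa i j h = S.yukawa i h j := by
  rw [← C.yukawa, ← C.yukawa, ← C.symm 0 3 (Equiv.swap 1 2)]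
  congr 1
  funext k
  fin_cases k <;> rfl

include C in
theorem yukawa_rotate (i j h : Idx N) : S.yukawa i j h = S.yukawa j h i := by
  rw [← C.yukawa, ← C.yukawa, ← C.symm 0 3 (finRotate 3)]
  congr 1
  funext k
  fin_cases k <;> rfl

end FockSpace

/-- The derivative in the direction `∂_ν`, as a derivation of the ring. -/
def intDer (S : CTP N U) (ν : Idx N) : IntDer S.RegRing :=
  IntDer.ofLeibniz (S.dTot ν).toLinearMap.toAddMonoidHom fun x y => (S.dTot ν).leibniz x y

theorem intDer_apply (ν : Idx N) (x : S.RegRing) : S.intDer ν x = S.dTot ν x := rfl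

end CTP

/-! ### Identification of the combinatorial terms with the geometric ones. -/

namespace CTP

variable {N : ℕ} {U : TopologicalSpace.Opens (Base N)} {S : CTP N U} {P : S.PseudoOpposite}

namespace FockSpace

open Heat

variable (C : FockSpace P) {s : Finset (Idx N)}

-- This is `christoffel_sub`, summed over the finite index set: the Yukawa coupling vanishes outside
-- the directions `dt^i`.
include C in
theorem sum_propagator_yukawa (Q : S.PseudoOpposite) (hs : ∀ i, Sum.inl i ∈ s) (ν ρ σ : Idx N) :
    christoffel P ρ ν σ - ∑ a : s, propagator P Q a ρ * S.yukawa ν a σ = christoffel Q ρ ν σ := by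
  have hz : ∀ m, propagator P Q (Sum.inr m) ρ * S.yukawa ν (Sum.inr m) σ = 0 := fun m => by
    have : S.yukawa ν (Sum.inr m) σ = 0 := by rcases ν with i | i <;> rfl
    rw [this, mul_zero]
  rw [sum_coe_eq_sum_inl (G := fun a => propagator P Q a ρ * S.yukawa ν a σ) hs hz, sub_eq_iff_eq_add',
    ← sub_eq_iff_eq_add, christoffel_sub]
  exact Finset.sum_congr rfl fun i _ => by rw [C.yukawa_rotate]

-- This is `torsion_eq_sub`. The conditions `ha` and `hb` ensure that the Christoffel terms, summed
-- over `s` only, are complete.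
include C in
theorem torMat_eq_torsion (hP : P.IsParallel) (Q : S.PseudoOpposite) (hs : ∀ i, Sum.inl i ∈ s)
    (ν : Idx N) (a b : s) (ha : ∀ ρ, christoffel P a ν ρ ≠ 0 → ρ ∈ s)
    (hb : ∀ ρ, christoffel P b ν ρ ≠ 0 → ρ ∈ s) :
    torMat (S.intDer ν) (fun a b : s => propagator P Q a b) (fun a b => S.yukawa ν a b)
      (fun a b => christoffel P a ν b) a b = torsion Q ν a b := by
  rw [torsion_eq_sub P Q hP ν a b ha hb, torMat, covMat, intDer_apply, add_assoc, add_assoc]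
  congr 1
  · have h0 : ∀ m x, S.yukawa ν (Sum.inr m) x = 0 := fun m x => by
      rcases ν with i | i <;> rfl
    have h1 : ∀ m x, S.yukawa ν x (Sum.inr m) = 0 := fun m x => by
      rcases ν with i | i <;> rcases x with j | j <;> rfl
    rw [sum_coe_eq_sum_inl (G := fun x => ∑ y : s, propagator P Q x a * S.yukawa ν x y *
      propagator P Q y b) hs fun m => Finset.sum_eq_zero fun y _ => by rw [h0, mul_zero, zero_mul]]
    refine Finset.sum_congr rfl fun i _ => ?_
    rw [sum_coe_eq_sum_inl (G := fun y => propagator P Q (Sum.inl i) a * S.yukawa ν (Sum.inl i) y *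
      propagator P Q y b) hs fun m => by rw [h1, mul_zero, zero_mul]]
    refine Finset.sum_congr rfl fun k _ => ?_
    rw [C.yukawa_rotate (Sum.inl k), mul_right_comm]
  · congr 2
    · exact Finset.sum_coe_sort s fun ρ => christoffel P a ν ρ * propagator P Q ρ b
    · rw [← Finset.sum_coe_sort s fun ρ => christoffel P b ν ρ * propagator P Q ρ a]
      exact Finset.sum_congr rfl fun ρ _ => by rw [propagator_symm P Q a]

theorem corr_jet {B : ℕ} (hs : C.coords B ⊆ s) (ν : Idx N) {g n : ℕ} (hg : g < B) (hn : n < B)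
    (hgn : 2 < 2 * g + n) (μ : Fin n → s) :
    C.corr g (n + 1) (Fin.cons ν fun i => (μ i : Idx N)) =
      S.intDer ν (C.corr g n fun i => (μ i : Idx N)) - ∑ i, ∑ c : s, christoffel P c ν (μ i) *
        C.corr g n fun j => (Function.update μ i c j : Idx N) := by
  rw [C.jet g n hgn, covDeriv, intDer_apply]
  congr 1
  refine Finset.sum_congr rfl fun i _ => ?_
  rw [finsum_eq_sum_coe (s := s) fun ρ hρ => ?_]
  · refine Finset.sum_congr rfl fun c _ => ?_
    rw [mul_comm]
    congr 2
    funext j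
    rcases eq_or_ne j i with rfl | hj
    · simp
    · simp [hj]
  · have := mem_coords hg hn (left_ne_zero_of_mul hρ) i
    rw [Function.update_self] at this
    exact hs this

theorem covDeriv_under (Q : S.PseudoOpposite) {B g n : ℕ} (hB : 6 * g + 3 * n + 1 ≤ B)
    (hs : C.coords B ⊆ s) (ν : Idx N) (μ : Fin n → s) :
    covDeriv Q (C.under Q g n) ν (fun i => (μ i : Idx N)) =
      S.intDer ν (C.under Q g n fun i => (μ i : Idx N)) - ∑ i, ∑ c : s, christoffel Q c ν (μ i) *
        C.under Q g n fun j => (Function.update μ i c j : Idx N) := by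
  rw [covDeriv, intDer_apply]
  congr 1
  refine Finset.sum_congr rfl fun i _ => ?_
  rw [finsum_eq_sum_coe (s := s) fun ρ hρ => ?_]
  · refine Finset.sum_congr rfl fun c _ => ?_
    rw [mul_comm]
    congr 2
    funext j
    rcases eq_or_ne j i with rfl | hj
    · simp
    · simp [hj]
  · have := C.mem_coords_of_under Q hB (left_ne_zero_of_mul hρ) i
    rw [Function.update_self] at this
    exact hs this

theorem coe_finSnoc {n : ℕ} (x : Fin n → s) (a : s) :
    (fun i => ((Fin.snoc x a : Fin (n + 1) → s) i : Idx N)) =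
      Fin.snoc (fun i => (x i : Idx N)) (a : Idx N) := comp_finSnoc Subtype.val x a

theorem loopTerm_under (Q : S.PseudoOpposite) {B g n : ℕ} (hB : 6 * g + 3 * n + 7 ≤ B)
    (hs : C.coords B ⊆ s) (ν : Idx N) (μ : Fin n → s) :
    loopTerm (C.under Q) Q n ν (fun i => (μ i : Idx N)) g = (1 / 2 : ℂ) • ∑ a : s, ∑ b : s,
      torsion Q ν a b * PowerSeries.coeff g (PowerSeries.X * edgeTotal (C.gen s)
        (fun a b => PowerSeries.C (propagator P Q a b)) (b ::ₘ a ::ₘ Finset.univ.val.map μ)) := by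
  rcases g with _ | g
  · simp [loopTerm]
  · rw [loopTerm]
    congr 1
    have hB' : 6 * g + 3 * (n + 2) + 1 ≤ B := by omega
    rw [finsum_pair_eq_sum_coe (s := s) fun x hx => ?_]
    · refine Finset.sum_congr rfl fun a _ => Finset.sum_congr rfl fun b _ => ?_
      rw [PowerSeries.coeff_succ_X_mul, ← map_finSnoc, ← map_finSnoc,
        ← C.under_eq_edgeTotal Q hB' hs, coe_finSnoc, coe_finSnoc, mul_comm]
    · have h := C.mem_coords_of_under Q hB' (left_ne_zero_of_mul hx)
      have h1 := h (Fin.last (n + 1))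
      have h2 := h (Fin.last n).castSucc
      rw [Fin.snoc_last] at h1
      rw [Fin.snoc_castSucc, Fin.snoc_last] at h2
      exact ⟨hs h2, hs h1⟩

theorem splitTerm_under (Q : S.PseudoOpposite) {B g n : ℕ} (hB : 6 * g + 3 * n + 7 ≤ B)
    (hs : C.coords B ⊆ s) (ν : Idx N) (μ : Fin n → s) :
    splitTerm (C.under Q) Q g n ν (fun i => (μ i : Idx N)) = (1 / 2 : ℂ) • ∑ a : s, ∑ b : s,
      torsion Q ν a b * ∑ p ∈ Finset.HasAntidiagonal.antidiagonal g, ∑ A : Finset (Fin n),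
        PowerSeries.coeff p.1 (edgeTotal (C.gen s)
          (fun a b => PowerSeries.C (propagator P Q a b)) (a ::ₘ A.val.map μ)) *
        PowerSeries.coeff p.2 (edgeTotal (C.gen s)
          (fun a b => PowerSeries.C (propagator P Q a b)) (b ::ₘ Aᶜ.val.map μ)) := by
  have hk : ∀ {k : ℕ} (A : Finset (Fin n)), k ≤ g → 6 * k + 3 * (A.card + 1) + 1 ≤ B := by
    intro k A hk
    have := A.card_le_univ
    rw [Fintype.card_fin] at this
    omega
  have hA : ∀ {k : ℕ} (A : Finset (Fin n)) (a : s), k ≤ g →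
      C.under Q k (A.card + 1) (Fin.snoc (fun j => (μ (A.orderEmbOfFin rfl j) : Idx N)) (a : Idx N)) =
      PowerSeries.coeff k (edgeTotal (C.gen s)
          (fun a b => PowerSeries.C (propagator P Q a b)) (a ::ₘ A.val.map μ)) := by
    intro k A a hkg
    rw [← map_orderEmbOfFin, ← map_finSnoc, ← C.under_eq_edgeTotal Q (hk A hkg) hs, coe_finSnoc]
  rw [splitTerm]
  congr 1
  simp only [Finset.mul_sum]
  symm
  refine (Finset.sum_congr rfl fun a _ => Finset.sum_comm).trans (Finset.sum_comm.trans ?_)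
  refine Finset.sum_congr rfl fun p hp => ?_
  have hp' := Finset.HasAntidiagonal.mem_antidiagonal.1 hp
  refine (Finset.sum_congr rfl fun a _ => Finset.sum_comm).trans (Finset.sum_comm.trans ?_)
  refine Finset.sum_congr rfl fun A _ => ?_
  rw [finsum_pair_eq_sum_coe (s := s) fun x hx => ?_]
  · refine Finset.sum_congr rfl fun a _ => Finset.sum_congr rfl fun b _ => ?_
    rw [hA A a (by omega), hA Aᶜ b (by omega)]
    ring
  · have h1 := C.mem_coords_of_under Q (hk A (by omega))
      (left_ne_zero_of_mul (left_ne_zero_of_mul hx)) (Fin.last _)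
    have h2 := C.mem_coords_of_under Q (hk Aᶜ (by omega)) (right_ne_zero_of_mul hx) (Fin.last _)
    rw [Fin.snoc_last] at h1 h2
    exact ⟨hs h1, hs h2⟩

end FockSpace
end CTP

/-! ### The anomaly equation for generating functions. -/

namespace CTP

variable {N : ℕ} {U : TopologicalSpace.Opens (Base N)} {S : CTP N U} {P : S.PseudoOpposite}

namespace FockSpace

open Heat

/-- The anomaly equation, in terms of the generating functions over a finite set of indices. -/
theorem anomaly_edgeTotal (hP : P.IsParallel) (C : FockSpace P) (Q : S.PseudoOpposite) {g n B : ℕ}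
    (hgn : 2 < 2 * g + n) (hB : 6 * g + 3 * n + 7 ≤ B) {s : Finset (Idx N)} (ν : s) (μ : Fin n → s)
    (hinl : ∀ i, Sum.inl i ∈ s) (hs : C.coords B ⊆ s)
    (hsΓ : ∀ α ∈ C.coords B, ∀ ρ, christoffel P α ν ρ ≠ 0 → ρ ∈ s) {F : Hz s (PowerSeries S.RegRing)}
    (hF : F = edgeTotal (C.gen s) fun a b => PowerSeries.C (propagator P Q a b)) :
    2 * PowerSeries.coeff g (F (ν ::ₘ Finset.univ.val.map μ)) =
      2 * (S.intDer ν (PowerSeries.coeff g (F (Finset.univ.val.map μ))) -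
        ∑ i, ∑ c : s, christoffel Q c ν (μ i) *
          PowerSeries.coeff g (F (Finset.univ.val.map (Function.update μ i c)))) +
      ((∑ a : s, ∑ b : s, torsion Q ν a b * PowerSeries.coeff g
        (PowerSeries.X * F (b ::ₘ a ::ₘ Finset.univ.val.map μ))) +
      ∑ a : s, ∑ b : s, torsion Q ν a b * ∑ p ∈ Finset.HasAntidiagonal.antidiagonal g,
        ∑ A : Finset (Fin n), PowerSeries.coeff p.1 (F (a ::ₘ A.val.map μ)) *
          PowerSeries.coeff p.2 (F (b ::ₘ Aᶜ.val.map μ))) := by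
  have hY : ∀ a b : s, S.yukawa ν a b = S.yukawa ν b a := fun a b => C.yukawa_swap _ _ _
  -- The genus-one one-point function is not the derivative of a stable correlation function, so it
  -- enters the defect as a separate constant.
  set c : PowerSeries S.RegRing := PowerSeries.monomial 1 (PowerSeries.coeff 1 (C.gen s {ν})) with hc
  have hc0 : ∀ g, g ≠ 1 → PowerSeries.coeff g c = 0 := fun g hg => by
    rw [hc, PowerSeries.coeff_monomial, if_neg hg]
  have hjet : ∀ (g' n' : ℕ) (μ : Fin n' → s), 2 < 2 * g' + n' → 2 * g' + n' < 2 * g + n - 1 + 2 →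
      PowerSeries.coeff g' (C.gen s (ν ::ₘ Finset.univ.val.map μ)) =
        S.intDer ν (PowerSeries.coeff g' (C.gen s (Finset.univ.val.map μ))) -
        ∑ i, ∑ c : s, christoffel P c ν (μ i) *
          PowerSeries.coeff g' (C.gen s (Finset.univ.val.map (Function.update μ i c))) := by
    intro g' n' μ h1 h2
    rw [← map_finCons]
    simp only [coeff_gen]
    rw [← C.corr_jet hs ν (by omega) (by omega) h1 μ]
    congr 1
    exact Fin.comp_cons Subtype.val ν μ
  have hYuk : ∀ x y : s, PowerSeries.coeff 0 (C.gen s {ν, x, y}) = S.yukawa ν x y := fun x y => by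
    have h3 : ({ν, x, y} : Multiset s) = Finset.univ.val.map ![ν, x, y] := by
      rw [Fin.univ_val_map]
      rfl
    rw [h3, coeff_gen, ← C.yukawa]
    congr 1
    funext k
    fin_cases k <;> rfl
  -- With this `W`, vanishing below weight `W + 2 = 2 * g + n + 1` just covers the component sought,
  -- of weight `2 * g + n`.
  have h0 := hasOrder_defect_zero (W := 2 * g + n - 1) (D := S.intDer ν) (ν := ν) (c := c)
    (Y := fun a b : s => S.yukawa ν a b) (Γ := fun a b : s => christoffel P a ν b) hY hc0 (C.hasOrder_gen s)
    (fun a b => PowerSeries.C (propagator P Q a b)) hjet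
    (by rw [hc, PowerSeries.coeff_monomial, if_pos rfl]) hYuk
  have h := hasOrder_defect (W := 2 * g + n - 1) (D := S.intDer ν) (ν := ν) (c := c)
    (Y := fun a b : s => PowerSeries.C (S.yukawa ν a b))
    (Γ := fun a b : s => PowerSeries.C (christoffel P a ν b))
    (Δ := fun a b : s => PowerSeries.C (propagator P Q a b)) (C.hasOrder_gen s) (fun a b => by rw [propagator_symm])
    (fun a b => by rw [hY]) h0
  rw [← hF] at h
  have key := anomaly_components (W := 2 * g + n - 1) (D := S.intDer ν) (ν := ν) (c := c)
    (Y := fun a b : s => S.yukawa ν a b) (Γ := fun a b : s => christoffel P a ν b) (Δ := fun a b : s => propagator P Q a b) hY hc0 h μ hgn (by omega)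
  -- The term of the defect linear in the gradient of `q` turns the Christoffel symbols of P into
  -- those of Q.
  simp only [sum_propagator_yukawa C Q hinl] at key
  rw [key]
  have hvan : ∀ {k m : ℕ} (a : s) (x : Fin m → s), 6 * k + 3 * (m + 1) + 1 ≤ B →
      PowerSeries.coeff k (F (a ::ₘ Finset.univ.val.map x)) ≠ 0 → (a : Idx N) ∈ C.coords B := by
    intro k m a x hk h
    rw [hF, ← map_finCons, ← C.under_eq_edgeTotal Q hk hs] at h
    exact C.mem_coords_of_under Q hk h 0
  -- `torMat` is identified with the torsion only for indices in `coords B`, where the finite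
  -- Christoffel sums are complete. For other indices the correlation functions multiplied with it
  -- vanish.
  have htor : ∀ (a b : s) (x : S.RegRing), (x ≠ 0 → (a : Idx N) ∈ C.coords B ∧ (b : Idx N) ∈ C.coords B) →
      torMat (S.intDer ν) (fun a b : s => propagator P Q a b) (fun a b => S.yukawa ν a b)
        (fun a b => christoffel P a ν b) a b * x = torsion Q ν a b * x := by
    intro a b x hx
    by_cases hx0 : x = 0
    · rw [hx0, mul_zero, mul_zero]
    · rw [C.torMat_eq_torsion hP Q hinl ν a b (hsΓ a (hx hx0).1) (hsΓ b (hx hx0).2)]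
  congr 2
  · refine Finset.sum_congr rfl fun a _ => Finset.sum_congr rfl fun b _ => htor a b _ fun hx => ?_
    rcases g with _ | g
    · exact absurd (PowerSeries.coeff_zero_X_mul _) hx
    · rw [PowerSeries.coeff_succ_X_mul] at hx
      refine ⟨?_, ?_⟩
      · rw [Multiset.cons_swap, ← map_finCons] at hx
        exact hvan a _ (by omega) hx
      · rw [← map_finCons] at hx
        exact hvan b _ (by omega) hx
  · refine Finset.sum_congr rfl fun a _ => Finset.sum_congr rfl fun b _ => htor a b _ fun hx => ?_
    obtain ⟨p, hp, hx⟩ := Finset.exists_ne_zero_of_sum_ne_zero hx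
    obtain ⟨A, -, hx⟩ := Finset.exists_ne_zero_of_sum_ne_zero hx
    have hp' := Finset.HasAntidiagonal.mem_antidiagonal.1 hp
    have h1 := A.card_le_univ
    have h2 := Aᶜ.card_le_univ
    rw [Fintype.card_fin] at h1 h2
    refine ⟨?_, ?_⟩
    · have hx := left_ne_zero_of_mul hx
      rw [← map_orderEmbOfFin] at hx
      exact hvan a _ (by omega) hx
    · have hx := right_ne_zero_of_mul hx
      rw [← map_orderEmbOfFin] at hx
      exact hvan b _ (by omega) hx

end FockSpace
end CTP
end CTPFock
end

/-! ### The anomaly equation for the correlation functions. -/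

theorem mainTheorem8 {N : ℕ} {U : TopologicalSpace.Opens (CTPFock.Base N)} (S : CTPFock.CTP N U)
    (hS : S.IsMiniversal) (P Q : S.PseudoOpposite) (hP : P.IsParallel)
    (C : CTPFock.CTP.FockSpace P) (g n : ℕ) (hgn : 2 < 2 * g + n)
    (ν : CTPFock.Idx N) (μ : Fin n → CTPFock.Idx N) :
    C.under Q g (n + 1) (Fin.cons ν μ) =
      CTPFock.CTP.covDeriv Q (C.under Q g n) ν μ
        + CTPFock.CTP.splitTerm (C.under Q) Q g n ν μ
        + CTPFock.CTP.loopTerm (C.under Q) Q n ν μ g := by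
  -- The bound is at least `6 * k + 3 * m + 1` for each genus-k, m-point function in the equation,
  -- including (g, n + 1), (g - 1, n + 2) and the factors of the splitting term, as
  -- `under_eq_edgeTotal` requires.
  obtain ⟨s, hν, hμ, hinl, hs, hsΓ⟩ := C.exists_indexSet (6 * g + 3 * n + 7) ν μ
  have h := CTPFock.CTP.FockSpace.anomaly_edgeTotal hP C Q hgn le_rfl ⟨ν, hν⟩
    (fun i => ⟨μ i, hμ i⟩) hinl hs hsΓ rfl
  have hcons : C.under Q g (n + 1) (Fin.cons ν μ) = C.under Q g (n + 1) fun i =>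
      ((Fin.cons ⟨ν, hν⟩ fun i => ⟨μ i, hμ i⟩ : Fin (n + 1) → s) i : CTPFock.Idx N) := by
    congr 1
    exact (Fin.comp_cons Subtype.val (⟨ν, hν⟩ : s) fun i => ⟨μ i, hμ i⟩).symm
  have hcov := C.covDeriv_under Q (B := 6 * g + 3 * n + 7) (g := g) (n := n) (by omega) hs ν fun i =>
    ⟨μ i, hμ i⟩
  have hund := C.under_eq_edgeTotal Q (B := 6 * g + 3 * n + 7) (g := g) (n := n) (by omega) hs
    fun i => ⟨μ i, hμ i⟩
  have hloop := C.loopTerm_under Q (g := g) le_rfl hs ν fun i => ⟨μ i, hμ i⟩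
  have hsplit := C.splitTerm_under Q (g := g) le_rfl hs ν fun i => ⟨μ i, hμ i⟩
  have hhalf : ∀ x : S.RegRing, (1 / 2 : ℂ) • (2 * x) = x := fun x => by
    rw [two_mul, ← two_smul ℂ, smul_smul]
    norm_num
  simp only at hcov hloop hsplit hund
  rw [hcons, hcov, hloop, hsplit,
    C.under_eq_edgeTotal Q (B := 6 * g + 3 * n + 7) (g := g) (n := n + 1) (by omega) hs, CTPFock.map_finCons,
    ← hhalf (PowerSeries.coeff g _), h, smul_add, hhalf, smul_add, hund]
  simp only [C.under_eq_edgeTotal Q (B := 6 * g + 3 * n + 7) (g := g) (n := n) (by omega) hs]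
  abel
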